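/- Let $n\ge 3$, let $\Omega\subset\mathbb R^n$ be a bounded domain (non-empty, open, connected) with smooth boundary, and let $T>0$, $C_0>0$, $\lambda>0$, $\alpha,\beta\ge 0$, $\gamma=\frac{n}{n-2}$, $Q^T=\Omega\times(0,T)$. For $\varepsilon>0$ put $a_\varepsilon=C_0\varepsilon^{\gamma}$ and, for $j\in\mathbb Z^n$, let $G_\varepsilon^j$ be the open ball of radius $a_\varepsilon$ centred at $\varepsilon j$. Let $\widetilde\Omega_\varepsilon=\{x\in\Omega: d(x,\partial\Omega)>2\varepsilon\}$, $\Upsilon_\varepsilon=\{j\in\mathbb Z^n:\ \overline{G_\varepsilon^j}\subset \varepsilon j+(-\tfrac{\varepsilon}{2},\tfrac{\varepsilon}{2})^n,\ G_\varepsilon^j\cap\overline{\widetilde\Omega_\varepsilon}\neq\emptyset\}$, $G_\varepsilon=\bigcup_{j\in\Upsilon_\varepsilon}G_\varepsilon^j$, $S_\varepsilon=\partial G_\varepsilon$, $\Omega_\varepsilon=\Omega\setminus\overline{G_\varepsilon}$, $Q_\varepsilon^T=\Omega_\varepsilon\times(0,T)$. Let $g\in C^1(\overline{Q^T})$ and assume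 that either $\alpha>0$ and $f\in L^2(Q^T)$, or $\beta>0$ and $f\in H^1(0,T;L^2(\Omega))$. Consider the problem $$\begin{cases}\alpha\,\partial_t u_\varepsilon-\Delta u_\varepsilon=f & \text{in } Q_\varepsilon^T,\\ \varepsilon^{-\gamma}\beta\,\partial_t u_\varepsilon+\partial_\nu u_\varepsilon+\varepsilon^{-\gamma}\lambda u_\varepsilon=\varepsilon^{-\gamma}g & \text{on } S_\varepsilon\times(0,T),\\ u_\varepsilon=0 & \text{on }\partial\Omega\times(0,T),\\ \alpha u_\varepsilon(\cdot,0)=0 & \text{in }\Omega_\varepsilon,\\ \beta u_\varepsilon(\cdot,0)=0 & \text{on } S_\varepsilon,\end{cases}\qquad(1)$$ where $\nu$ is the unit normal on $S_\varepsilon$ pointing out of $\Omega_\varepsilon$. Let $V_\varepsilon=H^1(\Omega_\varepsilon,\partial\Omega)$ be the closure in $H^1(\Omega_\varepsilon)$ of the functions that are smooth on $\overline{\Omega_\varepsilon}$ and vanish near $\partial\Omega$, and $V_\varepsilon'$ its dual. A weak solution of (1) is a function $u_\varepsilon\in L^2(0,T;V_\varepsilon)$ with $\alpha\partial_tu_\varepsilon\in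 L^2(0,T;V_\varepsilon')$ and $\beta\partial_t u_\varepsilon|_{S_\varepsilon}\in L^2(0,T;H^{-1/2}(S_\varepsilon))$, such that $\alpha u_\varepsilon(\cdot,0)=0$ in $L^2(\Omega_\varepsilon)$, $\beta u_\varepsilon(\cdot,0)=0$ in $L^2(S_\varepsilon)$, and for all $\phi\in L^2(0,T;V_\varepsilon)$ $$\alpha\int_0^T\langle\partial_tu_\varepsilon,\phi\rangle_{\Omega_\varepsilon}dt+\beta\varepsilon^{-\gamma}\int_0^T\langle\partial_tu_\varepsilon,\phi\rangle_{S_\varepsilon}dt+\int_{Q_\varepsilon^T}\nabla u_\varepsilon\cdot\nabla\phi\,dx\,dt+\lambda\varepsilon^{-\gamma}\int_0^T\!\!\int_{S_\varepsilon}u_\varepsilon\phi\,ds\,dt=\varepsilon^{-\gamma}\int_0^T\!\!\int_{S_\varepsilon}g\phi\,ds\,dt+\int_{Q_\varepsilon^T}f\phi\,dx\,dt,$$ where $\langle\cdot,\cdot\rangle_{\Omega_\varepsilon}$ is the duality of $V_\varepsilon'$ and $V_\varepsilon$, and $\langle\cdot,\cdot\rangle_{S_\varepsilon}$ that of $H^{-1/2}(S_\varepsilon)$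 and $H^{1/2}(S_\varepsilon)$. Theorem. There is a constant $K>0$, independent of $\varepsilon$, such that for every $\varepsilon>0$ with $C_0\varepsilon^{\gamma}<\varepsilon/4$, problem (1) has a unique weak solution $u_\varepsilon$ (unique up to equality for almost every $t\in(0,T)$), and $u_\varepsilon\in H^1(Q_\varepsilon^T)$ with $$\|u_\varepsilon\|_{H^1(Q_\varepsilon^T)}\le K.$$ -/

import Mathlib

open MeasureTheory Set Filter Topology
open scoped ContDiff ENNReal

noncomputable section

namespace DynBC

/-- Euclidean space `ℝⁿ`. -/
abbrev E (n : ℕ) : Type := EuclideanSpace ℝ (Fin n)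

/-! ### Weak derivatives, regularity of domains and data -/

/-- `g` is the weak derivative of `f` in the direction `v` on the (open) set `D`:
`∫_D f ∂_v η = - ∫_D g η` for all `η ∈ C_c^∞(D)`. -/
def HasWeakDeriv {X : Type*} [NormedAddCommGroup X] [NormedSpace ℝ X] [MeasureSpace X]
    (D : Set X) (v : X) (f g : X → ℝ) : Prop :=
  ∀ η : X → ℝ, ContDiff ℝ ∞ η → HasCompactSupport η → tsupport η ⊆ D →
    ∫ z in D, f z * fderiv ℝ η z v = -∫ z in D, g z * η z

/-- `Ω` has a smooth boundary: near each boundary point, `Ω` is the set where some smooth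
function with nonvanishing differential is negative. -/
def HasSmoothBoundary {n : ℕ} (Ω : Set (E n)) : Prop :=
  ∀ x ∈ frontier Ω, ∃ ρ : E n → ℝ, ContDiff ℝ ∞ ρ ∧ fderiv ℝ ρ x ≠ 0 ∧
    ∀ᶠ y in 𝓝 x, (y ∈ Ω ↔ ρ y < 0)

/-- The space-time cylinder `D × (0, T)`. -/
def cylinder {n : ℕ} (D : Set (E n)) (T : ℝ) : Set (E n × ℝ) := D ×ˢ Ioo 0 T

/-- `g ∈ C¹(closure Q)`: `g` is `C¹` in the open set `Q`, and `g` and its differential extend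
continuously to the closure of `Q`. -/
def IsC1OnClosure {X : Type*} [NormedAddCommGroup X] [NormedSpace ℝ X]
    (Q : Set X) (g : X → ℝ) : Prop :=
  ContinuousOn g (closure Q) ∧ ∃ g' : X → (X →L[ℝ] ℝ), ContinuousOn g' (closure Q) ∧
    ∀ z ∈ Q, HasFDerivAt g (g' z) z

/-- `f ∈ L²(Ω × (0, T))`. -/
def IsL2 {n : ℕ} (Ω : Set (E n)) (T : ℝ) (f : E n × ℝ → ℝ) : Prop :=
  MemLp f 2 (volume.restrict (cylinder Ω T))

/-- `f ∈ H¹(0, T; L²(Ω))`: `f` and its weak time derivative belong to `L²(Ω × (0, T))`. -/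
def IsH1TimeL2 {n : ℕ} (Ω : Set (E n)) (T : ℝ) (f : E n × ℝ → ℝ) : Prop :=
  IsL2 Ω T f ∧ ∃ f' : E n × ℝ → ℝ, IsL2 Ω T f' ∧
    HasWeakDeriv (cylinder Ω T) ((0 : E n), (1 : ℝ)) f f'

/-! ### The perforated domain -/

/-- The exponent `γ = n / (n - 2)`. -/
def gam (n : ℕ) : ℝ := (n : ℝ) / ((n : ℝ) - 2)

/-- The radius `a_ε = C₀ ε ^ γ` of the particles. -/
def radius (n : ℕ) (C₀ ε : ℝ) : ℝ := C₀ * ε ^ gam n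

/-- The centre `ε j` of the cell with index `j ∈ ℤⁿ`. -/
def center {n : ℕ} (ε : ℝ) (j : Fin n → ℤ) : E n := WithLp.toLp 2 fun i => ε * (j i : ℝ)

/-- The open cell `ε Y + ε j`, `Y = (-1/2, 1/2)ⁿ`. -/
def cell {n : ℕ} (ε : ℝ) (j : Fin n → ℤ) : Set (E n) :=
  {x | ∀ i, x i ∈ Ioo (ε * (j i : ℝ) - ε / 2) (ε * (j i : ℝ) + ε / 2)}

/-- The open particle `G_ε^j = a_ε G₀ + ε j`, `G₀` being the open unit ball. -/
def particle {n : ℕ} (C₀ ε : ℝ) (j : Fin n → ℤ) : Set (E n) :=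
  Metric.ball (center ε j) (radius n C₀ ε)

/-- The points of `Ω` at distance more than `2 ε` from the boundary. -/
def innerDomain {n : ℕ} (Ω : Set (E n)) (ε : ℝ) : Set (E n) :=
  {x ∈ Ω | 2 * ε < Metric.infDist x (frontier Ω)}

/-- The set `Υ_ε` of indices of the particles. -/
def indices {n : ℕ} (Ω : Set (E n)) (C₀ ε : ℝ) : Set (Fin n → ℤ) :=
  {j | closure (particle C₀ ε j) ⊆ cell ε j ∧
    (particle C₀ ε j ∩ closure (innerDomain Ω ε)).Nonempty}

/-- The union `G_ε` of the particles. -/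
def particles {n : ℕ} (Ω : Set (E n)) (C₀ ε : ℝ) : Set (E n) :=
  ⋃ j ∈ indices Ω C₀ ε, particle C₀ ε j

/-- The perforated domain `Ω_ε`. -/
def perforated {n : ℕ} (Ω : Set (E n)) (C₀ ε : ℝ) : Set (E n) :=
  Ω \ closure (particles Ω C₀ ε)

/-- The surface measure of the sphere with centre `c` and radius `a > 0`: the surface measure
`volume.toSphere` of the unit sphere, scaled by `a ^ (n - 1)` and transported to that sphere. -/
def sphereMeasure {n : ℕ} (c : E n) (a : ℝ) : Measure (E n) :=
  ENNReal.ofReal (a ^ (n - 1)) •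
    Measure.map (fun y : Metric.sphere (0 : E n) 1 => c + a • (y : E n))
      (volume : Measure (E n)).toSphere

/-- The surface measure of `S_ε = ∂G_ε`, the disjoint union of the spheres `∂G_ε^j`. -/
def surfaceMeasure {n : ℕ} (Ω : Set (E n)) (C₀ ε : ℝ) : Measure (E n) :=
  Measure.sum fun j : indices Ω C₀ ε => sphereMeasure (center ε (j : Fin n → ℤ)) (radius n C₀ ε)

/-! ### The space `H¹(D)` -/

section WeakDerivLemmas

variable {X : Type*} [NormedAddCommGroup X] [NormedSpace ℝ X] [MeasureSpace X]

theorem HasWeakDeriv.smul {D : Set X} {v : X} {f g : X → ℝ} (c : ℝ)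
    (h : HasWeakDeriv D v f g) : HasWeakDeriv D v (c • f) (c • g) := by
  intro η hη hc hs
  simp only [Pi.smul_apply, smul_eq_mul, mul_assoc, integral_const_mul]
  rw [h η hη hc hs]
  ring

theorem HasWeakDeriv.congr {D : Set X} {v : X} {f g f' g' : X → ℝ}
    (hf : f' =ᵐ[volume.restrict D] f) (hg : g' =ᵐ[volume.restrict D] g)
    (h : HasWeakDeriv D v f g) : HasWeakDeriv D v f' g' := by
  intro η hη hc hs
  have e₁ := integral_congr_ae (hf.mul (EventuallyEq.refl _ fun z => fderiv ℝ η z v))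
  have e₂ := integral_congr_ae (hg.mul (EventuallyEq.refl _ η))
  have k := h η hη hc hs
  simp only [Pi.mul_apply] at e₁ e₂
  rw [e₁, e₂, k]

variable [BorelSpace X] [IsFiniteMeasureOnCompacts (volume : Measure X)]

theorem memLp_two_of_test {η : X → ℝ} (D : Set X) (hη : ContDiff ℝ ∞ η)
    (hc : HasCompactSupport η) : MemLp η 2 (volume.restrict D) :=
  (hη.continuous.memLp_of_hasCompactSupport hc).restrict D

theorem memLp_two_fderiv {η : X → ℝ} (D : Set X) (v : X) (hη : ContDiff ℝ ∞ η)
    (hc : HasCompactSupport η) : MemLp (fun z => fderiv ℝ η z v) 2 (volume.restrict D) := by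
  have h1 : Continuous fun z => fderiv ℝ η z v :=
    (hη.continuous_fderiv (by simp)).clm_apply continuous_const
  have h2 : HasCompactSupport fun z => fderiv ℝ η z v := hc.fderiv_apply (𝕜 := ℝ) v
  exact (h1.memLp_of_hasCompactSupport h2).restrict D

theorem HasWeakDeriv.add {D : Set X} {v : X} {f₁ g₁ f₂ g₂ : X → ℝ}
    (hf₁ : MemLp f₁ 2 (volume.restrict D)) (hg₁ : MemLp g₁ 2 (volume.restrict D))
    (hf₂ : MemLp f₂ 2 (volume.restrict D)) (hg₂ : MemLp g₂ 2 (volume.restrict D))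
    (h₁ : HasWeakDeriv D v f₁ g₁) (h₂ : HasWeakDeriv D v f₂ g₂) :
    HasWeakDeriv D v (f₁ + f₂) (g₁ + g₂) := by
  intro η hη hc hs
  have m := memLp_two_of_test D hη hc
  have m' := memLp_two_fderiv D v hη hc
  have e₁ := integral_add (hf₁.integrable_mul m') (hf₂.integrable_mul m')
  have e₂ := integral_add (hg₁.integrable_mul m) (hg₂.integrable_mul m)
  have k₁ := h₁ η hη hc hs
  have k₂ := h₂ η hη hc hs
  simp only [Pi.mul_apply] at e₁ e₂
  simp only [Pi.add_apply, add_mul]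
  rw [e₁, e₂, k₁, k₂]
  ring

end WeakDerivLemmas

/-- The Hilbert space `L²(D) × L²(D; ℝⁿ)` with the norm `(‖u‖² + ‖G‖²)^{1/2}`. -/
def L2Pair {n : ℕ} (D : Set (E n)) : Type :=
  WithLp 2 (Lp ℝ 2 (volume.restrict D) × Lp (E n) 2 (volume.restrict D))

instance instNormedGroupL2Pair {n : ℕ} (D : Set (E n)) : NormedAddCommGroup (L2Pair D) :=
  inferInstanceAs (NormedAddCommGroup
    (WithLp 2 (Lp ℝ 2 (volume.restrict D) × Lp (E n) 2 (volume.restrict D))))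

instance instInnerL2Pair {n : ℕ} (D : Set (E n)) : InnerProductSpace ℝ (L2Pair D) :=
  inferInstanceAs (InnerProductSpace ℝ
    (WithLp 2 (Lp ℝ 2 (volume.restrict D) × Lp (E n) 2 (volume.restrict D))))

instance instCompleteL2Pair {n : ℕ} (D : Set (E n)) : CompleteSpace (L2Pair D) :=
  inferInstanceAs (CompleteSpace
    (WithLp 2 (Lp ℝ 2 (volume.restrict D) × Lp (E n) 2 (volume.restrict D))))

/-- The first component. -/
def L2Pair.fst {n : ℕ} {D : Set (E n)} (p : L2Pair D) : Lp ℝ 2 (volume.restrict D) :=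
  WithLp.fst p

/-- The second component. -/
def L2Pair.snd {n : ℕ} {D : Set (E n)} (p : L2Pair D) : Lp (E n) 2 (volume.restrict D) :=
  WithLp.snd p

theorem L2Pair.add_snd {n : ℕ} {D : Set (E n)} (p q : L2Pair D) :
    (p + q).snd = p.snd + q.snd := rfl

theorem L2Pair.zero_snd {n : ℕ} {D : Set (E n)} : (0 : L2Pair D).snd = 0 := rfl

theorem L2Pair.smul_snd {n : ℕ} {D : Set (E n)} (c : ℝ) (p : L2Pair D) :
    (c • p).snd = c • p.snd := rfl

/-- The Sobolev space `H¹(D)`, as the space of all pairs `(u, G)` where `u ∈ L²(D)` and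
`G ∈ L²(D; ℝⁿ)` is the weak gradient of `u`; its norm is `(‖u‖² + ‖∇u‖²)^{1/2}`. -/
def H1 {n : ℕ} (D : Set (E n)) : Submodule ℝ (L2Pair D) where
  carrier := {p | ∀ e : E n, HasWeakDeriv D e (p.fst : E n → ℝ)
    (fun x => inner ℝ ((p.snd : E n → E n) x) e)}
  add_mem' := by
    intro p q hp hq e
    refine HasWeakDeriv.congr (Lp.coeFn_add p.fst q.fst) ?_
      (HasWeakDeriv.add (Lp.memLp _) ((Lp.memLp p.snd).inner_const (𝕜 := ℝ) e)
        (Lp.memLp _) ((Lp.memLp q.snd).inner_const (𝕜 := ℝ) e) (hp e) (hq e))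
    filter_upwards [Lp.coeFn_add p.snd q.snd] with x hx
    simp only [L2Pair.add_snd, hx, Pi.add_apply, inner_add_left]
  zero_mem' := by
    intro e
    have h0 : HasWeakDeriv D e (0 : E n → ℝ) 0 := by
      intro η _ _ _
      simp
    refine HasWeakDeriv.congr (Lp.coeFn_zero ℝ 2 (volume.restrict D)) ?_ h0
    filter_upwards [Lp.coeFn_zero (E n) 2 (volume.restrict D)] with x hx
    simp only [L2Pair.zero_snd, hx, Pi.zero_apply, inner_zero_left]
  smul_mem' := by
    intro c p hp e
    refine HasWeakDeriv.congr (Lp.coeFn_smul c p.fst) ?_ (HasWeakDeriv.smul c (hp e))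
    filter_upwards [Lp.coeFn_smul c p.snd] with x hx
    simp only [L2Pair.smul_snd, hx, Pi.smul_apply, inner_smul_left, smul_eq_mul]
    simp

/-! ### The space `H¹(D, ∂Ω)`, traces, and `H^{1/2}` -/

/-- Smooth functions that vanish in a neighbourhood of `∂Ω`. -/
def smoothVanishing {n : ℕ} (Ω : Set (E n)) : Submodule ℝ (E n → ℝ) where
  carrier := {φ | ContDiff ℝ ∞ φ ∧ ∀ᶠ x in 𝓝ˢ (frontier Ω), φ x = 0}
  add_mem' := by
    rintro φ ψ ⟨h1, h2⟩ ⟨h3, h4⟩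
    refine ⟨h1.add h3, ?_⟩
    filter_upwards [h2, h4] with x hx hy
    simp [hx, hy]
  zero_mem' := ⟨contDiff_const, Eventually.of_forall fun _ => rfl⟩
  smul_mem' := by
    rintro c φ ⟨h1, h2⟩
    refine ⟨contDiff_const.smul h1, ?_⟩
    filter_upwards [h2] with x hx
    simp [hx]

/-- The elements of `H¹(D)` given by smooth functions that vanish near `∂Ω`. -/
def smoothH1 {n : ℕ} (Ω D : Set (E n)) : Submodule ℝ (H1 D) where
  carrier := {p | ∃ φ ∈ smoothVanishing Ω, (p.1.fst : E n → ℝ) =ᵐ[volume.restrict D] φ}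
  add_mem' := by
    rintro p q ⟨φ, h1, h2⟩ ⟨ψ, h3, h4⟩
    exact ⟨φ + ψ, add_mem h1 h3, (Lp.coeFn_add p.1.fst q.1.fst).trans (h2.add h4)⟩
  zero_mem' := ⟨0, zero_mem _, Lp.coeFn_zero ℝ 2 (volume.restrict D)⟩
  smul_mem' := by
    rintro c p ⟨φ, h1, h2⟩
    exact ⟨c • φ, Submodule.smul_mem _ c h1,
      (Lp.coeFn_smul c p.1.fst).trans (h2.const_smul c)⟩

/-- `H¹(D, ∂Ω)`: the closure in `H¹(D)` of the smooth functions vanishing near `∂Ω`. -/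
def H1V {n : ℕ} (Ω D : Set (E n)) : Submodule ℝ (H1 D) := (smoothH1 Ω D).topologicalClosure

/-- The element of `L²(D)` underlying an element of `H¹(D, ∂Ω)`. -/
def H1V.val {n : ℕ} {Ω D : Set (E n)} (u : H1V Ω D) : Lp ℝ 2 (volume.restrict D) := u.1.1.fst

/-- The weak gradient of an element of `H¹(D, ∂Ω)`. -/
def H1V.grad {n : ℕ} {Ω D : Set (E n)} (u : H1V Ω D) : Lp (E n) 2 (volume.restrict D) :=
  u.1.1.snd

/-- The pairs `(u, v)` in `H¹(D, ∂Ω) × L²(σ)` where `u` is given on `D` and `v` on the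
surface by the same smooth function. -/
def smoothTraceGraph {n : ℕ} (Ω D : Set (E n)) (σ : Measure (E n)) :
    Submodule ℝ (H1V Ω D × Lp ℝ 2 σ) where
  carrier := {p | ∃ φ ∈ smoothVanishing Ω,
    (H1V.val p.1 : E n → ℝ) =ᵐ[volume.restrict D] φ ∧ (p.2 : E n → ℝ) =ᵐ[σ] φ}
  add_mem' := by
    rintro p q ⟨φ, h1, h2, h2'⟩ ⟨ψ, h3, h4, h4'⟩
    exact ⟨φ + ψ, add_mem h1 h3,
      (Lp.coeFn_add (H1V.val p.1) (H1V.val q.1)).trans (h2.add h4),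
      (Lp.coeFn_add p.2 q.2).trans (h2'.add h4')⟩
  zero_mem' := ⟨0, zero_mem _, Lp.coeFn_zero ℝ 2 (volume.restrict D), Lp.coeFn_zero ℝ 2 σ⟩
  smul_mem' := by
    rintro c p ⟨φ, h1, h2, h2'⟩
    exact ⟨c • φ, Submodule.smul_mem _ c h1,
      (Lp.coeFn_smul c (H1V.val p.1)).trans (h2.const_smul c),
      (Lp.coeFn_smul c p.2).trans (h2'.const_smul c)⟩

/-- The graph of the trace operator `H¹(D, ∂Ω) → L²(σ)`, the extension by continuity of the
restriction of smooth functions to the surface: the closure of its graph on smooth functions. -/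
def traceGraph {n : ℕ} (Ω D : Set (E n)) (σ : Measure (E n)) :
    Submodule ℝ (H1V Ω D × Lp ℝ 2 σ) := (smoothTraceGraph Ω D σ).topologicalClosure

open Classical in
/-- The trace of `u ∈ H¹(D, ∂Ω)` on the surface with surface measure `σ`: the `v ∈ L²(σ)` with
`(u, v)` in the trace graph. (On a surface for which the trace theorem holds, such as the union
of the particle surfaces, there is exactly one such `v`, so the second branch does not occur.) -/
def trace {n : ℕ} {Ω D : Set (E n)} (σ : Measure (E n)) (u : H1V Ω D) : Lp ℝ 2 σ :=
  if h : ∃ v, (u, v) ∈ traceGraph Ω D σ then h.choose else 0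

/-- The functions in `H¹(D, ∂Ω)` with zero trace on the surface. -/
def traceKer {n : ℕ} (Ω D : Set (E n)) (σ : Measure (E n)) : Submodule ℝ (H1V Ω D) :=
  (traceGraph Ω D σ).comap (LinearMap.inl ℝ (H1V Ω D) (Lp ℝ 2 σ))

instance isClosed_traceKer {n : ℕ} (Ω D : Set (E n)) (σ : Measure (E n)) :
    IsClosed (traceKer Ω D σ : Set (H1V Ω D)) := by
  have h1 : IsClosed (traceGraph Ω D σ : Set (H1V Ω D × Lp ℝ 2 σ)) :=
    Submodule.isClosed_topologicalClosure _
  have h2 : Continuous fun u : H1V Ω D => (u, (0 : Lp ℝ 2 σ)) := by fun_prop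
  exact h1.preimage h2

/-- `H^{1/2}` of the surface: the space of the traces of the functions in `H¹(D, ∂Ω)`, with the
quotient norm; that is, `H¹(D, ∂Ω)` modulo the functions with zero trace. -/
def HHalf {n : ℕ} (Ω D : Set (E n)) (σ : Measure (E n)) : Type :=
  H1V Ω D ⧸ traceKer Ω D σ

instance instNormedGroupHHalf {n : ℕ} (Ω D : Set (E n)) (σ : Measure (E n)) :
    NormedAddCommGroup (HHalf Ω D σ) :=
  inferInstanceAs (NormedAddCommGroup (H1V Ω D ⧸ traceKer Ω D σ))

instance instNormedSpaceHHalf {n : ℕ} (Ω D : Set (E n)) (σ : Measure (E n)) :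
    NormedSpace ℝ (HHalf Ω D σ) :=
  inferInstanceAs (NormedSpace ℝ (H1V Ω D ⧸ traceKer Ω D σ))

/-- The trace of `φ` as an element of `H^{1/2}`. -/
def traceHalf {n : ℕ} {Ω D : Set (E n)} (σ : Measure (E n)) (φ : H1V Ω D) : HHalf Ω D σ :=
  Submodule.Quotient.mk (p := traceKer Ω D σ) φ

/-! ### Weak solutions -/

/-- The family of linear functionals `w t` is the distributional derivative on `(0, T)` of the
family `y t`: `∫ y(t)(φ) η'(t) dt = - ∫ w(t)(φ) η(t) dt` for all `φ` and `η ∈ C_c^∞(0, T)`. -/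
def IsTimeDeriv {V : Type*} (T : ℝ) (y w : ℝ → V → ℝ) : Prop :=
  ∀ φ : V, ∀ η : ℝ → ℝ, ContDiff ℝ ∞ η → HasCompactSupport η → tsupport η ⊆ Ioo 0 T →
    ∫ t in Ioo 0 T, y t φ * deriv η t = -∫ t in Ioo 0 T, w t φ * η t

/-- `y`, as a function on `(0, T)`, has a representative in `C([0, T]; B)` which vanishes at
`t = 0`. -/
def HasZeroInitialValue {B : Type*} [NormedAddCommGroup B] (T : ℝ) (y : ℝ → B) : Prop :=
  ∃ Y : ℝ → B, ContinuousOn Y (Icc 0 T) ∧ (∀ᵐ t ∂volume.restrict (Ioo 0 T), Y t = y t) ∧ Y 0 = 0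

/-- The space `L²(0, T; B)`. -/
def IsL2Bochner {B : Type*} [NormedAddCommGroup B] (T : ℝ) (y : ℝ → B) : Prop :=
  MemLp y 2 (volume.restrict (Ioo 0 T))

/-- The space `H¹(Ω_ε, ∂Ω)`. -/
abbrev Vε {n : ℕ} (Ω : Set (E n)) (C₀ ε : ℝ) : Type := H1V Ω (perforated Ω C₀ ε)

/-- The space `H^{1/2}(S_ε)`. -/
abbrev HHalfS {n : ℕ} (Ω : Set (E n)) (C₀ ε : ℝ) : Type :=
  HHalf Ω (perforated Ω C₀ ε) (surfaceMeasure Ω C₀ ε)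

/-- The trace on `S_ε`. -/
def tr {n : ℕ} {Ω : Set (E n)} {C₀ ε : ℝ} (u : Vε Ω C₀ ε) : Lp ℝ 2 (surfaceMeasure Ω C₀ ε) :=
  trace (surfaceMeasure Ω C₀ ε) u

/-- The trace on `S_ε`, as an element of `H^{1/2}(S_ε)`. -/
def trHalf {n : ℕ} {Ω : Set (E n)} {C₀ ε : ℝ} (u : Vε Ω C₀ ε) : HHalfS Ω C₀ ε :=
  traceHalf (surfaceMeasure Ω C₀ ε) u

/-- `w = α ∂ₜu`, where `L²(Ω_ε)` is embedded in the dual of `H¹(Ω_ε, ∂Ω)` by its inner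
product. -/
def IsVolumeTimeDeriv {n : ℕ} {Ω : Set (E n)} {C₀ ε : ℝ} (T α : ℝ) (u : ℝ → Vε Ω C₀ ε)
    (w : ℝ → StrongDual ℝ (Vε Ω C₀ ε)) : Prop :=
  IsTimeDeriv T
    (fun t (φ : Vε Ω C₀ ε) => α * ∫ x in perforated Ω C₀ ε, H1V.val (u t) x * H1V.val φ x)
    (fun t (φ : Vε Ω C₀ ε) => w t φ)

/-- `w = β ∂ₜ(u|_{S_ε})`, where `L²(S_ε)` is embedded in `H^{-1/2}(S_ε)` by its inner
product. -/
def IsSurfaceTimeDeriv {n : ℕ} {Ω : Set (E n)} {C₀ ε : ℝ} (T β : ℝ) (u : ℝ → Vε Ω C₀ ε)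
    (w : ℝ → StrongDual ℝ (HHalfS Ω C₀ ε)) : Prop :=
  IsTimeDeriv T
    (fun t (φ : Vε Ω C₀ ε) => β * ∫ x, tr (u t) x * tr φ x ∂surfaceMeasure Ω C₀ ε)
    (fun t (φ : Vε Ω C₀ ε) => w t (trHalf φ))

/-- `u` is a weak solution of the problem
`α ∂ₜu - Δu = f` in `Ω_ε × (0, T)`,
`ε^{-γ} β ∂ₜu + ∂_ν u + ε^{-γ} lam u = ε^{-γ} g` on `S_ε × (0, T)`,
`u = 0` on `∂Ω × (0, T)`, `α u(x, 0) = 0` in `Ω_ε`, `β u(x, 0) = 0` on `S_ε`. -/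
def IsWeakSolution {n : ℕ} (Ω : Set (E n)) (T C₀ α β lam : ℝ) (f g : E n × ℝ → ℝ) (ε : ℝ)
    (u : ℝ → Vε Ω C₀ ε) : Prop :=
  IsL2Bochner T u ∧
  HasZeroInitialValue T (fun t => α • H1V.val (u t)) ∧
  HasZeroInitialValue T (fun t => β • tr (u t)) ∧
  ∃ (w₁ : ℝ → StrongDual ℝ (Vε Ω C₀ ε)) (w₂ : ℝ → StrongDual ℝ (HHalfS Ω C₀ ε)),
    IsL2Bochner T w₁ ∧ IsVolumeTimeDeriv T α u w₁ ∧
    IsL2Bochner T w₂ ∧ IsSurfaceTimeDeriv T β u w₂ ∧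
    ∀ φ : ℝ → Vε Ω C₀ ε, IsL2Bochner T φ →
      (∫ t in Ioo 0 T, w₁ t (φ t))
        + ε ^ (-gam n) * (∫ t in Ioo 0 T, w₂ t (trHalf (φ t)))
        + (∫ t in Ioo 0 T, ∫ x in perforated Ω C₀ ε,
            inner ℝ (H1V.grad (u t) x) (H1V.grad (φ t) x))
        + lam * ε ^ (-gam n) *
            (∫ t in Ioo 0 T, ∫ x, tr (u t) x * tr (φ t) x ∂surfaceMeasure Ω C₀ ε)
      = ε ^ (-gam n) *
            (∫ t in Ioo 0 T, ∫ x, g (x, t) * tr (φ t) x ∂surfaceMeasure Ω C₀ ε)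
        + ∫ t in Ioo 0 T, ∫ x in perforated Ω C₀ ε, f (x, t) * H1V.val (φ t) x

/-- `u ∈ H¹(Q)` with `‖u‖_{H¹(Q)} ≤ K`, for an (open) set `Q` in space-time: `u`, its weak
spatial gradient `G` and its weak time derivative `D` are in `L²(Q)`, and
`(‖u‖² + ‖G‖² + ‖D‖²)^{1/2} ≤ K`. -/
def H1NormLE {n : ℕ} (Q : Set (E n × ℝ)) (u : E n × ℝ → ℝ) (K : ℝ) : Prop :=
  ∃ (G : E n × ℝ → E n) (D : E n × ℝ → ℝ),
    MemLp u 2 (volume.restrict Q) ∧ MemLp G 2 (volume.restrict Q) ∧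
    MemLp D 2 (volume.restrict Q) ∧
    (∀ e : E n, HasWeakDeriv Q (e, (0 : ℝ)) u (fun z => inner ℝ (G z) e)) ∧
    HasWeakDeriv Q ((0 : E n), (1 : ℝ)) u D ∧
    √((∫ z in Q, u z ^ 2) + (∫ z in Q, ‖G z‖ ^ 2) + ∫ z in Q, D z ^ 2) ≤ K

/-- The function `U` of `(x, t)` represents the vector-valued function `u` of `t`. -/
def Represents {n : ℕ} {Ω D : Set (E n)} (T : ℝ) (U : E n × ℝ → ℝ) (u : ℝ → H1V Ω D) : Prop :=
  ∀ᵐ t ∂volume.restrict (Ioo 0 T),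
    (fun x => U (x, t)) =ᵐ[volume.restrict D] (H1V.val (u t) : E n → ℝ)

end DynBC

end

/-!
The problem is an evolution equation `(α v*v + β e τ*τ) u' + (∇*∇ + λ e τ*τ) u = v* f + e τ* g` in
the Hilbert space `V = H¹(Ω_ε, ∂Ω)`, where `v : V → L²(Ω_ε)` is the inclusion, `τ : V → L²(S_ε)`
the trace and `e = ε^{-γ}`. Existence and uniqueness are soft; the point is that every constant in
the estimates is independent of `ε`.

**The barrier.** The inequalities that are uniform in `ε` all come from one function `ψ`
(`IsBarrier`, `exists_isBarrier`): `0 ≤ ψ ≤ M` on `Ω_ε`, `ψ = 0` on `S_ε`, `-Δψ = 1 + κ` with `κ ≥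
0`, and the normal derivative of `ψ` on `S_ε` has the constant size `b ≤ C ε^{-γ}`. It is a
regularized minimum of the paraboloid `M - |x|² / 2n` and, for each particle, a radial function of
the form `A (1 - (a / r)ⁿ⁻²) - (r² - a²) / 2n`; a smooth minimum of functions with Laplacian `-1`
has Laplacian at most `-1`. The slope of the radial functions on the spheres `r = a` is of order
`1 / a = ε^{-γ} / C₀`, which is where the critical scaling enters. No extension operator is
needed: only test functions with compact support in `Ω` occur. Green's formula for `ψ` is proved
by cutting the test function near the particles and using polar coordinates around each of them
(`integral_partition_radial`). Testing it with

* `φ²` gives the trace inequality, and with it the trace operator (`IsBarrier.traceL`);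
* `φ² exp (-ψ)` gives the Poincaré inequality `‖φ‖² ≤ e^M (‖∇φ‖² + b ‖τ φ‖²)`
  (`IsBarrier.norm_sq_val_le`), so that the energy controls the whole norm of `V`;
* `v²`, together with the equation tested with `v ψ`, gives
  `‖v‖² ≤ 2 b ‖τ v‖² + 4 M² ‖F‖²` for weak solutions of `-Δv = F` whose trace is arbitrary
  (`IsBarrier.norm_sq_val_le_of_forall_traceKer`).

**Existence and bounds.** `exists_evolution` solves `(m*m u)' + u = ℓ`, `(m u)(0) = 0`, by a
Lions-type variant of the Lax-Milgram theorem (`exists_of_lions`): in the closed space of pairs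
`(u, p)` with `m u = ∫₀ᵗ p`, the equation is tested with curves `(1 + T - t) w(t)`, and its
left-hand side is coercive with respect to `∫₀ᵗ w` and `m w`. This is the energy estimate obtained
by testing with `u'`, so it bounds `p = (m u)'` in `L²` as well as `u`. The right-hand side has to
be bounded in terms of `m w` and `∫₀ᵗ w`. The term with `g` is integrated by parts in time
(`abs_curveFunctional_weight_le_of_deriv`), and it is of the right size because `ε^{-γ}` times the
area of `S_ε` is bounded (`surfaceMeasure_univ_le`). The term with `f` is bounded by `m w` if `α >
0`, and it is integrated by parts too if `α = 0` and `f ∈ H¹(0, T; L²)`.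

**The time derivative.** If `α > 0`, it is part of `p`. If `α = 0`, then `-Δu = f` at almost every
time, so the third inequality makes `u(t)` the image of `(τ u(t), f(t))` under a bounded linear
map, and `u` is differentiable in time because `τ u` and `f` are (`exists_time_deriv`).

**Uniqueness.** The difference `d` of two solutions is tested with `∫ₜᵀ d`
(`ae_eq_zero_of_evolution`), which requires no time derivative of `d`.

Curves with values in `L²(Ω_ε)` are identified with functions on the cylinder by `jointLp` and its
adjoint `curveOf`.
-/

open MeasureTheory Set Filter Topology
open scoped ContDiff ENNReal

noncomputable section

namespace DynBC

/-! ### Primitives of vector-valued curves -/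

section Primitive

variable {A B G : Type*} [NormedAddCommGroup A] [NormedSpace ℝ A]
  [NormedAddCommGroup B] [NormedSpace ℝ B] [NormedAddCommGroup G] [NormedSpace ℝ G]

/-- The primitive `t ↦ ∫₀ᵗ p` of a curve `p`. -/
def prim (p : ℝ → A) (t : ℝ) : A := ∫ s in (0 : ℝ)..t, p s

@[simp] theorem prim_zero (p : ℝ → A) : prim p 0 = 0 := by simp [prim]

omit [NormedSpace ℝ A] in
theorem integrable_Ioo_mono {p : ℝ → A} {T t : ℝ} (ht : t ≤ T)
    (hp : Integrable p (volume.restrict (Ioo 0 T))) :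
    Integrable p (volume.restrict (Ioo 0 t)) :=
  hp.mono_measure (Measure.restrict_mono (Ioo_subset_Ioo_right ht) le_rfl)

theorem prim_eq_setIntegral (p : ℝ → A) {t : ℝ} (ht : 0 ≤ t) :
    prim p t = ∫ s in Ioo 0 t, p s := by
  rw [prim, intervalIntegral.integral_of_le ht, integral_Ioc_eq_integral_Ioo]

theorem continuousOn_prim {p : ℝ → A} {T : ℝ} (hT : 0 ≤ T)
    (hp : Integrable p (volume.restrict (Ioo 0 T))) : ContinuousOn (prim p) (Icc 0 T) := by
  have h : IntegrableOn p (uIcc 0 T) := by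
    rw [uIcc_of_le hT, integrableOn_Icc_iff_integrableOn_Ioo]
    exact hp
  have := intervalIntegral.continuousOn_primitive_interval h
  rwa [uIcc_of_le hT] at this

theorem norm_prim_le {p : ℝ → A} {T t : ℝ} (ht : t ∈ Icc 0 T)
    (hp : Integrable p (volume.restrict (Ioo 0 T))) :
    ‖prim p t‖ ≤ ∫ s in Ioo 0 T, ‖p s‖ := by
  rw [prim_eq_setIntegral p ht.1]
  refine (norm_integral_le_integral_norm _).trans ?_
  exact setIntegral_mono_set hp.norm (Eventually.of_forall fun _ => norm_nonneg _)
    (Ioo_subset_Ioo_right ht.2).eventuallyLE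

theorem prim_congr {p q : ℝ → A} {T t : ℝ} (ht : t ∈ Icc 0 T)
    (h : p =ᵐ[volume.restrict (Ioo 0 T)] q) : prim p t = prim q t := by
  rw [prim_eq_setIntegral p ht.1, prim_eq_setIntegral q ht.1]
  exact integral_congr_ae (ae_restrict_of_ae_restrict_of_subset (Ioo_subset_Ioo_right ht.2) h)

theorem clm_prim [CompleteSpace A] [CompleteSpace B] (L : A →L[ℝ] B) {p : ℝ → A} {T t : ℝ}
    (ht : t ∈ Icc 0 T)
    (hp : Integrable p (volume.restrict (Ioo 0 T))) :
    L (prim p t) = prim (fun s => L (p s)) t := by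
  rw [prim_eq_setIntegral _ ht.1, prim_eq_setIntegral _ ht.1,
    L.integral_comp_comm (integrable_Ioo_mono ht.2 hp)]

/-- Integration by parts for a bilinear pairing of two primitives; this is Fubini's theorem on
the square `(0, T)²`, cut along its diagonal. -/
theorem integral_bilin_prim [CompleteSpace A] [CompleteSpace B] [CompleteSpace G]
    (L : A →L[ℝ] B →L[ℝ] G) {p : ℝ → A} {q : ℝ → B} {T : ℝ}
    (hT : 0 ≤ T) (hp : Integrable p (volume.restrict (Ioo 0 T)))
    (hq : Integrable q (volume.restrict (Ioo 0 T))) :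
    (∫ t in Ioo 0 T, L (prim p t) (q t)) + (∫ t in Ioo 0 T, L (p t) (prim q t))
      = L (prim p T) (prim q T) := by
  set μ : Measure ℝ := volume.restrict (Ioo 0 T) with hμ
  have hΦ : Integrable (fun z : ℝ × ℝ => L (p z.1) (q z.2)) (μ.prod μ) := by
    have h1 : AEStronglyMeasurable (fun z : ℝ × ℝ => L (p z.1) (q z.2)) (μ.prod μ) :=
      L.aestronglyMeasurable_comp₂ hp.aestronglyMeasurable.comp_fst
        hq.aestronglyMeasurable.comp_snd
    refine ((hp.norm.mul_prod hq.norm).const_mul ‖L‖).mono' h1 (Eventually.of_forall fun z => ?_)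
    have := L.le_opNorm₂ (p z.1) (q z.2)
    simpa [mul_assoc] using this
  have hM : MeasurableSet {z : ℝ × ℝ | z.1 < z.2} := measurableSet_lt measurable_fst measurable_snd
  have e0 : ∫ z, L (p z.1) (q z.2) ∂(μ.prod μ) = L (prim p T) (prim q T) := by
    rw [integral_prod_bilin L hp hq, prim_eq_setIntegral p hT, prim_eq_setIntegral q hT]
  rw [← e0, ← integral_add_compl hM hΦ]
  congr 1
  · rw [← integral_indicator hM, integral_prod_symm _ (hΦ.indicator hM)]
    refine setIntegral_congr_fun measurableSet_Ioo fun t ht => ?_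
    have h1 : ∀ s, ({z : ℝ × ℝ | z.1 < z.2}.indicator (fun z => L (p z.1) (q z.2))) (s, t)
        = (Iio t).indicator (fun s => L (p s) (q t)) s := by
      intro s
      by_cases h : s < t <;> simp [indicator, h]
    simp only [h1]
    rw [integral_indicator measurableSet_Iio, hμ, Measure.restrict_restrict measurableSet_Iio,
      Set.inter_comm, Ioo_inter_Iio, min_eq_right ht.2.le, prim_eq_setIntegral p ht.1.le]
    exact ((L.flip (q t)).integral_comp_comm (integrable_Ioo_mono ht.2.le hp)).symm
  · rw [← integral_indicator hM.compl, integral_prod _ (hΦ.indicator hM.compl)]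
    refine setIntegral_congr_fun measurableSet_Ioo fun s hs => ?_
    have h1 : ∀ t, ({z : ℝ × ℝ | z.1 < z.2}ᶜ.indicator (fun z => L (p z.1) (q z.2))) (s, t)
        = (Iic s).indicator (fun t => L (p s) (q t)) t := by
      intro t
      by_cases h : s < t
      · simp [indicator, h]
      · simp [indicator, h, not_lt.1 h]
    simp only [h1]
    rw [integral_indicator measurableSet_Iic, hμ, Measure.restrict_restrict measurableSet_Iic]
    have : Iic s ∩ Ioo 0 T = Ioc 0 s := by
      ext x; simp only [mem_inter_iff, mem_Iic, mem_Ioo, mem_Ioc]; constructor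
      · rintro ⟨h1, h2, h3⟩; exact ⟨h2, h1⟩
      · rintro ⟨h1, h2⟩; exact ⟨h2, h1, h2.trans_lt hs.2⟩
    rw [this, integral_Ioc_eq_integral_Ioo, prim_eq_setIntegral q hs.1.le]
    exact ((L (p s)).integral_comp_comm (integrable_Ioo_mono hs.2.le hq)).symm

theorem integrable_prim {p : ℝ → A} {T : ℝ} (hT : 0 ≤ T)
    (hp : Integrable p (volume.restrict (Ioo 0 T))) :
    Integrable (prim p) (volume.restrict (Ioo 0 T)) := by
  have h : IntegrableOn (prim p) (Icc 0 T) :=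
    (continuousOn_prim hT hp).integrableOn_compact isCompact_Icc
  exact h.mono_set Ioo_subset_Icc_self

omit [NormedSpace ℝ A] in
theorem memLp_of_continuousOn {p : ℝ → A} {T : ℝ} (hp : ContinuousOn p (Icc 0 T)) (r : ℝ≥0∞) :
    MemLp p r (volume.restrict (Ioo 0 T)) := by
  obtain ⟨C, hC⟩ := isCompact_Icc.exists_bound_of_continuousOn hp
  refine MemLp.of_bound ((hp.mono Ioo_subset_Icc_self).aestronglyMeasurable measurableSet_Ioo) C ?_
  filter_upwards [ae_restrict_mem measurableSet_Ioo] with t ht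
  exact hC t (Ioo_subset_Icc_self ht)

theorem memLp_prim {p : ℝ → A} {T : ℝ} (hT : 0 ≤ T)
    (hp : Integrable p (volume.restrict (Ioo 0 T))) (r : ℝ≥0∞) :
    MemLp (prim p) r (volume.restrict (Ioo 0 T)) :=
  memLp_of_continuousOn (continuousOn_prim hT hp) r

/-- The du Bois-Reymond lemma: a curve whose weak derivative vanishes is constant. -/
theorem ae_eq_const_of_integral_deriv_smul_eq_zero [CompleteSpace A] {r : ℝ → A} {T : ℝ}
    (hT : 0 < T)
    (hr : Integrable r (volume.restrict (Ioo 0 T)))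
    (h : ∀ η : ℝ → ℝ, ContDiff ℝ ∞ η → HasCompactSupport η → tsupport η ⊆ Ioo 0 T →
      ∫ t in Ioo 0 T, deriv η t • r t = 0) :
    ∃ c, r =ᵐ[volume.restrict (Ioo 0 T)] fun _ => c := by
  let β : ContDiffBump (T / 2) := ⟨T / 8, T / 4, by positivity, by linarith⟩
  set η₀ : ℝ → ℝ := β.normed volume with hη₀
  have h0s : ContDiff ℝ ∞ η₀ := β.contDiff_normed
  have h0c : HasCompactSupport η₀ := β.hasCompactSupport_normed
  have h0t : tsupport η₀ ⊆ Ioo 0 T := by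
    rw [hη₀, β.tsupport_normed_eq, Real.closedBall_eq_Icc]
    intro x hx
    have : β.rOut = T / 4 := rfl
    rw [this] at hx
    constructor <;> linarith [hx.1, hx.2]
  have h0i : ∫ t, η₀ t = 1 := β.integral_normed
  have hbd : ∀ η : ℝ → ℝ, ContDiff ℝ ∞ η → HasCompactSupport η →
      Integrable (fun t => η t • r t) (volume.restrict (Ioo 0 T)) := by
    intro η hη hc
    obtain ⟨C, hC⟩ := hη.continuous.bounded_above_of_compact_support hc
    exact hr.bdd_smul (C := C) hη.continuous.aestronglyMeasurable (Eventually.of_forall hC)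
  refine ⟨∫ t in Ioo 0 T, η₀ t • r t, ?_⟩
  set c := ∫ t in Ioo 0 T, η₀ t • r t
  have key := isOpen_Ioo.ae_eq_zero_of_integral_contDiff_smul_eq_zero (μ := volume)
    (U := Ioo 0 T) (f := fun t => r t - c)
    (IntegrableOn.locallyIntegrableOn (hr.sub (integrable_const c))) ?_
  · rw [EventuallyEq, ae_restrict_iff' measurableSet_Ioo]
    filter_upwards [key] with t ht hm using sub_eq_zero.1 (ht hm)
  intro η hη hc ht
  set I := ∫ t, η t with hI
  have hcont : Continuous fun t => η t - I * η₀ t := by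
    have := hη.continuous; have := h0s.continuous; fun_prop
  set ζ : ℝ → ℝ := fun t => ∫ s in (0 : ℝ)..t, (η s - I * η₀ s) with hζ
  have hd : ∀ t, HasDerivAt ζ (η t - I * η₀ t) t := fun t =>
    intervalIntegral.integral_hasDerivAt_right (hcont.intervalIntegrable _ _)
      hcont.stronglyMeasurable.stronglyMeasurableAtFilter hcont.continuousAt
  have hderiv : deriv ζ = fun t => η t - I * η₀ t := funext fun t => (hd t).deriv
  have hζs : ContDiff ℝ ∞ ζ := by
    rw [contDiff_infty_iff_deriv, hderiv]
    exact ⟨fun t => (hd t).differentiableAt, hη.sub (contDiff_const.mul h0s)⟩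
  -- the supports of `η` and `η₀` lie in a compact interval `[a, b]` inside `(0, T)`
  obtain ⟨a, b, ha, hb, hab⟩ : ∃ a b, 0 < a ∧ b < T ∧
      tsupport η ∪ tsupport η₀ ⊆ Icc a b := by
    have hK : IsCompact (tsupport η ∪ tsupport η₀) := hc.union h0c
    have hne : (tsupport η ∪ tsupport η₀).Nonempty := by
      by_contra hne
      rw [Set.not_nonempty_iff_eq_empty, Set.union_empty_iff, tsupport_eq_empty_iff] at hne
      have : η₀ = 0 := tsupport_eq_empty_iff.1 hne.2
      rw [this] at h0i; simp at h0i
    have hsub := Set.union_subset ht h0t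
    exact ⟨_, _, (hsub (hK.sInf_mem hne)).1, (hsub (hK.sSup_mem hne)).2,
      fun x hx => ⟨csInf_le hK.bddBelow hx, le_csSup hK.bddAbove hx⟩⟩
  have hz : ∀ s, s ∉ Icc a b → η s - I * η₀ s = 0 := by
    intro s hs
    rw [image_eq_zero_of_notMem_tsupport fun h => hs (hab (Or.inl h)),
      image_eq_zero_of_notMem_tsupport fun h => hs (hab (Or.inr h))]
    simp
  have hζ0 : ∀ t, t ∉ Icc a b → ζ t = 0 := by
    intro t htt
    have hcs : HasCompactSupport fun s => η s - I * η₀ s := hc.sub (h0c.mul_left)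
    by_cases hta : t < a
    · rw [hζ]
      simp only
      rw [intervalIntegral.integral_congr (g := fun _ => (0 : ℝ)), intervalIntegral.integral_zero]
      intro s hs
      refine hz s fun h => ?_
      rcases le_total 0 t with h0 | h0
      · rw [uIcc_of_le h0] at hs; linarith [hs.2, h.1]
      · rw [uIcc_of_ge h0] at hs; linarith [hs.2, h.1]
    · have htb : b < t := by
        by_contra hh; exact htt ⟨not_lt.1 hta, not_lt.1 hh⟩
      have hab' : a ≤ b := by
        by_contra hh
        have : η₀ = 0 := by
          ext s
          refine image_eq_zero_of_notMem_tsupport fun h => ?_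
          have := hab (Or.inr h)
          exact hh (this.1.trans this.2)
        rw [this] at h0i; simp at h0i
      have e1 : ζ t = ∫ s, (η s - I * η₀ s) := by
        rw [hζ]; simp only
        rw [intervalIntegral.integral_of_le (by linarith), setIntegral_eq_integral_of_forall_compl_eq_zero]
        intro s hs
        refine hz s fun h => hs ⟨by linarith [h.1], by linarith [h.2]⟩
      rw [e1, integral_sub (hη.continuous.integrable_of_hasCompactSupport hc)
        ((h0s.continuous.integrable_of_hasCompactSupport h0c).const_mul I), integral_const_mul,
        h0i, hI]
      simp
  have hts : tsupport ζ ⊆ Icc a b :=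
    closure_minimal (fun t ht' => by by_contra hh; exact ht' (hζ0 t hh)) isClosed_Icc
  have k := h ζ hζs (HasCompactSupport.intro isCompact_Icc hζ0)
    (hts.trans fun x hx => ⟨ha.trans_le hx.1, hx.2.trans_lt hb⟩)
  rw [hderiv] at k
  simp only [sub_smul, mul_smul] at k
  rw [integral_sub (hbd η hη hc) (by exact (hbd η₀ h0s h0c).smul I), integral_smul] at k
  have e2 : ∫ t in Ioo 0 T, η t = I :=
    setIntegral_eq_integral_of_forall_compl_eq_zero fun t htt =>
      image_eq_zero_of_notMem_tsupport fun hh => htt (ht hh)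
  have e3 : ∫ x, η x • (r x - c) = ∫ x in Ioo 0 T, η x • (r x - c) :=
    (setIntegral_eq_integral_of_forall_compl_eq_zero fun t htt => by
      rw [image_eq_zero_of_notMem_tsupport fun hh => htt (ht hh), zero_smul]).symm
  rw [e3]
  simp only [smul_sub]
  rw [integral_sub (hbd η hη hc)
    (((hη.continuous.integrable_of_hasCompactSupport hc).restrict).smul_const c),
    integral_smul_const, e2]
  exact k

end Primitive

/-! ### Weak time derivatives -/

section WeakTimeDerivative

variable {A B G : Type*} [NormedAddCommGroup A] [NormedSpace ℝ A]
  [NormedAddCommGroup B] [NormedSpace ℝ B] [NormedAddCommGroup G] [NormedSpace ℝ G]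

/-- Lebesgue measure on the time interval `(0, T)`. -/
abbrev timeMeasure (T : ℝ) : Measure ℝ := volume.restrict (Ioo 0 T)

theorem prim_deriv_of_tsupport {η : ℝ → ℝ} {T : ℝ} (hη : ContDiff ℝ ∞ η)
    (ht : tsupport η ⊆ Ioo 0 T) (t : ℝ) : prim (deriv η) t = η t := by
  have h0 : η 0 = 0 := image_eq_zero_of_notMem_tsupport fun h => lt_irrefl _ (ht h).1
  have hd : Continuous (deriv η) := hη.continuous_deriv (by simp)
  rw [prim, intervalIntegral.integral_deriv_eq_sub
    (fun x _ => (hη.differentiable (by simp)).differentiableAt) (hd.intervalIntegrable _ _), h0,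
    sub_zero]

theorem integrable_test_deriv {η : ℝ → ℝ} {T : ℝ} (hη : ContDiff ℝ ∞ η) :
    Integrable (deriv η) (timeMeasure T) :=
  ((memLp_of_continuousOn (hη.continuous_deriv (by simp)).continuousOn 1).integrable le_rfl)

/-- A primitive has the original curve as its weak derivative. -/
theorem integral_deriv_smul_prim [CompleteSpace A] {p : ℝ → A} {T : ℝ} (hT : 0 ≤ T)
    (hp : Integrable p (timeMeasure T)) {η : ℝ → ℝ} (hη : ContDiff ℝ ∞ η)
    (ht : tsupport η ⊆ Ioo 0 T) :
    ∫ t in Ioo 0 T, deriv η t • prim p t = -∫ t in Ioo 0 T, η t • p t := by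
  have k := integral_bilin_prim (ContinuousLinearMap.lsmul ℝ ℝ : ℝ →L[ℝ] A →L[ℝ] A) hT
    (integrable_test_deriv (T := T) hη) hp
  have hT0 : η T = 0 := image_eq_zero_of_notMem_tsupport fun h => lt_irrefl _ (ht h).2
  simp only [ContinuousLinearMap.lsmul_apply, prim_deriv_of_tsupport hη ht, hT0, zero_smul] at k
  rw [eq_neg_iff_add_eq_zero, add_comm]
  exact k

theorem integrable_smul_of_continuous {r : ℝ → A} {T : ℝ} (hr : Integrable r (timeMeasure T))
    {η : ℝ → ℝ} (hη : Continuous η) : Integrable (fun t => η t • r t) (timeMeasure T) := by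
  obtain ⟨C, hC⟩ := isCompact_Icc.exists_bound_of_continuousOn
    (hη.continuousOn (s := Icc 0 T))
  refine hr.bdd_smul (C := C) hη.aestronglyMeasurable ?_
  filter_upwards [ae_restrict_mem measurableSet_Ioo] with t ht
  exact hC t (Ioo_subset_Icc_self ht)

/-- A curve with an integrable weak derivative is a constant plus the primitive of the latter. -/
theorem exists_ae_eq_const_add_prim [CompleteSpace A] {h h' : ℝ → A} {T : ℝ} (hT : 0 < T)
    (hh : Integrable h (timeMeasure T)) (hh' : Integrable h' (timeMeasure T))
    (hw : ∀ η : ℝ → ℝ, ContDiff ℝ ∞ η → HasCompactSupport η → tsupport η ⊆ Ioo 0 T →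
      ∫ t in Ioo 0 T, deriv η t • h t = -∫ t in Ioo 0 T, η t • h' t) :
    ∃ c, ∀ᵐ t ∂timeMeasure T, h t = c + prim h' t := by
  have hi := integrable_prim hT.le hh'
  obtain ⟨c, hc⟩ := ae_eq_const_of_integral_deriv_smul_eq_zero (r := fun t => h t - prim h' t) hT
    (hh.sub hi) (by
      intro η hη hcs ht
      have hd := hη.continuous_deriv (by simp)
      simp only [smul_sub]
      rw [integral_sub (integrable_smul_of_continuous hh hd) (integrable_smul_of_continuous hi hd),
        hw η hη hcs ht, integral_deriv_smul_prim hT.le hh' hη ht, sub_self])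
  refine ⟨c, ?_⟩
  filter_upwards [hc] with t ht
  rw [← ht]; abel

/-- The constant of integration is controlled by the `L¹` norms of the curve and of its
derivative. -/
theorem norm_const_le_of_ae_eq {h h' : ℝ → A} {T : ℝ} (hT : 0 < T)
    (hh : Integrable h (timeMeasure T)) (hh' : Integrable h' (timeMeasure T)) {c : A}
    (hc : ∀ᵐ t ∂timeMeasure T, h t = c + prim h' t) :
    T * ‖c‖ ≤ (∫ t in Ioo 0 T, ‖h t‖) + T * ∫ t in Ioo 0 T, ‖h' t‖ := by
  have h1 : ∀ᵐ t ∂timeMeasure T, ‖c‖ ≤ ‖h t‖ + ∫ s in Ioo 0 T, ‖h' s‖ := by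
    filter_upwards [hc, ae_restrict_mem measurableSet_Ioo] with t ht hm
    have : c = h t - prim h' t := by rw [ht]; abel
    calc ‖c‖ = ‖h t - prim h' t‖ := by rw [← this]
      _ ≤ ‖h t‖ + ‖prim h' t‖ := norm_sub_le _ _
      _ ≤ _ := by gcongr; exact norm_prim_le (Ioo_subset_Icc_self hm) hh'
  have h2 := integral_mono_ae (integrable_const _) (hh.norm.add (integrable_const _)) h1
  simp only [Pi.add_apply] at h2
  rw [integral_add hh.norm (integrable_const _)] at h2
  simpa [hT.le] using h2

/-- A curve is determined by its primitive, since it is the weak derivative of the primitive. -/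
theorem ae_eq_zero_of_prim_eq_zero [CompleteSpace A] {w : ℝ → A} {T : ℝ} (hT : 0 ≤ T)
    (hw : Integrable w (timeMeasure T)) (h : ∀ᵐ t ∂timeMeasure T, prim w t = 0) :
    w =ᵐ[timeMeasure T] 0 := by
  have key := isOpen_Ioo.ae_eq_zero_of_integral_contDiff_smul_eq_zero (μ := volume)
    (U := Ioo 0 T) (f := w) (IntegrableOn.locallyIntegrableOn hw) ?_
  · rw [EventuallyEq, ae_restrict_iff' measurableSet_Ioo]
    exact key
  intro η hη _ ht
  have k := integral_deriv_smul_prim hT hw hη ht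
  rw [integral_eq_zero_of_ae (by filter_upwards [h] with t h0; simp [h0])] at k
  rw [← setIntegral_eq_integral_of_forall_compl_eq_zero (s := Ioo 0 T) fun t htt => by
      rw [image_eq_zero_of_notMem_tsupport fun hh => htt (ht hh), zero_smul]]
  simpa using k

/-- A curve with integrable weak derivative `w`, and with a representative that is continuous
on `[0, T]` and vanishes at `0`, is the primitive of `w`. -/
theorem ae_eq_prim_of_zero_initial [CompleteSpace A] {y w Y : ℝ → A} {T : ℝ} (hT : 0 < T)
    (hw : Integrable w (timeMeasure T)) (hY : ContinuousOn Y (Icc 0 T))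
    (hYy : ∀ᵐ t ∂timeMeasure T, Y t = y t) (hY0 : Y 0 = 0)
    (hyw : ∀ η : ℝ → ℝ, ContDiff ℝ ∞ η → HasCompactSupport η → tsupport η ⊆ Ioo 0 T →
      ∫ t in Ioo 0 T, deriv η t • y t = -∫ t in Ioo 0 T, η t • w t) :
    ∀ᵐ t ∂timeMeasure T, y t = prim w t := by
  have hyi : Integrable y (timeMeasure T) :=
    ((memLp_of_continuousOn hY 1).integrable le_rfl).congr hYy
  obtain ⟨c, hc⟩ := exists_ae_eq_const_add_prim hT hyi hw hyw
  have hcont : ContinuousOn (fun t => Y t - prim w t) (Icc 0 T) :=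
    hY.sub (continuousOn_prim hT.le hw)
  have hae : (fun t => Y t - prim w t) =ᵐ[volume.restrict (Icc 0 T)] fun _ => c := by
    rw [← restrict_Ioo_eq_restrict_Icc]
    filter_upwards [hc, hYy] with t h1 h2
    rw [h2, h1]; abel
  have heq := Measure.eqOn_Icc_of_ae_eq volume hT.ne hae hcont continuousOn_const
  have h0 : c = 0 := by
    have := heq (left_mem_Icc.2 hT.le)
    simpa [hY0] using this.symm
  filter_upwards [hc] with t h1
  rw [h1, h0, zero_add]

end WeakTimeDerivative

/-! ### Unique solvability of the abstract evolution problem -/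

section Evolution

variable {V B : Type*} [NormedAddCommGroup V] [InnerProductSpace ℝ V] [CompleteSpace V]
  [NormedAddCommGroup B] [InnerProductSpace ℝ B] [CompleteSpace B]

/-- Uniqueness for `(b d)' + a d = 0`, `(b d)(0) = 0`, with nonnegative symmetric forms `a`, `b`.
The equation is tested with `∫ₜᵀ d`; this needs no time derivative of `d`. -/
theorem ae_eq_zero_of_evolution {T : ℝ} (hT : 0 < T) (a b : V →L[ℝ] StrongDual ℝ V)
    (hasymm : ∀ v w, a v w = a w v) (ha0 : ∀ v, 0 ≤ a v v) (haz : ∀ v, a v v = 0 → v = 0)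
    (hb0 : ∀ v, 0 ≤ b v v) (hbz : ∀ v, b v v = 0 → b v = 0)
    {d : ℝ → V} {w : ℝ → StrongDual ℝ V} (hd : MemLp d 2 (timeMeasure T))
    (hw : MemLp w 2 (timeMeasure T)) (hbw : ∀ᵐ t ∂timeMeasure T, b (d t) = prim w t)
    (heq : ∀ φ : ℝ → V, MemLp φ 2 (timeMeasure T) →
      (∫ t in Ioo 0 T, w t (φ t)) + ∫ t in Ioo 0 T, a (d t) (φ t) = 0) :
    d =ᵐ[timeMeasure T] 0 := by
  have hdi : Integrable d (timeMeasure T) := hd.integrable one_le_two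
  have hwi : Integrable w (timeMeasure T) := hw.integrable one_le_two
  have hpair : ∀ {f : ℝ → StrongDual ℝ V} {g : ℝ → V}, MemLp f 2 (timeMeasure T) →
      MemLp g 2 (timeMeasure T) → Integrable (fun t => f t (g t)) (timeMeasure T) := by
    intro f g hf hg
    refine (hf.norm.integrable_mul hg.norm).mono'
      ((ContinuousLinearMap.id ℝ (StrongDual ℝ V)).aestronglyMeasurable_comp₂
        hf.aestronglyMeasurable hg.aestronglyMeasurable) (Eventually.of_forall fun t => ?_)
    simpa using (f t).le_opNorm (g t)
  have had : MemLp (fun t => a (d t)) 2 (timeMeasure T) := a.comp_memLp' hd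
  have hbd : MemLp (fun t => b (d t)) 2 (timeMeasure T) := b.comp_memLp' hd
  have hJ := memLp_prim hT.le hdi 2
  -- the test function `∫ₜᵀ d`
  have hc : MemLp (fun _ : ℝ => prim d T) 2 (timeMeasure T) := memLp_const _
  have k := heq (fun t => prim d T - prim d t) (hc.sub hJ)
  simp only [map_sub] at k
  rw [integral_sub (hpair hw hc) (hpair hw hJ), integral_sub (hpair had hc) (hpair had hJ)] at k
  have i1 := integral_bilin_prim (ContinuousLinearMap.id ℝ (StrongDual ℝ V)) hT.le hwi hdi
  have i2 := integral_bilin_prim a hT.le hdi hdi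
  simp only [ContinuousLinearMap.id_apply] at i1
  have e1 : ∫ t in Ioo 0 T, w t (prim d T) = prim w T (prim d T) := by
    rw [prim_eq_setIntegral w hT.le]
    exact ((ContinuousLinearMap.apply ℝ ℝ (prim d T)).integral_comp_comm hwi)
  have e2 : ∫ t in Ioo 0 T, a (d t) (prim d T) = a (prim d T) (prim d T) := by
    conv_rhs => rw [prim_eq_setIntegral d hT.le]
    rw [prim_eq_setIntegral d hT.le]
    exact ((a.flip (∫ s in Ioo 0 T, d s)).integral_comp_comm hdi)
  have e3 : ∫ t in Ioo 0 T, a (prim d t) (d t) = ∫ t in Ioo 0 T, a (d t) (prim d t) :=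
    integral_congr_ae (Eventually.of_forall fun t => hasymm _ _)
  have e4 : ∫ t in Ioo 0 T, prim w t (d t) = ∫ t in Ioo 0 T, b (d t) (d t) :=
    integral_congr_ae (by filter_upwards [hbw] with t ht; rw [ht])
  rw [e1, e2] at k
  rw [e4] at i1
  rw [e3] at i2
  have p1 := ha0 (prim d T)
  have p2 : 0 ≤ ∫ t in Ioo 0 T, b (d t) (d t) := integral_nonneg fun t => hb0 _
  have p3 : ∫ t in Ioo 0 T, b (d t) (d t) = 0 := by linarith
  rw [integral_eq_zero_iff_of_nonneg (fun t => hb0 _) (hpair hbd hd)] at p3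
  have hprim : ∀ᵐ t ∂timeMeasure T, prim w t = 0 := by
    filter_upwards [p3, hbw] with t h1 h2
    rw [← h2]; exact hbz _ h1
  have hw0 := ae_eq_zero_of_prim_eq_zero hT.le hwi hprim
  have k2 := heq d hd
  rw [integral_eq_zero_of_ae (by filter_upwards [hw0] with t h; simp [h]), zero_add,
    integral_eq_zero_iff_of_nonneg (fun t => ha0 _) (hpair had hd)] at k2
  filter_upwards [k2] with t ht
  exact haz _ ht

/-- A variant of the Lax-Milgram theorem due to Lions: in a closed subspace `K` of a Hilbert
space, the equations `⟨R w, x⟩ = ℓ w` are solvable if `⟨R w, Ψ w⟩ ≥ c ‖Ψ w‖²` for some map `Ψ`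
into `K` with `|ℓ w| ≤ M ‖Ψ w‖`. -/
theorem exists_of_lions {H W : Type*} [NormedAddCommGroup H] [InnerProductSpace ℝ H]
    [AddCommGroup W] [Module ℝ W] (K : Submodule ℝ H) [CompleteSpace K]
    (R : W →ₗ[ℝ] H) (Ψ : W → K) (ℓ : W →ₗ[ℝ] ℝ) {c M : ℝ} (hc : 0 < c) (hM : 0 ≤ M)
    (hcoer : ∀ w, c * ‖Ψ w‖ ^ 2 ≤ inner ℝ (R w) (Ψ w : H)) (hℓ : ∀ w, |ℓ w| ≤ M * ‖Ψ w‖) :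
    ∃ x : K, (∀ w, inner ℝ (R w) (x : H) = ℓ w) ∧ ‖x‖ ≤ M / c := by
  set r : W →ₗ[ℝ] K := K.orthogonalProjectionOnto.toLinearMap ∘ₗ R with hr
  have hin : ∀ w (x : K), inner ℝ (r w) x = inner ℝ (R w) (x : H) := fun w x => by
    rw [hr]
    exact Submodule.inner_orthogonalProjectionOnto_eq_of_mem_right x (R w)
  have hb : ∀ w, ‖ℓ w‖ ≤ M / c * ‖r w‖ := by
    intro w
    refine (hℓ w).trans ?_
    rw [div_mul_eq_mul_div, mul_div_assoc]
    refine mul_le_mul_of_nonneg_left ?_ hM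
    rw [le_div_iff₀ hc]
    have h1 := (hcoer w).trans ((hin w (Ψ w)).ge.trans (real_inner_le_norm _ _))
    rcases (norm_nonneg (Ψ w)).eq_or_lt with h0 | h0
    · rw [← h0]; simp
    · nlinarith
  have hMc : 0 ≤ M / c := by positivity
  -- `ℓ` factors through `r` as a bounded functional on the range of `r`, which extends to `K`
  set f := ℓ.compLeftInverse r
  have hf : ∀ w, f ⟨r w, ⟨w, rfl⟩⟩ = ℓ w := fun w =>
    LinearMap.compLeftInverse_apply_of_bdd ℓ r ⟨_, hb⟩ w (r w) rfl
  have hfn : ‖f‖ ≤ M / c := by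
    refine f.opNorm_le_bound hMc ?_
    rintro ⟨_, w, rfl⟩
    rw [hf]; exact hb w
  obtain ⟨g, hg1, hg2⟩ := exists_extension_norm_eq (LinearMap.range r) f
  refine ⟨(InnerProductSpace.toDual ℝ K).symm g, fun w => ?_, ?_⟩
  · rw [← hin, real_inner_comm, InnerProductSpace.toDual_symm_apply, hg1 ⟨r w, ⟨w, rfl⟩⟩, hf]
  · rw [LinearIsometryEquiv.norm_map, hg2]; exact hfn

end Evolution

/-! ### Square-integrable functions -/

section SquareIntegrable

variable {X F : Type*} [MeasurableSpace X] {μ : Measure X} [NormedAddCommGroup F]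

theorem norm_sq_Lp [InnerProductSpace ℝ F] (f : Lp F 2 μ) : ‖f‖ ^ 2 = ∫ x, ‖f x‖ ^ 2 ∂μ := by
  rw [← real_inner_self_eq_norm_sq, L2.inner_def]
  simp only [real_inner_self_eq_norm_sq]

theorem norm_sq_toLp [InnerProductSpace ℝ F] {f : X → F} (hf : MemLp f 2 μ) :
    ‖hf.toLp f‖ ^ 2 = ∫ x, ‖f x‖ ^ 2 ∂μ := by
  rw [norm_sq_Lp]
  refine integral_congr_ae ?_
  filter_upwards [hf.coeFn_toLp] with x hx
  rw [hx]

theorem inner_toLp [InnerProductSpace ℝ F] {f g : X → F} (hf : MemLp f 2 μ) (hg : MemLp g 2 μ) :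
    inner ℝ (hf.toLp f) (hg.toLp g) = ∫ x, inner ℝ (f x) (g x) ∂μ := by
  rw [L2.inner_def]
  refine integral_congr_ae ?_
  filter_upwards [hf.coeFn_toLp, hg.coeFn_toLp] with x hx hy
  rw [hx, hy]

theorem integrable_norm_sq {f : X → F} (hf : MemLp f 2 μ) :
    Integrable (fun x => ‖f x‖ ^ 2) μ := hf.integrable_norm_pow (by norm_num)

theorem integrable_inner [InnerProductSpace ℝ F] {f g : X → F} (hf : MemLp f 2 μ)
    (hg : MemLp g 2 μ) : Integrable (fun x => inner ℝ (f x) (g x)) μ := by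
  refine (L2.integrable_inner (𝕜 := ℝ) (hf.toLp f) (hg.toLp g)).congr ?_
  filter_upwards [hf.coeFn_toLp, hg.coeFn_toLp] with x hx hy
  rw [hx, hy]

theorem abs_integral_inner_le [InnerProductSpace ℝ F] {f g : X → F} (hf : MemLp f 2 μ)
    (hg : MemLp g 2 μ) :
    |∫ x, inner ℝ (f x) (g x) ∂μ| ≤ √(∫ x, ‖f x‖ ^ 2 ∂μ) * √(∫ x, ‖g x‖ ^ 2 ∂μ) := by
  rw [← inner_toLp hf hg, ← norm_sq_toLp hf, ← norm_sq_toLp hg, Real.sqrt_sq (norm_nonneg _),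
    Real.sqrt_sq (norm_nonneg _)]
  exact abs_real_inner_le_norm _ _

theorem integral_norm_le_sqrt [IsFiniteMeasure μ] {f : X → F} (hf : MemLp f 2 μ) :
    ∫ x, ‖f x‖ ∂μ ≤ √(μ.real univ) * √(∫ x, ‖f x‖ ^ 2 ∂μ) := by
  have := abs_integral_inner_le (memLp_const (1 : ℝ)) hf.norm
  simp only [norm_one, one_pow, integral_const, smul_eq_mul, mul_one, norm_norm] at this
  refine le_trans (le_of_eq ?_) ((le_abs_self _).trans this)
  simp

end SquareIntegrable

/-! ### Solvability of the abstract evolution problem -/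

section Existence

variable {V B : Type*} [NormedAddCommGroup V] [InnerProductSpace ℝ V]
  [NormedAddCommGroup B] [InnerProductSpace ℝ B]

theorem timeMeasure_real_univ {T : ℝ} (hT : 0 ≤ T) : (timeMeasure T).real univ = T := by
  simp [hT]

/-- Continuous curves as elements of `L²(0, T; V)`. -/
def contToLp (V : Type*) [NormedAddCommGroup V] [InnerProductSpace ℝ V] (T : ℝ) :
    C(ℝ, V) →ₗ[ℝ] Lp V 2 (timeMeasure T) where
  toFun w := (memLp_of_continuousOn (T := T) w.continuous.continuousOn 2).toLp w
  map_add' _ _ := rfl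
  map_smul' _ _ := rfl

theorem coeFn_contToLp (T : ℝ) (w : C(ℝ, V)) : contToLp V T w =ᵐ[timeMeasure T] w :=
  (memLp_of_continuousOn (T := T) w.continuous.continuousOn 2).coeFn_toLp

/-- The weight `1 + |T - t|`, which equals `1 + T - t` on `[0, T]`. -/
def weight (T : ℝ) : C(ℝ, ℝ) := ⟨fun t => 1 + |T - t|, by fun_prop⟩

theorem weight_pos (T t : ℝ) : 0 < weight T t := by
  change 0 < 1 + |T - t|
  positivity

/-- Multiplication by the weight. -/
def mulWeight (V : Type*) [NormedAddCommGroup V] [InnerProductSpace ℝ V] (T : ℝ) :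
    C(ℝ, V) →ₗ[ℝ] C(ℝ, V) where
  toFun w := ⟨fun t => weight T t • w t, by fun_prop⟩
  map_add' _ _ := by ext; simp
  map_smul' c _ := by ext t; simp [smul_comm c]

theorem mulWeight_apply (T : ℝ) (w : C(ℝ, V)) (t : ℝ) :
    mulWeight V T w t = weight T t • w t := rfl

/-- The weight is bounded below by `1`, so that it may be divided out. -/
theorem mulWeight_surjective (T : ℝ) : Function.Surjective (mulWeight V T) := by
  intro φ
  refine ⟨⟨fun t => (weight T t)⁻¹ • φ t, ?_⟩, ?_⟩
  · exact ((weight T).continuous.inv₀ fun t => (weight_pos T t).ne').smul φ.continuous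
  · ext t
    rw [mulWeight_apply]
    exact smul_inv_smul₀ (weight_pos T t).ne' _

theorem denseRange_contToLp (T : ℝ) : DenseRange (contToLp V T) := by
  refine (BoundedContinuousFunction.toLp_denseRange V (timeMeasure T) ℝ
    (p := 2) (by norm_num)).mono ?_
  rintro _ ⟨f, rfl⟩
  exact ⟨f.toContinuousMap, rfl⟩

theorem primLp_bound {T : ℝ} (hT : 0 ≤ T) (w : Lp V 2 (timeMeasure T)) :
    ‖(memLp_prim hT ((Lp.memLp w).integrable one_le_two) 2).toLp (prim w)‖ ≤ T * ‖w‖ := by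
  have hi := (Lp.memLp w).integrable one_le_two
  refine abs_le_of_sq_le_sq' ?_ (by positivity) |>.2
  rw [norm_sq_toLp, mul_pow, norm_sq_Lp w]
  have h1 := integral_norm_le_sqrt (Lp.memLp w)
  rw [timeMeasure_real_univ hT] at h1
  set S := ∫ x, ‖w x‖ ^ 2 ∂timeMeasure T
  have hS : 0 ≤ S := integral_nonneg fun _ => by positivity
  have h2 : ∀ t ∈ Ioo 0 T, ‖prim w t‖ ^ 2 ≤ T * S := by
    intro t ht
    have h3 := (norm_prim_le (Ioo_subset_Icc_self ht) hi).trans h1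
    calc ‖prim w t‖ ^ 2 ≤ (√T * √S) ^ 2 := by gcongr
      _ = T * S := by rw [mul_pow, Real.sq_sqrt hT, Real.sq_sqrt hS]
  calc ∫ t in Ioo 0 T, ‖prim w t‖ ^ 2 ≤ ∫ t in Ioo 0 T, T * S :=
        setIntegral_mono_on (integrable_norm_sq (memLp_prim hT hi 2)) (integrable_const _)
          measurableSet_Ioo h2
    _ = T ^ 2 * S := by simp [hT]; ring

/-- The operator `w ↦ ∫₀ᵗ w` on `L²(0, T; V)`. -/
def primLp (V : Type*) [NormedAddCommGroup V] [InnerProductSpace ℝ V] {T : ℝ} (hT : 0 ≤ T) :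
    Lp V 2 (timeMeasure T) →L[ℝ] Lp V 2 (timeMeasure T) :=
  LinearMap.mkContinuous
    { toFun := fun w => (memLp_prim hT ((Lp.memLp w).integrable one_le_two) 2).toLp (prim w)
      map_add' := by
        intro p q
        have hp := (Lp.memLp p).integrable one_le_two
        have hq := (Lp.memLp q).integrable one_le_two
        rw [← MemLp.toLp_add]
        refine MemLp.toLp_congr _ _ ?_
        filter_upwards [ae_restrict_mem measurableSet_Ioo] with t ht
        rw [prim_congr (Ioo_subset_Icc_self ht) (Lp.coeFn_add p q), Pi.add_apply]
        simp only [prim_eq_setIntegral _ ht.1.le, Pi.add_apply]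
        exact integral_add (integrable_Ioo_mono ht.2.le hp) (integrable_Ioo_mono ht.2.le hq)
      map_smul' := by
        intro c p
        simp only [RingHom.id_apply]
        rw [← MemLp.toLp_const_smul]
        refine MemLp.toLp_congr _ _ ?_
        filter_upwards [ae_restrict_mem measurableSet_Ioo] with t ht
        rw [prim_congr (Ioo_subset_Icc_self ht) (Lp.coeFn_smul c p), Pi.smul_apply]
        simp only [prim_eq_setIntegral _ ht.1.le, Pi.smul_apply]
        exact integral_smul c _ }
    T (primLp_bound hT)

theorem coeFn_primLp {T : ℝ} (hT : 0 ≤ T) (w : Lp V 2 (timeMeasure T)) :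
    primLp V hT w =ᵐ[timeMeasure T] prim w :=
  (memLp_prim hT ((Lp.memLp w).integrable one_le_two) 2).coeFn_toLp

theorem hasDerivAt_prim [CompleteSpace V] (w : C(ℝ, V)) (t : ℝ) :
    HasDerivAt (prim w) (w t) t :=
  intervalIntegral.integral_hasDerivAt_right (w.continuous.intervalIntegrable _ _)
    w.continuous.stronglyMeasurable.stronglyMeasurableAtFilter w.continuous.continuousAt

/-- The energy identity for a curve `w` and its primitive, with the weight `1 + T - t`. -/
theorem integral_weight_inner_prim [CompleteSpace V] {T : ℝ} (hT : 0 ≤ T) (w : C(ℝ, V)) :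
    ∫ t in Ioo 0 T, weight T t * inner ℝ (w t) (prim w t)
      = ‖prim w T‖ ^ 2 / 2 + (∫ t in Ioo 0 T, ‖prim w t‖ ^ 2) / 2 := by
  have hpc : Continuous (prim w) := continuous_iff_continuousAt.2 fun t =>
    (hasDerivAt_prim w t).continuousAt
  have hd : ∀ t, HasDerivAt (fun t => (1 + T - t) * ‖prim w t‖ ^ 2 / 2)
      ((1 + T - t) * inner ℝ (w t) (prim w t) - ‖prim w t‖ ^ 2 / 2) t := by
    intro t
    have h1 := (hasDerivAt_prim w t).norm_sq
    have h2 : HasDerivAt (fun t : ℝ => 1 + T - t) (-1) t := (hasDerivAt_id t).const_sub _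
    refine ((h2.mul h1).div_const 2).congr_deriv ?_
    rw [real_inner_comm]; ring
  have hcont : Continuous fun t => (1 + T - t) * inner ℝ (w t) (prim w t) := by fun_prop
  have hcont2 : Continuous fun t => ‖prim w t‖ ^ 2 / 2 := by fun_prop
  have k := intervalIntegral.integral_eq_sub_of_hasDerivAt (fun t _ => hd t)
    ((hcont.sub hcont2).intervalIntegrable 0 T)
  rw [intervalIntegral.integral_sub (hcont.intervalIntegrable _ _)
    (hcont2.intervalIntegrable _ _), intervalIntegral.integral_of_le hT,
    intervalIntegral.integral_of_le hT, integral_Ioc_eq_integral_Ioo,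
    integral_Ioc_eq_integral_Ioo, integral_div] at k
  have e : ∫ t in Ioo 0 T, weight T t * inner ℝ (w t) (prim w t)
      = ∫ t in Ioo 0 T, (1 + T - t) * inner ℝ (w t) (prim w t) := by
    refine setIntegral_congr_fun measurableSet_Ioo fun t ht => ?_
    have : weight T t = 1 + T - t := by
      change 1 + |T - t| = _
      rw [abs_of_pos (by linarith [ht.2])]; ring
    simp only [this]
  rw [e]
  simp only [prim_zero, norm_zero] at k
  linarith

/-- Solvability of `(m* m u)' + u = ℓ`, `(m u)(0) = 0` in the energy space `V`, with
square-integrable `p = (m u)'`. The bound on `ℓ` is the one that results from testing with the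
time derivative of the solution, against the weight `1 + T - t`. -/
theorem exists_evolution [CompleteSpace V] [CompleteSpace B] (m : V →L[ℝ] B) {T : ℝ}
    (hT : 0 < T) (ℓ : Lp V 2 (timeMeasure T) →L[ℝ] ℝ) {M : ℝ} (hM : 0 ≤ M)
    (hℓ : ∀ w : C(ℝ, V), |ℓ (contToLp V T (mulWeight V T w))| ≤
      M * √((∫ t in Ioo 0 T, ‖m (w t)‖ ^ 2) + ‖prim w T‖ ^ 2 + ∫ t in Ioo 0 T, ‖prim w t‖ ^ 2)) :
    ∃ (u : Lp V 2 (timeMeasure T)) (p : Lp B 2 (timeMeasure T)),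
      (∀ᵐ t ∂timeMeasure T, m (u t) = prim p t) ∧
      (∀ φ : Lp V 2 (timeMeasure T),
        (∫ t in Ioo 0 T, inner ℝ (p t) (m (φ t))) + (∫ t in Ioo 0 T, inner ℝ (u t) (φ t)) = ℓ φ) ∧
      ‖u‖ ≤ 2 * M ∧ ‖p‖ ≤ 2 * M := by
  let LV := Lp V 2 (timeMeasure T)
  let LB := Lp B 2 (timeMeasure T)
  -- the third component is the value at `T`, which occurs in the energy identity
  let H := WithLp 2 (LV × WithLp 2 (LB × V))
  let mL : LV →L[ℝ] LB := m.compLpL 2 (timeMeasure T)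
  have hmL : ∀ v : LV, mL v =ᵐ[timeMeasure T] fun t => m (v t) := fun v =>
    ContinuousLinearMap.coeFn_compLpL m v
  let π₁ : H →L[ℝ] LV := WithLp.fstL 2 ℝ LV (WithLp 2 (LB × V))
  let π₂ : H →L[ℝ] LB := (WithLp.fstL 2 ℝ LB V).comp (WithLp.sndL 2 ℝ LV (WithLp 2 (LB × V)))
  -- the constraint `m u = ∫₀ᵗ p`
  let K : Submodule ℝ H := LinearMap.ker (mL.comp π₁ - (primLp B hT.le).comp π₂).toLinearMap
  have hKc : IsClosed (K : Set H) :=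
    (mL.comp π₁ - (primLp B hT.le).comp π₂).isClosed_ker
  have : CompleteSpace K := hKc.completeSpace_coe
  -- the left-hand side of the equation tested with `(1 + T - t) w(t)`
  let R : C(ℝ, V) →ₗ[ℝ] H :=
    { toFun := fun w => WithLp.toLp 2 (contToLp V T (mulWeight V T w),
        WithLp.toLp 2 (mL (contToLp V T (mulWeight V T w)), 0))
      map_add' := by
        intro w z
        rw [map_add, map_add, map_add]
        exact congrArg (fun z : V => (WithLp.toLp 2 (_, WithLp.toLp 2 (_, z)) : H))
          (add_zero 0).symm
      map_smul' := by
        intro c w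
        rw [map_smul, map_smul, map_smul]
        exact congrArg (fun z : V => (WithLp.toLp 2 (_, WithLp.toLp 2 (_, z)) : H))
          (smul_zero c).symm }
  have hprimc : ∀ w : C(ℝ, V), MemLp (prim w) 2 (timeMeasure T) := fun w =>
    memLp_of_continuousOn (continuousOn_prim hT.le
      ((memLp_of_continuousOn w.continuous.continuousOn 1).integrable le_rfl)) 2
  have hmc : ∀ w : C(ℝ, V), MemLp (fun t => m (w t)) 2 (timeMeasure T) := fun w =>
    memLp_of_continuousOn (m.continuous.comp w.continuous).continuousOn 2
  have hΨ : ∀ w : C(ℝ, V), (WithLp.toLp 2 ((hprimc w).toLp _,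
      WithLp.toLp 2 ((hmc w).toLp _, prim w T)) : H) ∈ K := by
    intro w
    rw [LinearMap.mem_ker]
    refine sub_eq_zero.2 ?_
    refine Lp.ext ?_
    refine (hmL _).trans (EventuallyEq.trans ?_ (coeFn_primLp hT.le _).symm)
    filter_upwards [(hprimc w).coeFn_toLp, ae_restrict_mem measurableSet_Ioo] with t h1 ht
    change m ((hprimc w).toLp _ t) = prim ((hmc w).toLp _) t
    rw [h1, prim_congr (Ioo_subset_Icc_self ht) (hmc w).coeFn_toLp]
    exact clm_prim m (Ioo_subset_Icc_self ht)
      ((memLp_of_continuousOn w.continuous.continuousOn 1).integrable le_rfl)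
  let Ψ : C(ℝ, V) → K := fun w => ⟨_, hΨ w⟩
  have hΨn : ∀ w, ‖Ψ w‖ ^ 2 = (∫ t in Ioo 0 T, ‖m (w t)‖ ^ 2) + ‖prim w T‖ ^ 2
      + ∫ t in Ioo 0 T, ‖prim w t‖ ^ 2 := by
    intro w
    rw [Submodule.coe_norm, WithLp.prod_norm_sq_eq_of_L2, WithLp.prod_norm_sq_eq_of_L2]
    change ‖(hprimc w).toLp _‖ ^ 2 + (‖(hmc w).toLp _‖ ^ 2 + ‖prim w T‖ ^ 2) = _
    rw [norm_sq_toLp, norm_sq_toLp]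
    ring
  have hin : ∀ w (x : H), inner ℝ (R w) x
      = inner ℝ (contToLp V T (mulWeight V T w)) (π₁ x)
        + inner ℝ (mL (contToLp V T (mulWeight V T w))) (π₂ x) := by
    intro w x
    rw [WithLp.prod_inner_apply, WithLp.prod_inner_apply]
    change inner ℝ (contToLp V T (mulWeight V T w)) (π₁ x)
      + (inner ℝ (mL (contToLp V T (mulWeight V T w))) (π₂ x) + inner ℝ (0 : V) _) = _
    rw [inner_zero_left, add_zero]
  obtain ⟨x, hx, hxn⟩ := exists_of_lions K R Ψ (ℓ.toLinearMap ∘ₗ contToLp V T ∘ₗ mulWeight V T)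
    (c := 1 / 2) (M := M) (by norm_num) hM (by
      intro w
      rw [hΨn, hin]
      change _ ≤ inner ℝ (contToLp V T (mulWeight V T w)) ((hprimc w).toLp _)
        + inner ℝ (mL (contToLp V T (mulWeight V T w))) ((hmc w).toLp _)
      have e1 : inner ℝ (contToLp V T (mulWeight V T w)) ((hprimc w).toLp _)
          = ∫ t in Ioo 0 T, weight T t * inner ℝ (w t) (prim w t) := by
        rw [L2.inner_def]
        refine integral_congr_ae ?_
        filter_upwards [(hprimc w).coeFn_toLp, coeFn_contToLp T (mulWeight V T w)] with t h1 h2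
        rw [h1, h2, mulWeight_apply, real_inner_smul_left]
      have e2 : inner ℝ (mL (contToLp V T (mulWeight V T w))) ((hmc w).toLp _)
          = ∫ t in Ioo 0 T, weight T t * ‖m (w t)‖ ^ 2 := by
        rw [L2.inner_def]
        refine integral_congr_ae ?_
        filter_upwards [hmL (contToLp V T (mulWeight V T w)), (hmc w).coeFn_toLp,
          coeFn_contToLp T (mulWeight V T w)] with t h1 h2 h3
        rw [h1, h2, h3, mulWeight_apply, map_smul, real_inner_smul_left,
          real_inner_self_eq_norm_sq]
      rw [e1, e2, integral_weight_inner_prim hT.le]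
      have h1 : ∫ t in Ioo 0 T, ‖m (w t)‖ ^ 2 ≤ ∫ t in Ioo 0 T, weight T t * ‖m (w t)‖ ^ 2 := by
        have hc2 : Continuous fun t => weight T t * ‖m (w t)‖ ^ 2 := by fun_prop
        refine integral_mono (integrable_norm_sq (hmc w))
          ((memLp_of_continuousOn hc2.continuousOn 1).integrable le_rfl) fun t => ?_
        have : (1 : ℝ) ≤ weight T t := by
          change (1 : ℝ) ≤ 1 + |T - t|
          linarith [abs_nonneg (T - t)]
        exact le_mul_of_one_le_left (by positivity) this
      have h0 : 0 ≤ ∫ t in Ioo 0 T, ‖m (w t)‖ ^ 2 := integral_nonneg fun _ => by positivity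
      linarith)
    (by
      intro w
      refine (hℓ w).trans (le_of_eq ?_)
      rw [← hΨn, Real.sqrt_sq (norm_nonneg _)])
  have hxn2 : ‖x‖ ≤ 2 * M := by
    refine hxn.trans (le_of_eq ?_); ring
  have hsq : ‖(x : H)‖ ^ 2 = ‖π₁ x‖ ^ 2 + ‖WithLp.sndL 2 ℝ LV (WithLp 2 (LB × V)) x‖ ^ 2 :=
    WithLp.prod_norm_sq_eq_of_L2 _
  have hsq2 : ‖WithLp.sndL 2 ℝ LV (WithLp 2 (LB × V)) (x : H)‖ ^ 2 = ‖π₂ x‖ ^ 2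
      + ‖(WithLp.sndL 2 ℝ LV (WithLp 2 (LB × V)) (x : H)).snd‖ ^ 2 :=
    WithLp.prod_norm_sq_eq_of_L2 _
  refine ⟨π₁ x, π₂ x, ?_, ?_, ?_, ?_⟩
  · have h1 : mL (π₁ x) = primLp B hT.le (π₂ x) := sub_eq_zero.1 (LinearMap.mem_ker.1 x.2)
    have h2 := hmL (π₁ x)
    rw [h1] at h2
    filter_upwards [h2, coeFn_primLp hT.le (π₂ x)] with t h3 h4
    rw [← h3, h4]
  · -- both sides are continuous in `φ`, and they agree on the dense set of continuous curves
    have hd : ∀ φ : LV, (∫ t in Ioo 0 T, inner ℝ (π₂ x t) (m (φ t)))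
        + (∫ t in Ioo 0 T, inner ℝ (π₁ x t) (φ t)) = inner ℝ (π₂ x) (mL φ) + inner ℝ (π₁ x) φ := by
      intro φ
      rw [L2.inner_def, L2.inner_def]
      congr 1
      refine integral_congr_ae ?_
      filter_upwards [hmL φ] with t ht
      rw [ht]
    intro φ
    rw [hd]
    refine DenseRange.induction_on (denseRange_contToLp (V := V) T) φ
      (isClosed_eq (by fun_prop) (by fun_prop)) ?_
    intro w
    obtain ⟨w, rfl⟩ := mulWeight_surjective T w
    have := hx w
    rw [hin] at this
    rw [real_inner_comm, add_comm, real_inner_comm]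
    exact this
  · refine (abs_le_of_sq_le_sq' ?_ (norm_nonneg _)).2.trans hxn2
    change _ ≤ ‖(x : H)‖ ^ 2
    rw [hsq]; nlinarith [norm_nonneg (WithLp.sndL 2 ℝ LV (WithLp 2 (LB × V)) (x : H))]
  · refine (abs_le_of_sq_le_sq' ?_ (norm_nonneg _)).2.trans hxn2
    change _ ≤ ‖(x : H)‖ ^ 2
    rw [hsq, hsq2]; nlinarith [norm_nonneg (WithLp.sndL 2 ℝ LV (WithLp 2 (LB × V)) (x : H)).snd,
      norm_nonneg (π₁ x)]

end Existence

/-! ### Curves in `L²` as functions of two variables -/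

section Joint

variable {X Y F : Type*} [MeasurableSpace X] [MeasurableSpace Y] {μ : Measure X} {ν : Measure Y}
  [SFinite μ] [SFinite ν] [NormedAddCommGroup F]

omit [SFinite μ] in
theorem enorm_sq_Lp (f : Lp F 2 μ) : ‖f‖ₑ ^ 2 = ∫⁻ x, ‖f x‖ₑ ^ 2 ∂μ := by
  rw [Lp.enorm_def, eLpNorm_eq_lintegral_rpow_enorm_toReal (by norm_num) (by norm_num),
    ← ENNReal.rpow_natCast, ← ENNReal.rpow_mul]
  norm_num

theorem ae_ae_of_ae_prod_swap {p : X × Y → Prop} (h : ∀ᵐ z ∂μ.prod ν, p z) :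
    ∀ᵐ t ∂ν, ∀ᵐ x ∂μ, p (x, t) := by
  have h1 : ∀ᵐ z ∂ν.prod μ, p z.swap := by
    have hq : Measure.QuasiMeasurePreserving Prod.swap (ν.prod μ) (μ.prod ν) :=
      Measure.measurePreserving_swap.quasiMeasurePreserving
    exact hq.ae h
  exact Measure.ae_ae_of_ae_prod h1

/-- The function `U` of two variables represents the curve `u` in `L²`. -/
def IsJoint (U : Lp F 2 (μ.prod ν)) (u : Lp (Lp F 2 μ) 2 ν) : Prop :=
  ∀ᵐ t ∂ν, (fun x => U (x, t)) =ᵐ[μ] u t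

theorem IsJoint.add {U U' : Lp F 2 (μ.prod ν)} {u u' : Lp (Lp F 2 μ) 2 ν}
    (h : IsJoint U u) (h' : IsJoint U' u') : IsJoint (U + U') (u + u') := by
  filter_upwards [h, h', ae_ae_of_ae_prod_swap (Lp.coeFn_add U U'), Lp.coeFn_add u u']
    with t h1 h2 h3 h4
  rw [h4]
  filter_upwards [h1, h2, h3, Lp.coeFn_add (u t) (u' t)] with x k1 k2 k3 k4
  rw [k3, Pi.add_apply, Pi.add_apply, k4, Pi.add_apply, k1, k2]

theorem IsJoint.smul [NormedSpace ℝ F] {U : Lp F 2 (μ.prod ν)} {u : Lp (Lp F 2 μ) 2 ν} (c : ℝ)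
    (h : IsJoint U u) : IsJoint (c • U) (c • u) := by
  filter_upwards [h, ae_ae_of_ae_prod_swap (Lp.coeFn_smul c U), Lp.coeFn_smul c u]
    with t h1 h3 h4
  rw [h4]
  filter_upwards [h1, h3, Lp.coeFn_smul c (u t)] with x k1 k3 k4
  rw [k3, Pi.smul_apply, Pi.smul_apply, k4, Pi.smul_apply, k1]

theorem IsJoint.sub {U U' : Lp F 2 (μ.prod ν)} {u u' : Lp (Lp F 2 μ) 2 ν}
    (h : IsJoint U u) (h' : IsJoint U' u') : IsJoint (U - U') (u - u') := by
  filter_upwards [h, h', ae_ae_of_ae_prod_swap (Lp.coeFn_sub U U'), Lp.coeFn_sub u u']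
    with t h1 h2 h3 h4
  rw [h4]
  filter_upwards [h1, h2, h3, Lp.coeFn_sub (u t) (u' t)] with x k1 k2 k3 k4
  rw [k3, Pi.sub_apply, Pi.sub_apply, k4, Pi.sub_apply, k1, k2]

theorem enorm_sq_joint (U : Lp F 2 (μ.prod ν)) :
    ‖U‖ₑ ^ 2 = ∫⁻ t, ∫⁻ x, ‖U (x, t)‖ₑ ^ 2 ∂μ ∂ν := by
  rw [enorm_sq_Lp, lintegral_prod_symm]
  exact (Lp.aestronglyMeasurable U).enorm.pow_const 2

theorem IsJoint.norm_eq {U : Lp F 2 (μ.prod ν)} {u : Lp (Lp F 2 μ) 2 ν} (h : IsJoint U u) :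
    ‖U‖ = ‖u‖ := by
  have : ‖U‖ₑ ^ 2 = ‖u‖ₑ ^ 2 := by
    rw [enorm_sq_joint, enorm_sq_Lp]
    refine lintegral_congr_ae ?_
    filter_upwards [h] with t ht
    rw [enorm_sq_Lp]
    refine lintegral_congr_ae ?_
    filter_upwards [ht] with x hx
    rw [hx]
  have h2 := congrArg ENNReal.toReal this
  rw [ENNReal.toReal_pow, ENNReal.toReal_pow, toReal_enorm, toReal_enorm] at h2
  exact (sq_eq_sq₀ (norm_nonneg _) (norm_nonneg _)).1 h2

theorem IsJoint.unique {U U' : Lp F 2 (μ.prod ν)} {u : Lp (Lp F 2 μ) 2 ν}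
    (h : IsJoint U u) (h' : IsJoint U' u) : U = U' := by
  have := (h.sub h').norm_eq
  rw [sub_self, norm_zero] at this
  exact sub_eq_zero.1 (norm_eq_zero.1 this)

theorem tendsto_enorm_sq_zero {W : Type*} [NormedAddCommGroup W] {f : ℕ → W} {a : W}
    (h : Tendsto f atTop (𝓝 a)) : Tendsto (fun n => ‖f n - a‖ₑ ^ 2) atTop (𝓝 0) := by
  have h1 : Tendsto (fun n => ‖f n - a‖ₑ) atTop (𝓝 0) := by
    have h2 : Tendsto (fun n => f n - a) atTop (𝓝 0) := by
      simpa using h.sub_const a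
    simpa using h2.enorm
  simpa using ENNReal.Tendsto.pow (n := 2) h1

/-- The curves that come from a function of two variables form a closed set: the functions converge
in `L²` since `IsJoint` preserves norms, and the slices of the limit are the values of the limit
curve because the infimum of the bounds for their squared distances has integral zero. -/
theorem isClosed_exists_isJoint [CompleteSpace F] :
    IsClosed {u : Lp (Lp F 2 μ) 2 ν | ∃ U : Lp F 2 (μ.prod ν), IsJoint U u} := by
  refine isClosed_of_closure_subset fun u hu => ?_
  obtain ⟨v, hv, hlim⟩ := mem_closure_iff_seq_limit.1 hu
  choose U hU using hv
  have hc : CauchySeq U := by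
    have h1 := hlim.cauchySeq
    rw [Metric.cauchySeq_iff] at h1 ⊢
    simp only [dist_eq_norm, fun m n => ((hU m).sub (hU n)).norm_eq] at h1 ⊢
    exact h1
  obtain ⟨U₀, hU₀⟩ := cauchySeq_tendsto_of_complete hc
  refine ⟨U₀, ?_⟩
  -- the squared distance of the slices is at most `Z n`, and the integral of `Z n` tends to `0`
  let Z : ℕ → Y → ℝ≥0∞ := fun n t =>
    2 * (∫⁻ x, ‖(U n - U₀) (x, t)‖ₑ ^ 2 ∂μ) + 2 * ‖(v n - u) t‖ₑ ^ 2
  have hm1 : ∀ n, AEMeasurable (fun t => ∫⁻ x, ‖(U n - U₀) (x, t)‖ₑ ^ 2 ∂μ) ν := fun n =>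
    ((Lp.aestronglyMeasurable (U n - U₀)).enorm.pow_const 2).lintegral_prod_left'
  have hm2 : ∀ n, AEMeasurable (fun t => ‖(v n - u) t‖ₑ ^ 2) ν := fun n =>
    (Lp.aestronglyMeasurable (v n - u)).enorm.pow_const 2
  have hZm : ∀ n, AEMeasurable (Z n) ν := fun n =>
    ((hm1 n).const_mul 2).add ((hm2 n).const_mul 2)
  have hZi : ∀ n, ∫⁻ t, Z n t ∂ν = 2 * ‖U n - U₀‖ₑ ^ 2 + 2 * ‖v n - u‖ₑ ^ 2 := by
    intro n
    rw [lintegral_add_left' ((hm1 n).const_mul 2), lintegral_const_mul'' _ (hm1 n),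
      lintegral_const_mul'' _ (hm2 n), enorm_sq_joint, enorm_sq_Lp (v n - u)]
  have hZ0 : Tendsto (fun n => ∫⁻ t, Z n t ∂ν) atTop (𝓝 0) := by
    simp only [hZi]
    have a1 := ENNReal.Tendsto.const_mul (a := 2) (tendsto_enorm_sq_zero hU₀) (Or.inr (by norm_num))
    have a2 := ENNReal.Tendsto.const_mul (a := 2) (tendsto_enorm_sq_zero hlim) (Or.inr (by norm_num))
    simpa using a1.add a2
  have hinf : ∫⁻ t, (⨅ n, Z n t) ∂ν = 0 := by
    refine le_antisymm (ge_of_tendsto' hZ0 fun n => ?_) zero_le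
    exact lintegral_mono fun t => iInf_le _ n
  have hinf' := (lintegral_eq_zero_iff' (AEMeasurable.iInf hZm)).1 hinf
  have hle : ∀ n, ∀ᵐ t ∂ν, ∫⁻ x, ‖U₀ (x, t) - u t x‖ₑ ^ 2 ∂μ ≤ Z n t := by
    intro n
    filter_upwards [hU n, ae_ae_of_ae_prod_swap (Lp.coeFn_sub (U n) U₀), Lp.coeFn_sub (v n) u,
      ae_ae_of_ae_prod_swap (((Lp.aestronglyMeasurable (U n - U₀)).enorm.pow_const 2).ae_eq_mk)]
      with t h1 h2 h3 h4
    have e2 : ‖(v n - u) t‖ₑ ^ 2 = ∫⁻ x, ‖v n t x - u t x‖ₑ ^ 2 ∂μ := by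
      rw [h3, Pi.sub_apply, enorm_sq_Lp]
      refine lintegral_congr_ae ?_
      filter_upwards [Lp.coeFn_sub (v n t) (u t)] with x hx
      rw [hx, Pi.sub_apply]
    have hmt : AEMeasurable (fun x => ‖(U n - U₀) (x, t)‖ₑ ^ 2) μ :=
      ⟨_, (((Lp.aestronglyMeasurable (U n - U₀)).enorm.pow_const 2).measurable_mk.comp
        measurable_prodMk_right), h4⟩
    have hmv : AEMeasurable (fun x => ‖v n t x - u t x‖ₑ ^ 2) μ :=
      (((Lp.aestronglyMeasurable (v n t)).sub (Lp.aestronglyMeasurable (u t))).enorm.pow_const 2)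
    change _ ≤ 2 * _ + 2 * _
    rw [e2, ← lintegral_const_mul'' _ hmt, ← lintegral_const_mul'' _ hmv,
      ← lintegral_add_left' (hmt.const_mul 2)]
    refine lintegral_mono_ae ?_
    filter_upwards [h1, h2] with x k1 k2
    rw [k2, Pi.sub_apply, k1]
    have : U₀ (x, t) - u t x = -(v n t x - U₀ (x, t)) + (v n t x - u t x) := by abel
    rw [this]
    calc ‖-(v n t x - U₀ (x, t)) + (v n t x - u t x)‖ₑ ^ 2
        ≤ (‖v n t x - U₀ (x, t)‖ₑ + ‖v n t x - u t x‖ₑ) ^ 2 := by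
          gcongr
          exact (enorm_add_le _ _).trans (by rw [enorm_neg])
      _ ≤ _ := by
          have := ENNReal.rpow_add_le_mul_rpow_add_rpow ‖v n t x - U₀ (x, t)‖ₑ
            ‖v n t x - u t x‖ₑ (p := 2) (by norm_num)
          norm_num at this
          rw [← mul_add]
          exact this
  filter_upwards [hinf', ae_all_iff.2 hle, ae_ae_of_ae_prod_swap
    (Lp.aestronglyMeasurable U₀).ae_eq_mk] with t h1 h2 h3
  have h4 : ∫⁻ x, ‖U₀ (x, t) - u t x‖ₑ ^ 2 ∂μ = 0 :=
    le_antisymm ((le_iInf h2).trans h1.le) zero_le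
  have hmt : AEStronglyMeasurable (fun x => U₀ (x, t)) μ :=
    ⟨_, ((Lp.aestronglyMeasurable U₀).stronglyMeasurable_mk.comp_measurable
        measurable_prodMk_right), h3⟩
  have h5 := (lintegral_eq_zero_iff'
    ((hmt.sub (Lp.aestronglyMeasurable (u t))).enorm.pow_const 2)).1 h4
  filter_upwards [h5] with x hx
  simpa [sub_eq_zero] using hx

theorem exists_isJoint [CompleteSpace F] (u : Lp (Lp F 2 μ) 2 ν) :
    ∃ U : Lp F 2 (μ.prod ν), IsJoint U u := by
  refine Lp.induction (by norm_num)
    (fun u : Lp (Lp F 2 μ) 2 ν => ∃ U : Lp F 2 (μ.prod ν), IsJoint U u)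
    (fun c s hs hμs => ?_) (fun f g hf hg _ ⟨U, h1⟩ ⟨U', h2⟩ => ⟨_, h1.add h2⟩)
    isClosed_exists_isJoint u
  have hcm : AEStronglyMeasurable (fun z : X × Y => (univ ×ˢ s).indicator (fun z => c z.1) z)
      (μ.prod ν) :=
    (Lp.aestronglyMeasurable c).comp_fst.indicator (MeasurableSet.univ.prod hs)
  have hU : MemLp (fun z : X × Y => (univ ×ˢ s).indicator (fun z => c z.1) z) 2 (μ.prod ν) := by
    refine ⟨hcm, ?_⟩
    rw [eLpNorm_lt_top_iff_lintegral_rpow_enorm_lt_top (by norm_num) (by norm_num)]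
    have e : ∀ z : X × Y, ‖(univ ×ˢ s).indicator (fun z => c z.1) z‖ₑ ^ (2 : ℝ≥0∞).toReal
        = ‖c z.1‖ₑ ^ 2 * s.indicator 1 z.2 := by
      intro z
      by_cases hz : z.2 ∈ s <;> simp [indicator, hz]
    simp only [e]
    rw [lintegral_prod_mul ((Lp.aestronglyMeasurable c).enorm.pow_const 2)
      (g := s.indicator (1 : Y → ℝ≥0∞))
      ((aemeasurable_const (b := (1 : ℝ≥0∞))).indicator hs), ← enorm_sq_Lp, lintegral_indicator_one hs]
    exact ENNReal.mul_lt_top (by simp) hμs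
  refine ⟨hU.toLp _, ?_⟩
  rw [Lp.simpleFunc.coe_indicatorConst]
  filter_upwards [ae_ae_of_ae_prod_swap hU.coeFn_toLp,
    indicatorConstLp_coeFn (p := 2) (hs := hs) (hμs := hμs.ne) (c := c)] with t h1 h2
  rw [h2]
  by_cases ht : t ∈ s
  · filter_upwards [h1] with x hx
    rw [hx]; simp [ht]
  · rw [indicator_of_notMem ht]
    filter_upwards [h1, Lp.coeFn_zero F 2 μ] with x hx h0
    rw [hx, h0]; simp [ht]

variable [InnerProductSpace ℝ F] [CompleteSpace F]

/-- The isometric embedding of `L²(ν; L²(μ; F))` into `L²(μ × ν; F)`. -/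
def jointLp (F : Type*) [NormedAddCommGroup F] [InnerProductSpace ℝ F] [CompleteSpace F]
    (μ : Measure X) (ν : Measure Y) [SFinite μ] [SFinite ν] :
    Lp (Lp F 2 μ) 2 ν →ₗᵢ[ℝ] Lp F 2 (μ.prod ν) where
  toFun u := (exists_isJoint u).choose
  map_add' u v := ((exists_isJoint (u + v)).choose_spec).unique
    ((exists_isJoint u).choose_spec.add (exists_isJoint v).choose_spec)
  map_smul' c u := ((exists_isJoint (c • u)).choose_spec).unique
    ((exists_isJoint u).choose_spec.smul c)
  norm_map' u := (exists_isJoint u).choose_spec.norm_eq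

theorem isJoint_jointLp (u : Lp (Lp F 2 μ) 2 ν) : IsJoint (jointLp F μ ν u) u :=
  (exists_isJoint u).choose_spec

theorem inner_jointLp (f : Lp F 2 (μ.prod ν)) (u : Lp (Lp F 2 μ) 2 ν) :
    inner ℝ f (jointLp F μ ν u) = ∫ t, ∫ x, inner ℝ (f (x, t)) (u t x) ∂μ ∂ν := by
  rw [L2.inner_def, integral_prod_symm _ (L2.integrable_inner f (jointLp F μ ν u))]
  refine integral_congr_ae ?_
  filter_upwards [isJoint_jointLp u] with t ht
  refine integral_congr_ae ?_
  filter_upwards [ht] with x hx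
  rw [hx]

/-- The curve in `L²(μ)` that corresponds to a square-integrable function of two variables,
obtained as the adjoint of `jointLp`. -/
def curveOf {f : X × Y → F} (hf : MemLp f 2 (μ.prod ν)) : Lp (Lp F 2 μ) 2 ν :=
  ContinuousLinearMap.adjoint (jointLp F μ ν).toContinuousLinearMap (hf.toLp f)

theorem integral_inner_curveOf {f : X × Y → F} (hf : MemLp f 2 (μ.prod ν))
    (u : Lp (Lp F 2 μ) 2 ν) :
    ∫ t, inner ℝ (curveOf hf t) (u t) ∂ν = ∫ t, ∫ x, inner ℝ (f (x, t)) (u t x) ∂μ ∂ν := by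
  rw [← L2.inner_def, curveOf, ContinuousLinearMap.adjoint_inner_left]
  refine (inner_jointLp _ u).trans ?_
  refine integral_congr_ae ?_
  filter_upwards [ae_ae_of_ae_prod_swap hf.coeFn_toLp] with t ht
  refine integral_congr_ae ?_
  filter_upwards [ht] with x hx
  rw [hx]

theorem norm_curveOf_le {f : X × Y → F} (hf : MemLp f 2 (μ.prod ν)) :
    ‖curveOf hf‖ ^ 2 ≤ ∫ z, ‖f z‖ ^ 2 ∂(μ.prod ν) := by
  have h1 : ‖curveOf hf‖ ≤ ‖hf.toLp f‖ := by
    refine (ContinuousLinearMap.le_opNorm _ _).trans ?_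
    rw [LinearIsometryEquiv.norm_map]
    exact mul_le_of_le_one_left (norm_nonneg _) (LinearIsometry.norm_toContinuousLinearMap_le _)
  rw [← norm_sq_toLp hf]
  gcongr

end Joint

/-! ### Radial vector fields and polar coordinates -/

section Polar

/-- Integration in polar coordinates. -/
theorem integral_eq_integral_sphere {n : ℕ} (hn : 1 ≤ n) {f : E n → ℝ} (hf : Integrable f) :
    ∫ x, f x = ∫ ξ : Metric.sphere (0 : E n) 1, ∫ r in Ioi (0 : ℝ), r ^ (n - 1) * f (r • (ξ : E n))
      ∂volume ∂(volume : Measure (E n)).toSphere := by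
  have hnt : Nontrivial (E n) := by
    have : Nonempty (Fin n) := ⟨⟨0, hn⟩⟩
    infer_instance
  have hd : Module.finrank ℝ (E n) = n := by simp
  have hmp := (volume : Measure (E n)).measurePreserving_homeomorphUnitSphereProd
  rw [hd] at hmp
  have hemb := (homeomorphUnitSphereProd (E n)).measurableEmbedding
  let g : Metric.sphere (0 : E n) 1 × Ioi (0 : ℝ) → ℝ := fun z => f ((z.2 : ℝ) • (z.1 : E n))
  have hg : ∀ x : ({0}ᶜ : Set (E n)), g (homeomorphUnitSphereProd (E n) x) = f x := by
    intro x
    have h := congrArg Subtype.val ((homeomorphUnitSphereProd (E n)).symm_apply_apply x)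
    exact congrArg f h
  have hgi : Integrable g ((volume : Measure (E n)).toSphere.prod (Measure.volumeIoiPow (n - 1))) := by
    rw [← hmp.integrable_comp_emb hemb]
    have : g ∘ homeomorphUnitSphereProd (E n) = f ∘ Subtype.val := funext hg
    rw [this, ← integrableOn_iff_comap_subtypeVal (measurableSet_singleton _).compl]
    exact hf.integrableOn
  calc ∫ x, f x = ∫ x : ({0}ᶜ : Set (E n)), f x ∂(Measure.comap Subtype.val volume) := by
        rw [integral_subtype_comap (measurableSet_singleton _).compl f, restrict_compl_singleton]
    _ = ∫ z, g z ∂((volume : Measure (E n)).toSphere.prod (Measure.volumeIoiPow (n - 1))) := by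
        rw [← hmp.integral_comp hemb]
        exact integral_congr_ae (Eventually.of_forall fun x => (hg x).symm)
    _ = _ := by
        rw [integral_prod _ hgi]
        refine integral_congr_ae (Eventually.of_forall fun ξ => ?_)
        simp only [Measure.volumeIoiPow, ENNReal.ofReal]
        rw [integral_withDensity_eq_integral_smul
            (measurable_subtype_coe.pow_const _).real_toNNReal,
          integral_subtype_comap measurableSet_Ioi
            fun r : ℝ => Real.toNNReal (r ^ (n - 1)) • f (r • (ξ : E n))]
        refine setIntegral_congr_fun measurableSet_Ioi fun r hr => ?_
        simp only [NNReal.smul_def, smul_eq_mul]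
        rw [Real.coe_toNNReal _ (pow_nonneg (le_of_lt hr) _)]

/-- The radial field `(K |y|⁻ⁿ - 1/n) y` has divergence `-1`; this is the divergence theorem for
it on the exterior of a ball (with `K = 0` if the radius vanishes). -/
theorem integral_fderiv_radial_zero {n : ℕ} (hn : 1 ≤ n) {a K : ℝ} (ha : 0 ≤ a)
    (haK : a = 0 → K = 0) {F : E n → ℝ} (hF : ContDiff ℝ 1 F) (hc : HasCompactSupport F) :
    ∫ y in {y : E n | a < ‖y‖}, fderiv ℝ F y ((K / ‖y‖ ^ n - 1 / n) • y)
      = (∫ y in {y : E n | a < ‖y‖}, F y)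
        - (K - a ^ n / n) * ∫ ξ : Metric.sphere (0 : E n) 1, F (a • (ξ : E n))
          ∂(volume : Measure (E n)).toSphere := by
  have hn0 : (n : ℝ) ≠ 0 := by positivity
  set s : Set (E n) := {y : E n | a < ‖y‖} with hs
  have hsm : MeasurableSet s := measurableSet_lt measurable_const measurable_norm
  have hDc : Continuous fun y : E n => fderiv ℝ F y y :=
    (hF.continuous_fderiv one_ne_zero).clm_apply continuous_id
  have hDs : HasCompactSupport fun y : E n => fderiv ℝ F y y :=
    HasCompactSupport.intro hc.isCompact fun y hy => by
      rw [image_eq_zero_of_notMem_tsupport fun h => hy (tsupport_fderiv_subset ℝ h)]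
      simp
  have hi1 : IntegrableOn (fun y => fderiv ℝ F y ((K / ‖y‖ ^ n - 1 / n) • y)) s := by
    have e : (fun y => fderiv ℝ F y ((K / ‖y‖ ^ n - 1 / n) • y))
        = fun y => (K / ‖y‖ ^ n - 1 / n) * fderiv ℝ F y y := by
      ext y; rw [map_smul, smul_eq_mul]
    rw [e]
    refine (hDc.integrable_of_hasCompactSupport hDs).integrableOn.bdd_mul
      (c := |K| / a ^ n + 1 / n) ?_ ?_
    · refine Measurable.aestronglyMeasurable ?_
      fun_prop
    · filter_upwards [ae_restrict_mem hsm] with y hy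
      have hy' : a < ‖y‖ := hy
      refine (abs_sub _ _).trans ?_
      rw [abs_div, abs_of_nonneg (by positivity : (0 : ℝ) ≤ ‖y‖ ^ n),
        abs_of_nonneg (by positivity : (0 : ℝ) ≤ 1 / n)]
      refine add_le_add ?_ le_rfl
      rcases ha.eq_or_lt with h0 | h0
      · rw [haK h0.symm]; simp
      · gcongr
  have hi2 : IntegrableOn F s := (hF.continuous.integrable_of_hasCompactSupport hc).integrableOn
  have hI : Integrable (s.indicator fun y =>
      fderiv ℝ F y ((K / ‖y‖ ^ n - 1 / n) • y) - F y) :=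
    (integrable_indicator_iff hsm).2 (hi1.sub hi2)
  rw [sub_eq_add_neg, ← sub_eq_iff_eq_add', ← integral_sub hi1 hi2, ← integral_indicator hsm,
    integral_eq_integral_sphere hn hI,
    ← integral_const_mul, ← integral_neg]
  refine integral_congr_ae (Eventually.of_forall fun ξ => ?_)
  have hξ : ‖(ξ : E n)‖ = 1 := by simp
  have hsub : Ioi a ⊆ Ioi (0 : ℝ) := Ioi_subset_Ioi ha
  have e1 : ∫ r in Ioi (0 : ℝ), r ^ (n - 1) * s.indicator
        (fun y => fderiv ℝ F y ((K / ‖y‖ ^ n - 1 / n) • y) - F y) (r • (ξ : E n))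
      = ∫ r in Ioi a, (fderiv ℝ F (r • (ξ : E n)) ξ * (K - r ^ n / n)
          - F (r • (ξ : E n)) * r ^ (n - 1)) := by
    rw [← integral_indicator measurableSet_Ioi, ← integral_indicator measurableSet_Ioi]
    congr 1
    ext r
    by_cases hr : a < r
    · have hr0 : 0 < r := ha.trans_lt hr
      have hm : r • (ξ : E n) ∈ s := by
        simp [hs, norm_smul, hξ, abs_of_pos hr0, hr]
      rw [indicator_of_mem (hsub hr), indicator_of_mem (show r ∈ Ioi a from hr),
        indicator_of_mem hm]
      simp only [map_smul, smul_eq_mul, norm_smul, hξ, Real.norm_eq_abs, abs_of_pos hr0, mul_one]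
      obtain ⟨k, rfl⟩ : ∃ k, n = k + 1 := ⟨n - 1, by omega⟩
      simp only [Nat.add_sub_cancel]
      field_simp
      ring
    · rw [indicator_of_notMem (show r ∉ Ioi a from hr)]
      by_cases hr0 : 0 < r
      · have hm : r • (ξ : E n) ∉ s := by
          simp [hs, norm_smul, hξ, abs_of_pos hr0, not_lt.1 hr]
        rw [indicator_of_mem (show r ∈ Ioi 0 from hr0), indicator_of_notMem hm, mul_zero]
      · rw [indicator_of_notMem (show r ∉ Ioi 0 from hr0)]
  refine e1.trans ?_
  have hray : ContDiff ℝ 1 fun r : ℝ => F (r • (ξ : E n)) := by fun_prop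
  have hrayc : HasCompactSupport fun r : ℝ => F (r • (ξ : E n)) := by
    obtain ⟨ρ, hρ⟩ := hc.isCompact.isBounded.subset_closedBall 0
    refine HasCompactSupport.intro (isCompact_Icc (a := -ρ) (b := ρ)) fun r hr => ?_
    refine image_eq_zero_of_notMem_tsupport fun h => hr ?_
    have := hρ h
    rw [mem_closedBall_zero_iff, norm_smul, hξ, mul_one] at this
    exact abs_le.1 this
  let H : ℝ → ℝ := fun r => F (r • (ξ : E n)) * (K - r ^ n / n)
  have hH : ContDiff ℝ 1 H := by
    change ContDiff ℝ 1 fun r : ℝ => F (r • (ξ : E n)) * (K - r ^ n / n)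
    fun_prop
  have hHc : HasCompactSupport H := hrayc.mul_right
  have hHd : ∀ r, deriv H r = fderiv ℝ F (r • (ξ : E n)) ξ * (K - r ^ n / n)
      - F (r • (ξ : E n)) * r ^ (n - 1) := by
    intro r
    have h1 : HasDerivAt (fun r : ℝ => F (r • (ξ : E n))) (fderiv ℝ F (r • (ξ : E n)) ξ) r := by
      have hl : HasDerivAt (fun r : ℝ => r • (ξ : E n)) (ξ : E n) r := by
        simpa using (hasDerivAt_id r).smul_const (ξ : E n)
      exact ((hF.differentiable one_ne_zero) _).hasFDerivAt.comp_hasDerivAt r hl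
    have h2 : HasDerivAt (fun r : ℝ => K - r ^ n / n) (-(r ^ (n - 1))) r := by
      refine (((hasDerivAt_pow n r).div_const (n : ℝ)).const_sub K).congr_deriv ?_
      field_simp
    refine ((h1.mul h2).congr_deriv ?_).deriv
    ring
  have := hHc.integral_Ioi_deriv_eq hH a
  simp only [hHd] at this
  rw [this]
  simp only [H]
  ring

/-- `integral_fderiv_radial_zero` around an arbitrary centre. -/
theorem integral_fderiv_radial {n : ℕ} (hn : 1 ≤ n) (c : E n) {a K : ℝ} (ha : 0 ≤ a)
    (haK : a = 0 → K = 0) {F : E n → ℝ} (hF : ContDiff ℝ 1 F) (hc : HasCompactSupport F) :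
    ∫ x in {x : E n | a < ‖x - c‖}, fderiv ℝ F x ((K / ‖x - c‖ ^ n - 1 / n) • (x - c))
      = (∫ x in {x : E n | a < ‖x - c‖}, F x)
        - (K - a ^ n / n) * ∫ ξ : Metric.sphere (0 : E n) 1, F (c + a • (ξ : E n))
          ∂(volume : Measure (E n)).toSphere := by
  have hF' : ContDiff ℝ 1 fun y => F (c + y) := by fun_prop
  have hc' : HasCompactSupport fun y => F (c + y) :=
    hc.comp_homeomorph (Homeomorph.addLeft c)
  have k := integral_fderiv_radial_zero hn ha haK hF' hc'
  have hsm : MeasurableSet {y : E n | a < ‖y‖} := measurableSet_lt measurable_const measurable_norm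
  have hsm' : MeasurableSet {x : E n | a < ‖x - c‖} :=
    measurableSet_lt measurable_const (by fun_prop)
  have tr : ∀ f : E n → ℝ, ∫ x in {x : E n | a < ‖x - c‖}, f x
      = ∫ y in {y : E n | a < ‖y‖}, f (c + y) := by
    intro f
    rw [← integral_indicator hsm, ← integral_indicator hsm', ← integral_add_left_eq_self _ c]
    congr 1
    ext y
    simp [indicator]
  rw [tr, tr, ← k]
  refine setIntegral_congr_fun hsm fun y _ => ?_
  simp only [add_sub_cancel_left]
  congr 1
  rw [fderiv_comp_add_left]

/-- The integral with respect to the surface measure of a sphere. -/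
theorem integral_sphereMeasure {n : ℕ} (c : E n) {a : ℝ} (ha : 0 ≤ a) {F : E n → ℝ}
    (hF : Continuous F) :
    ∫ x, F x ∂sphereMeasure c a = a ^ (n - 1) * ∫ ξ : Metric.sphere (0 : E n) 1,
      F (c + a • (ξ : E n)) ∂(volume : Measure (E n)).toSphere := by
  rw [sphereMeasure, integral_smul_measure, ENNReal.toReal_ofReal (by positivity),
    integral_map (by fun_prop) hF.aestronglyMeasurable, smul_eq_mul]

theorem sphereMeasure_univ {n : ℕ} (c : E n) (a : ℝ) :
    sphereMeasure c a univ = ENNReal.ofReal (a ^ (n - 1)) *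
      (volume : Measure (E n)).toSphere univ := by
  rw [sphereMeasure, Measure.smul_apply, Measure.map_apply (by fun_prop) MeasurableSet.univ,
    preimage_univ, smul_eq_mul]

theorem ae_sphereMeasure_mem {n : ℕ} (c : E n) {a : ℝ} (ha : 0 ≤ a) :
    ∀ᵐ x ∂sphereMeasure c a, ‖x - c‖ = a := by
  refine Measure.ae_smul_measure ?_ _
  rw [ae_map_iff (by fun_prop) (measurableSet_eq_fun (by fun_prop) (by fun_prop))]
  refine Eventually.of_forall fun ξ => ?_
  have hξ : ‖(ξ : E n)‖ = 1 := by simp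
  rw [add_sub_cancel_left, norm_smul, hξ, mul_one, Real.norm_of_nonneg ha]

instance isFiniteMeasure_sphereMeasure {n : ℕ} (c : E n) (a : ℝ) :
    IsFiniteMeasure (sphereMeasure c a) :=
  ⟨by rw [sphereMeasure_univ]; exact ENNReal.mul_lt_top ENNReal.ofReal_lt_top (measure_lt_top _ _)⟩

theorem integrable_sphereMeasure {n : ℕ} (c : E n) (a : ℝ) {F : E n → ℝ} (hF : Continuous F) :
    Integrable F (sphereMeasure c a) := by
  refine Integrable.smul_measure ?_ ENNReal.ofReal_ne_top
  rw [integrable_map_measure hF.aestronglyMeasurable (by fun_prop)]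
  exact (hF.comp (by fun_prop)).integrable_of_hasCompactSupport
    (HasCompactSupport.of_compactSpace _)

end Polar

/-! ### The geometry of the particles -/

section Geometry

variable {n : ℕ} {Ω : Set (E n)} {C₀ ε : ℝ}

theorem radius_pos (hC : 0 < C₀) (hε : 0 < ε) : 0 < radius n C₀ ε :=
  mul_pos hC (Real.rpow_pos_of_pos hε _)

/-- A particle lies well inside `Ω`: its centre is at distance more than `ε` from the boundary. -/
theorem closedBall_center_subset (hΩ : IsOpen Ω) (hε : 0 < ε)
    (hr : radius n C₀ ε < ε / 4) {j : Fin n → ℤ} (hj : j ∈ indices Ω C₀ ε) :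
    Metric.closedBall (center ε j) ε ⊆ Ω := by
  obtain ⟨y, hy1, hy2⟩ := hj.2
  have hyd : 2 * ε ≤ Metric.infDist y (frontier Ω) := by
    have hcl : IsClosed {x : E n | 2 * ε ≤ Metric.infDist x (frontier Ω)} :=
      isClosed_le continuous_const (Metric.continuous_infDist_pt _)
    exact closure_minimal (fun x hx => hx.2.le) hcl hy2
  have hyΩ : y ∈ Ω := by
    have h1 : y ∈ closure Ω := closure_mono (fun x hx => hx.1) hy2
    by_contra h2
    have h3 : y ∈ frontier Ω := by rw [hΩ.frontier_eq]; exact ⟨h1, h2⟩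
    rw [Metric.infDist_zero_of_mem h3] at hyd
    linarith
  have hsub : Metric.ball y (2 * ε) ⊆ Ω := by
    refine (convex_ball y (2 * ε)).isPreconnected.subset_of_closure_inter_subset hΩ
      ⟨y, Metric.mem_ball_self (by positivity), hyΩ⟩ ?_
    rintro z ⟨hz1, hz2⟩
    by_contra hz3
    have hz4 : z ∈ frontier Ω := by rw [hΩ.frontier_eq]; exact ⟨hz1, hz3⟩
    have := Metric.infDist_le_dist_of_mem (x := y) hz4
    rw [Metric.mem_ball, dist_comm] at hz2
    linarith
  refine Subset.trans (fun x hx => ?_) hsub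
  rw [Metric.mem_closedBall] at hx
  have hy3 : dist y (center ε j) < radius n C₀ ε := hy1
  rw [Metric.mem_ball]
  calc dist x y ≤ dist x (center ε j) + dist (center ε j) y := dist_triangle _ _ _
    _ < 2 * ε := by rw [dist_comm (center ε j)]; linarith

theorem le_dist_center (hε : 0 < ε) {i j : Fin n → ℤ} (hij : i ≠ j) :
    ε ≤ dist (center ε i) (center ε j) := by
  obtain ⟨k, hk⟩ := Function.ne_iff.1 hij
  have h1 := PiLp.norm_apply_le (center ε i - center ε j) k
  rw [dist_eq_norm]
  refine le_trans ?_ h1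
  have e : (center ε i - center ε j) k = ε * ((i k - j k : ℤ) : ℝ) := by
    change ε * (i k : ℝ) - ε * (j k : ℝ) = _
    push_cast; ring
  rw [e, norm_mul, Real.norm_of_nonneg hε.le, Real.norm_eq_abs, ← Int.cast_abs]
  have h2 : (1 : ℤ) ≤ |i k - j k| := Int.one_le_abs (sub_ne_zero.2 hk)
  have h3 : (1 : ℝ) ≤ ((|i k - j k| : ℤ) : ℝ) := by exact_mod_cast h2
  nlinarith

/-- The balls of radius `ε / 2` around the centres are disjoint. -/
theorem eq_of_mem_balls (hε : 0 < ε) {i j : Fin n → ℤ} {x : E n}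
    (hi : ‖x - center ε i‖ < ε / 2) (hj : ‖x - center ε j‖ ≤ ε / 2) : i = j := by
  by_contra h
  have h1 := le_dist_center hε h
  have h2 := dist_triangle_left (center ε i) (center ε j) x
  rw [dist_eq_norm x, dist_eq_norm x] at h2
  linarith

theorem finite_indices (hΩb : Bornology.IsBounded Ω) (hΩ : IsOpen Ω) (hε : 0 < ε)
    (hr : radius n C₀ ε < ε / 4) : (indices Ω C₀ ε).Finite := by
  obtain ⟨ρ, hρ⟩ := hΩb.subset_closedBall 0
  refine (Set.finite_Icc (fun _ : Fin n => -⌈ρ / ε⌉) (fun _ => ⌈ρ / ε⌉)).subset fun j hj => ?_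
  have h1 := hρ (closedBall_center_subset hΩ hε hr hj (Metric.mem_closedBall_self hε.le))
  rw [mem_closedBall_zero_iff] at h1
  have h2 : ∀ k, |(j k : ℝ)| ≤ ⌈ρ / ε⌉ := by
    intro k
    have h3 := (PiLp.norm_apply_le (center ε j) k).trans h1
    have e : (center ε j) k = ε * (j k : ℝ) := rfl
    rw [e, norm_mul, Real.norm_of_nonneg hε.le, Real.norm_eq_abs] at h3
    refine le_trans ?_ (Int.le_ceil _)
    rw [le_div_iff₀ hε]; linarith
  refine ⟨fun k => ?_, fun k => ?_⟩
  · have := (abs_le.1 (h2 k)).1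
    exact_mod_cast this
  · have := (abs_le.1 (h2 k)).2
    exact_mod_cast this

/-- The indices of the particles, as a finite set. -/
def indexFinset (Ω : Set (E n)) (C₀ ε : ℝ) (h : (indices Ω C₀ ε).Finite) :
    Finset (Fin n → ℤ) := h.toFinset

theorem mem_indexFinset {h : (indices Ω C₀ ε).Finite} {j : Fin n → ℤ} :
    j ∈ indexFinset Ω C₀ ε h ↔ j ∈ indices Ω C₀ ε := h.mem_toFinset

theorem perforated_eq (h : (indices Ω C₀ ε).Finite) (ha : 0 < radius n C₀ ε) :
    perforated Ω C₀ ε = {x ∈ Ω | ∀ j ∈ indices Ω C₀ ε, radius n C₀ ε < ‖x - center ε j‖} := by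
  ext x
  rw [perforated, particles, h.closure_biUnion]
  simp only [particle, closure_ball _ ha.ne', Set.mem_sdiff, mem_iUnion, Metric.mem_closedBall,
    not_exists, not_le, mem_ofPred_eq, dist_eq_norm]

theorem isOpen_perforated (hΩ : IsOpen Ω) : IsOpen (perforated Ω C₀ ε) :=
  hΩ.sdiff isClosed_closure

theorem perforated_subset : perforated Ω C₀ ε ⊆ Ω := sdiff_subset

theorem surfaceMeasure_eq (h : (indices Ω C₀ ε).Finite) :
    surfaceMeasure Ω C₀ ε = ∑ j ∈ indexFinset Ω C₀ ε h,
      sphereMeasure (center ε j) (radius n C₀ ε) := by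
  have : Fintype (indices Ω C₀ ε) := h.fintype
  rw [surfaceMeasure, Measure.sum_fintype]
  refine (Finset.sum_subtype _ (fun j => ?_)
    fun j => sphereMeasure (center ε j) (radius n C₀ ε)).symm
  exact mem_indexFinset

theorem integral_surfaceMeasure (h : (indices Ω C₀ ε).Finite) {F : E n → ℝ} (hF : Continuous F) :
    ∫ x, F x ∂surfaceMeasure Ω C₀ ε = ∑ j ∈ indexFinset Ω C₀ ε h,
      ∫ x, F x ∂sphereMeasure (center ε j) (radius n C₀ ε) := by
  rw [surfaceMeasure_eq h, integral_finsetSum_measure]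
  exact fun j _ => integrable_sphereMeasure _ _ hF

theorem isFiniteMeasure_surfaceMeasure (h : (indices Ω C₀ ε).Finite) :
    IsFiniteMeasure (surfaceMeasure Ω C₀ ε) := by
  rw [surfaceMeasure_eq h]
  infer_instance

theorem ae_surfaceMeasure_mem (h : (indices Ω C₀ ε).Finite) (ha : 0 ≤ radius n C₀ ε) :
    ∀ᵐ x ∂surfaceMeasure Ω C₀ ε, ∃ j ∈ indices Ω C₀ ε, ‖x - center ε j‖ = radius n C₀ ε := by
  have : Countable (indices Ω C₀ ε) := h.countable.to_subtype
  rw [surfaceMeasure, Measure.ae_sum_iff]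
  intro j
  filter_upwards [ae_sphereMeasure_mem (center ε (j : Fin n → ℤ)) ha] with x hx
  exact ⟨j, j.2, hx⟩

/-- The particles fill the volume with density `O(1)` per cell. -/
theorem card_mul_le (hΩb : Bornology.IsBounded Ω) (hΩ : IsOpen Ω) (hε : 0 < ε)
    (hr : radius n C₀ ε < ε / 4) (h : (indices Ω C₀ ε).Finite) :
    (indexFinset Ω C₀ ε h).card * ((ε / 2) ^ n * volume.real (Metric.ball (0 : E n) 1))
      ≤ volume.real Ω := by
  have hb : ∀ j : Fin n → ℤ, volume.real (Metric.ball (center ε j) (ε / 2))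
      = (ε / 2) ^ n * volume.real (Metric.ball (0 : E n) 1) := by
    intro j
    rw [measureReal_def, Measure.addHaar_ball_of_pos _ _ (by positivity), ENNReal.toReal_mul,
      ENNReal.toReal_ofReal (by positivity), finrank_euclideanSpace_fin, measureReal_def]
  have hdis : Set.PairwiseDisjoint (indexFinset Ω C₀ ε h : Set (Fin n → ℤ))
      fun j => Metric.ball (center ε j) (ε / 2) := by
    intro i _ j _ hij
    refine Metric.ball_disjoint_ball ?_
    linarith [le_dist_center hε hij]
  have hsub : (⋃ j ∈ indexFinset Ω C₀ ε h, Metric.ball (center ε j) (ε / 2)) ⊆ Ω := by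
    refine iUnion₂_subset fun j hj => ?_
    refine Subset.trans ?_ (closedBall_center_subset hΩ hε hr (mem_indexFinset.1 hj))
    exact Metric.ball_subset_closedBall.trans (Metric.closedBall_subset_closedBall (by linarith))
  have := measureReal_mono hsub (hΩb.measure_lt_top (μ := volume)).ne
  rw [measureReal_biUnion_finset hdis fun _ _ => measurableSet_ball] at this
  simpa [hb] using this

/-- The critical scaling: the exponent `γ` is chosen such that `aⁿ⁻²` is proportional to `εⁿ`. -/
theorem rpow_gam_identity (hn : 3 ≤ n) (hε : 0 < ε) :
    (ε ^ gam n) ^ (n - 1) = ε ^ gam n * ε ^ n := by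
  have h2 : ((n : ℝ) - 2) ≠ 0 := by
    have : (3 : ℝ) ≤ n := by exact_mod_cast hn
    linarith
  rw [← Real.rpow_natCast (ε ^ gam n), ← Real.rpow_mul hε.le, ← Real.rpow_natCast ε n,
    ← Real.rpow_add hε]
  congr 1
  rw [gam, Nat.cast_sub (by omega)]
  push_cast
  field_simp
  ring

/-- The area of all particle surfaces is of order `ε^γ`. -/
theorem surfaceMeasure_univ_le (hn : 3 ≤ n) (hΩb : Bornology.IsBounded Ω) (hΩ : IsOpen Ω)
    (hC : 0 < C₀) (hε : 0 < ε) (hr : radius n C₀ ε < ε / 4) :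
    ε ^ (-gam n) * (surfaceMeasure Ω C₀ ε).real univ
      ≤ volume.real Ω * (n * 2 ^ n * C₀ ^ (n - 1)) := by
  have h := finite_indices hΩb hΩ hε hr
  have hcard := card_mul_le hΩb hΩ hε hr h
  have e1 : (surfaceMeasure Ω C₀ ε).real univ = (indexFinset Ω C₀ ε h).card *
      (radius n C₀ ε ^ (n - 1) * (n * volume.real (Metric.ball (0 : E n) 1))) := by
    rw [measureReal_def, surfaceMeasure_eq h, Measure.finsetSum_apply]
    simp only [sphereMeasure_univ, Finset.sum_const, nsmul_eq_mul]
    rw [ENNReal.toReal_mul, ENNReal.toReal_mul,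
      ENNReal.toReal_ofReal (pow_nonneg (radius_pos hC hε).le _), ← measureReal_def,
      Measure.toSphere_real_apply_univ, finrank_euclideanSpace_fin]
    simp
  have hg : ε ^ (-gam n) * radius n C₀ ε ^ (n - 1) = C₀ ^ (n - 1) * ε ^ n := by
    rw [radius, mul_pow, rpow_gam_identity hn hε, Real.rpow_neg hε.le]
    have : ε ^ gam n ≠ 0 := (Real.rpow_pos_of_pos hε _).ne'
    field_simp
  calc ε ^ (-gam n) * (surfaceMeasure Ω C₀ ε).real univ
      = (ε ^ (-gam n) * radius n C₀ ε ^ (n - 1)) * ((indexFinset Ω C₀ ε h).card *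
        (n * volume.real (Metric.ball (0 : E n) 1))) := by rw [e1]; ring
    _ = ((indexFinset Ω C₀ ε h).card * ((ε / 2) ^ n * volume.real (Metric.ball (0 : E n) 1)))
        * (n * 2 ^ n * C₀ ^ (n - 1)) := by
      rw [hg, div_pow]; field_simp
    _ ≤ _ := by gcongr

end Geometry

/-! ### A smooth ramp and radial barriers -/

section Ramp

/-- A smooth convex function that vanishes on `(-∞, 0]` and has slope `1` on `[1, ∞)`. -/
def ramp (s : ℝ) : ℝ := ∫ x in (0 : ℝ)..s, Real.smoothTransition x

/-- The constant by which `ramp s` falls short of `s` for `s ≥ 1`. -/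
def rampGap : ℝ := 1 - ramp 1

theorem hasDerivAt_ramp (s : ℝ) : HasDerivAt ramp (Real.smoothTransition s) s :=
  intervalIntegral.integral_hasDerivAt_right
    (Real.smoothTransition.continuous.intervalIntegrable _ _)
    Real.smoothTransition.continuous.stronglyMeasurable.stronglyMeasurableAtFilter
    Real.smoothTransition.continuous.continuousAt

theorem contDiff_ramp : ContDiff ℝ ∞ ramp := by
  rw [contDiff_infty_iff_deriv]
  refine ⟨fun s => (hasDerivAt_ramp s).differentiableAt, ?_⟩
  rw [funext fun s => (hasDerivAt_ramp s).deriv]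
  exact Real.smoothTransition.contDiff

theorem ramp_of_nonpos {s : ℝ} (hs : s ≤ 0) : ramp s = 0 := by
  rw [ramp, intervalIntegral.integral_congr (g := fun _ => (0 : ℝ)), intervalIntegral.integral_zero]
  intro x hx
  rw [uIcc_of_ge hs] at hx
  exact Real.smoothTransition.zero_of_nonpos hx.2

theorem monotone_ramp : Monotone ramp :=
  monotone_of_deriv_nonneg (fun s => (hasDerivAt_ramp s).differentiableAt) fun s => by
    rw [(hasDerivAt_ramp s).deriv]; exact Real.smoothTransition.nonneg s

theorem ramp_nonneg (s : ℝ) : 0 ≤ ramp s := by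
  rcases le_total s 0 with h | h
  · rw [ramp_of_nonpos h]
  · rw [← ramp_of_nonpos le_rfl]; exact monotone_ramp h

theorem ramp_of_one_le {s : ℝ} (hs : 1 ≤ s) : ramp s = s - rampGap := by
  have h : ramp s = ramp 1 + ∫ x in (1 : ℝ)..s, Real.smoothTransition x :=
    (intervalIntegral.integral_add_adjacent_intervals
      (Real.smoothTransition.continuous.intervalIntegrable _ _)
      (Real.smoothTransition.continuous.intervalIntegrable _ _)).symm
  rw [h, intervalIntegral.integral_congr (g := fun _ => (1 : ℝ))]
  · simp [rampGap]; ring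
  · intro x hx
    rw [uIcc_of_le hs] at hx
    exact Real.smoothTransition.one_of_one_le hx.1

theorem ramp_one_le : ramp 1 ≤ 1 := by
  have h := intervalIntegral.integral_mono_on (μ := volume) zero_le_one
    (Real.smoothTransition.continuous.intervalIntegrable 0 1)
    (continuous_const.intervalIntegrable 0 1) fun x _ => Real.smoothTransition.le_one x
  simpa [ramp] using h

theorem rampGap_nonneg : 0 ≤ rampGap := by
  rw [rampGap]; linarith [ramp_one_le]

theorem rampGap_le_one : rampGap ≤ 1 := by
  rw [rampGap]; linarith [ramp_nonneg 1]

end Ramp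

section RadialBarrier

variable {n : ℕ}

/-- The radial function `A (1 - (a / r)ⁿ⁻²) - (r² - a²) / (2 n)`, `r = |x - c|`, which vanishes on
the sphere `r = a` and has Laplacian `-1` outside it; inside, it is cut off to be smooth. -/
def radialBarrier (A a : ℝ) (c x : E n) : ℝ :=
  A * (Real.smoothTransition (2 * ‖x - c‖ ^ 2 / a ^ 2 - 1) * (1 - (a / ‖x - c‖) ^ (n - 2)))
    - (‖x - c‖ ^ 2 - a ^ 2) / (2 * n)

theorem contDiff_radialBarrier (A a : ℝ) (c : E n) :
    ContDiff ℝ ∞ (radialBarrier A a c) := by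
  have h2 : ContDiff ℝ ∞ fun x : E n => (‖x - c‖ ^ 2 - a ^ 2) / (2 * n) :=
    (((contDiff_id.sub contDiff_const).norm_sq ℝ).sub contDiff_const).div_const _
  have hT : ContDiff ℝ ∞ fun x : E n => Real.smoothTransition (2 * ‖x - c‖ ^ 2 / a ^ 2 - 1) :=
    Real.smoothTransition.contDiff.comp
      (((contDiff_const.mul ((contDiff_id.sub contDiff_const).norm_sq ℝ)).div_const _).sub
        contDiff_const)
  refine ContDiff.sub (contDiff_const.mul ?_) h2
  rw [contDiff_iff_contDiffAt]
  intro x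
  by_cases hx : x = c
  · have hev : (fun x : E n => Real.smoothTransition (2 * ‖x - c‖ ^ 2 / a ^ 2 - 1) *
        (1 - (a / ‖x - c‖) ^ (n - 2))) =ᶠ[𝓝 x] fun _ => 0 := by
      have hc : ContinuousAt (fun x : E n => 2 * ‖x - c‖ ^ 2 / a ^ 2 - 1) x := by fun_prop
      have hlt : (fun x : E n => 2 * ‖x - c‖ ^ 2 / a ^ 2 - 1) x < 0 := by simp [hx]
      filter_upwards [hc.eventually_lt_const hlt] with y hy
      rw [Real.smoothTransition.zero_of_nonpos (le_of_lt hy), zero_mul]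
    exact contDiffAt_const.congr_of_eventuallyEq hev
  · have hne : ‖x - c‖ ≠ 0 := norm_ne_zero_iff.2 (sub_ne_zero.2 hx)
    have hnorm : ContDiffAt ℝ ∞ (fun x : E n => ‖x - c‖) x :=
      (contDiffAt_id.sub contDiffAt_const).norm ℝ (sub_ne_zero.2 hx)
    exact hT.contDiffAt.mul (contDiffAt_const.sub ((contDiffAt_const.div hnorm hne).pow _))

theorem radialBarrier_of_le {A a : ℝ} (ha : 0 < a) {c x : E n} (hx : a ≤ ‖x - c‖) :
    radialBarrier A a c x
      = A * (1 - (a / ‖x - c‖) ^ (n - 2)) - (‖x - c‖ ^ 2 - a ^ 2) / (2 * n) := by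
  have h : 1 ≤ 2 * ‖x - c‖ ^ 2 / a ^ 2 - 1 := by
    have : a ^ 2 ≤ ‖x - c‖ ^ 2 := by gcongr
    have h2 : 2 ≤ 2 * ‖x - c‖ ^ 2 / a ^ 2 := by rw [le_div_iff₀ (by positivity)]; linarith
    linarith
  rw [radialBarrier, Real.smoothTransition.one_of_one_le h, one_mul]

/-- Inside the particle the factor `1 - (a / r)ⁿ⁻²` is negative, so that the cut-off does
no harm. -/
theorem radialBarrier_le {A a : ℝ} (hn : 3 ≤ n) (hA : 0 ≤ A) {c x : E n}
    (hx : ‖x - c‖ ≤ a) : radialBarrier A a c x ≤ a ^ 2 / (2 * n) := by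
  have h1 : Real.smoothTransition (2 * ‖x - c‖ ^ 2 / a ^ 2 - 1) *
      (1 - (a / ‖x - c‖) ^ (n - 2)) ≤ 0 := by
    rcases (norm_nonneg (x - c)).eq_or_lt with h0 | h0
    · rw [← h0, Real.smoothTransition.zero_of_nonpos (by simp), zero_mul]
    · refine mul_nonpos_of_nonneg_of_nonpos (Real.smoothTransition.nonneg _) ?_
      have : 1 ≤ a / ‖x - c‖ := by rw [le_div_iff₀ h0]; linarith
      linarith [one_le_pow₀ this (n := n - 2)]
  have h2 : 0 ≤ ‖x - c‖ ^ 2 / (2 * n) := by positivity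
  rw [radialBarrier, sub_div]
  nlinarith [mul_nonneg hA (neg_nonneg.2 h1)]

/-- Outside the particle, the gradient is a radial field as in `integral_fderiv_radial_zero`. -/
theorem fderiv_radialBarrier {A a : ℝ} (hn : 3 ≤ n) (ha : 0 < a) {c x : E n}
    (hx : a < ‖x - c‖) (v : E n) :
    fderiv ℝ (radialBarrier A a c) x v =
      inner ℝ (((A * (n - 2 : ℕ) * a ^ (n - 2)) / ‖x - c‖ ^ n - 1 / n) • (x - c)) v := by
  have hr : 0 < ‖x - c‖ := ha.trans hx
  have hev : radialBarrier A a c =ᶠ[𝓝 x] fun x =>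
      A * (1 - (a / ‖x - c‖) ^ (n - 2)) - (‖x - c‖ ^ 2 - a ^ 2) / (2 * n) := by
    have hc : ContinuousAt (fun x : E n => ‖x - c‖) x := by fun_prop
    filter_upwards [hc.eventually_const_lt hx] with y hy
    exact radialBarrier_of_le ha hy.le
  have hsq : HasFDerivAt (fun x : E n => ‖x - c‖ ^ 2) (2 • innerSL ℝ (x - c)) x := by
    simpa using ((hasFDerivAt_id x).sub_const c).norm_sq
  have hnorm : HasFDerivAt (fun x : E n => ‖x - c‖) (‖x - c‖⁻¹ • innerSL ℝ (x - c)) x := by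
    have := hsq.sqrt (by positivity)
    simp only [Real.sqrt_sq (norm_nonneg _)] at this
    refine this.congr_fderiv ?_
    ext w
    simp
    field_simp
  obtain ⟨m, rfl⟩ : ∃ m, n = m + 2 := ⟨n - 2, by omega⟩
  simp only [Nat.add_sub_cancel] at *
  have hpow : HasDerivAt (fun r : ℝ => (a / r) ^ m) (-(m * a ^ m / ‖x - c‖ ^ (m + 1))) ‖x - c‖ := by
    have h1 : HasDerivAt (fun r : ℝ => a / r) (-(a / ‖x - c‖ ^ 2)) ‖x - c‖ := by
      refine ((hasDerivAt_inv hr.ne').const_mul a).congr_deriv ?_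
      field_simp
    refine (h1.pow m).congr_deriv ?_
    obtain ⟨k, rfl⟩ : ∃ k, m = k + 1 := ⟨m - 1, by omega⟩
    simp only [Nat.add_sub_cancel, div_pow]
    field_simp
    ring
  have hpow' := hpow.comp_hasFDerivAt x hnorm
  have hall := ((hpow'.const_sub 1).const_mul A).sub ((hsq.sub_const (a ^ 2)).mul_const
    ((2 * ((m + 2 : ℕ) : ℝ))⁻¹))
  have hfun : HasFDerivAt (fun x : E (m + 2) => A * (1 - (a / ‖x - c‖) ^ m) -
      (‖x - c‖ ^ 2 - a ^ 2) / (2 * ((m + 2 : ℕ) : ℝ))) _ x := hall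
  rw [hev.fderiv_eq, hfun.fderiv]
  simp [inner_smul_left, inner_sub_left]
  field_simp
  ring

end RadialBarrier

/-! ### A barrier function for the perforated domain -/

section BarrierIdentity

variable {n : ℕ} {ι : Type*}

theorem integrable_fderiv_apply {F : E n → ℝ} (hF : ContDiff ℝ 1 F) (hc : HasCompactSupport F)
    {G : E n → E n} (hG : Continuous G) : Integrable fun x => fderiv ℝ F x (G x) := by
  have h1 : Continuous fun x => fderiv ℝ F x (G x) :=
    (hF.continuous_fderiv one_ne_zero).clm_apply hG
  refine h1.integrable_of_hasCompactSupport (HasCompactSupport.intro hc.isCompact fun y hy => ?_)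
  have : fderiv ℝ F y = 0 := image_eq_zero_of_notMem_tsupport
    (fun h => hy (tsupport_fderiv_subset ℝ h))
  rw [this]; rfl

/-- Green's formula in a domain with spherical holes, for a test function cut into a piece that
vanishes near the holes and pieces that each live near one hole; each piece is tested with its own
radial field of divergence `-1`. -/
theorem integral_partition_radial (hn : 1 ≤ n) (J : Finset ι) (c : ι → E n) {Ω D : Set (E n)}
    {a K b : ℝ} (ha : 0 < a) (hb : b * a ^ (n - 1) = K - a ^ n / n)
    (hΩ : MeasurableSet Ω)
    (hD : D = {x ∈ Ω | ∀ j ∈ J, a < ‖x - c j‖}) {θ : ι → E n → ℝ}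
    (hθ : ∀ j, ContDiff ℝ 1 (θ j))
    (hθ1 : ∀ j ∈ J, ∀ x, ‖x - c j‖ ≤ a → ∀ᶠ y in 𝓝 x, θ j y = 1)
    (hθ0 : ∀ j ∈ J, ∀ x, ‖x - c j‖ ≤ a → ∀ i ∈ J, i ≠ j → ∀ᶠ y in 𝓝 x, θ i y = 0)
    {G : ι → E n → E n} (hGc : ∀ j, Continuous (G j))
    (hG : ∀ j x, a < ‖x - c j‖ → G j x = (K / ‖x - c j‖ ^ n - 1 / n) • (x - c j))
    {q : E n → ℝ} (hq : ContDiff ℝ 1 q) (hqc : HasCompactSupport q) (hqs : tsupport q ⊆ Ω) :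
    ∫ x in D, (fderiv ℝ (fun y => (1 - ∑ j ∈ J, θ j y) * q y) x (-(1 / n : ℝ) • x)
        + ∑ j ∈ J, fderiv ℝ (fun y => θ j y * q y) x (G j x))
      = (∫ x in D, q x) - b * ∑ j ∈ J, ∫ x, q x ∂sphereMeasure (c j) a := by
  have hq0 : ∀ x, x ∉ Ω → q =ᶠ[𝓝 x] 0 := fun x hx =>
    notMem_tsupport_iff_eventuallyEq.1 fun h => hx (hqs h)
  have hDm : MeasurableSet D := by
    have : D = Ω ∩ ⋂ j ∈ J, {x | a < ‖x - c j‖} := by rw [hD]; ext x; simp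
    rw [this]
    exact hΩ.inter (J.measurableSet_biInter fun j _ =>
      measurableSet_lt measurable_const (by fun_prop))
  have h0s : ContDiff ℝ 1 fun y => (1 - ∑ j ∈ J, θ j y) * q y :=
    (contDiff_const.sub (ContDiff.sum fun j _ => hθ j)).mul hq
  have h0c : HasCompactSupport fun y => (1 - ∑ j ∈ J, θ j y) * q y := hqc.mul_left
  have hjs : ∀ j, ContDiff ℝ 1 fun y => θ j y * q y := fun j => (hθ j).mul hq
  have hjc : ∀ j, HasCompactSupport fun y => θ j y * q y := fun j => hqc.mul_left
  -- the first piece vanishes near every point outside `D`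
  have h0z : ∀ x, x ∉ D → (fun y => (1 - ∑ j ∈ J, θ j y) * q y) =ᶠ[𝓝 x] fun _ => 0 := by
    intro x hx
    by_cases hxΩ : x ∈ Ω
    · obtain ⟨j, hj, hjx⟩ : ∃ j ∈ J, ‖x - c j‖ ≤ a := by
        by_contra! h
        exact hx (hD ▸ ⟨hxΩ, h⟩)
      have hall : ∀ᶠ y in 𝓝 x, ∀ i ∈ J, i ≠ j → θ i y = 0 := by
        rw [eventually_all_finset]
        intro i hi
        by_cases hij : i = j
        · exact Eventually.of_forall fun y h => absurd hij h
        · filter_upwards [hθ0 j hj x hjx i hi hij] with y hy _ using hy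
      filter_upwards [hall, hθ1 j hj x hjx] with y hy hy1
      rw [Finset.sum_eq_single_of_mem j hj hy, hy1, sub_self, zero_mul]
    · filter_upwards [hq0 x hxΩ] with y hy
      rw [hy, Pi.zero_apply, mul_zero]
  -- the piece with index `j` vanishes near every point outside `D` and the hole with index `j`
  have hjz : ∀ j ∈ J, ∀ x, x ∉ D → a < ‖x - c j‖ →
      (fun y => θ j y * q y) =ᶠ[𝓝 x] fun _ => 0 := by
    intro j hj x hx hxj
    by_cases hxΩ : x ∈ Ω
    · obtain ⟨i, hi, hix⟩ : ∃ i ∈ J, ‖x - c i‖ ≤ a := by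
        by_contra! h
        exact hx (hD ▸ ⟨hxΩ, h⟩)
      have hij : j ≠ i := by rintro rfl; exact absurd hxj hix.not_gt
      filter_upwards [hθ0 i hi x hix j hj hij] with y hy
      rw [hy, zero_mul]
    · filter_upwards [hq0 x hxΩ] with y hy
      rw [hy, Pi.zero_apply, mul_zero]
  have e0 : ∫ x in D, fderiv ℝ (fun y => (1 - ∑ j ∈ J, θ j y) * q y) x (-(1 / n : ℝ) • x)
      = ∫ x in D, (1 - ∑ j ∈ J, θ j x) * q x := by
    have k := integral_fderiv_radial hn (0 : E n) (K := 0) le_rfl (fun _ => rfl) h0s h0c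
    have hnt : Nontrivial (E n) := by
      have : Nonempty (Fin n) := ⟨⟨0, hn⟩⟩
      infer_instance
    have hu : {x : E n | (0 : ℝ) < ‖x - 0‖} =ᵐ[volume] univ := by
      have : {x : E n | (0 : ℝ) < ‖x - 0‖} = {0}ᶜ := by ext x; simp
      rw [this]
      exact ae_eq_univ.2 (by simp)
    rw [setIntegral_congr_set hu, setIntegral_congr_set hu, Measure.restrict_univ] at k
    have hn0 : (n : ℝ) ≠ 0 := by positivity
    simp only [zero_div, zero_sub, sub_zero, zero_pow (show n ≠ 0 by omega), zero_mul,
      sub_zero] at k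
    rw [setIntegral_eq_integral_of_forall_compl_eq_zero, k,
      setIntegral_eq_integral_of_forall_compl_eq_zero]
    · exact fun x hx => (h0z x hx).self_of_nhds
    · intro x hx
      rw [(h0z x hx).fderiv_eq]; simp
  have ej : ∀ j ∈ J, ∫ x in D, fderiv ℝ (fun y => θ j y * q y) x (G j x)
      = (∫ x in D, θ j x * q x) - b * ∫ x, q x ∂sphereMeasure (c j) a := by
    intro j hj
    have hsub : D ⊆ {x | a < ‖x - c j‖} := by rw [hD]; exact fun x hx => hx.2 j hj
    have hsm : MeasurableSet {x : E n | a < ‖x - c j‖} :=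
      measurableSet_lt measurable_const (by fun_prop)
    have k := integral_fderiv_radial hn (c j) (K := K) ha.le (fun h => absurd h ha.ne')
      (hjs j) (hjc j)
    have hsph : ∀ ξ : Metric.sphere (0 : E n) 1, θ j (c j + a • (ξ : E n)) = 1 := by
      intro ξ
      refine (hθ1 j hj _ ?_).self_of_nhds
      have hξ : ‖(ξ : E n)‖ = 1 := by simp
      rw [add_sub_cancel_left, norm_smul, hξ, mul_one, Real.norm_of_nonneg ha.le]
    simp only [hsph, one_mul] at k
    rw [integral_sphereMeasure _ ha.le hq.continuous, ← mul_assoc, hb,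
      ← setIntegral_eq_of_subset_of_forall_sdiff_eq_zero hsm hsub
        (fun x hx => (hjz j hj x hx.2 hx.1).self_of_nhds), ← k,
      setIntegral_congr_fun hsm (fun x hx => congrArg _ (hG j x hx).symm)]
    refine (setIntegral_eq_of_subset_of_forall_sdiff_eq_zero hsm hsub fun x hx => ?_).symm
    rw [(hjz j hj x hx.2 hx.1).fderiv_eq]; simp
  have i0 : IntegrableOn (fun x => fderiv ℝ (fun y => (1 - ∑ j ∈ J, θ j y) * q y) x
      (-(1 / n : ℝ) • x)) D :=
    (integrable_fderiv_apply h0s h0c (by fun_prop)).integrableOn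
  have ij : ∀ j, IntegrableOn (fun x => fderiv ℝ (fun y => θ j y * q y) x (G j x)) D := fun j =>
    (integrable_fderiv_apply (hjs j) (hjc j) (hGc j)).integrableOn
  rw [integral_add i0 (integrable_finsetSum _ fun j _ => ij j),
    integral_finsetSum _ fun j _ => ij j, e0, Finset.sum_congr rfl ej, Finset.sum_sub_distrib,
    ← Finset.mul_sum, ← add_sub_assoc, ← integral_finsetSum, ← integral_add]
  · congr 2
    ext x
    rw [← Finset.sum_mul]; ring
  · exact (h0s.continuous.integrable_of_hasCompactSupport h0c).integrableOn
  · exact integrable_finsetSum _ fun j _ =>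
      ((hjs j).continuous.integrable_of_hasCompactSupport (hjc j)).integrableOn
  · exact fun j _ => ((hjs j).continuous.integrable_of_hasCompactSupport (hjc j)).integrableOn

/-- The product rule behind the barrier identity. -/
theorem fderiv_partition (J : Finset ι) {P : E n → ℝ} {b : ι → E n → ℝ} {q : E n → ℝ}
    (hP : Differentiable ℝ P) (hb : ∀ j, Differentiable ℝ (b j)) (hq : Differentiable ℝ q)
    (r : ℝ) (x : E n) :
    fderiv ℝ q x (gradient (fun y => P y - ∑ j ∈ J, ramp (P y - b j y + r)) x)
      = fderiv ℝ (fun y => (1 - ∑ j ∈ J, Real.smoothTransition (P y - b j y + r)) * q y) x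
          (gradient P x)
        + ∑ j ∈ J, fderiv ℝ (fun y => Real.smoothTransition (P y - b j y + r) * q y) x
          (gradient (b j) x)
        + (∑ j ∈ J, deriv Real.smoothTransition (P x - b j x + r)
            * ‖gradient P x - gradient (b j) x‖ ^ 2) * q x := by
  have hs : ∀ j, HasGradientAt (fun y => P y - b j y + r) (gradient P x - gradient (b j) x) x := by
    intro j
    have h1 := (hP x).hasGradientAt.hasFDerivAt
    have h2 := (hb j x).hasGradientAt.hasFDerivAt
    rw [hasGradientAt_iff_hasFDerivAt, map_sub]
    exact (h1.sub h2).add_const r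
  have hτ : ∀ s, HasDerivAt Real.smoothTransition (deriv Real.smoothTransition s) s := fun s =>
    (Real.smoothTransition.contDiff (n := 1)).differentiable one_ne_zero s |>.hasDerivAt
  have hθ : ∀ j, HasFDerivAt (fun y => Real.smoothTransition (P y - b j y + r))
      (deriv Real.smoothTransition (P x - b j x + r) •
        innerSL ℝ (gradient P x - gradient (b j) x)) x := fun j =>
    (hτ _).comp_hasFDerivAt x (hs j).hasFDerivAt
  have hψ : HasGradientAt (fun y => P y - ∑ j ∈ J, ramp (P y - b j y + r))
      (gradient P x - ∑ j ∈ J, Real.smoothTransition (P x - b j x + r) •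
        (gradient P x - gradient (b j) x)) x := by
    rw [hasGradientAt_iff_hasFDerivAt, map_sub, map_sum]
    refine (hP x).hasGradientAt.hasFDerivAt.sub (HasFDerivAt.fun_sum fun j _ => ?_)
    rw [map_smul]
    exact (hasDerivAt_ramp _).comp_hasFDerivAt x (hs j).hasFDerivAt
  have hq' := (hq x).hasFDerivAt
  have h0 := ((HasFDerivAt.fun_sum (u := J) fun j _ => hθ j).const_sub 1).fun_mul hq'
  have hj := fun j => HasFDerivAt.fderiv ((hθ j).fun_mul hq')
  rw [hψ.gradient, HasFDerivAt.fderiv h0]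
  simp only [hj]
  simp only [map_sub (fderiv ℝ q x), map_sum (fderiv ℝ q x), map_smul (fderiv ℝ q x),
    add_apply, smul_apply, neg_apply,
    sum_apply, smul_eq_mul, innerSL_apply_apply]
  have hA : ∀ j, ‖gradient P x - gradient (b j) x‖ ^ 2
      = inner ℝ (gradient P x - gradient (b j) x) (gradient P x)
        - inner ℝ (gradient P x - gradient (b j) x) (gradient (b j) x) := fun j => by
    rw [← inner_sub_right, real_inner_self_eq_norm_sq]
  rw [Finset.sum_congr (s₁ := J) rfl fun j _ => show
      Real.smoothTransition (P x - b j x + r) * fderiv ℝ q x (gradient (b j) x)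
        + q x * (deriv Real.smoothTransition (P x - b j x + r) *
          inner ℝ (gradient P x - gradient (b j) x) (gradient (b j) x)) =
      -(Real.smoothTransition (P x - b j x + r) *
        (fderiv ℝ q x (gradient P x) - fderiv ℝ q x (gradient (b j) x)))
      + Real.smoothTransition (P x - b j x + r) * fderiv ℝ q x (gradient P x)
      + q x * (deriv Real.smoothTransition (P x - b j x + r) *
        inner ℝ (gradient P x - gradient (b j) x) (gradient P x))
      - deriv Real.smoothTransition (P x - b j x + r)
        * ‖gradient P x - gradient (b j) x‖ ^ 2 * q x by rw [hA j]; ring]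
  simp only [Finset.sum_add_distrib, Finset.sum_sub_distrib, Finset.sum_neg_distrib,
    ← Finset.sum_mul, ← Finset.mul_sum]
  ring

end BarrierIdentity

section Barrier

variable {n : ℕ} {Ω : Set (E n)} {C₀ ε : ℝ}

/-- `ψ` is a smooth function with values in `[0, M]` on the perforated domain that vanishes on the
surface of the particles, with `-Δψ = 1 + κ` and normal derivative of size `b` on that surface, in
the weak sense that corresponds to Green's formula. -/
structure IsBarrier (Ω : Set (E n)) (C₀ ε M b : ℝ) (ψ κ : E n → ℝ) : Prop where
  contDiff : ContDiff ℝ ∞ ψ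
  continuous : Continuous κ
  nonneg_source : ∀ x, 0 ≤ κ x
  nonneg : ∀ x ∈ perforated Ω C₀ ε, 0 ≤ ψ x
  le : ∀ x ∈ perforated Ω C₀ ε, ψ x ≤ M
  ae_eq_zero : ∀ᵐ x ∂surfaceMeasure Ω C₀ ε, ψ x = 0
  flux_pos : 0 < b
  integral_eq : ∀ q : E n → ℝ, ContDiff ℝ 1 q → HasCompactSupport q → tsupport q ⊆ Ω →
    ∫ x in perforated Ω C₀ ε, fderiv ℝ q x (gradient ψ x)
      = (∫ x in perforated Ω C₀ ε, (1 + κ x) * q x) - b * ∫ x, q x ∂surfaceMeasure Ω C₀ ε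

theorem deriv_smoothTransition_nonneg (s : ℝ) : 0 ≤ deriv Real.smoothTransition s :=
  Real.smoothTransition.monotone.deriv_nonneg

theorem contDiff_gradient {f : E n → ℝ} (hf : ContDiff ℝ ∞ f) : ContDiff ℝ ∞ (gradient f) :=
  (InnerProductSpace.toDual ℝ (E n)).symm.contDiff.comp (hf.fderiv_right (by simp))

theorem radialBarrier_nonneg {A a R : ℝ} (hn : 3 ≤ n) (ha : 0 < a) (hA : R ^ 2 ≤ A) {c x : E n}
    (hx : a ≤ ‖x - c‖) (hxR : ‖x - c‖ ≤ R) : 0 ≤ radialBarrier A a c x := by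
  rw [radialBarrier_of_le ha hx]
  set r := ‖x - c‖
  have hr : 0 < r := ha.trans_le hx
  have hA0 : 0 ≤ A := (sq_nonneg R).trans hA
  have h1 : (a / r) ^ (n - 2) ≤ a / r :=
    pow_le_of_le_one (by positivity) (by rw [div_le_one hr]; exact hx) (by omega)
  have h2 : (r ^ 2 - a ^ 2) / (2 * n) ≤ A * (1 - a / r) := by
    have hn' : (3 : ℝ) ≤ n := by exact_mod_cast hn
    rw [div_le_iff₀ (by positivity)]
    have h3 : A * (1 - a / r) = (A / r) * (r - a) := by field_simp
    have h4 : r ≤ A / r := by rw [le_div_iff₀ hr]; nlinarith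
    rw [h3]
    have h5 : r * (r - a) * (2 * n) ≤ A / r * (r - a) * (2 * n) := by gcongr
    refine le_trans ?_ h5
    nlinarith [mul_nonneg (sub_nonneg.2 hx) hr.le]
  nlinarith

/-- Barriers exist, with constants `M` and `C` that do not depend on `ε`. -/
theorem exists_isBarrier (hn : 3 ≤ n) (hΩ : IsOpen Ω) (hΩb : Bornology.IsBounded Ω)
    (hC : 0 < C₀) : ∃ M C : ℝ, 0 < M ∧ 0 < C ∧ ∀ ε, 0 < ε → radius n C₀ ε < ε / 4 →
      ∃ (ψ κ : E n → ℝ) (b : ℝ), b ≤ C * ε ^ (-gam n) ∧ IsBarrier Ω C₀ ε M b ψ κ := by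
  obtain ⟨ρ, hρ1, hρ⟩ : ∃ ρ : ℝ, 1 ≤ ρ ∧ Ω ⊆ Metric.closedBall 0 ρ := by
    obtain ⟨ρ, hρ⟩ := hΩb.subset_closedBall 0
    exact ⟨max ρ 1, le_max_right _ _, hρ.trans (Metric.closedBall_subset_closedBall (le_max_left _ _))⟩
  have hn' : (3 : ℝ) ≤ n := by exact_mod_cast hn
  have hΩn : ∀ x ∈ Ω, ‖x‖ ≤ ρ := fun x hx => by simpa using hρ hx
  have hρ0 : 0 < ρ := by linarith
  -- `M` makes the paraboloid larger than `1` on `Ω`; `A` makes the radial functions larger than it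
  -- at distance `ε / 2` from their centres
  set M : ℝ := 2 + ρ ^ 2 with hM
  set A : ℝ := 2 * (M + 1) + 4 * ρ ^ 2 with hA
  have hMpos : 0 < M := by positivity
  have hApos : 0 < A := by positivity
  refine ⟨M, A * (n - 2 : ℕ) / C₀, hMpos, ?_, ?_⟩
  · have : 0 < n - 2 := by omega
    positivity
  intro ε hε hr
  have hfin := finite_indices hΩb hΩ hε hr
  set J := indexFinset Ω C₀ ε hfin with hJ
  set a := radius n C₀ ε with ha_def
  have ha : 0 < a := radius_pos hC hε
  set c : (Fin n → ℤ) → E n := center ε with hc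
  have hJΩ : ∀ j ∈ J, Metric.closedBall (c j) ε ⊆ Ω := fun j hj =>
    closedBall_center_subset hΩ hε hr (mem_indexFinset.1 hj)
  -- if there is a particle, then a ball of radius `ε` fits into `Ω`
  have hε_le : ∀ j ∈ J, ε ≤ ρ := by
    intro j hj
    let e : E n := EuclideanSpace.single ⟨0, by omega⟩ 1
    have he : ‖e‖ = 1 := by simp [e]
    have h1 := hΩn (c j + ε • e) (hJΩ j hj (by simp [norm_smul, he, abs_of_pos hε]))
    have h2 := hΩn (c j - ε • e) (hJΩ j hj (by simp [norm_smul, he, abs_of_pos hε]))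
    have h3 := norm_sub_le (c j + ε • e) (c j - ε • e)
    have h4 : c j + ε • e - (c j - ε • e) = (2 * ε) • e := by module
    rw [h4, norm_smul, he, mul_one, Real.norm_of_nonneg (by positivity)] at h3
    linarith
  let P : E n → ℝ := fun x => M - ‖x‖ ^ 2 / (2 * n)
  let b : (Fin n → ℤ) → E n → ℝ := fun j => radialBarrier A a (c j)
  let s : (Fin n → ℤ) → E n → ℝ := fun j y => P y - b j y + rampGap
  have hPs : ContDiff ℝ ∞ P := contDiff_const.sub ((contDiff_id.norm_sq ℝ).div_const _)
  have hbs : ∀ j, ContDiff ℝ ∞ (b j) := fun j => contDiff_radialBarrier A a (c j)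
  have hss : ∀ j, ContDiff ℝ ∞ (s j) := fun j => (hPs.sub (hbs j)).add contDiff_const
  have hPle : ∀ x, P x ≤ M := fun x => sub_le_self _ (by positivity)
  have hPge : ∀ x ∈ Ω, 2 + ρ ^ 2 / 2 ≤ P x := by
    intro x hx
    have h1 : ‖x‖ ^ 2 / (2 * n) ≤ ρ ^ 2 / 2 := by
      rw [div_le_iff₀ (by positivity)]
      have := pow_le_pow_left₀ (norm_nonneg x) (hΩn x hx) 2
      nlinarith [sq_nonneg ρ]
    simp only [P]; linarith
  -- far from its particle a barrier exceeds `P`, and on the particle it is below `P`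
  have hfar : ∀ j ∈ J, ∀ x ∈ Ω, ε / 2 ≤ ‖x - c j‖ → s j x ≤ 0 := by
    intro j hj x hx hxj
    have hcj := hΩn _ (hJΩ j hj (Metric.mem_closedBall_self hε.le))
    have hx2 : ‖x - c j‖ ≤ 2 * ρ := (norm_sub_le _ _).trans (by linarith [hΩn x hx])
    have h1 : (a / ‖x - c j‖) ^ (n - 2) ≤ 1 / 2 := by
      have hpos : 0 < ‖x - c j‖ := by linarith
      have h2 : a / ‖x - c j‖ ≤ 1 / 2 := by rw [div_le_iff₀ hpos]; linarith
      exact (pow_le_of_le_one (by positivity) (h2.trans (by norm_num)) (by omega)).trans h2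
    have h3 : (‖x - c j‖ ^ 2 - a ^ 2) / (2 * n) ≤ 2 * ρ ^ 2 := by
      rw [div_le_iff₀ (by positivity)]
      have := pow_le_pow_left₀ (norm_nonneg _) hx2 2
      nlinarith [sq_nonneg ρ, sq_nonneg a]
    have h4 : M + 1 ≤ b j x := by
      simp only [b]
      rw [radialBarrier_of_le ha (by linarith)]
      nlinarith
    simp only [s]
    linarith [hPle x, rampGap_le_one]
  have hnear : ∀ j ∈ J, ∀ x, ‖x - c j‖ ≤ a → 1 < s j x := by
    intro j hj x hx
    have hxΩ : x ∈ Ω := hJΩ j hj (by rw [Metric.mem_closedBall, dist_eq_norm]; linarith)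
    have h1 : b j x ≤ ρ ^ 2 / 2 := by
      refine (radialBarrier_le hn hApos.le hx).trans ?_
      have h2 : a ≤ ρ := by linarith [hε_le j hj]
      rw [div_le_iff₀ (by positivity)]
      have := pow_le_pow_left₀ ha.le h2 2
      nlinarith [sq_nonneg ρ]
    simp only [s]
    linarith [hPge x hxΩ, rampGap_nonneg]
  have hsep : ∀ i j, ∀ x, ‖x - c i‖ < ε / 2 → j ≠ i → ε / 2 ≤ ‖x - c j‖ := by
    intro i j x hi hji
    by_contra! h
    exact hji (eq_of_mem_balls hε hi h.le).symm
  have hD := perforated_eq (Ω := Ω) (C₀ := C₀) (ε := ε) hfin ha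
  -- near the particle with index `i` only the barrier with index `i` is active
  have hψi : ∀ i ∈ J, ∀ x ∈ Ω, ‖x - c i‖ < ε / 2 →
      P x - ∑ j ∈ J, ramp (s j x) = P x - ramp (s i x) := by
    intro i hi x hx hxi
    rw [Finset.sum_eq_single_of_mem i hi fun j hj hji =>
      ramp_of_nonpos (hfar j hj x hx (hsep i j x hxi hji))]
  have hψ_one : ∀ i x, 1 ≤ s i x → P x - ramp (s i x) = b i x := by
    intro i x h
    rw [ramp_of_one_le h]; simp only [s]; ring
  have hb_nonneg : ∀ i ∈ J, ∀ x, a ≤ ‖x - c i‖ → ‖x - c i‖ ≤ ε / 2 → 0 ≤ b i x := by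
    intro i hi x hx hx'
    refine radialBarrier_nonneg hn ha (R := ε / 2) ?_ hx hx'
    have := pow_le_pow_left₀ hε.le (hε_le i hi) 2
    nlinarith
  -- the flux through the spheres; without particles any positive value will do
  obtain ⟨β, hβ0, hβle, hβJ⟩ : ∃ β : ℝ, 0 < β ∧ β ≤ A * (n - 2 : ℕ) / C₀ * ε ^ (-gam n) ∧
      (J.Nonempty → β = (A * (n - 2 : ℕ) * a ^ (n - 2) - a ^ n / n) / a ^ (n - 1)) := by
    have hn2 : (1 : ℝ) ≤ (n - 2 : ℕ) := by exact_mod_cast (by omega : 1 ≤ n - 2)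
    have e1 : A * (n - 2 : ℕ) / C₀ * ε ^ (-gam n) = A * (n - 2 : ℕ) / a := by
      rw [ha_def, radius, Real.rpow_neg hε.le]; field_simp
    rw [e1]
    by_cases hJe : J.Nonempty
    · obtain ⟨j, hj⟩ := hJe
      have h2 : a ≤ ρ := by linarith [hε_le j hj]
      have e2 : (A * (n - 2 : ℕ) * a ^ (n - 2) - a ^ n / n) / a ^ (n - 1)
          = A * (n - 2 : ℕ) / a - a / n := by
        obtain ⟨m, rfl⟩ : ∃ m, n = m + 2 := ⟨n - 2, by omega⟩
        simp only [Nat.add_sub_cancel, show m + 2 - 1 = m + 1 by omega, pow_succ]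
        field_simp
      refine ⟨_, ?_, ?_, fun _ => rfl⟩
      · rw [e2, sub_pos, div_lt_div_iff₀ (by positivity) ha]
        have := pow_le_pow_left₀ ha.le h2 2
        nlinarith [mul_le_mul hn2 hn' (by norm_num) (by positivity)]
      · rw [e2]; linarith [show 0 ≤ a / n by positivity]
    · exact ⟨_, by positivity, le_rfl, fun h => absurd h hJe⟩
  -- `P - ∑ ramp (P - b j + rampGap)` is a smooth version of the minimum of `P` and of the `b j`
  have hsc : ∀ j, Continuous (s j) := fun j => (hss j).continuous
  have hψs : ContDiff ℝ ∞ fun x => P x - ∑ j ∈ J, ramp (s j x) :=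
    hPs.sub (ContDiff.sum fun j _ => contDiff_ramp.comp (hss j))
  have hκc : Continuous fun x => ∑ j ∈ J,
      deriv Real.smoothTransition (s j x) * ‖gradient P x - gradient (b j) x‖ ^ 2 := by
    have h1 : Continuous (deriv Real.smoothTransition) :=
      (Real.smoothTransition.contDiff (n := 1)).continuous_deriv le_rfl
    refine continuous_finsetSum _ fun j _ => (h1.comp (hsc j)).mul (Continuous.pow
      (Continuous.norm ?_) 2)
    exact (contDiff_gradient hPs).continuous.sub (contDiff_gradient (hbs j)).continuous
  refine ⟨fun x => P x - ∑ j ∈ J, ramp (s j x), fun x => ∑ j ∈ J,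
    deriv Real.smoothTransition (s j x) * ‖gradient P x - gradient (b j) x‖ ^ 2, β, hβle,
    ⟨hψs, hκc, ?_, ?_, ?_, ?_, hβ0, ?_⟩⟩
  · exact fun x => Finset.sum_nonneg fun j _ =>
      mul_nonneg (deriv_smoothTransition_nonneg _) (sq_nonneg _)
  · intro x hx
    rw [hD] at hx
    by_cases hxi : ∃ i ∈ J, ‖x - c i‖ < ε / 2
    · obtain ⟨i, hi, hxi⟩ := hxi
      simp only [hψi i hi x hx.1 hxi]
      rcases le_total 1 (s i x) with h | h
      · rw [hψ_one i x h]
        exact hb_nonneg i hi x (hx.2 i (mem_indexFinset.1 hi)).le hxi.le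
      · linarith [monotone_ramp h, ramp_one_le, hPge x hx.1, sq_nonneg ρ]
    · push Not at hxi
      rw [Finset.sum_eq_zero fun j hj => ramp_of_nonpos (hfar j hj x hx.1 (hxi j hj))]
      linarith [hPge x hx.1, sq_nonneg ρ]
  · intro x _
    have := Finset.sum_nonneg fun j (_ : j ∈ J) => ramp_nonneg (s j x)
    linarith [hPle x]
  · filter_upwards [ae_surfaceMeasure_mem hfin ha.le] with x hx
    obtain ⟨i, hi, hxi⟩ := hx
    rw [← mem_indexFinset (h := hfin)] at hi
    have hxΩ : x ∈ Ω := hJΩ i hi (by rw [Metric.mem_closedBall, dist_eq_norm, hxi]; linarith)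
    rw [hψi i hi x hxΩ (by linarith), hψ_one i x (hnear i hi x hxi.le).le]
    simp only [b]
    rw [radialBarrier_of_le ha hxi.ge, show ‖x - c i‖ = a from hxi, div_self ha.ne']
    simp
  · intro q hq hqc hqs
    have hgP : ∀ x, gradient P x = -(1 / n : ℝ) • x := by
      intro x
      refine HasGradientAt.gradient ?_
      rw [hasGradientAt_iff_hasFDerivAt]
      have h1 := (((hasFDerivAt_id x).norm_sq.mul_const (2 * (n : ℝ))⁻¹).const_sub M)
      refine HasFDerivAt.congr_fderiv (f := P) h1 ?_
      ext v
      simp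
      ring
    have key := integral_partition_radial (by omega : 1 ≤ n) J c (D := perforated Ω C₀ ε) ha
      (K := A * (n - 2 : ℕ) * a ^ (n - 2))
      (b := (A * (n - 2 : ℕ) * a ^ (n - 2) - a ^ n / n) / a ^ (n - 1))
      (div_mul_cancel₀ _ (by positivity)) hΩ.measurableSet
      (by rw [hD]; simp only [hJ, mem_indexFinset]; rfl)
      (θ := fun j x => Real.smoothTransition (s j x))
      (fun j => Real.smoothTransition.contDiff.comp ((hss j).of_le (by simp)))
      (fun j hj x hx => by
        filter_upwards [(hsc j).continuousAt.eventually_const_lt (hnear j hj x hx)] with y hy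
        exact Real.smoothTransition.one_of_one_le hy.le)
      (fun j hj x hx i hi hij => by
        have hxΩ : x ∈ Ω := hJΩ j hj (by rw [Metric.mem_closedBall, dist_eq_norm]; linarith)
        have hc1 : ContinuousAt (fun y => ‖y - c j‖) x := by fun_prop
        have hlt : (fun y => ‖y - c j‖) x < ε / 2 := by simp only; linarith
        filter_upwards [hΩ.mem_nhds hxΩ, hc1.eventually_lt_const hlt] with y hy hy'
        exact Real.smoothTransition.zero_of_nonpos (hfar i hi y hy (hsep j i y hy' hij)))
      (G := fun j => gradient (b j)) (fun j => (contDiff_gradient (hbs j)).continuous)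
      (fun j x hx => by
        refine ext_inner_right ℝ fun v => ?_
        rw [← fderiv_radialBarrier hn ha hx v, inner_gradient_left])
      hq hqc hqs
    have hσ : ((A * (n - 2 : ℕ) * a ^ (n - 2) - a ^ n / n) / a ^ (n - 1)) *
        ∑ j ∈ J, ∫ x, q x ∂sphereMeasure (c j) a = β * ∫ x, q x ∂surfaceMeasure Ω C₀ ε := by
      rw [integral_surfaceMeasure hfin hq.continuous]
      by_cases hJe : J.Nonempty
      · rw [hβJ hJe]
      · rw [Finset.not_nonempty_iff_eq_empty] at hJe
        rw [← hJ, hJe]; simp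
    rw [hσ] at key
    have hqd := hq.differentiable one_ne_zero
    have hpt := fun x => fderiv_partition J (hPs.differentiable (by simp))
      (fun j => (hbs j).differentiable (by simp)) hqd rampGap x
    simp only [hgP] at hpt
    have i1 : IntegrableOn (fun x => fderiv ℝ q x
        (gradient (fun x => P x - ∑ j ∈ J, ramp (s j x)) x)) (perforated Ω C₀ ε) :=
      (integrable_fderiv_apply hq hqc (contDiff_gradient hψs).continuous).integrableOn
    have i2 : IntegrableOn (fun x => (∑ j ∈ J, deriv Real.smoothTransition (s j x)
        * ‖gradient P x - gradient (b j) x‖ ^ 2) * q x) (perforated Ω C₀ ε) :=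
      ((hκc.mul hq.continuous).integrable_of_hasCompactSupport hqc.mul_left).integrableOn
    have i3 : IntegrableOn q (perforated Ω C₀ ε) :=
      (hq.continuous.integrable_of_hasCompactSupport hqc).integrableOn
    simp only [add_mul, one_mul]
    rw [integral_add i3 i2, add_sub_right_comm, ← key, ← sub_eq_iff_eq_add, ← integral_sub i1 i2]
    refine integral_congr_ae (Eventually.of_forall fun x => ?_)
    simp only [hgP]
    exact sub_eq_iff_eq_add.2 (hpt x)

end Barrier

/-! ### Test functions in `H¹(D, ∂Ω)` -/

section TestFunctions

variable {n : ℕ} {Ω D : Set (E n)}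

theorem norm_sq_L2Pair (p : L2Pair D) : ‖p‖ ^ 2 = ‖p.fst‖ ^ 2 + ‖p.snd‖ ^ 2 :=
  WithLp.prod_norm_sq_eq_of_L2 p

theorem norm_sq_H1V (u : H1V Ω D) : ‖u‖ ^ 2 = ‖H1V.val u‖ ^ 2 + ‖H1V.grad u‖ ^ 2 :=
  norm_sq_L2Pair u.1.1

/-- `u ↦ u` as a continuous linear map from `H¹(D, ∂Ω)` to `L²(D)`. -/
def valL (Ω D : Set (E n)) : H1V Ω D →L[ℝ] Lp ℝ 2 (volume.restrict D) :=
  LinearMap.mkContinuous ⟨⟨H1V.val, fun _ _ => rfl⟩, fun _ _ => rfl⟩ 1 fun u => by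
    rw [one_mul]
    refine le_of_sq_le_sq ?_ (norm_nonneg _)
    rw [norm_sq_H1V]
    exact le_add_of_nonneg_right (sq_nonneg _)

/-- `u ↦ ∇u` as a continuous linear map from `H¹(D, ∂Ω)` to `L²(D; ℝⁿ)`. -/
def gradL (Ω D : Set (E n)) : H1V Ω D →L[ℝ] Lp (E n) 2 (volume.restrict D) :=
  LinearMap.mkContinuous ⟨⟨H1V.grad, fun _ _ => rfl⟩, fun _ _ => rfl⟩ 1 fun u => by
    rw [one_mul]
    refine le_of_sq_le_sq ?_ (norm_nonneg _)
    rw [norm_sq_H1V]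
    exact le_add_of_nonneg_left (sq_nonneg _)

theorem valL_apply (u : H1V Ω D) : valL Ω D u = H1V.val u := rfl

theorem gradL_apply (u : H1V Ω D) : gradL Ω D u = H1V.grad u := rfl

/-- Weak gradients are unique. -/
theorem eq_of_fst_eq (hD : IsOpen D) {p q : H1 D} (h : p.1.fst = q.1.fst) : p = q := by
  have hs : p.1.snd = q.1.snd := by
    have hint : ∀ r : H1 D, LocallyIntegrableOn (r.1.snd : E n → E n) D := fun r =>
      locallyIntegrableOn_of_locallyIntegrable_restrict
        ((Lp.memLp r.1.snd).locallyIntegrable one_le_two)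
    have h0 := hD.ae_eq_zero_of_integral_contDiff_smul_eq_zero ((hint p).sub (hint q))
      fun η hη hc hs => ?_
    · refine Lp.ext ?_
      rw [EventuallyEq, ae_restrict_iff' hD.measurableSet]
      filter_upwards [h0] with x hx hxD
      exact sub_eq_zero.1 (hx hxD)
    · have hη0 : ∀ x, x ∉ D → η x = 0 := fun x hx =>
        image_eq_zero_of_notMem_tsupport fun h => hx (hs h)
      have hI : ∀ r : H1 D, IntegrableOn (fun x => η x • (r.1.snd : E n → E n) x) D := fun r =>
        memLp_one_iff_integrable.1 ((Lp.memLp r.1.snd).smul (memLp_two_of_test D hη hc))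
      rw [← setIntegral_eq_integral_of_forall_compl_eq_zero (s := D)
        fun x hx => by simp [hη0 x hx]]
      simp only [Pi.sub_apply, smul_sub]
      rw [integral_sub (hI p) (hI q), sub_eq_zero]
      refine ext_inner_left ℝ fun e => ?_
      have key : ∀ r : H1 D, inner ℝ e (∫ x in D, η x • (r.1.snd : E n → E n) x)
          = -∫ x in D, (r.1.fst : E n → ℝ) x * fderiv ℝ η x e := by
        intro r
        rw [← integral_inner (hI r) e, r.2 e η hη hc hs, neg_neg]
        refine integral_congr_ae (Eventually.of_forall fun x => ?_)
        simp only [real_inner_smul_right, real_inner_comm, mul_comm]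
      rw [key p, key q, h]
  refine Subtype.ext (WithLp.ofLp_injective 2 (Prod.ext h hs))

/-- The smooth functions with compact support in `Ω`. -/
structure IsTest (Ω : Set (E n)) (φ : E n → ℝ) : Prop where
  contDiff : ContDiff ℝ ∞ φ
  hasCompactSupport : HasCompactSupport φ
  tsupport_subset : tsupport φ ⊆ Ω

theorem IsTest.continuous {φ : E n → ℝ} (h : IsTest Ω φ) : Continuous φ := h.contDiff.continuous

theorem IsTest.continuous_gradient {φ : E n → ℝ} (h : IsTest Ω φ) : Continuous (gradient φ) :=
  (contDiff_gradient h.contDiff).continuous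

theorem IsTest.mul {φ ψ : E n → ℝ} (h : IsTest Ω φ) (hψ : ContDiff ℝ ∞ ψ) :
    IsTest Ω fun x => φ x * ψ x :=
  ⟨h.contDiff.mul hψ, h.hasCompactSupport.mul_right,
    (closure_mono (Function.support_mul_subset_left _ _)).trans h.tsupport_subset⟩

theorem hasCompactSupport_gradient {φ : E n → ℝ} (h : HasCompactSupport φ) :
    HasCompactSupport (gradient φ) :=
  (h.fderiv ℝ).comp_left (g := (InnerProductSpace.toDual ℝ (E n)).symm) (map_zero _)

theorem IsTest.memLp {φ : E n → ℝ} (h : IsTest Ω φ) (μ : Measure (E n))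
    [IsFiniteMeasureOnCompacts μ] : MemLp φ 2 μ :=
  h.continuous.memLp_of_hasCompactSupport h.hasCompactSupport

theorem IsTest.memLp_gradient {φ : E n → ℝ} (h : IsTest Ω φ) (μ : Measure (E n))
    [IsFiniteMeasureOnCompacts μ] : MemLp (gradient φ) 2 μ :=
  h.continuous_gradient.memLp_of_hasCompactSupport
    (hasCompactSupport_gradient h.hasCompactSupport)

theorem IsTest.mem_smoothVanishing (hΩ : IsOpen Ω) {φ : E n → ℝ} (h : IsTest Ω φ) :
    φ ∈ smoothVanishing Ω := by
  refine ⟨h.contDiff, ?_⟩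
  have h1 : (tsupport φ)ᶜ ∈ 𝓝ˢ (frontier Ω) := by
    rw [(isClosed_tsupport φ).isOpen_compl.mem_nhdsSet]
    intro x hx hxs
    rw [hΩ.frontier_eq] at hx
    exact hx.2 (h.tsupport_subset hxs)
  filter_upwards [h1] with x hx using image_eq_zero_of_notMem_tsupport hx

/-- A smooth function vanishing near `∂Ω`, restricted to `Ω` and extended by zero. -/
theorem isTest_indicator (hΩ : IsOpen Ω) (hΩb : Bornology.IsBounded Ω) {φ : E n → ℝ}
    (h : φ ∈ smoothVanishing Ω) : IsTest Ω (Ω.indicator φ) := by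
  obtain ⟨h1, h2⟩ := h
  rw [eventually_nhdsSet_iff_forall] at h2
  have hout : ∀ x, x ∉ Ω → Ω.indicator φ =ᶠ[𝓝 x] 0 := by
    intro x hx
    by_cases hxc : x ∈ closure Ω
    · have hxf : x ∈ frontier Ω := by rw [hΩ.frontier_eq]; exact ⟨hxc, hx⟩
      filter_upwards [h2 x hxf] with y hy
      simp [indicator, hy]
    · filter_upwards [isClosed_closure.isOpen_compl.mem_nhds hxc] with y hy
      exact indicator_of_notMem (fun h => hy (subset_closure h)) _
  have hsub : tsupport (Ω.indicator φ) ⊆ Ω := by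
    intro x hx
    by_contra hxΩ
    exact (notMem_tsupport_iff_eventuallyEq.2 (hout x hxΩ)) hx
  refine ⟨?_, ?_, hsub⟩
  · rw [contDiff_iff_contDiffAt]
    intro x
    by_cases hx : x ∈ Ω
    · refine h1.contDiffAt.congr_of_eventuallyEq ?_
      filter_upwards [hΩ.mem_nhds hx] with y hy using indicator_of_mem hy _
    · exact contDiffAt_const.congr_of_eventuallyEq (hout x hx)
  · exact Metric.isCompact_of_isClosed_isBounded (isClosed_tsupport _) (hΩb.subset hsub)

/-- The element of `H¹(D)` given by a test function. -/
def IsTest.toH1 {φ : E n → ℝ} (h : IsTest Ω φ) (D : Set (E n)) : H1 D :=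
  ⟨WithLp.toLp 2 ((h.memLp (volume.restrict D)).toLp φ,
    (h.memLp_gradient (volume.restrict D)).toLp (gradient φ)), by
    intro e
    refine HasWeakDeriv.congr (f := φ) (g := fun x => fderiv ℝ φ x e)
      (MemLp.coeFn_toLp (h.memLp (volume.restrict D))) ?_ ?_
    · filter_upwards [MemLp.coeFn_toLp (h.memLp_gradient (volume.restrict D))] with x hx
      change inner ℝ ((h.memLp_gradient (volume.restrict D)).toLp (gradient φ) x) e = _
      rw [hx, inner_gradient_left]
    · intro η hη hc hs
      have hη0 : ∀ x, x ∉ D → η x = 0 := fun x hx =>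
        image_eq_zero_of_notMem_tsupport fun h => hx (hs h)
      have hη0' : ∀ x, x ∉ D → fderiv ℝ η x = 0 := fun x hx =>
        image_eq_zero_of_notMem_tsupport fun h => hx (hs (tsupport_fderiv_subset ℝ h))
      rw [setIntegral_eq_integral_of_forall_compl_eq_zero fun x hx => by simp [hη0' x hx],
        setIntegral_eq_integral_of_forall_compl_eq_zero fun x hx => by simp [hη0 x hx]]
      have c1 : Continuous fun x => fderiv ℝ φ x e :=
        (h.contDiff.continuous_fderiv (by simp)).clm_apply continuous_const
      have c2 : Continuous fun x => fderiv ℝ η x e :=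
        (hη.continuous_fderiv (by simp)).clm_apply continuous_const
      refine integral_mul_fderiv_eq_neg_fderiv_mul_of_integrable ?_ ?_ ?_
        (fun x _ => h.contDiff.differentiable (by simp) x)
        (fun x _ => hη.differentiable (by simp) x)
      · exact (c1.mul hη.continuous).integrable_of_hasCompactSupport hc.mul_left
      · exact (h.continuous.mul c2).integrable_of_hasCompactSupport
          h.hasCompactSupport.mul_right
      · exact (h.continuous.mul hη.continuous).integrable_of_hasCompactSupport hc.mul_left⟩

/-- The element of `H¹(D, ∂Ω)` given by a test function. -/
def IsTest.toV {φ : E n → ℝ} (h : IsTest Ω φ) (hΩ : IsOpen Ω) (D : Set (E n)) : H1V Ω D :=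
  ⟨h.toH1 D, (smoothH1 Ω D).le_topologicalClosure
    ⟨φ, h.mem_smoothVanishing hΩ, MemLp.coeFn_toLp (h.memLp (volume.restrict D))⟩⟩

theorem IsTest.val_toV {φ : E n → ℝ} (h : IsTest Ω φ) (hΩ : IsOpen Ω) :
    H1V.val (h.toV hΩ D) = (h.memLp (volume.restrict D)).toLp φ := rfl

theorem IsTest.grad_toV {φ : E n → ℝ} (h : IsTest Ω φ) (hΩ : IsOpen Ω) :
    H1V.grad (h.toV hΩ D) = (h.memLp_gradient (volume.restrict D)).toLp (gradient φ) := rfl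

theorem eq_of_val_eq (hD : IsOpen D) {u v : H1V Ω D} (h : H1V.val u = H1V.val v) : u = v :=
  Subtype.ext (eq_of_fst_eq hD h)

theorem eq_toV_indicator (hΩ : IsOpen Ω) (hΩb : Bornology.IsBounded Ω) (hD : IsOpen D)
    (hDΩ : D ⊆ Ω) {u : H1V Ω D} {φ : E n → ℝ} (hφ : φ ∈ smoothVanishing Ω)
    (hu : (H1V.val u : E n → ℝ) =ᵐ[volume.restrict D] φ) :
    u = (isTest_indicator hΩ hΩb hφ).toV hΩ D := by
  refine eq_of_val_eq hD (Lp.ext (hu.trans ?_))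
  rw [IsTest.val_toV]
  refine EventuallyEq.trans ?_ (MemLp.coeFn_toLp _).symm
  rw [EventuallyEq, ae_restrict_iff' hD.measurableSet]
  exact Eventually.of_forall fun x hx => (indicator_of_mem (hDΩ hx) _).symm

/-- A closed property of elements of `H¹(D, ∂Ω)` need only be checked on test functions. -/
theorem H1V.induction (hΩ : IsOpen Ω) (hΩb : Bornology.IsBounded Ω) (hD : IsOpen D)
    (hDΩ : D ⊆ Ω) {p : H1V Ω D → Prop} (hp : IsClosed {u | p u})
    (h : ∀ φ (hφ : IsTest Ω φ), p (hφ.toV hΩ D)) (u : H1V Ω D) : p u := by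
  have hd : DenseRange (inclusion (smoothH1 Ω D).le_topologicalClosure) :=
    (denseRange_inclusion_iff _).2 subset_rfl
  refine hd.induction_on (p := p) u hp fun v => ?_
  obtain ⟨φ, hφ, hv⟩ := v.2
  have e := eq_toV_indicator hΩ hΩb hD hDΩ hφ
    (u := inclusion (smoothH1 Ω D).le_topologicalClosure v) hv
  exact (congrArg p e).mpr (h _ _)

end TestFunctions

/-! ### The trace operator and two Poincaré inequalities -/

section TraceOperator

variable {n : ℕ} {Ω : Set (E n)} {C₀ ε M b : ℝ} {ψ κ : E n → ℝ}

/-- The standing assumptions on the perforated domain. -/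
structure Admissible (Ω : Set (E n)) (C₀ ε : ℝ) : Prop where
  isOpen : IsOpen Ω
  isBounded : Bornology.IsBounded Ω
  const_pos : 0 < C₀
  pos : 0 < ε
  radius_lt : radius n C₀ ε < ε / 4

namespace Admissible

theorem finite (h : Admissible Ω C₀ ε) : (indices Ω C₀ ε).Finite :=
  finite_indices h.isBounded h.isOpen h.pos h.radius_lt

theorem isOpen_perforated (h : Admissible Ω C₀ ε) : IsOpen (perforated Ω C₀ ε) :=
  DynBC.isOpen_perforated h.isOpen

theorem isFiniteMeasure (h : Admissible Ω C₀ ε) : IsFiniteMeasure (surfaceMeasure Ω C₀ ε) :=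
  isFiniteMeasure_surfaceMeasure h.finite

theorem ae_mem (h : Admissible Ω C₀ ε) : ∀ᵐ x ∂surfaceMeasure Ω C₀ ε, x ∈ Ω := by
  filter_upwards [ae_surfaceMeasure_mem h.finite (radius_pos h.const_pos h.pos).le] with x hx
  obtain ⟨j, hj, hx⟩ := hx
  refine closedBall_center_subset h.isOpen h.pos h.radius_lt hj ?_
  rw [Metric.mem_closedBall, dist_eq_norm, hx]
  linarith [h.radius_lt, h.pos]

theorem memLp (h : Admissible Ω C₀ ε) {φ : E n → ℝ} (hφ : IsTest Ω φ) :
    MemLp φ 2 (surfaceMeasure Ω C₀ ε) := by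
  have := h.isFiniteMeasure
  exact hφ.memLp _

/-- A test function as an element of `H¹(Ω_ε, ∂Ω)`. -/
def toV (h : Admissible Ω C₀ ε) {φ : E n → ℝ} (hφ : IsTest Ω φ) : Vε Ω C₀ ε :=
  hφ.toV h.isOpen _

theorem induction (h : Admissible Ω C₀ ε) {p : Vε Ω C₀ ε → Prop} (hp : IsClosed {u | p u})
    (ht : ∀ φ (hφ : IsTest Ω φ), p (h.toV hφ)) (u : Vε Ω C₀ ε) : p u :=
  H1V.induction h.isOpen h.isBounded h.isOpen_perforated perforated_subset hp ht u

theorem norm_sq_val (h : Admissible Ω C₀ ε) {φ : E n → ℝ} (hφ : IsTest Ω φ) :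
    ‖H1V.val (h.toV hφ)‖ ^ 2 = ∫ x in perforated Ω C₀ ε, φ x ^ 2 := by
  rw [toV, IsTest.val_toV, norm_sq_toLp]
  simp only [Real.norm_eq_abs, sq_abs]

theorem norm_sq_grad (h : Admissible Ω C₀ ε) {φ : E n → ℝ} (hφ : IsTest Ω φ) :
    ‖H1V.grad (h.toV hφ)‖ ^ 2 = ∫ x in perforated Ω C₀ ε, ‖gradient φ x‖ ^ 2 := by
  rw [toV, IsTest.grad_toV, norm_sq_toLp]

theorem norm_sq_surface (h : Admissible Ω C₀ ε) {φ : E n → ℝ} (hφ : IsTest Ω φ) :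
    ‖(h.memLp hφ).toLp φ‖ ^ 2 = ∫ x, φ x ^ 2 ∂surfaceMeasure Ω C₀ ε := by
  rw [norm_sq_toLp]
  simp only [Real.norm_eq_abs, sq_abs]

end Admissible

theorem IsTest.integrable_mul {φ g : E n → ℝ} (hφ : IsTest Ω φ) (hg : Continuous g)
    (μ : Measure (E n)) [IsFiniteMeasureOnCompacts μ] : Integrable (fun x => φ x * g x) μ :=
  (hφ.continuous.mul hg).integrable_of_hasCompactSupport hφ.hasCompactSupport.mul_right

theorem IsTest.integrable_sq {φ : E n → ℝ} (hφ : IsTest Ω φ)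
    (μ : Measure (E n)) [IsFiniteMeasureOnCompacts μ] : Integrable (fun x => φ x ^ 2) μ := by
  simpa only [pow_two] using hφ.integrable_mul hφ.continuous μ

theorem IsTest.integrable_norm_gradient_sq {φ : E n → ℝ} (hφ : IsTest Ω φ)
    (μ : Measure (E n)) [IsFiniteMeasureOnCompacts μ] :
    Integrable (fun x => ‖gradient φ x‖ ^ 2) μ :=
  integrable_norm_sq (hφ.memLp_gradient μ)

theorem gradient_mul {f g : E n → ℝ} {x : E n} (hf : DifferentiableAt ℝ f x)
    (hg : DifferentiableAt ℝ g x) :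
    gradient (fun y => f y * g y) x = f x • gradient g x + g x • gradient f x := by
  refine HasGradientAt.gradient ?_
  rw [hasGradientAt_iff_hasFDerivAt, map_add, map_smul, map_smul]
  exact hf.hasGradientAt.hasFDerivAt.fun_mul hg.hasGradientAt.hasFDerivAt

theorem fderiv_apply_eq_inner {f : E n → ℝ} (x v : E n) :
    fderiv ℝ f x v = inner ℝ (gradient f x) v := (inner_gradient_left ..).symm

/-- The barrier identity for the square of a test function. -/
theorem IsBarrier.integral_sq (hB : IsBarrier Ω C₀ ε M b ψ κ) {φ : E n → ℝ}
    (hφ : IsTest Ω φ) :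
    ∫ x in perforated Ω C₀ ε, 2 * (φ x * inner ℝ (gradient φ x) (gradient ψ x))
      = (∫ x in perforated Ω C₀ ε, (1 + κ x) * φ x ^ 2)
        - b * ∫ x, φ x ^ 2 ∂surfaceMeasure Ω C₀ ε := by
  have hq : IsTest Ω fun x => φ x * φ x := hφ.mul hφ.contDiff
  have k := hB.integral_eq _ (hq.contDiff.of_le (by simp)) hq.hasCompactSupport hq.tsupport_subset
  simp only [← pow_two] at k
  rw [← k]
  refine integral_congr_ae (Eventually.of_forall fun x => ?_)
  have hd := (hφ.contDiff.differentiable (by simp)) x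
  have e : gradient (fun y => φ y ^ 2) x = φ x • gradient φ x + φ x • gradient φ x := by
    rw [← gradient_mul hd hd]; simp only [pow_two]
  simp only [fderiv_apply_eq_inner, e, inner_add_left, real_inner_smul_left]
  ring

theorem IsBarrier.exists_bound (h : Admissible Ω C₀ ε) (hB : IsBarrier Ω C₀ ε M b ψ κ) :
    ∃ L : ℝ, 0 ≤ L ∧ ∀ x ∈ perforated Ω C₀ ε, κ x ≤ L ∧ ‖gradient ψ x‖ ≤ L := by
  have hc : IsCompact (closure Ω) := h.isBounded.isCompact_closure
  obtain ⟨L₁, h₁⟩ := hc.exists_bound_of_continuousOn hB.continuous.continuousOn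
  obtain ⟨L₂, h₂⟩ := hc.exists_bound_of_continuousOn
    (contDiff_gradient hB.contDiff).continuous.continuousOn
  refine ⟨max 0 (max L₁ L₂), le_max_left _ _, fun x hx => ?_⟩
  have hx' := subset_closure (perforated_subset hx)
  exact ⟨(le_abs_self _).trans ((h₁ x hx').trans ((le_max_left _ _).trans (le_max_right _ _))),
    (h₂ x hx').trans ((le_max_right _ _).trans (le_max_right _ _))⟩

/-- The trace inequality for test functions, from the barrier identity for `φ²`. Its constant may
depend on `ε`; it is only needed to have a trace operator. -/
theorem IsBarrier.exists_trace_bound (h : Admissible Ω C₀ ε) (hB : IsBarrier Ω C₀ ε M b ψ κ) :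
    ∃ C : ℝ, 0 ≤ C ∧ ∀ φ (hφ : IsTest Ω φ), ‖(h.memLp hφ).toLp φ‖ ^ 2 ≤ C * ‖h.toV hφ‖ ^ 2 := by
  obtain ⟨L, hL, hLb⟩ := hB.exists_bound h
  refine ⟨(1 + 2 * L) / b, div_nonneg (by linarith) hB.flux_pos.le, fun φ hφ => ?_⟩
  rw [norm_sq_H1V, h.norm_sq_val hφ, h.norm_sq_grad hφ, h.norm_sq_surface hφ, div_mul_eq_mul_div,
    le_div_iff₀ hB.flux_pos, mul_comm _ b]
  have k := hB.integral_sq hφ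
  have i1 := hφ.integrable_sq (volume.restrict (perforated Ω C₀ ε))
  have i2 := hφ.integrable_norm_gradient_sq (volume.restrict (perforated Ω C₀ ε))
  have i3 : Integrable (fun x => (1 + κ x) * φ x ^ 2) (volume.restrict (perforated Ω C₀ ε)) := by
    have := hφ.integrable_mul ((continuous_const.add hB.continuous).mul hφ.continuous)
      (volume.restrict (perforated Ω C₀ ε)) (g := fun x => (1 + κ x) * φ x)
    refine this.congr (Eventually.of_forall fun x => ?_)
    simp only; ring
  have i4 : Integrable (fun x => 2 * (φ x * inner ℝ (gradient φ x) (gradient ψ x)))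
      (volume.restrict (perforated Ω C₀ ε)) :=
    (hφ.integrable_mul (hφ.continuous_gradient.inner
      (contDiff_gradient hB.contDiff).continuous) _).const_mul 2
  have e : b * ∫ x, φ x ^ 2 ∂surfaceMeasure Ω C₀ ε = ∫ x in perforated Ω C₀ ε,
      ((1 + κ x) * φ x ^ 2 - 2 * (φ x * inner ℝ (gradient φ x) (gradient ψ x))) := by
    rw [integral_sub i3 i4, k]; ring
  rw [e, ← integral_add i1 i2, ← integral_const_mul]
  refine setIntegral_mono_on (i3.sub i4) ((i1.add i2).const_mul _)
    h.isOpen_perforated.measurableSet fun x hx => ?_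
  obtain ⟨h1, h2⟩ := hLb x hx
  have h4 : |φ x * inner ℝ (gradient φ x) (gradient ψ x)| ≤ |φ x| * (‖gradient φ x‖ * L) := by
    rw [abs_mul]
    gcongr
    exact (abs_real_inner_le_norm _ _).trans (by gcongr)
  have h5 := (abs_le.1 h4).1
  have h6 : (1 + κ x) * φ x ^ 2 ≤ (1 + L) * φ x ^ 2 := by gcongr
  have h7 : 2 * (|φ x| * (‖gradient φ x‖ * L)) ≤ L * (φ x ^ 2 + ‖gradient φ x‖ ^ 2) := by
    nlinarith [mul_nonneg hL (sq_nonneg (|φ x| - ‖gradient φ x‖)), sq_abs (φ x)]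
  nlinarith [mul_nonneg hL (sq_nonneg ‖gradient φ x‖)]

end TraceOperator

section Completeness

variable {n : ℕ} {Ω D : Set (E n)}

theorem L2Pair.continuous_fst : Continuous (L2Pair.fst : L2Pair D → Lp ℝ 2 (volume.restrict D)) :=
  (LinearMap.mkContinuous (E := L2Pair D) ⟨⟨L2Pair.fst, fun _ _ => rfl⟩, fun _ _ => rfl⟩ 1
    fun u => by
      rw [one_mul]
      refine le_of_sq_le_sq ?_ (norm_nonneg _)
      rw [norm_sq_L2Pair]
      exact le_add_of_nonneg_right (sq_nonneg _) :
    L2Pair D →L[ℝ] Lp ℝ 2 (volume.restrict D)).continuous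

theorem L2Pair.continuous_snd :
    Continuous (L2Pair.snd : L2Pair D → Lp (E n) 2 (volume.restrict D)) :=
  (LinearMap.mkContinuous (E := L2Pair D) ⟨⟨L2Pair.snd, fun _ _ => rfl⟩, fun _ _ => rfl⟩ 1
    fun u => by
      rw [one_mul]
      refine le_of_sq_le_sq ?_ (norm_nonneg _)
      rw [norm_sq_L2Pair]
      exact le_add_of_nonneg_left (sq_nonneg _) :
    L2Pair D →L[ℝ] Lp (E n) 2 (volume.restrict D)).continuous

theorem isClosed_H1 : IsClosed (H1 D : Set (L2Pair D)) := by
  have e : (H1 D : Set (L2Pair D)) = ⋂ (e : E n) (η : E n → ℝ) (_ : ContDiff ℝ ∞ η)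
      (_ : HasCompactSupport η) (_ : tsupport η ⊆ D), {p : L2Pair D |
        ∫ z in D, p.fst z * fderiv ℝ η z e = -∫ z in D, inner ℝ (p.snd z) e * η z} := by
    ext p
    simp only [mem_iInter, mem_ofPred_eq]
    rfl
  rw [e]
  refine isClosed_iInter fun e => isClosed_iInter fun η => isClosed_iInter fun hη =>
    isClosed_iInter fun hc => isClosed_iInter fun _ => ?_
  have h1 : ∀ p : L2Pair D, ∫ z in D, p.fst z * fderiv ℝ η z e
      = inner ℝ ((memLp_two_fderiv D e hη hc).toLp _) p.fst := by
    intro p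
    rw [L2.inner_def]
    refine integral_congr_ae ?_
    filter_upwards [(memLp_two_fderiv D e hη hc).coeFn_toLp] with x hx
    rw [hx]; rfl
  have hm : MemLp (fun x => η x • e) 2 (volume.restrict D) := by
    have hc' : HasCompactSupport fun x => η x • e := hc.smul_right
    exact ((hη.continuous.smul continuous_const).memLp_of_hasCompactSupport hc').restrict D
  have h2 : ∀ p : L2Pair D, ∫ z in D, inner ℝ (p.snd z) e * η z
      = inner ℝ p.snd (hm.toLp _) := by
    intro p
    rw [L2.inner_def]
    refine integral_congr_ae ?_
    filter_upwards [hm.coeFn_toLp] with x hx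
    rw [hx, real_inner_smul_right, mul_comm]
  simp only [h1, h2]
  exact isClosed_eq (continuous_const.inner L2Pair.continuous_fst)
    (L2Pair.continuous_snd.inner continuous_const).neg

instance completeSpace_H1 : CompleteSpace (H1 D) := isClosed_H1.completeSpace_coe

instance completeSpace_H1V : CompleteSpace (H1V Ω D) :=
  (Submodule.isClosed_topologicalClosure _).completeSpace_coe

end Completeness

section TraceOperator

variable {n : ℕ} {Ω : Set (E n)} {C₀ ε M b : ℝ} {ψ κ : E n → ℝ}

theorem Admissible.smooth_mem (h : Admissible Ω C₀ ε) {φ : E n → ℝ} (hφ : IsTest Ω φ) :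
    (h.toV hφ, (h.memLp hφ).toLp φ) ∈ traceGraph Ω (perforated Ω C₀ ε) (surfaceMeasure Ω C₀ ε) :=
  (smoothTraceGraph _ _ _).le_topologicalClosure
    ⟨φ, hφ.mem_smoothVanishing h.isOpen, MemLp.coeFn_toLp (hφ.memLp _),
      MemLp.coeFn_toLp (h.memLp hφ)⟩

/-- The trace inequality on the closure of the graph, which makes that closure a graph. -/
theorem IsBarrier.exists_traceGraph_bound (h : Admissible Ω C₀ ε)
    (hB : IsBarrier Ω C₀ ε M b ψ κ) : ∃ C : ℝ, 0 ≤ C ∧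
      ∀ p ∈ traceGraph Ω (perforated Ω C₀ ε) (surfaceMeasure Ω C₀ ε), ‖p.2‖ ≤ C * ‖p.1‖ := by
  obtain ⟨C, hC, hCb⟩ := hB.exists_trace_bound h
  refine ⟨√C, Real.sqrt_nonneg _, fun p hp => ?_⟩
  refine closure_minimal (t := {p : Vε Ω C₀ ε × Lp ℝ 2 (surfaceMeasure Ω C₀ ε) |
    ‖p.2‖ ≤ √C * ‖p.1‖}) ?_ (isClosed_le (by fun_prop) (by fun_prop)) hp
  rintro ⟨u, v⟩ ⟨φ, hφ, hu, hv⟩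
  have hind := isTest_indicator h.isOpen h.isBounded hφ
  have e1 : u = h.toV hind :=
    eq_toV_indicator h.isOpen h.isBounded h.isOpen_perforated perforated_subset hφ hu
  have e2 : v = (h.memLp hind).toLp _ := by
    refine Lp.ext (hv.trans (EventuallyEq.trans ?_ (MemLp.coeFn_toLp _).symm))
    filter_upwards [h.ae_mem] with x hx using (indicator_of_mem hx _).symm
  have := Real.sqrt_le_sqrt (hCb _ hind)
  rw [Real.sqrt_mul hC, Real.sqrt_sq (norm_nonneg _), Real.sqrt_sq (norm_nonneg _)] at this
  change ‖v‖ ≤ √C * ‖u‖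
  rw [e1, e2]
  exact this

/-- Every function has a trace: by the trace inequality the projection of the trace graph to
`H¹(Ω_ε, ∂Ω)` has closed range, and the range contains the test functions. -/
theorem IsBarrier.exists_mem_traceGraph (h : Admissible Ω C₀ ε)
    (hB : IsBarrier Ω C₀ ε M b ψ κ) (u : Vε Ω C₀ ε) :
    ∃ v, (u, v) ∈ traceGraph Ω (perforated Ω C₀ ε) (surfaceMeasure Ω C₀ ε) := by
  obtain ⟨C, hC, hCb⟩ := hB.exists_traceGraph_bound h
  set G := traceGraph Ω (perforated Ω C₀ ε) (surfaceMeasure Ω C₀ ε) with hG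
  have hGc : CompleteSpace G := (Submodule.isClosed_topologicalClosure _).completeSpace_coe
  let f : G →ₗ[ℝ] Vε Ω C₀ ε := (LinearMap.fst ℝ _ _).comp G.subtype
  have hf : UniformContinuous f :=
    uniformContinuous_fst.comp uniformContinuous_subtype_val
  have ha : AntilipschitzWith (Real.toNNReal (1 + C)) f := by
    refine AddMonoidHomClass.antilipschitz_of_bound f fun p => ?_
    rw [Real.coe_toNNReal _ (by linarith)]
    have h1 : ‖p‖ = max ‖p.1.1‖ ‖p.1.2‖ := rfl
    have h2 := hCb p.1 p.2
    have h3 : f p = p.1.1 := rfl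
    rw [h1, h3]
    have h4 := norm_nonneg p.1.1
    refine max_le ?_ ?_ <;> nlinarith [mul_nonneg hC h4]
  refine h.induction (p := fun u => ∃ v, (u, v) ∈ G) ?_ (fun φ hφ => ⟨_, h.smooth_mem hφ⟩) u
  have : {u : Vε Ω C₀ ε | ∃ v, (u, v) ∈ G} = range f := by
    ext u
    constructor
    · rintro ⟨v, hv⟩; exact ⟨⟨(u, v), hv⟩, rfl⟩
    · rintro ⟨⟨⟨u', v⟩, hp⟩, rfl⟩; exact ⟨v, hp⟩
  rw [this]
  exact ha.isClosed_range hf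

theorem IsBarrier.mem_traceGraph (h : Admissible Ω C₀ ε)
    (hB : IsBarrier Ω C₀ ε M b ψ κ) (u : Vε Ω C₀ ε) :
    (u, tr u) ∈ traceGraph Ω (perforated Ω C₀ ε) (surfaceMeasure Ω C₀ ε) := by
  have he := hB.exists_mem_traceGraph h u
  rw [tr, trace, dif_pos he]
  exact he.choose_spec

theorem IsBarrier.tr_eq (h : Admissible Ω C₀ ε) (hB : IsBarrier Ω C₀ ε M b ψ κ)
    {u : Vε Ω C₀ ε} {v : Lp ℝ 2 (surfaceMeasure Ω C₀ ε)}
    (hv : (u, v) ∈ traceGraph Ω (perforated Ω C₀ ε) (surfaceMeasure Ω C₀ ε)) : tr u = v := by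
  obtain ⟨C, hC, hCb⟩ := hB.exists_traceGraph_bound h
  have h1 := hCb _ (sub_mem (hB.mem_traceGraph h u) hv)
  simp only [Prod.fst_sub, Prod.snd_sub, sub_self, norm_zero, mul_zero] at h1
  exact sub_eq_zero.1 (norm_le_zero_iff.1 h1)

theorem IsBarrier.tr_add (h : Admissible Ω C₀ ε) (hB : IsBarrier Ω C₀ ε M b ψ κ)
    (u v : Vε Ω C₀ ε) : tr (u + v) = tr u + tr v := by
  have := add_mem (hB.mem_traceGraph h u) (hB.mem_traceGraph h v)
  rw [Prod.mk_add_mk] at this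
  exact hB.tr_eq h this

theorem IsBarrier.tr_smul (h : Admissible Ω C₀ ε) (hB : IsBarrier Ω C₀ ε M b ψ κ) (c : ℝ)
    (u : Vε Ω C₀ ε) : tr (c • u) = c • tr u := by
  have := Submodule.smul_mem _ c (hB.mem_traceGraph h u)
  rw [Prod.smul_mk] at this
  exact hB.tr_eq h this

/-- The trace operator as a continuous linear map. -/
def IsBarrier.traceL (h : Admissible Ω C₀ ε) (hB : IsBarrier Ω C₀ ε M b ψ κ) :
    Vε Ω C₀ ε →L[ℝ] Lp ℝ 2 (surfaceMeasure Ω C₀ ε) :=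
  LinearMap.mkContinuous ⟨⟨tr, hB.tr_add h⟩, hB.tr_smul h⟩
    (hB.exists_traceGraph_bound h).choose
    fun u => (hB.exists_traceGraph_bound h).choose_spec.2 (u, tr u) (hB.mem_traceGraph h u)

theorem IsBarrier.traceL_apply (h : Admissible Ω C₀ ε) (hB : IsBarrier Ω C₀ ε M b ψ κ)
    (u : Vε Ω C₀ ε) : hB.traceL h u = tr u := rfl

theorem IsBarrier.tr_toV (h : Admissible Ω C₀ ε) (hB : IsBarrier Ω C₀ ε M b ψ κ)
    {φ : E n → ℝ} (hφ : IsTest Ω φ) : tr (h.toV hφ) = (h.memLp hφ).toLp φ :=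
  hB.tr_eq h (h.smooth_mem hφ)

theorem IsBarrier.mem_traceKer (h : Admissible Ω C₀ ε) (hB : IsBarrier Ω C₀ ε M b ψ κ)
    {u : Vε Ω C₀ ε} :
    u ∈ traceKer Ω (perforated Ω C₀ ε) (surfaceMeasure Ω C₀ ε) ↔ tr u = 0 :=
  ⟨fun hu => hB.tr_eq h hu, fun hu => by
    have := hB.mem_traceGraph h u
    rw [hu] at this
    exact this⟩

/-- **Poincaré inequality**, uniform in `ε`: it follows from the barrier identity with the test
function `φ² exp (-ψ)`. -/
theorem IsBarrier.norm_sq_val_le (h : Admissible Ω C₀ ε) (hB : IsBarrier Ω C₀ ε M b ψ κ)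
    (u : Vε Ω C₀ ε) :
    ‖H1V.val u‖ ^ 2 ≤ Real.exp M * (‖H1V.grad u‖ ^ 2 + b * ‖tr u‖ ^ 2) := by
  refine h.induction (p := fun u => ‖H1V.val u‖ ^ 2 ≤
    Real.exp M * (‖H1V.grad u‖ ^ 2 + b * ‖tr u‖ ^ 2)) ?_ (fun φ hφ => ?_) u
  · have c1 := (valL Ω (perforated Ω C₀ ε)).continuous
    have c2 := (gradL Ω (perforated Ω C₀ ε)).continuous
    have c3 := (hB.traceL h).continuous
    exact isClosed_le (c1.norm.pow 2)
      (continuous_const.mul ((c2.norm.pow 2).add (continuous_const.mul (c3.norm.pow 2))))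
  rw [hB.tr_toV h hφ, h.norm_sq_val hφ, h.norm_sq_grad hφ, h.norm_sq_surface hφ]
  have hψe : ContDiff ℝ ∞ fun x => Real.exp (-ψ x) := hB.contDiff.neg.exp
  have hsq : IsTest Ω fun x => φ x * φ x := hφ.mul hφ.contDiff
  have hq := hsq.mul hψe
  have k := hB.integral_eq _ (hq.contDiff.of_le (by simp)) hq.hasCompactSupport hq.tsupport_subset
  have hgr : ∀ x, gradient (fun x => φ x * φ x * Real.exp (-ψ x)) x
      = Real.exp (-ψ x) • ((2 * φ x) • gradient φ x - φ x ^ 2 • gradient ψ x) := by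
    intro x
    have hd := (hφ.contDiff.differentiable (by simp)) x
    have hψd := (hB.contDiff.differentiable (by simp)) x
    have e1 : gradient (fun x => Real.exp (-ψ x)) x = -(Real.exp (-ψ x) • gradient ψ x) := by
      refine HasGradientAt.gradient ?_
      rw [hasGradientAt_iff_hasFDerivAt, map_neg, map_smul, ← smul_neg]
      exact hψd.hasGradientAt.hasFDerivAt.neg.exp
    rw [gradient_mul (hsq.contDiff.differentiable (by simp) x)
      (hψe.differentiable (by simp) x), gradient_mul hd hd, e1]
    module
  simp only [fderiv_apply_eq_inner, hgr] at k
  have hσ : ∫ x, φ x * φ x * Real.exp (-ψ x) ∂surfaceMeasure Ω C₀ ε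
      = ∫ x, φ x ^ 2 ∂surfaceMeasure Ω C₀ ε := by
    refine integral_congr_ae ?_
    filter_upwards [hB.ae_eq_zero] with x hx
    rw [hx]; simp [pow_two]
  rw [hσ] at k
  have i1 := hφ.integrable_sq (volume.restrict (perforated Ω C₀ ε))
  have i2 := hφ.integrable_norm_gradient_sq (volume.restrict (perforated Ω C₀ ε))
  have i3 : Integrable (fun x => (1 + κ x) * (φ x * φ x * Real.exp (-ψ x)))
      (volume.restrict (perforated Ω C₀ ε)) := by
    refine (hq.integrable_mul (continuous_const.add hB.continuous) _
      (g := fun x => 1 + κ x)).congr (Eventually.of_forall fun x => ?_)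
    simp only; ring
  have i4 : Integrable (fun x => inner ℝ (Real.exp (-ψ x) • ((2 * φ x) • gradient φ x
      - φ x ^ 2 • gradient ψ x)) (gradient ψ x)) (volume.restrict (perforated Ω C₀ ε)) := by
    refine Integrable.congr (integrable_fderiv_apply (hq.contDiff.of_le (by simp))
      hq.hasCompactSupport (contDiff_gradient hB.contDiff).continuous).integrableOn
      (Eventually.of_forall fun x => ?_)
    simp only [fderiv_apply_eq_inner, hgr]
  have e : b * ∫ x, φ x ^ 2 ∂surfaceMeasure Ω C₀ ε = ∫ x in perforated Ω C₀ ε,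
      ((1 + κ x) * (φ x * φ x * Real.exp (-ψ x)) - inner ℝ (Real.exp (-ψ x) •
        ((2 * φ x) • gradient φ x - φ x ^ 2 • gradient ψ x)) (gradient ψ x)) := by
    rw [integral_sub i3 i4, k]; ring
  have i5 : Integrable (fun x => (1 + κ x) * (φ x * φ x * Real.exp (-ψ x)) - inner ℝ
      (Real.exp (-ψ x) • ((2 * φ x) • gradient φ x - φ x ^ 2 • gradient ψ x)) (gradient ψ x))
      (volume.restrict (perforated Ω C₀ ε)) := i3.sub i4
  rw [e, ← integral_add i2 i5, ← integral_const_mul]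
  refine setIntegral_mono_on i1 ((i2.add i5).const_mul _)
    h.isOpen_perforated.measurableSet fun x hx => ?_
  have h1 : Real.exp (-ψ x) ≤ 1 := Real.exp_le_one_iff.2 (neg_nonpos.2 (hB.nonneg x hx))
  have h2 : 1 ≤ Real.exp M * Real.exp (-ψ x) := by
    rw [← Real.exp_add]; exact Real.one_le_exp (by linarith [hB.le x hx])
  have h3 : ‖gradient φ x - φ x • gradient ψ x‖ ^ 2 = ‖gradient φ x‖ ^ 2
      - 2 * (φ x * inner ℝ (gradient φ x) (gradient ψ x))
      + φ x ^ 2 * ‖gradient ψ x‖ ^ 2 := by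
    rw [norm_sub_sq_real, real_inner_smul_right, norm_smul, mul_pow, Real.norm_eq_abs, sq_abs]
  simp only [real_inner_smul_left, inner_sub_left, real_inner_self_eq_norm_sq]
  have hκ := hB.nonneg_source x
  -- the difference of the two sides is the sum of the nonnegative terms `h5`, `h6`, `h7`
  have h4 : Real.exp (-ψ x) * φ x ^ 2 ≤ ‖gradient φ x‖ ^ 2 +
      ((1 + κ x) * (φ x * φ x * Real.exp (-ψ x)) - Real.exp (-ψ x) *
        (2 * φ x * inner ℝ (gradient φ x) (gradient ψ x) - φ x ^ 2 * ‖gradient ψ x‖ ^ 2)) := by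
    have h5 : 0 ≤ (1 - Real.exp (-ψ x)) * ‖gradient φ x‖ ^ 2 :=
      mul_nonneg (by linarith) (sq_nonneg _)
    have h6 : 0 ≤ κ x * (Real.exp (-ψ x) * φ x ^ 2) := by positivity
    have h7 : 0 ≤ Real.exp (-ψ x) * ‖gradient φ x - φ x • gradient ψ x‖ ^ 2 := by positivity
    rw [h3] at h7
    nlinarith
  calc φ x ^ 2 ≤ Real.exp M * (Real.exp (-ψ x) * φ x ^ 2) := by
        rw [← mul_assoc]; exact le_mul_of_one_le_left (sq_nonneg _) h2
    _ ≤ _ := by gcongr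

/-- An `L²` estimate for the equation `-Δv = F` with prescribed trace, uniform in `ε`: it follows
from the barrier identity with the test function `v²` and the weak equation tested with `v ψ`. -/
theorem IsBarrier.norm_sq_val_le_of_forall_traceKer (h : Admissible Ω C₀ ε) (hM : 0 ≤ M)
    (hB : IsBarrier Ω C₀ ε M b ψ κ) (v : Vε Ω C₀ ε)
    (F : Lp ℝ 2 (volume.restrict (perforated Ω C₀ ε)))
    (hv : ∀ φ ∈ traceKer Ω (perforated Ω C₀ ε) (surfaceMeasure Ω C₀ ε),
      inner ℝ (H1V.grad v) (H1V.grad φ) = inner ℝ F (H1V.val φ)) :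
    ‖H1V.val v‖ ^ 2 ≤ 2 * b * ‖tr v‖ ^ 2 + 4 * M ^ 2 * ‖F‖ ^ 2 := by
  obtain ⟨L, hL, hLb⟩ := hB.exists_bound h
  have hb := hB.flux_pos
  set K := M + L with hK
  -- `v ψ` is defined for test functions only; the last term is the error from replacing `v` by `w`
  have key : ∀ w : Vε Ω C₀ ε, ‖H1V.val w‖ ^ 2 / 2 - b / 2 * ‖tr w‖ ^ 2
      ≤ M * ‖F‖ * ‖H1V.val w‖ + ‖H1V.grad v - H1V.grad w‖ * (K * ‖w‖) := by
    intro w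
    refine h.induction (p := fun w => ‖H1V.val w‖ ^ 2 / 2 - b / 2 * ‖tr w‖ ^ 2
      ≤ M * ‖F‖ * ‖H1V.val w‖ + ‖H1V.grad v - H1V.grad w‖ * (K * ‖w‖)) ?_ (fun φ hφ => ?_) w
    · have c1 := (valL Ω (perforated Ω C₀ ε)).continuous
      have c2 := (gradL Ω (perforated Ω C₀ ε)).continuous
      have c3 := (hB.traceL h).continuous
      exact isClosed_le (((c1.norm.pow 2).div_const 2).sub (continuous_const.mul (c3.norm.pow 2)))
        ((continuous_const.mul c1.norm).add ((continuous_const.sub c2).norm.mul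
          (continuous_const.mul continuous_norm)))
    have hDm : MeasurableSet (perforated Ω C₀ ε) := h.isOpen_perforated.measurableSet
    have hφψ : IsTest Ω fun x => φ x * ψ x := hφ.mul hB.contDiff
    have hgr : ∀ x, gradient (fun x => φ x * ψ x) x = φ x • gradient ψ x + ψ x • gradient φ x :=
      fun x => gradient_mul (hφ.contDiff.differentiable (by simp) x)
        (hB.contDiff.differentiable (by simp) x)
    have hker : h.toV hφψ ∈ traceKer Ω (perforated Ω C₀ ε) (surfaceMeasure Ω C₀ ε) := by
      rw [hB.mem_traceKer h, hB.tr_toV h]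
      refine Lp.ext ((MemLp.coeFn_toLp _).trans (EventuallyEq.trans ?_ (Lp.coeFn_zero _ _ _).symm))
      filter_upwards [hB.ae_eq_zero] with x hx
      rw [hx, mul_zero, Pi.zero_apply]
    have hw := hv _ hker
    have i1 := hφ.integrable_sq (volume.restrict (perforated Ω C₀ ε))
    have i2 := hφ.integrable_norm_gradient_sq (volume.restrict (perforated Ω C₀ ε))
    have hcψ := (contDiff_gradient hB.contDiff).continuous
    have i3 : Integrable (fun x => 2 * (φ x * inner ℝ (gradient φ x) (gradient ψ x)))
        (volume.restrict (perforated Ω C₀ ε)) :=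
      (hφ.integrable_mul (hφ.continuous_gradient.inner hcψ) _).const_mul 2
    have i4 : Integrable (fun x => (1 + κ x) * φ x ^ 2) (volume.restrict (perforated Ω C₀ ε)) := by
      refine (hφ.integrable_mul ((continuous_const.add hB.continuous).mul hφ.continuous)
        (volume.restrict (perforated Ω C₀ ε)) (g := fun x => (1 + κ x) * φ x)).congr
        (Eventually.of_forall fun x => ?_)
      simp only; ring
    have i5 : Integrable (fun x => inner ℝ (gradient φ x) (gradient (fun x => φ x * ψ x) x))
        (volume.restrict (perforated Ω C₀ ε)) :=
      integrable_inner (hφ.memLp_gradient _) (hφψ.memLp_gradient _)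
    -- `∇φ · ∇(φ ψ) ≥ φ ∇φ · ∇ψ`, and the latter is half of the integrand of `integral_sq`
    have m1 : ‖H1V.val (h.toV hφ)‖ ^ 2 / 2 - b / 2 * ‖tr (h.toV hφ)‖ ^ 2
        ≤ inner ℝ (H1V.grad (h.toV hφ)) (H1V.grad (h.toV hφψ)) := by
      have k := hB.integral_sq hφ
      have k1 : ∫ x in perforated Ω C₀ ε, φ x ^ 2 ≤ ∫ x in perforated Ω C₀ ε, (1 + κ x) * φ x ^ 2 :=
        integral_mono i1 i4 fun x => le_mul_of_one_le_left (sq_nonneg _)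
          (by linarith [hB.nonneg_source x])
      have k2 : ∫ x in perforated Ω C₀ ε, 2 * (φ x * inner ℝ (gradient φ x) (gradient ψ x))
          ≤ 2 * ∫ x in perforated Ω C₀ ε, inner ℝ (gradient φ x) (gradient (fun x => φ x * ψ x) x) := by
        rw [← integral_const_mul]
        refine setIntegral_mono_on i3 (i5.const_mul 2) hDm fun x hx => ?_
        rw [hgr, inner_add_right, real_inner_smul_right, real_inner_smul_right,
          real_inner_self_eq_norm_sq]
        nlinarith [mul_nonneg (hB.nonneg x hx) (sq_nonneg ‖gradient φ x‖)]
      rw [h.norm_sq_val hφ, hB.tr_toV h hφ, h.norm_sq_surface hφ, Admissible.toV, Admissible.toV,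
        IsTest.grad_toV, IsTest.grad_toV, inner_toLp]
      linarith
    have m2 : ‖H1V.val (h.toV hφψ)‖ ≤ M * ‖H1V.val (h.toV hφ)‖ := by
      refine le_of_sq_le_sq ?_ (by positivity)
      rw [mul_pow, h.norm_sq_val hφ, h.norm_sq_val hφψ, ← integral_const_mul]
      refine setIntegral_mono_on (hφψ.integrable_sq _) (i1.const_mul _) hDm fun x hx => ?_
      have := pow_le_pow_left₀ (hB.nonneg x hx) (hB.le x hx) 2
      rw [mul_pow, mul_comm]
      gcongr
    have m3 : ‖H1V.grad (h.toV hφψ)‖ ≤ K * ‖h.toV hφ‖ := by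
      refine le_of_sq_le_sq ?_ (by positivity)
      rw [mul_pow, norm_sq_H1V, h.norm_sq_val hφ, h.norm_sq_grad hφ, h.norm_sq_grad hφψ,
        ← integral_add i1 i2, ← integral_const_mul]
      refine setIntegral_mono_on (hφψ.integrable_norm_gradient_sq _) ((i1.add i2).const_mul _) hDm
        fun x hx => ?_
      have n1 : ‖gradient (fun x => φ x * ψ x) x‖ ≤ L * |φ x| + M * ‖gradient φ x‖ := by
        rw [hgr]
        refine (norm_add_le _ _).trans ?_
        rw [norm_smul, norm_smul, Real.norm_eq_abs, Real.norm_of_nonneg (hB.nonneg x hx), mul_comm]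
        gcongr
        · exact (hLb x hx).2
        · exact hB.le x hx
      have n2 := pow_le_pow_left₀ (norm_nonneg _) n1 2
      refine n2.trans ?_
      rw [← sq_abs (φ x), hK]
      nlinarith [sq_nonneg (L * ‖gradient φ x‖ - M * |φ x|), mul_nonneg hM hL,
        mul_nonneg (mul_nonneg hM hL) (add_nonneg (sq_nonneg |φ x|) (sq_nonneg ‖gradient φ x‖))]
    have m4 := abs_le.1 (abs_real_inner_le_norm
      (H1V.grad v - H1V.grad (h.toV hφ)) (H1V.grad (h.toV hφψ)))
    have m5 := abs_le.1 (abs_real_inner_le_norm F (H1V.val (h.toV hφψ)))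
    rw [inner_sub_left, hw] at m4
    have m6 : ‖H1V.grad v - H1V.grad (h.toV hφ)‖ * ‖H1V.grad (h.toV hφψ)‖
        ≤ ‖H1V.grad v - H1V.grad (h.toV hφ)‖ * (K * ‖h.toV hφ‖) := by gcongr
    have m7 : ‖F‖ * ‖H1V.val (h.toV hφψ)‖ ≤ ‖F‖ * (M * ‖H1V.val (h.toV hφ)‖) := by gcongr
    linarith [m4.1, m5.2]
  have := key v
  rw [sub_self, norm_zero, zero_mul, add_zero] at this
  nlinarith [sq_nonneg (‖H1V.val v‖ / 2 - M * ‖F‖)]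

end TraceOperator

/-! ### The evolution problem in the energy norm -/

section EnergyEvolution

variable {V W B Y : Type*} [NormedAddCommGroup V] [InnerProductSpace ℝ V]
  [NormedAddCommGroup W] [InnerProductSpace ℝ W] [NormedAddCommGroup B] [InnerProductSpace ℝ B]
  [NormedAddCommGroup Y] [InnerProductSpace ℝ Y] {T : ℝ}

/-- `exists_evolution` for the energy form `⟨k u, k φ⟩`, with bounds in terms of that form only. -/
theorem exists_evolution_energy [CompleteSpace V] [CompleteSpace W] [CompleteSpace B]
    (k : V →L[ℝ] W) {c : ℝ}
    (hk : ∀ v, ‖v‖ ≤ c * ‖k v‖)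
    (m : V →L[ℝ] B) (hT : 0 < T) (ℓ : Lp V 2 (timeMeasure T) →L[ℝ] ℝ) {M : ℝ} (hM : 0 ≤ M)
    (hℓ : ∀ w : C(ℝ, V), |ℓ (contToLp V T (mulWeight V T w))| ≤
      M * √((∫ t in Ioo 0 T, ‖m (w t)‖ ^ 2) + ‖k (prim w T)‖ ^ 2
        + ∫ t in Ioo 0 T, ‖k (prim w t)‖ ^ 2)) :
    ∃ (u : Lp V 2 (timeMeasure T)) (p : Lp B 2 (timeMeasure T)),
      (∀ᵐ t ∂timeMeasure T, m (u t) = prim p t) ∧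
      (∀ φ : Lp V 2 (timeMeasure T), (∫ t in Ioo 0 T, inner ℝ (p t) (m (φ t)))
        + (∫ t in Ioo 0 T, inner ℝ (k (u t)) (k (φ t))) = ℓ φ) ∧
      (∫ t in Ioo 0 T, ‖k (u t)‖ ^ 2) ≤ (2 * M) ^ 2 ∧ ‖p‖ ≤ 2 * M := by
  have hanti : AntilipschitzWith (Real.toNNReal c) k := by
    refine AddMonoidHomClass.antilipschitz_of_bound k fun v => (hk v).trans ?_
    gcongr
    exact Real.le_coe_toNNReal c
  have hcl : IsClosed (range k) := hanti.isClosed_range k.uniformContinuous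
  let e := k.equivRange hanti.injective hcl
  let i : k.range →L[ℝ] V := e.symm.toContinuousLinearMap
  have hR : CompleteSpace k.range := hcl.completeSpace_coe
  have hki : ∀ r : k.range, k (i r) = r := fun r => by
    have : e (e.symm r) = r := e.apply_symm_apply r
    exact congrArg Subtype.val this
  have hie : ∀ v, i (e v) = v := fun v => e.symm_apply_apply v
  let iL : Lp k.range 2 (timeMeasure T) →L[ℝ] Lp V 2 (timeMeasure T) := i.compLpL 2 _
  have hiL : ∀ u, iL u =ᵐ[timeMeasure T] fun t => i (u t) := fun u =>
    ContinuousLinearMap.coeFn_compLpL i u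
  let eL : Lp V 2 (timeMeasure T) →L[ℝ] Lp k.range 2 (timeMeasure T) :=
    (e : V →L[ℝ] k.range).compLpL 2 _
  have heL : ∀ u, eL u =ᵐ[timeMeasure T] fun t => e (u t) := fun u =>
    ContinuousLinearMap.coeFn_compLpL (e : V →L[ℝ] k.range) u
  obtain ⟨u, p, h1, h2, h3, h4⟩ := exists_evolution (m.comp i) hT (ℓ.comp iL) hM fun w => by
    have e1 : iL (contToLp k.range T (mulWeight k.range T w))
        = contToLp V T (mulWeight V T ((⟨i, i.continuous⟩ : C(k.range, V)).comp w)) := by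
      refine Lp.ext ((hiL _).trans ?_)
      filter_upwards [coeFn_contToLp T (mulWeight k.range T w), coeFn_contToLp T (mulWeight V T
        ((⟨i, i.continuous⟩ : C(k.range, V)).comp w))] with t h1 h2
      rw [h1, h2, mulWeight_apply, mulWeight_apply, map_smul]
      rfl
    have hwi : Integrable w (timeMeasure T) :=
      (memLp_of_continuousOn w.continuous.continuousOn 1).integrable le_rfl
    have e2 : ∀ t ∈ Icc 0 T, prim ((⟨i, i.continuous⟩ : C(k.range, V)).comp w) t
        = i (prim w t) := fun t ht => (clm_prim i ht hwi).symm
    have h := hℓ ((⟨i, i.continuous⟩ : C(k.range, V)).comp w)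
    rw [← e1, e2 T (right_mem_Icc.2 hT.le), hki, setIntegral_congr_fun (s := Ioo 0 T)
      (f := fun t => ‖k (prim ((⟨i, i.continuous⟩ : C(k.range, V)).comp w) t)‖ ^ 2)
      (g := fun t => ‖prim w t‖ ^ 2) measurableSet_Ioo fun t ht => by
        simp only [e2 t (Ioo_subset_Icc_self ht), hki]; rfl] at h
    exact h
  refine ⟨iL u, p, ?_, fun φ => ?_, ?_, h4⟩
  · filter_upwards [h1, hiL u] with t k1 k2
    rw [k2]; exact k1
  · have e3 : iL (eL φ) = φ := by
      refine Lp.ext ((hiL _).trans ?_)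
      filter_upwards [heL φ] with t ht
      rw [ht]; exact hie _
    have k0 := h2 (eL φ)
    rw [ContinuousLinearMap.comp_apply, e3] at k0
    rw [← k0]
    congr 1
    · refine integral_congr_ae ?_
      filter_upwards [heL φ] with t ht
      rw [ht, ContinuousLinearMap.comp_apply, hie]
    · refine integral_congr_ae ?_
      filter_upwards [heL φ, hiL u] with t ht ht'
      rw [ht, ht', hki]; rfl
  · have e4 : ∫ t in Ioo 0 T, ‖k (iL u t)‖ ^ 2 = ‖u‖ ^ 2 := by
      rw [norm_sq_Lp]
      refine integral_congr_ae ?_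
      filter_upwards [hiL u] with t ht'
      rw [ht', hki]; rfl
    rw [e4]
    gcongr

/-- The functional `φ ↦ ∫ ⟨H(t), κ φ(t)⟩ dt`. -/
def curveFunctional (κ : V →L[ℝ] Y) (H : Lp Y 2 (timeMeasure T)) :
    Lp V 2 (timeMeasure T) →L[ℝ] ℝ := (innerSL ℝ H).comp (κ.compLpL 2 (timeMeasure T))

theorem curveFunctional_apply (κ : V →L[ℝ] Y) (H : Lp Y 2 (timeMeasure T))
    (φ : Lp V 2 (timeMeasure T)) :
    curveFunctional κ H φ = ∫ t in Ioo 0 T, inner ℝ (H t) (κ (φ t)) := by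
  rw [curveFunctional, ContinuousLinearMap.comp_apply, innerSL_apply_apply, L2.inner_def]
  refine integral_congr_ae ?_
  filter_upwards [ContinuousLinearMap.coeFn_compLpL κ φ] with t ht
  rw [ht]

theorem curveFunctional_weight (κ : V →L[ℝ] Y) (H : Lp Y 2 (timeMeasure T)) (w : C(ℝ, V)) :
    curveFunctional κ H (contToLp V T (mulWeight V T w))
      = ∫ t in Ioo 0 T, (1 + T - t) * inner ℝ (H t) (κ (w t)) := by
  rw [curveFunctional_apply]
  refine integral_congr_ae ?_
  filter_upwards [coeFn_contToLp T (mulWeight V T w), ae_restrict_mem measurableSet_Ioo] with t ht h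
  have : weight T t = 1 + T - t := by
    change 1 + |T - t| = _
    rw [abs_of_pos (by linarith [h.2])]; ring
  rw [ht, mulWeight_apply, map_smul, real_inner_smul_right, this]

/-- The direct bound for the functional given by `H`, without integration by parts. -/
theorem abs_curveFunctional_weight_le (hT : 0 < T) (κ : V →L[ℝ] Y) (H : Lp Y 2 (timeMeasure T))
    (w : C(ℝ, V)) : |curveFunctional κ H (contToLp V T (mulWeight V T w))|
      ≤ (1 + T) * ‖H‖ * √(∫ t in Ioo 0 T, ‖κ (w t)‖ ^ 2) := by
  have hw : MemLp (fun t => κ (w t)) 2 (timeMeasure T) :=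
    memLp_of_continuousOn (κ.continuous.comp w.continuous).continuousOn 2
  have hω : MemLp (fun t => (1 + T - t) • H t) 2 (timeMeasure T) := by
    refine MemLp.of_le_mul (c := 1 + T) (Lp.memLp H)
      ((by fun_prop : Continuous fun t : ℝ => 1 + T - t).aestronglyMeasurable.smul
        (Lp.aestronglyMeasurable H)) ?_
    filter_upwards [ae_restrict_mem measurableSet_Ioo] with t ht
    rw [norm_smul, Real.norm_of_nonneg (by linarith [ht.2])]
    gcongr
    linarith [ht.1]
  have h1 := abs_integral_inner_le hω hw
  have h2 : √(∫ t in Ioo 0 T, ‖(1 + T - t) • H t‖ ^ 2) ≤ (1 + T) * ‖H‖ := by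
    rw [Real.sqrt_le_left (by positivity), mul_pow, norm_sq_Lp, ← integral_const_mul]
    refine setIntegral_mono_on (integrable_norm_sq hω)
      ((integrable_norm_sq (Lp.memLp H)).const_mul _) measurableSet_Ioo fun t ht => ?_
    rw [norm_smul, Real.norm_of_nonneg (by linarith [ht.2]), mul_pow]
    gcongr
    · linarith [ht.2]
    · linarith [ht.1]
  rw [curveFunctional_weight]
  simp only [real_inner_smul_left] at h1
  exact h1.trans (by gcongr)

/-- The constant in `abs_curveFunctional_weight_le_of_deriv`. -/
def timeConst (T : ℝ) : ℝ := (1 + √T) * (1 / √T + 2 * √T) + (1 + T)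

theorem timeConst_pos (hT : 0 < T) : 0 < timeConst T := by
  rw [timeConst]; positivity

/-- If `H` has a square-integrable derivative, then integration by parts bounds the functional
given by `H` in terms of the primitive of the argument. -/
theorem abs_curveFunctional_weight_le_of_deriv [CompleteSpace V] [CompleteSpace Y]
    (hT : 0 < T) (κ : V →L[ℝ] Y)
    {H H' : Lp Y 2 (timeMeasure T)} {c : Y} (hc : ∀ᵐ t ∂timeMeasure T, H t = c + prim H' t)
    (w : C(ℝ, V)) : |curveFunctional κ H (contToLp V T (mulWeight V T w))|
      ≤ timeConst T * (‖H‖ + ‖H'‖) *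
        √(‖κ (prim w T)‖ ^ 2 + ∫ t in Ioo 0 T, ‖κ (prim w t)‖ ^ 2) := by
  let q : ℝ → Y := fun t => κ (w t)
  have hqc : Continuous q := κ.continuous.comp w.continuous
  have hq : MemLp q 2 (timeMeasure T) := memLp_of_continuousOn hqc.continuousOn 2
  have hqi : Integrable q (timeMeasure T) := hq.integrable one_le_two
  have hwi : Integrable w (timeMeasure T) :=
    (memLp_of_continuousOn w.continuous.continuousOn 1).integrable le_rfl
  have hH' : Integrable H' (timeMeasure T) := (Lp.memLp H').integrable one_le_two
  have hJ : MemLp (prim q) 2 (timeMeasure T) := memLp_prim hT.le hqi 2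
  have e0 : ∀ t ∈ Icc 0 T, κ (prim w t) = prim q t := fun t ht => clm_prim κ ht hwi
  rw [curveFunctional_weight, e0 T (right_mem_Icc.2 hT.le), setIntegral_congr_fun (s := Ioo 0 T)
      (f := fun t => ‖κ (prim w t)‖ ^ 2) (g := fun t => ‖prim q t‖ ^ 2) measurableSet_Ioo
      fun t ht => by simp only [e0 t (Ioo_subset_Icc_self ht)]]
  set R := √(∫ t in Ioo 0 T, ‖prim q t‖ ^ 2) with hR
  set S := √(‖prim q T‖ ^ 2 + ∫ t in Ioo 0 T, ‖prim q t‖ ^ 2) with hS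
  have hint0 : 0 ≤ ∫ t in Ioo 0 T, ‖prim q t‖ ^ 2 := integral_nonneg fun _ => sq_nonneg _
  have hRS : R ≤ S := Real.sqrt_le_sqrt (le_add_of_nonneg_left (sq_nonneg _))
  have hTS : ‖prim q T‖ ≤ S := Real.le_sqrt_of_sq_le (le_add_of_nonneg_right hint0)
  have hR0 : 0 ≤ R := Real.sqrt_nonneg _
  let f : ℝ → ℝ := fun t => inner ℝ (H t) (q t)
  have hf : Integrable f (timeMeasure T) := integrable_inner (Lp.memLp H) hq
  have hPf : Integrable (prim f) (timeMeasure T) := integrable_prim hT.le hf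
  -- `∫ (1 + T - t) f = F(T) + ∫ F` for the primitive `F` of `f`
  have e1 : ∫ t in Ioo 0 T, (1 + T - t) * f t = prim f T + ∫ t in Ioo 0 T, prim f t := by
    have hone : Integrable (fun _ : ℝ => (1 : ℝ)) (timeMeasure T) := integrable_const _
    have k := integral_bilin_prim (ContinuousLinearMap.mul ℝ ℝ) hT.le hone hf
    have hp1 : ∀ t, prim (fun _ : ℝ => (1 : ℝ)) t = t := fun t => by simp [prim]
    simp only [ContinuousLinearMap.mul_apply', one_mul, hp1] at k
    have hid : Integrable (fun t => t * f t) (timeMeasure T) := by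
      refine hf.bdd_mul (c := T) continuous_id.aestronglyMeasurable ?_
      filter_upwards [ae_restrict_mem measurableSet_Ioo] with t ht
      rw [Real.norm_of_nonneg ht.1.le]; exact ht.2.le
    have e : ∫ t in Ioo 0 T, (1 + T - t) * f t
        = (1 + T) * (∫ t in Ioo 0 T, f t) - ∫ t in Ioo 0 T, t * f t := by
      rw [← integral_const_mul, ← integral_sub (hf.const_mul _) hid]
      refine integral_congr_ae (Eventually.of_forall fun t => ?_)
      simp only; ring
    rw [e, ← prim_eq_setIntegral f hT.le]
    linarith
  set N := ‖c‖ + √T * ‖H'‖ with hN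
  have hN0 : 0 ≤ N := by positivity
  have hH'n : ∫ t in Ioo 0 T, ‖H' t‖ ≤ √T * ‖H'‖ := by
    have := integral_norm_le_sqrt (Lp.memLp H')
    rwa [timeMeasure_real_univ hT.le, ← norm_sq_Lp, Real.sqrt_sq (norm_nonneg _)] at this
  have e2 : ∀ t ∈ Icc 0 T, |prim f t| ≤ N * ‖prim q t‖ + ‖H'‖ * R := by
    intro t ht
    have hH't : Integrable H' (timeMeasure t) := integrable_Ioo_mono ht.2 hH'
    have hqt : Integrable q (timeMeasure t) := integrable_Ioo_mono ht.2 hqi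
    have k := integral_bilin_prim (innerSL ℝ (E := Y)) ht.1 hH't hqt
    change (∫ s in Ioo 0 t, inner ℝ (prim H' s) (q s)) + (∫ s in Ioo 0 t, inner ℝ (H' s) (prim q s))
      = inner ℝ (prim H' t) (prim q t) at k
    have hqt2 : MemLp q 2 (timeMeasure t) := memLp_of_continuousOn hqc.continuousOn 2
    have i1 : Integrable (fun s => inner ℝ c (q s)) (timeMeasure t) :=
      integrable_inner (memLp_const c) hqt2
    have i2 : Integrable (fun s => inner ℝ (prim H' s) (q s)) (timeMeasure t) :=
      integrable_inner (memLp_prim ht.1 hH't 2) hqt2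
    have e3 : prim f t = inner ℝ (c + prim H' t) (prim q t)
        - ∫ s in Ioo 0 t, inner ℝ (H' s) (prim q s) := by
      rw [inner_add_left, ← k, prim_eq_setIntegral f ht.1, prim_eq_setIntegral q ht.1,
        ← integral_inner hqt, add_sub_assoc, add_sub_cancel_right, ← integral_add i1 i2]
      refine integral_congr_ae ?_
      filter_upwards [ae_restrict_of_ae_restrict_of_subset (Ioo_subset_Ioo_right ht.2) hc]
        with s hs
      simp only [f, hs, inner_add_left]
    have b1 : |∫ s in Ioo 0 t, inner ℝ (H' s) (prim q s)| ≤ ‖H'‖ * R := by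
      have hm : Integrable (fun s => ‖H' s‖ * ‖prim q s‖) (timeMeasure T) :=
        integrable_inner (Lp.memLp H').norm hJ.norm |>.congr
          (Eventually.of_forall fun s => by simp [mul_comm])
      have hm2 := abs_integral_inner_le (Lp.memLp H').norm hJ.norm
      simp only [norm_norm] at hm2
      rw [← norm_sq_Lp, Real.sqrt_sq (norm_nonneg _)] at hm2
      refine (abs_integral_le_integral_abs).trans (le_trans ?_ ((le_abs_self _).trans hm2))
      refine le_trans ?_ (setIntegral_mono_set (s := Ioo 0 t) ?_ (Eventually.of_forall fun s => ?_)
        (Ioo_subset_Ioo_right ht.2).eventuallyLE)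
      · refine integral_mono_of_nonneg (Eventually.of_forall fun s => abs_nonneg _) ?_
          (Eventually.of_forall fun s => ?_)
        · refine (integrable_Ioo_mono ht.2 hm).congr (Eventually.of_forall fun s => ?_)
          simp [mul_comm]
        · simp only
          refine (abs_real_inner_le_norm _ _).trans (le_of_eq ?_)
          simp [mul_comm]
      · refine hm.congr (Eventually.of_forall fun s => ?_)
        simp [mul_comm]
      · simp only [RCLike.inner_apply, Pi.zero_apply, conj_trivial]; positivity
    have b2 : ‖c + prim H' t‖ ≤ N :=
      (norm_add_le _ _).trans (by rw [hN]; gcongr; exact (norm_prim_le ht hH').trans hH'n)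
    rw [e3]
    refine (abs_sub _ _).trans (add_le_add ((abs_real_inner_le_norm _ _).trans ?_) b1)
    gcongr
  have hJ1 : ∫ t in Ioo 0 T, ‖prim q t‖ ≤ √T * R := by
    have := integral_norm_le_sqrt hJ
    rwa [timeMeasure_real_univ hT.le] at this
  have e4 : |∫ t in Ioo 0 T, prim f t| ≤ N * (√T * R) + T * (‖H'‖ * R) := by
    have i1 : Integrable (fun t => N * ‖prim q t‖) (timeMeasure T) :=
      (hJ.integrable one_le_two).norm.const_mul _
    have i2 : Integrable (fun _ : ℝ => ‖H'‖ * R) (timeMeasure T) := integrable_const _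
    refine abs_integral_le_integral_abs.trans ((setIntegral_mono_on hPf.abs (i1.add i2)
      measurableSet_Ioo fun t ht => e2 t (Ioo_subset_Icc_self ht)).trans ?_)
    simp only [Pi.add_apply]
    rw [integral_add i1 i2, integral_const_mul, integral_const, measureReal_restrict_apply_univ,
      Real.volume_real_Ioo_of_le hT.le, sub_zero, smul_eq_mul]
    gcongr
  have hNle : N ≤ (1 / √T + 2 * √T) * (‖H‖ + ‖H'‖) := by
    have k := norm_const_le_of_ae_eq hT ((Lp.memLp H).integrable one_le_two) hH' hc
    have hHn := integral_norm_le_sqrt (Lp.memLp H)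
    rw [timeMeasure_real_univ hT.le, ← norm_sq_Lp, Real.sqrt_sq (norm_nonneg _)] at hHn
    have hsT : 0 < √T := Real.sqrt_pos.2 hT
    have hTT : √T * √T = T := Real.mul_self_sqrt hT.le
    have k1 : ‖c‖ ≤ 1 / √T * ‖H‖ + √T * ‖H'‖ := by
      have k2 : T * ‖c‖ ≤ √T * ‖H‖ + T * (√T * ‖H'‖) := k.trans (by gcongr)
      have k3 : T * (1 / √T * ‖H‖ + √T * ‖H'‖) = √T * ‖H‖ + T * (√T * ‖H'‖) := by
        rw [mul_add, ← mul_assoc, mul_one_div, Real.div_sqrt]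
      exact le_of_mul_le_mul_left (k2.trans_eq k3.symm) hT
    rw [hN]
    have k4 : 0 ≤ 1 / √T * ‖H'‖ + 2 * √T * ‖H‖ := by positivity
    linarith
  calc |∫ t in Ioo 0 T, (1 + T - t) * inner ℝ (H t) (κ (w t))|
      = |prim f T + ∫ t in Ioo 0 T, prim f t| := congrArg _ e1
    _ ≤ (N * ‖prim q T‖ + ‖H'‖ * R) + (N * (√T * R) + T * (‖H'‖ * R)) :=
        (abs_add_le _ _).trans (add_le_add (e2 T (right_mem_Icc.2 hT.le)) e4)
    _ ≤ (N * S + ‖H'‖ * S) + (N * (√T * S) + T * (‖H'‖ * S)) := by gcongr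
    _ = ((1 + √T) * N + (1 + T) * ‖H'‖) * S := by ring
    _ ≤ ((1 + √T) * ((1 / √T + 2 * √T) * (‖H‖ + ‖H'‖)) + (1 + T) * (‖H‖ + ‖H'‖)) * S := by
        gcongr
        linarith [norm_nonneg H]
    _ = timeConst T * (‖H‖ + ‖H'‖) * S := by rw [timeConst]; ring

end EnergyEvolution

/-! ### Weak derivatives in space-time -/

section SpaceTime

variable {n : ℕ} {D Ω : Set (E n)} {T : ℝ}

theorem restrict_cylinder (D : Set (E n)) (T : ℝ) :
    (volume : Measure (E n × ℝ)).restrict (cylinder D T)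
      = (volume.restrict D).prod (timeMeasure T) := by
  rw [cylinder, Measure.volume_eq_prod, Measure.prod_restrict]

theorem setIntegral_cylinder {f : E n × ℝ → ℝ}
    (hf : Integrable f ((volume.restrict D).prod (timeMeasure T))) :
    ∫ z in cylinder D T, f z = ∫ t in Ioo 0 T, ∫ x in D, f (x, t) := by
  rw [restrict_cylinder, integral_prod_symm f hf]

/-- The time slices of a test function on the cylinder are test functions. -/
theorem slice_test {η : E n × ℝ → ℝ} (hη : ContDiff ℝ ∞ η) (hc : HasCompactSupport η)
    (hs : tsupport η ⊆ cylinder D T) (t : ℝ) :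
    ContDiff ℝ ∞ (fun x => η (x, t)) ∧ HasCompactSupport (fun x => η (x, t)) ∧
      tsupport (fun x => η (x, t)) ⊆ D := by
  have hsub : tsupport (fun x => η (x, t)) ⊆ (fun x => (x, t)) ⁻¹' tsupport η :=
    tsupport_comp_subset_preimage η (by fun_prop : Continuous fun x : E n => (x, t))
  refine ⟨by fun_prop, ?_, fun x hx => (hs (hsub hx)).1⟩
  refine HasCompactSupport.of_support_subset_isCompact (hc.isCompact.image continuous_fst)
    fun x hx => ⟨(x, t), subset_tsupport _ hx, rfl⟩

theorem fderiv_slice {η : E n × ℝ → ℝ} (hη : ContDiff ℝ ∞ η) (x e : E n) (t : ℝ) :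
    fderiv ℝ (fun x => η (x, t)) x e = fderiv ℝ η (x, t) (e, 0) := by
  have h1 : HasFDerivAt (fun x : E n => (x, t)) (ContinuousLinearMap.inl ℝ (E n) ℝ) x :=
    hasFDerivAt_prodMk_left x t
  have h2 := ((hη.differentiable (by simp)) (x, t)).hasFDerivAt.comp x h1
  rw [show (fun x => η (x, t)) = η ∘ fun x => (x, t) from rfl, h2.fderiv]
  simp

theorem hasDerivAt_slice {η : E n × ℝ → ℝ} (hη : ContDiff ℝ ∞ η) (x : E n) (t : ℝ) :
    HasDerivAt (fun t => η (x, t)) (fderiv ℝ η (x, t) (0, 1)) t := by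
  have h1 : HasDerivAt (fun t : ℝ => (x, t)) ((0 : E n), (1 : ℝ)) t :=
    (hasDerivAt_const t x).prodMk (hasDerivAt_id t)
  exact ((hη.differentiable (by simp)) (x, t)).hasFDerivAt.comp_hasDerivAt t h1

theorem memLp_test_prod {η : E n × ℝ → ℝ} (hη : ContDiff ℝ ∞ η) (hc : HasCompactSupport η) :
    MemLp η 2 ((volume.restrict D).prod (timeMeasure T)) := by
  rw [← restrict_cylinder]; exact memLp_two_of_test _ hη hc

theorem memLp_fderiv_test_prod {η : E n × ℝ → ℝ} (hη : ContDiff ℝ ∞ η)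
    (hc : HasCompactSupport η) (v : E n × ℝ) :
    MemLp (fun z => fderiv ℝ η z v) 2 ((volume.restrict D).prod (timeMeasure T)) := by
  rw [← restrict_cylinder]; exact memLp_two_fderiv _ v hη hc

theorem integrable_mul_prod {X : Type*} [MeasurableSpace X] {μ : Measure X} {f g : X → ℝ}
    (hf : MemLp f 2 μ) (hg : MemLp g 2 μ) : Integrable (fun z => f z * g z) μ :=
  hf.integrable_mul hg

/-- The spatial weak gradient of a curve in `H¹(D, ∂Ω)`, regarded as a function on the
cylinder. -/
theorem hasWeakDeriv_space_jointLp (v : Lp (H1V Ω D) 2 (timeMeasure T)) (e : E n) :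
    HasWeakDeriv (cylinder D T) (e, (0 : ℝ))
      (jointLp ℝ (volume.restrict D) (timeMeasure T) ((valL Ω D).compLp v))
      (fun z => inner ℝ (jointLp (E n) (volume.restrict D) (timeMeasure T)
        ((gradL Ω D).compLp v) z) e) := by
  intro η hη hc hs
  rw [setIntegral_cylinder (integrable_mul_prod (Lp.memLp _) (memLp_fderiv_test_prod hη hc _)),
    setIntegral_cylinder (integrable_mul_prod ((Lp.memLp _).inner_const (𝕜 := ℝ) e)
      (memLp_test_prod hη hc)), ← integral_neg]
  refine integral_congr_ae ?_
  filter_upwards [isJoint_jointLp ((valL Ω D).compLp v), isJoint_jointLp ((gradL Ω D).compLp v),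
    (valL Ω D).coeFn_compLp v, (gradL Ω D).coeFn_compLp v] with t h1 h2 h3 h4
  obtain ⟨k1, k2, k3⟩ := slice_test hη hc hs t
  have k : ∫ x in D, H1V.val (v t) x * fderiv ℝ (fun x => η (x, t)) x e
      = -∫ x in D, inner ℝ (H1V.grad (v t) x) e * η (x, t) := (v t).1.2 e _ k1 k2 k3
  have h3' : ((valL Ω D).compLp v t : E n → ℝ) = H1V.val (v t) :=
    congrArg (fun f : Lp ℝ 2 (volume.restrict D) => (f : E n → ℝ)) h3
  have h4' : ((gradL Ω D).compLp v t : E n → E n) = H1V.grad (v t) :=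
    congrArg (fun f : Lp (E n) 2 (volume.restrict D) => (f : E n → E n)) h4
  have e1 : ∫ x in D, jointLp ℝ (volume.restrict D) (timeMeasure T) ((valL Ω D).compLp v) (x, t) *
      fderiv ℝ η (x, t) (e, 0) = ∫ x in D, H1V.val (v t) x * fderiv ℝ (fun x => η (x, t)) x e := by
    refine integral_congr_ae ?_
    filter_upwards [h1] with x hx
    simp only [hx, h3', fderiv_slice hη]
  have e2 : ∫ x in D, inner ℝ (jointLp (E n) (volume.restrict D) (timeMeasure T)
        ((gradL Ω D).compLp v) (x, t)) e * η (x, t)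
      = ∫ x in D, inner ℝ (H1V.grad (v t) x) e * η (x, t) := by
    refine integral_congr_ae ?_
    filter_upwards [h2] with x hx
    simp only [hx, h4']
  exact e1.trans (k.trans (congrArg Neg.neg e2.symm))

/-- A test function on the cylinder, as a curve in `L²(D)`, is the primitive of its time
derivative. -/
theorem prim_curveOf_test (hDb : Bornology.IsBounded D) {η : E n × ℝ → ℝ} (hη : ContDiff ℝ ∞ η)
    (hc : HasCompactSupport η) (hs : tsupport η ⊆ cylinder D T) {t : ℝ} (ht : t ∈ Icc 0 T) :
    (prim (curveOf (memLp_fderiv_test_prod (D := D) (T := T) hη hc (0, 1)) :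
      ℝ → Lp ℝ 2 (volume.restrict D)) t : Lp ℝ 2 (volume.restrict D))
      =ᵐ[volume.restrict D] fun x => η (x, t) := by
  set q := curveOf (memLp_fderiv_test_prod (D := D) (T := T) hη hc (0, 1)) with hq
  have hqi : Integrable q (timeMeasure T) := (Lp.memLp q).integrable one_le_two
  have hslice : MemLp (fun x => η (x, t)) 2 (volume.restrict D) :=
    memLp_two_of_test _ (slice_test hη hc hs t).1 (slice_test hη hc hs t).2.1
  have hfin : IsFiniteMeasure ((volume : Measure (E n)).restrict D) :=
    ⟨by rw [Measure.restrict_apply_univ]; exact hDb.measure_lt_top⟩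
  have key : prim q t = hslice.toLp _ := by
    refine ext_inner_right ℝ fun φ => ?_
    have hφ : Integrable φ (volume.restrict D) := (Lp.memLp φ).integrable one_le_two
    -- the indicator of `(0, t)` times `φ`, as a curve
    have hu : MemLp (fun s => (Ioo 0 t).indicator (fun _ => φ) s) 2 (timeMeasure T) :=
      (memLp_const φ).indicator measurableSet_Ioo
    have k := integral_inner_curveOf (memLp_fderiv_test_prod (D := D) (T := T) hη hc (0, 1))
      (hu.toLp _)
    rw [← hq] at k
    have hI : ∀ g : ℝ → ℝ, ∫ s in Ioo 0 T, (Ioo 0 t).indicator g s = ∫ s in Ioo 0 t, g s :=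
      fun g => by
        rw [setIntegral_indicator measurableSet_Ioo,
          inter_eq_right.2 (Ioo_subset_Ioo_right ht.2)]
    have e1 : ∫ s in Ioo 0 T, inner ℝ (q s) (hu.toLp _ s) = inner ℝ (prim q t) φ := by
      rw [prim_eq_setIntegral q ht.1, real_inner_comm,
        ← integral_inner (integrable_Ioo_mono ht.2 hqi), ← hI]
      refine integral_congr_ae ?_
      filter_upwards [hu.coeFn_toLp] with s hs
      rw [hs]
      by_cases h : s ∈ Ioo 0 t
      · simp only [indicator_of_mem h, real_inner_comm]
      · simp only [indicator_of_notMem h, inner_zero_right]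
    have e2 : ∫ s in Ioo 0 T, ∫ x in D, inner ℝ (fderiv ℝ η (x, s) (0, 1)) (hu.toLp _ s x)
        = ∫ s in Ioo 0 t, ∫ x in D, fderiv ℝ η (x, s) (0, 1) * φ x := by
      rw [← hI]
      refine integral_congr_ae ?_
      filter_upwards [hu.coeFn_toLp] with s hs
      rw [hs]
      by_cases h : s ∈ Ioo 0 t
      · simp only [indicator_of_mem h]
        refine integral_congr_ae (Eventually.of_forall fun x => ?_)
        simp [mul_comm]
      · simp only [indicator_of_notMem h]
        refine (integral_congr_ae (g := fun _ => (0 : ℝ)) ?_).trans (by simp)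
        filter_upwards [Lp.coeFn_zero ℝ 2 (volume.restrict D)] with x hx
        rw [hx]; simp
    have hint : Integrable (fun z : E n × ℝ => fderiv ℝ η z (0, 1) * φ z.1)
        ((volume.restrict D).prod (timeMeasure t)) :=
      integrable_mul_prod (memLp_fderiv_test_prod hη hc _) ((Lp.memLp φ).comp_fst _)
    have e3 : ∫ s in Ioo 0 t, ∫ x in D, fderiv ℝ η (x, s) (0, 1) * φ x
        = ∫ x in D, η (x, t) * φ x := by
      rw [← integral_prod_symm _ hint, integral_prod _ hint]
      refine integral_congr_ae (Eventually.of_forall fun x => ?_)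
      have hη0 : η (x, 0) = 0 := image_eq_zero_of_notMem_tsupport fun h => (hs h).2.1.false
      have hcont : Continuous fun s => fderiv ℝ η (x, s) (0, 1) :=
        ((hη.continuous_fderiv (by simp)).comp (by fun_prop)).clm_apply continuous_const
      have k := intervalIntegral.integral_eq_sub_of_hasDerivAt (a := 0) (b := t)
        (fun s _ => hasDerivAt_slice hη x s) (hcont.intervalIntegrable _ _)
      rw [hη0, sub_zero, intervalIntegral.integral_of_le ht.1, integral_Ioc_eq_integral_Ioo] at k
      simp only
      rw [integral_mul_const, k]
    rw [← e1, k, e2, e3, L2.inner_def]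
    refine integral_congr_ae ?_
    filter_upwards [hslice.coeFn_toLp] with x hx
    rw [hx]
    simp [mul_comm]
  rw [key]
  exact hslice.coeFn_toLp

end SpaceTime

section IntegrationByParts

variable {H : Type*} [NormedAddCommGroup H] [InnerProductSpace ℝ H] [CompleteSpace H] {T : ℝ}

theorem integral_inner_of_ae_eq_const_add_prim (hT : 0 < T) {y d q : ℝ → H} {c : H}
    (hd : MemLp d 2 (timeMeasure T)) (hq : MemLp q 2 (timeMeasure T))
    (hc : ∀ᵐ t ∂timeMeasure T, y t = c + prim d t) (hqT : prim q T = 0) :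
    ∫ t in Ioo 0 T, inner ℝ (y t) (q t) = -∫ t in Ioo 0 T, inner ℝ (d t) (prim q t) := by
  have hdi : Integrable d (timeMeasure T) := hd.integrable one_le_two
  have hqi : Integrable q (timeMeasure T) := hq.integrable one_le_two
  have k := integral_bilin_prim (innerSL ℝ (E := H)) hT.le hdi hqi
  change (∫ t in Ioo 0 T, inner ℝ (prim d t) (q t)) + (∫ t in Ioo 0 T, inner ℝ (d t) (prim q t))
    = inner ℝ (prim d T) (prim q T) at k
  have i1 : Integrable (fun s => inner ℝ c (q s)) (timeMeasure T) :=
    integrable_inner (memLp_const c) hq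
  have i2 : Integrable (fun s => inner ℝ (prim d s) (q s)) (timeMeasure T) :=
    integrable_inner (memLp_prim hT.le hdi 2) hq
  have e3 : ∫ t in Ioo 0 T, inner ℝ (y t) (q t)
      = inner ℝ c (prim q T) + ∫ t in Ioo 0 T, inner ℝ (prim d t) (q t) := by
    rw [prim_eq_setIntegral q hT.le, ← integral_inner hqi, ← integral_add i1 i2]
    refine integral_congr_ae ?_
    filter_upwards [hc] with t ht
    rw [ht, inner_add_left]
  rw [e3]
  rw [hqT, inner_zero_right] at k ⊢
  linarith

end IntegrationByParts

section JointIntegrals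

variable {X Y : Type*} [MeasurableSpace X] [MeasurableSpace Y] {μ : Measure X} {ν : Measure Y}
  [SFinite μ] [SFinite ν]

theorem integral_jointLp_mul_of_ae (y : Lp (Lp ℝ 2 μ) 2 ν) {Q : Y → Lp ℝ 2 μ} {η : X × Y → ℝ}
    (h : ∀ᵐ t ∂ν, Q t =ᵐ[μ] fun x => η (x, t)) :
    ∫ t, ∫ x, jointLp ℝ μ ν y (x, t) * η (x, t) ∂μ ∂ν = ∫ t, inner ℝ (y t) (Q t) ∂ν := by
  refine integral_congr_ae ?_
  filter_upwards [isJoint_jointLp y, h] with t ht ht'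
  rw [L2.inner_def]
  refine integral_congr_ae ?_
  filter_upwards [ht, ht'] with x hx hx'
  rw [hx, hx']; simp [mul_comm]

theorem integral_jointLp_mul (y : Lp (Lp ℝ 2 μ) 2 ν) {f : X × Y → ℝ}
    (hf : MemLp f 2 (μ.prod ν)) :
    ∫ t, ∫ x, jointLp ℝ μ ν y (x, t) * f (x, t) ∂μ ∂ν
      = ∫ t, inner ℝ (y t) (curveOf hf t) ∂ν := by
  refine Eq.trans ?_ ((integral_inner_curveOf hf y).symm.trans (integral_congr_ae
    (Eventually.of_forall fun t => real_inner_comm _ _)))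
  refine integral_congr_ae ?_
  filter_upwards [isJoint_jointLp y] with t ht
  refine integral_congr_ae ?_
  filter_upwards [ht] with x hx
  rw [hx]; rfl

end JointIntegrals

section TimeDerivatives

variable {n : ℕ} {D Ω : Set (E n)} {T : ℝ}

/-- A curve with values in `L²(D)` that is a primitive has a weak time derivative as a function on
the cylinder. -/
theorem hasWeakDeriv_time_jointLp (hT : 0 < T) (hDb : Bornology.IsBounded D)
    {y d : Lp (Lp ℝ 2 (volume.restrict D)) 2 (timeMeasure T)} {c : Lp ℝ 2 (volume.restrict D)}
    (hc : ∀ᵐ t ∂timeMeasure T, y t = c + prim d t) :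
    HasWeakDeriv (cylinder D T) ((0 : E n), (1 : ℝ))
      (jointLp ℝ (volume.restrict D) (timeMeasure T) y)
      (jointLp ℝ (volume.restrict D) (timeMeasure T) d) := by
  intro η hη hcs hs
  have hm := memLp_fderiv_test_prod (D := D) (T := T) hη hcs (0, 1)
  rw [setIntegral_cylinder (integrable_mul_prod (Lp.memLp _) hm),
    setIntegral_cylinder (integrable_mul_prod (Lp.memLp _) (memLp_test_prod hη hcs))]
  have hqT : prim (curveOf hm) T = 0 := by
    refine Lp.ext ((prim_curveOf_test hDb hη hcs hs (right_mem_Icc.2 hT.le)).trans ?_)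
    filter_upwards [Lp.coeFn_zero ℝ 2 (volume.restrict D)] with x hx
    rw [hx]
    exact image_eq_zero_of_notMem_tsupport fun h => (hs h).2.2.false
  have e2 := integral_jointLp_mul_of_ae d (Q := prim (curveOf hm)) (η := η) (by
    filter_upwards [ae_restrict_mem measurableSet_Ioo] with t htm
    exact prim_curveOf_test hDb hη hcs hs (Ioo_subset_Icc_self htm))
  exact (integral_jointLp_mul y hm).trans ((integral_inner_of_ae_eq_const_add_prim hT
    (Lp.memLp d) (Lp.memLp _) hc hqT).trans (congrArg Neg.neg e2.symm))

/-- The weak time derivative of the curve in `L²(μ)` given by a function of two variables may be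
tested with products. -/
theorem exists_curveOf_eq {X : Type*} [MeasurableSpace X] {μ : Measure X} [SFinite μ] (hT : 0 < T)
    {f f' : X × ℝ → ℝ} (hf : MemLp f 2 (μ.prod (timeMeasure T)))
    (hf' : MemLp f' 2 (μ.prod (timeMeasure T))) (P : Set (Lp ℝ 2 μ))
    (hP : ∀ z : Lp ℝ 2 μ, (∀ φ ∈ P, inner ℝ z φ = 0) → z = 0)
    (h : ∀ φ ∈ P, ∀ θ : ℝ → ℝ, ContDiff ℝ ∞ θ → HasCompactSupport θ → tsupport θ ⊆ Ioo 0 T →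
      ∫ t in Ioo 0 T, ∫ x, f (x, t) * (deriv θ t * φ x) ∂μ
        = -∫ t in Ioo 0 T, ∫ x, f' (x, t) * (θ t * φ x) ∂μ) :
    ∃ c, ∀ᵐ t ∂timeMeasure T, curveOf hf t = c + prim (curveOf hf') t := by
  have hF : ∀ {f : X × ℝ → ℝ} (hf : MemLp f 2 (μ.prod (timeMeasure T))),
      Integrable (curveOf hf) (timeMeasure T) := fun hf => (Lp.memLp _).integrable one_le_two
  refine exists_ae_eq_const_add_prim hT (hF hf) (hF hf') fun θ hθ hθc hθs => ?_
  have hsm : ∀ {f : X × ℝ → ℝ} (hf : MemLp f 2 (μ.prod (timeMeasure T))) {ρ : ℝ → ℝ},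
      Continuous ρ → Integrable (fun t => ρ t • curveOf hf t) (timeMeasure T) := fun hf ρ hρ => by
    have hm : MemLp ρ 2 (timeMeasure T) := memLp_of_continuousOn hρ.continuousOn 2
    exact memLp_one_iff_integrable.1 ((Lp.memLp (curveOf hf)).smul hm)
  have key : ∀ {f : X × ℝ → ℝ} (hf : MemLp f 2 (μ.prod (timeMeasure T))) {ρ : ℝ → ℝ},
      Continuous ρ → ∀ φ : Lp ℝ 2 μ, inner ℝ (∫ t in Ioo 0 T, ρ t • curveOf hf t) φ
        = ∫ t in Ioo 0 T, ∫ x, f (x, t) * (ρ t * φ x) ∂μ := fun {f} hf ρ hρ φ => by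
    have hm : MemLp (fun t => ρ t • φ) 2 (timeMeasure T) :=
      memLp_of_continuousOn (hρ.smul continuous_const).continuousOn 2
    have k := integral_inner_curveOf hf (hm.toLp _)
    rw [real_inner_comm, ← integral_inner (hsm hf hρ)]
    refine Eq.trans (integral_congr_ae ?_) (k.trans (integral_congr_ae ?_))
    · filter_upwards [hm.coeFn_toLp] with t ht
      rw [ht, real_inner_smul_right, real_inner_smul_right, real_inner_comm]
    · filter_upwards [hm.coeFn_toLp] with t ht
      rw [ht]
      refine integral_congr_ae ?_
      filter_upwards [Lp.coeFn_smul (ρ t) φ] with x hx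
      rw [hx]; simp [mul_comm, mul_left_comm]
  rw [← add_eq_zero_iff_eq_neg]
  refine hP _ fun φ hφ => ?_
  rw [inner_add_left, key hf (hθ.continuous_deriv (by simp)), key hf' hθ.continuous,
    h φ hφ θ hθ hθc hθs, neg_add_cancel]

theorem IsL2.memLp_prod {f : E n × ℝ → ℝ} (hf : IsL2 Ω T f) (hD : D ⊆ Ω) :
    MemLp f 2 ((volume.restrict D).prod (timeMeasure T)) := by
  rw [← restrict_cylinder]
  exact hf.mono_measure (Measure.restrict_mono (prod_mono hD subset_rfl) le_rfl)

/-- Elements of `L²(D)` orthogonal to all test functions vanish. -/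
theorem eq_zero_of_inner_test (hD : IsOpen D) {z : Lp ℝ 2 (volume.restrict D)}
    (h : ∀ φ (hφ : IsTest D φ), inner ℝ z ((hφ.memLp (volume.restrict D)).toLp φ) = 0) :
    z = 0 := by
  have hl : LocallyIntegrableOn (z : E n → ℝ) D :=
    locallyIntegrableOn_of_locallyIntegrable_restrict ((Lp.memLp z).locallyIntegrable one_le_two)
  have h0 := hD.ae_eq_zero_of_integral_contDiff_smul_eq_zero hl fun φ h1 h2 h3 => by
    have hφ : IsTest D φ := ⟨h1, h2, h3⟩
    rw [← h φ hφ, L2.inner_def, ← setIntegral_eq_integral_of_forall_compl_eq_zero (s := D)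
      fun x hx => by rw [image_eq_zero_of_notMem_tsupport fun h => hx (h3 h), zero_smul]]
    refine integral_congr_ae ?_
    filter_upwards [(hφ.memLp (volume.restrict D)).coeFn_toLp] with x hx
    rw [hx]; simp
  refine Lp.ext ?_
  rw [EventuallyEq, ae_restrict_iff' hD.measurableSet]
  have hz := Lp.coeFn_zero ℝ 2 (volume.restrict D)
  rw [EventuallyEq, ae_restrict_iff' hD.measurableSet] at hz
  filter_upwards [h0, hz] with x hx hx' hxD
  rw [hx hxD, hx' hxD, Pi.zero_apply]

/-- The weak time derivative of a source term, restricted to a subdomain. -/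
theorem exists_curveOf_eq_of_hasWeakDeriv (hT : 0 < T) (hD : IsOpen D) (hDΩ : D ⊆ Ω)
    {f f' : E n × ℝ → ℝ} (hf : IsL2 Ω T f) (hf' : IsL2 Ω T f')
    (hw : HasWeakDeriv (cylinder Ω T) ((0 : E n), (1 : ℝ)) f f') :
    ∃ c, ∀ᵐ t ∂timeMeasure T,
      curveOf (hf.memLp_prod hDΩ) t = c + prim (curveOf (hf'.memLp_prod hDΩ)) t := by
  refine exists_curveOf_eq hT _ _
    {z | ∃ φ, ∃ hφ : IsTest D φ, z = (hφ.memLp (volume.restrict D)).toLp φ}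
    (fun z hz => eq_zero_of_inner_test hD fun φ hφ => hz _ ⟨φ, hφ, rfl⟩) ?_
  rintro _ ⟨φ, hφ, rfl⟩ θ hθ hθc hθs
  let η : E n × ℝ → ℝ := fun z => φ z.1 * θ z.2
  have hη : ContDiff ℝ ∞ η := (hφ.contDiff.comp contDiff_fst).mul (hθ.comp contDiff_snd)
  have hsupp : Function.support η ⊆ tsupport φ ×ˢ tsupport θ := fun z hz => by
    have : φ z.1 * θ z.2 ≠ 0 := hz
    exact ⟨subset_tsupport _ (left_ne_zero_of_mul this),
      subset_tsupport _ (right_ne_zero_of_mul this)⟩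
  have hcl : tsupport η ⊆ tsupport φ ×ˢ tsupport θ :=
    closure_minimal hsupp ((isClosed_tsupport _).prod (isClosed_tsupport _))
  have hηc : HasCompactSupport η :=
    HasCompactSupport.of_support_subset_isCompact (hφ.hasCompactSupport.isCompact.prod
      hθc.isCompact) hsupp
  have hηD : tsupport η ⊆ cylinder D T := hcl.trans (prod_mono hφ.tsupport_subset hθs)
  have hDm : cylinder D T ⊆ cylinder Ω T := prod_mono hDΩ subset_rfl
  have hdη : ∀ z, fderiv ℝ η z (0, 1) = deriv θ z.2 * φ z.1 := by
    rintro ⟨x, t⟩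
    have h1 := hasDerivAt_slice hη x t
    have h2 : HasDerivAt (fun t => η (x, t)) (φ x * deriv θ t) t :=
      ((hθ.differentiable (by simp)) t).hasDerivAt.const_mul (φ x)
    rw [h1.unique h2, mul_comm]
  have k := hw η hη hηc (hηD.trans hDm)
  have hm1 := memLp_fderiv_test_prod (D := D) (T := T) hη hηc (0, 1)
  have hm2 := memLp_test_prod (D := D) (T := T) hη hηc
  have e : ∀ h : E n × ℝ → ℝ, (∀ z, z ∉ cylinder D T → h z = 0) →
      ∫ z in cylinder Ω T, h z = ∫ z in cylinder D T, h z := fun h hh => by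
    rw [setIntegral_eq_integral_of_forall_compl_eq_zero fun z hz => hh z fun h => hz (hDm h),
      setIntegral_eq_integral_of_forall_compl_eq_zero hh]
  rw [e _ fun z hz => by
      rw [image_eq_zero_of_notMem_tsupport (f := fderiv ℝ η)
        fun h => hz (hηD (tsupport_fderiv_subset ℝ h))]
      simp,
    e _ fun z hz => by rw [image_eq_zero_of_notMem_tsupport fun h => hz (hηD h), mul_zero],
    setIntegral_cylinder (integrable_mul_prod (hf.memLp_prod hDΩ) hm1),
    setIntegral_cylinder (integrable_mul_prod (hf'.memLp_prod hDΩ) hm2)] at k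
  refine Eq.trans ?_ (k.trans (congrArg Neg.neg ?_))
  · refine integral_congr_ae (Eventually.of_forall fun t => integral_congr_ae ?_)
    filter_upwards [(hφ.memLp (volume.restrict D)).coeFn_toLp] with x hx
    rw [hx, hdη]
  · refine integral_congr_ae (Eventually.of_forall fun t => integral_congr_ae ?_)
    filter_upwards [(hφ.memLp (volume.restrict D)).coeFn_toLp] with x hx
    rw [hx]
    simp only [η]; ring

end TimeDerivatives

/-! ### The boundary data as a curve in `L²` of the surface -/

section BoundaryData

variable {n : ℕ} {Ω : Set (E n)} {T : ℝ}

/-- Integration by parts in time against a test function, for a function that is `C¹` in the open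
interval only. -/
theorem integral_slice_deriv {G G' θ : ℝ → ℝ} {B : ℝ}
    (hG : ∀ t ∈ Ioo 0 T, HasDerivAt G (G' t) t) (hG'c : ContinuousOn G' (Ioo 0 T))
    (hB : ∀ t ∈ Ioo 0 T, |G t| ≤ B) (hB' : ∀ t ∈ Ioo 0 T, |G' t| ≤ B)
    (hθ : ContDiff ℝ ∞ θ) (hθs : tsupport θ ⊆ Ioo 0 T) :
    ∫ t in Ioo 0 T, G t * deriv θ t = -∫ t in Ioo 0 T, G' t * θ t := by
  have hGc : ContinuousOn G (Ioo 0 T) := fun t ht => (hG t ht).continuousAt.continuousWithinAt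
  have hdc : Continuous (deriv θ) := hθ.continuous_deriv (by simp)
  have z0 : ∀ t, t ∉ Ioo 0 T → θ t = 0 := fun t ht =>
    image_eq_zero_of_notMem_tsupport fun h => ht (hθs h)
  have z1 : ∀ t, t ∉ Ioo 0 T → deriv θ t = 0 := fun t ht =>
    image_eq_zero_of_notMem_tsupport fun h => ht (hθs (tsupport_deriv_subset h))
  -- a product of a bounded continuous function with a test function is integrable
  have hint : ∀ {u ρ : ℝ → ℝ}, ContinuousOn u (Ioo 0 T) → (∀ t ∈ Ioo 0 T, |u t| ≤ B) →
      Continuous ρ → (∀ t, t ∉ Ioo 0 T → ρ t = 0) → Integrable fun t => u t * ρ t := by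
    intro u ρ hu hub hρ hρz
    rw [← integrableOn_iff_integrable_of_support_subset (s := Ioo 0 T) fun t ht => by
      by_contra h
      exact ht (by simp [hρz t h])]
    have hρi : Integrable ρ (timeMeasure T) :=
      (memLp_of_continuousOn hρ.continuousOn 1).integrable le_rfl
    refine hρi.bdd_mul (c := B) (hu.aestronglyMeasurable measurableSet_Ioo) ?_
    filter_upwards [ae_restrict_mem measurableSet_Ioo] with t ht using hub t ht
  have hfd : ∀ t ∈ Ioo 0 T, fderiv ℝ G t 1 = G' t := fun t ht => by
    rw [fderiv_apply_one_eq_deriv, (hG t ht).deriv]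
  have e : (fun t => fderiv ℝ G t 1 * θ t) = fun t => G' t * θ t := by
    funext t
    by_cases ht : t ∈ Ioo 0 T
    · rw [hfd t ht]
    · rw [z0 t ht, mul_zero, mul_zero]
  have k := integral_mul_fderiv_eq_neg_fderiv_mul_of_integrable (𝕜 := ℝ) (μ := volume) (f := G)
    (g := θ) (v := 1) (by rw [e]; exact hint hG'c hB' hθ.continuous z0)
    (by simp only [fderiv_apply_one_eq_deriv]; exact hint hGc hB hdc z1)
    (hint hGc hB hθ.continuous z0)
    (fun t ht => (hG t (hθs ht)).differentiableAt) (fun t _ => hθ.differentiable (by simp) t)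
  rw [e] at k
  simp only [fderiv_apply_one_eq_deriv] at k
  rw [setIntegral_eq_integral_of_forall_compl_eq_zero fun t ht => by rw [z1 t ht, mul_zero],
    setIntegral_eq_integral_of_forall_compl_eq_zero fun t ht => by rw [z0 t ht, mul_zero], k]

theorem memLp_of_continuousOn_cylinder (hT : 0 ≤ T) {σ : Measure (E n)} [IsFiniteMeasure σ]
    (hσ : ∀ᵐ x ∂σ, x ∈ Ω) {g : E n × ℝ → ℝ} (hg : ContinuousOn g (closure (cylinder Ω T)))
    {B : ℝ} (hB : ∀ z ∈ closure (cylinder Ω T), |g z| ≤ B) :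
    MemLp g 2 (σ.prod (timeMeasure T)) ∧
      ∫ z, ‖g z‖ ^ 2 ∂(σ.prod (timeMeasure T)) ≤ T * B ^ 2 * σ.real univ := by
  have hmem : ∀ᵐ z ∂σ.prod (timeMeasure T), z ∈ closure (cylinder Ω T) := by
    have h1 : ∀ᵐ z ∂σ.prod (timeMeasure T), z.2 ∈ Ioo 0 T :=
      Measure.quasiMeasurePreserving_snd.ae (ae_restrict_mem measurableSet_Ioo)
    have h2 : ∀ᵐ z ∂σ.prod (timeMeasure T), z.1 ∈ Ω :=
      Measure.quasiMeasurePreserving_fst.ae hσ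
    filter_upwards [h1, h2] with z hz₁ hz₂ using subset_closure ⟨hz₂, hz₁⟩
  have hm : AEStronglyMeasurable g (σ.prod (timeMeasure T)) := by
    rw [← Measure.restrict_eq_self_of_ae_mem hmem]
    exact hg.aestronglyMeasurable isClosed_closure.measurableSet
  have hb : ∀ᵐ z ∂σ.prod (timeMeasure T), ‖g z‖ ≤ B := by
    filter_upwards [hmem] with z hz using hB z hz
  have hgm : MemLp g 2 (σ.prod (timeMeasure T)) := MemLp.of_bound hm B hb
  refine ⟨hgm, ?_⟩
  calc ∫ z, ‖g z‖ ^ 2 ∂(σ.prod (timeMeasure T))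
      ≤ ∫ _, B ^ 2 ∂(σ.prod (timeMeasure T)) := by
        refine integral_mono_ae hgm.integrable_norm_pow' (integrable_const _) ?_
        filter_upwards [hb] with z hz
        gcongr
    _ = T * B ^ 2 * σ.real univ := by
        rw [integral_const, smul_eq_mul, ← univ_prod_univ, measureReal_prod_prod,
          timeMeasure_real_univ hT]
        ring

/-- A `C¹` function on the closed cylinder, as a curve in `L²` of a surface in `Ω`, has a
square-integrable derivative; the norms are controlled by the area of the surface. -/
theorem exists_boundary_curve (hT : 0 < T) (hΩb : Bornology.IsBounded Ω) {g : E n × ℝ → ℝ}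
    (hg : IsC1OnClosure (cylinder Ω T) g) : ∃ B : ℝ, 0 ≤ B ∧
      ∀ (σ : Measure (E n)) [IsFiniteMeasure σ], (∀ᵐ x ∂σ, x ∈ Ω) →
        ∃ (hgm : MemLp g 2 (σ.prod (timeMeasure T))) (H' : Lp (Lp ℝ 2 σ) 2 (timeMeasure T))
          (c : Lp ℝ 2 σ), (∀ᵐ t ∂timeMeasure T, curveOf hgm t = c + prim H' t) ∧
          ‖curveOf hgm‖ ^ 2 ≤ B * σ.real univ ∧ ‖H'‖ ^ 2 ≤ B * σ.real univ := by
  obtain ⟨hgc, g', hg'c, hg'⟩ := hg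
  have hK : IsCompact (closure (cylinder Ω T)) :=
    (hΩb.prod (Metric.isBounded_Ioo 0 T)).isCompact_closure
  let gt : E n × ℝ → ℝ := fun z => g' z (0, 1)
  have hgt : ContinuousOn gt (closure (cylinder Ω T)) := hg'c.clm_apply continuousOn_const
  obtain ⟨B₁, h₁⟩ := hK.exists_bound_of_continuousOn hgc
  obtain ⟨B₂, h₂⟩ := hK.exists_bound_of_continuousOn hgt
  set B := max B₁ B₂
  have hb₁ : ∀ z ∈ closure (cylinder Ω T), |g z| ≤ B := fun z hz => (h₁ z hz).trans (le_max_left _ _)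
  have hb₂ : ∀ z ∈ closure (cylinder Ω T), |gt z| ≤ B := fun z hz =>
    (h₂ z hz).trans (le_max_right _ _)
  refine ⟨T * B ^ 2, by positivity, fun σ _ hσ => ?_⟩
  obtain ⟨m₁, n₁⟩ := memLp_of_continuousOn_cylinder hT.le hσ hgc hb₁
  obtain ⟨m₂, n₂⟩ := memLp_of_continuousOn_cylinder hT.le hσ hgt hb₂
  obtain ⟨c, hc⟩ := exists_curveOf_eq hT m₁ m₂ univ
    (fun z hz => inner_self_eq_zero.1 (hz z (mem_univ _))) (by
    intro φ _ θ hθ _ hθs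
    have hint : ∀ {u : E n × ℝ → ℝ} {ρ : ℝ → ℝ}, MemLp u 2 (σ.prod (timeMeasure T)) →
        Continuous ρ → Integrable (fun z => u z * (ρ z.2 * φ z.1)) (σ.prod (timeMeasure T)) := by
      intro u ρ hu hρ
      obtain ⟨C, hC⟩ := (isCompact_Icc (a := (0 : ℝ)) (b := T)).exists_bound_of_continuousOn
        hρ.continuousOn
      have hφ := (Lp.memLp φ).comp_fst (timeMeasure T)
      refine integrable_mul_prod hu (MemLp.of_le_mul (c := C) hφ
        ((hρ.comp continuous_snd).aestronglyMeasurable.mul hφ.aestronglyMeasurable) ?_)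
      have : ∀ᵐ z ∂σ.prod (timeMeasure T), z.2 ∈ Ioo 0 T :=
        Measure.quasiMeasurePreserving_snd.ae (ae_restrict_mem measurableSet_Ioo)
      filter_upwards [this] with z hz
      rw [norm_mul]
      gcongr
      exact hC _ (Ioo_subset_Icc_self hz)
    rw [← integral_prod_symm _ (hint m₁ (hθ.continuous_deriv (by simp))),
      ← integral_prod_symm _ (hint m₂ hθ.continuous),
      integral_prod _ (hint m₁ (hθ.continuous_deriv (by simp))),
      integral_prod _ (hint m₂ hθ.continuous), ← integral_neg]
    refine integral_congr_ae ?_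
    filter_upwards [hσ] with x hx
    have hmem : ∀ t ∈ Ioo 0 T, (x, t) ∈ cylinder Ω T := fun t ht => ⟨hx, ht⟩
    have hcl : MapsTo (fun t : ℝ => (x, t)) (Ioo 0 T) (closure (cylinder Ω T)) := fun t ht =>
      subset_closure (hmem t ht)
    have k := integral_slice_deriv (G := fun t => g (x, t)) (G' := fun t => gt (x, t)) (B := B)
      (fun t ht => by
        have h1 : HasDerivAt (fun t : ℝ => (x, t)) ((0 : E n), (1 : ℝ)) t :=
          (hasDerivAt_const t x).prodMk (hasDerivAt_id t)
        exact (hg' _ (hmem t ht)).comp_hasDerivAt t h1)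
      (hgt.comp (by fun_prop) hcl) (fun t ht => hb₁ _ (hcl ht)) (fun t ht => hb₂ _ (hcl ht))
      hθ hθs
    simp only [← mul_assoc]
    rw [integral_mul_const, integral_mul_const, k, neg_mul])
  exact ⟨m₁, curveOf m₂, c, hc, (norm_curveOf_le m₁).trans n₁, (norm_curveOf_le m₂).trans n₂⟩

end BoundaryData

/-! ### Evolution equations with a mass in the interior and on the boundary -/

/-- The functional `φ ↦ ⟨x, P φ⟩`, depending linearly and continuously on `x`. -/
def innerPull {V X : Type*} [NormedAddCommGroup V] [NormedSpace ℝ V] [NormedAddCommGroup X]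
    [InnerProductSpace ℝ X] (P : V →L[ℝ] X) : X →L[ℝ] StrongDual ℝ V :=
  ((ContinuousLinearMap.compL ℝ V X ℝ).flip P).comp (innerSL ℝ)

theorem innerPull_apply {V X : Type*} [NormedAddCommGroup V] [NormedSpace ℝ V]
    [NormedAddCommGroup X] [InnerProductSpace ℝ X] (P : V →L[ℝ] X) (x : X) (φ : V) :
    innerPull P x φ = inner ℝ x (P φ) := rfl

section PairMap

variable {V X S : Type*} [NormedAddCommGroup V] [InnerProductSpace ℝ V]
  [NormedAddCommGroup X] [InnerProductSpace ℝ X] [NormedAddCommGroup S] [InnerProductSpace ℝ S]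

/-- The map `u ↦ (P u, Q u)` into the Hilbert sum of two Hilbert spaces. -/
def pairL (P : V →L[ℝ] X) (Q : V →L[ℝ] S) : V →L[ℝ] WithLp 2 (X × S) :=
  ((WithLp.prodContinuousLinearEquiv 2 ℝ X S).symm : X × S →L[ℝ] WithLp 2 (X × S)).comp (P.prod Q)

theorem inner_pairL (P : V →L[ℝ] X) (Q : V →L[ℝ] S) (x : WithLp 2 (X × S)) (v : V) :
    inner ℝ x (pairL P Q v) = inner ℝ x.fst (P v) + inner ℝ x.snd (Q v) := rfl

theorem norm_sq_pairL (P : V →L[ℝ] X) (Q : V →L[ℝ] S) (v : V) :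
    ‖pairL P Q v‖ ^ 2 = ‖P v‖ ^ 2 + ‖Q v‖ ^ 2 := WithLp.prod_norm_sq_eq_of_L2 _

end PairMap

section Pair

variable {V X Y S : Type*} [NormedAddCommGroup V] [InnerProductSpace ℝ V] [CompleteSpace V]
  [NormedAddCommGroup X] [InnerProductSpace ℝ X] [CompleteSpace X]
  [NormedAddCommGroup Y] [InnerProductSpace ℝ Y] [CompleteSpace Y]
  [NormedAddCommGroup S] [InnerProductSpace ℝ S] [CompleteSpace S] {T : ℝ}

/-- `exists_evolution_energy` for the mass `a² ⟨v u, v φ⟩ + b² ⟨τ u, τ φ⟩` and the energy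
`⟨g u, g φ⟩ + s² ⟨τ u, τ φ⟩`. -/
theorem exists_evolution_pair (v : V →L[ℝ] Y) (g : V →L[ℝ] X) (τ : V →L[ℝ] S) (a b s : ℝ) {c : ℝ}
    (hc : ∀ u, ‖u‖ ^ 2 ≤ c * (‖g u‖ ^ 2 + s ^ 2 * ‖τ u‖ ^ 2)) (hT : 0 < T)
    (ℓ : Lp V 2 (timeMeasure T) →L[ℝ] ℝ) {M : ℝ} (hM : 0 ≤ M)
    (hℓ : ∀ w : C(ℝ, V), |ℓ (contToLp V T (mulWeight V T w))| ≤
      M * √((∫ t in Ioo 0 T, (a ^ 2 * ‖v (w t)‖ ^ 2 + b ^ 2 * ‖τ (w t)‖ ^ 2))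
        + (‖g (prim w T)‖ ^ 2 + s ^ 2 * ‖τ (prim w T)‖ ^ 2)
        + ∫ t in Ioo 0 T, (‖g (prim w t)‖ ^ 2 + s ^ 2 * ‖τ (prim w t)‖ ^ 2))) :
    ∃ (u : Lp V 2 (timeMeasure T)) (p₁ : Lp Y 2 (timeMeasure T)) (p₂ : Lp S 2 (timeMeasure T)),
      (∀ᵐ t ∂timeMeasure T, a • v (u t) = prim p₁ t) ∧
      (∀ᵐ t ∂timeMeasure T, b • τ (u t) = prim p₂ t) ∧
      (∀ φ : Lp V 2 (timeMeasure T),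
        (∫ t in Ioo 0 T, (a * inner ℝ (p₁ t) (v (φ t)) + b * inner ℝ (p₂ t) (τ (φ t))))
        + (∫ t in Ioo 0 T, (inner ℝ (g (u t)) (g (φ t)) + s ^ 2 * inner ℝ (τ (u t)) (τ (φ t))))
          = ℓ φ) ∧
      (∫ t in Ioo 0 T, (‖g (u t)‖ ^ 2 + s ^ 2 * ‖τ (u t)‖ ^ 2)) ≤ (2 * M) ^ 2 ∧
      ‖p₁‖ ≤ 2 * M ∧ ‖p₂‖ ≤ 2 * M := by
  have hk : ∀ u, ‖pairL g (s • τ) u‖ ^ 2 = ‖g u‖ ^ 2 + s ^ 2 * ‖τ u‖ ^ 2 := fun u => by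
    rw [norm_sq_pairL, smul_apply, norm_smul, mul_pow, Real.norm_eq_abs, sq_abs]
  have hm : ∀ u, ‖pairL (a • v) (b • τ) u‖ ^ 2 = a ^ 2 * ‖v u‖ ^ 2 + b ^ 2 * ‖τ u‖ ^ 2 := fun u => by
    rw [norm_sq_pairL, smul_apply, smul_apply, norm_smul,
      norm_smul, mul_pow, mul_pow, Real.norm_eq_abs, Real.norm_eq_abs, sq_abs, sq_abs]
  obtain ⟨u, p, h1, h2, h3, h4⟩ := exists_evolution_energy (pairL g (s • τ)) (c := √(max c 0))
    (fun u => by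
      rw [← abs_of_nonneg (norm_nonneg u), ← Real.sqrt_sq_eq_abs,
        ← Real.sqrt_sq (norm_nonneg (pairL g (s • τ) u)), ← Real.sqrt_mul (le_max_right _ _), hk]
      refine Real.sqrt_le_sqrt ((hc u).trans ?_)
      gcongr
      exact le_max_left _ _) (pairL (a • v) (b • τ)) hT ℓ hM
    (fun w => by simpa only [hk, hm] using hℓ w)
  have e₁ := ContinuousLinearMap.coeFn_compLp (WithLp.fstL 2 ℝ Y S) p
  have e₂ := ContinuousLinearMap.coeFn_compLp (WithLp.sndL 2 ℝ Y S) p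
  have hpi : Integrable p (timeMeasure T) := (Lp.memLp p).integrable (by norm_num)
  refine ⟨u, (WithLp.fstL 2 ℝ Y S).compLp p, (WithLp.sndL 2 ℝ Y S).compLp p, ?_, ?_, fun φ => ?_,
    ?_, ?_, ?_⟩
  · filter_upwards [h1, ae_restrict_mem measurableSet_Ioo] with t k1 ht
    have k2 := congrArg (WithLp.fstL 2 ℝ Y S) k1
    rw [clm_prim _ (Ioo_subset_Icc_self ht) hpi] at k2
    rw [prim_congr (Ioo_subset_Icc_self ht) e₁]
    exact k2
  · filter_upwards [h1, ae_restrict_mem measurableSet_Ioo] with t k1 ht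
    have k2 := congrArg (WithLp.sndL 2 ℝ Y S) k1
    rw [clm_prim _ (Ioo_subset_Icc_self ht) hpi] at k2
    rw [prim_congr (Ioo_subset_Icc_self ht) e₂]
    exact k2
  · rw [← h2 φ]
    congr 1
    · refine integral_congr_ae ?_
      filter_upwards [e₁, e₂] with t k1 k2
      rw [inner_pairL, smul_apply, smul_apply, real_inner_smul_right, real_inner_smul_right]
      exact congrArg₂ (fun x y => a * inner ℝ x (v (φ t)) + b * inner ℝ y (τ (φ t))) k1 k2
    · refine integral_congr_ae (Eventually.of_forall fun t => ?_)
      simp only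
      rw [inner_pairL]
      change _ = inner ℝ (g (u t)) (g (φ t)) + inner ℝ (s • τ (u t)) (s • τ (φ t))
      rw [real_inner_smul_left, real_inner_smul_right]
      ring
  · simpa only [hk] using h3
  · refine le_trans ?_ h4
    refine Lp.norm_le_norm_of_ae_le ?_
    filter_upwards [e₁] with t k1
    refine (congrArg norm k1).le.trans ?_
    exact WithLp.norm_fst_le _ _
  · refine le_trans ?_ h4
    refine Lp.norm_le_norm_of_ae_le ?_
    filter_upwards [e₂] with t k1
    refine (congrArg norm k1).le.trans ?_
    exact WithLp.norm_snd_le _ _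

/-- If `‖v z‖ ≤ ‖r z‖` for all `z`, then `v` factors through `r` as a contraction. -/
theorem exists_clm_comp_eq {Z R : Type*} [AddCommGroup Z] [Module ℝ Z] [NormedAddCommGroup R]
    [InnerProductSpace ℝ R] [CompleteSpace R] (r : Z →ₗ[ℝ] R) (v : Z →ₗ[ℝ] Y)
    (h : ∀ z, ‖v z‖ ≤ ‖r z‖) : ∃ Λ : R →L[ℝ] Y, (∀ z, Λ (r z) = v z) ∧ ∀ x, ‖Λ x‖ ≤ ‖x‖ := by
  let N := (LinearMap.range r).topologicalClosure
  have hrN : ∀ z, r z ∈ N := fun z => Submodule.le_topologicalClosure _ (LinearMap.mem_range_self r z)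
  let e : Z →ₗ[ℝ] N := r.codRestrict N hrN
  have hd : DenseRange e := by
    rw [DenseRange, Subtype.dense_iff]
    intro x hx
    refine closure_mono ?_ hx
    rintro _ ⟨z, rfl⟩
    exact ⟨e z, mem_range_self z, rfl⟩
  have hn : ∀ z, ‖v z‖ ≤ 1 * ‖e z‖ := fun z => by
    rw [one_mul]
    exact h z
  have : CompleteSpace N := (Submodule.isClosed_topologicalClosure _).completeSpace_coe
  refine ⟨(v.extendOfNorm e).comp N.orthogonalProjectionOnto, fun z => ?_, fun x => ?_⟩
  · have : N.orthogonalProjectionOnto (r z) = e z :=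
      Submodule.orthogonalProjectionOnto_mem_subspace_eq_self (K := N) (e z)
    rw [ContinuousLinearMap.comp_apply, this]
    exact LinearMap.extendOfNorm_eq hd ⟨1, hn⟩ z
  · have h1 := LinearMap.norm_extendOfNorm_apply_le hd 1 hn (N.orthogonalProjectionOnto x)
    rw [one_mul] at h1
    exact h1.trans (N.norm_orthogonalProjectionOnto_apply_le x)

end Pair

section TwoMasses

variable {V X Y S : Type*} [NormedAddCommGroup V] [InnerProductSpace ℝ V]
  [NormedAddCommGroup X] [InnerProductSpace ℝ X] [NormedAddCommGroup Y] [InnerProductSpace ℝ Y]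
  [NormedAddCommGroup S] [InnerProductSpace ℝ S] {T : ℝ}

/-- The norm of the weight `w` in which `exists_evolution_pair` requires the right-hand side to
be bounded. -/
def weightNorm (v : V →L[ℝ] Y) (g : V →L[ℝ] X) (τ : V →L[ℝ] S) (a b s T : ℝ) (w : ℝ → V) : ℝ :=
  √((∫ t in Ioo 0 T, (a ^ 2 * ‖v (w t)‖ ^ 2 + b ^ 2 * ‖τ (w t)‖ ^ 2))
    + (‖g (prim w T)‖ ^ 2 + s ^ 2 * ‖τ (prim w T)‖ ^ 2)
    + ∫ t in Ioo 0 T, (‖g (prim w t)‖ ^ 2 + s ^ 2 * ‖τ (prim w t)‖ ^ 2))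

variable (v : V →L[ℝ] Y) (g : V →L[ℝ] X) (τ : V →L[ℝ] S) (a b s : ℝ)

theorem weightNorm_nonneg (w : ℝ → V) : 0 ≤ weightNorm v g τ a b s T w :=
  Real.sqrt_nonneg _

theorem sqrt_integral_le_weightNorm {c : ℝ} (hc : 0 < c) (hca : c ≤ a) (w : C(ℝ, V)) :
    √(∫ t in Ioo 0 T, ‖v (w t)‖ ^ 2) ≤ c⁻¹ * weightNorm v g τ a b s T w := by
  have hi : ∀ L : V →L[ℝ] Y, Integrable (fun t => ‖L (w t)‖ ^ 2) (timeMeasure T) := fun L =>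
    integrable_norm_sq (memLp_of_continuousOn (L.continuous.comp w.continuous).continuousOn 2)
  have hi' : Integrable (fun t => ‖τ (w t)‖ ^ 2) (timeMeasure T) :=
    integrable_norm_sq (memLp_of_continuousOn (τ.continuous.comp w.continuous).continuousOn 2)
  rw [inv_mul_eq_div, le_div_iff₀ hc, mul_comm, ← Real.sqrt_sq hc.le,
    ← Real.sqrt_mul (sq_nonneg _), weightNorm]
  refine Real.sqrt_le_sqrt ?_
  have h1 : c ^ 2 * ∫ t in Ioo 0 T, ‖v (w t)‖ ^ 2
      ≤ ∫ t in Ioo 0 T, (a ^ 2 * ‖v (w t)‖ ^ 2 + b ^ 2 * ‖τ (w t)‖ ^ 2) := by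
    rw [← integral_const_mul]
    refine integral_mono ((hi v).const_mul _) (((hi v).const_mul _).add (hi'.const_mul _))
      fun t => ?_
    have : c ^ 2 ≤ a ^ 2 := by gcongr
    have := mul_le_mul_of_nonneg_right this (sq_nonneg ‖v (w t)‖)
    have : 0 ≤ b ^ 2 * ‖τ (w t)‖ ^ 2 := by positivity
    simp only
    linarith
  have h2 : 0 ≤ ∫ t in Ioo 0 T, (‖g (prim w t)‖ ^ 2 + s ^ 2 * ‖τ (prim w t)‖ ^ 2) :=
    integral_nonneg fun t => by positivity
  have h3 : 0 ≤ ‖g (prim w T)‖ ^ 2 + s ^ 2 * ‖τ (prim w T)‖ ^ 2 := by positivity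
  linarith

theorem sqrt_prim_le_weightNorm (hT : 0 < T) {Z : Type*} [NormedAddCommGroup Z]
    [InnerProductSpace ℝ Z] (κ : V →L[ℝ] Z) {c : ℝ} (hc : 0 ≤ c)
    (hκ : ∀ u, ‖κ u‖ ^ 2 ≤ c ^ 2 * (‖g u‖ ^ 2 + s ^ 2 * ‖τ u‖ ^ 2)) (w : C(ℝ, V)) :
    √(‖κ (prim w T)‖ ^ 2 + ∫ t in Ioo 0 T, ‖κ (prim w t)‖ ^ 2)
      ≤ c * weightNorm v g τ a b s T w := by
  have hw : Integrable w (timeMeasure T) :=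
    (memLp_of_continuousOn w.continuous.continuousOn 1).integrable le_rfl
  have hp := memLp_prim hT.le hw 2
  have hi₁ : Integrable (fun t => ‖κ (prim w t)‖ ^ 2) (timeMeasure T) :=
    integrable_norm_sq (κ.comp_memLp' hp)
  have hi₂ : Integrable (fun t => ‖g (prim w t)‖ ^ 2) (timeMeasure T) :=
    integrable_norm_sq (g.comp_memLp' hp)
  have hi₃ : Integrable (fun t => ‖τ (prim w t)‖ ^ 2) (timeMeasure T) :=
    integrable_norm_sq (τ.comp_memLp' hp)
  conv_rhs => rw [weightNorm, ← Real.sqrt_sq hc, ← Real.sqrt_mul (sq_nonneg _)]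
  refine Real.sqrt_le_sqrt ?_
  have h1 : ∫ t in Ioo 0 T, ‖κ (prim w t)‖ ^ 2
      ≤ c ^ 2 * ∫ t in Ioo 0 T, (‖g (prim w t)‖ ^ 2 + s ^ 2 * ‖τ (prim w t)‖ ^ 2) := by
    rw [← integral_const_mul]
    exact integral_mono hi₁ ((hi₂.add (hi₃.const_mul _)).const_mul _) fun t => hκ _
  have h2 : 0 ≤ c ^ 2 * ∫ t in Ioo 0 T, (a ^ 2 * ‖v (w t)‖ ^ 2 + b ^ 2 * ‖τ (w t)‖ ^ 2) :=
    mul_nonneg (sq_nonneg _) (integral_nonneg fun t => by positivity)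
  have h3 := hκ (prim w T)
  linarith

/-- If the energy is stationary against test functions with zero trace, and such stationary
functions are controlled by their traces and sources, then time regularity of the traces and of
the sources carries over to the functions. -/
theorem exists_time_deriv [CompleteSpace V] [CompleteSpace X] [CompleteSpace Y] [CompleteSpace S]
    {C₁ C₂ : ℝ}
    (hreg : ∀ w F, (∀ φ, τ φ = 0 → inner ℝ (g w) (g φ) = inner ℝ F (v φ)) →
      ‖v w‖ ^ 2 ≤ C₁ ^ 2 * ‖τ w‖ ^ 2 + C₂ ^ 2 * ‖F‖ ^ 2)
    {u : Lp V 2 (timeMeasure T)} {q : Lp S 2 (timeMeasure T)} {F F' : Lp Y 2 (timeMeasure T)}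
    {c : Y} (hq : ∀ᵐ t ∂timeMeasure T, τ (u t) = prim q t)
    (hF : ∀ᵐ t ∂timeMeasure T, F t = c + prim F' t)
    (hu : ∀ φ : Lp V 2 (timeMeasure T), (∀ᵐ t ∂timeMeasure T, τ (φ t) = 0) →
      ∫ t in Ioo 0 T, inner ℝ (g (u t)) (g (φ t)) = ∫ t in Ioo 0 T, inner ℝ (F t) (v (φ t))) :
    ∃ (d : Lp Y 2 (timeMeasure T)) (c' : Y), (∀ᵐ t ∂timeMeasure T, v (u t) = c' + prim d t) ∧
      ‖d‖ ^ 2 ≤ C₁ ^ 2 * ‖q‖ ^ 2 + C₂ ^ 2 * ‖F'‖ ^ 2 := by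
  let N : Submodule ℝ V := LinearMap.ker τ.toLinearMap
  have hN : ∀ x : N, τ x = 0 := fun x => x.2
  have : CompleteSpace N := (τ.isClosed_ker).completeSpace_coe
  let gN : N →L[ℝ] X := g.comp N.subtypeL
  let vN : N →L[ℝ] Y := v.comp N.subtypeL
  -- the residual of the stationary equation, represented in `N`
  let R : ℝ → N := fun t => gN.adjoint (g (u t)) - vN.adjoint (F t)
  have hR : MemLp R 2 (timeMeasure T) :=
    (gN.adjoint.comp_memLp' (g.comp_memLp' (Lp.memLp u))).sub (vN.adjoint.comp_memLp' (Lp.memLp F))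
  have hRin : ∀ t (x : N), inner ℝ (R t) x = inner ℝ (g (u t)) (g x) - inner ℝ (F t) (v x) :=
    fun t x => by
      rw [inner_sub_left, ContinuousLinearMap.adjoint_inner_left,
        ContinuousLinearMap.adjoint_inner_left]
      rfl
  have hR0 : ∀ᵐ t ∂timeMeasure T, R t = 0 := by
    have hφ : MemLp (fun t => N.subtypeL (R t)) 2 (timeMeasure T) := N.subtypeL.comp_memLp' hR
    have hco := hφ.coeFn_toLp
    have k := hu (hφ.toLp _) (by filter_upwards [hco] with t ht; rw [ht]; exact hN (R t))
    have e₁ : ∫ t in Ioo 0 T, inner ℝ (g (u t)) (g (hφ.toLp _ t))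
        = ∫ t in Ioo 0 T, inner ℝ (g (u t)) (g (R t)) :=
      integral_congr_ae (by filter_upwards [hco] with t ht; rw [ht]; rfl)
    have e₂ : ∫ t in Ioo 0 T, inner ℝ (F t) (v (hφ.toLp _ t))
        = ∫ t in Ioo 0 T, inner ℝ (F t) (v (R t)) :=
      integral_congr_ae (by filter_upwards [hco] with t ht; rw [ht]; rfl)
    rw [e₁, e₂] at k
    have e₃ : ∫ t in Ioo 0 T, ‖R t‖ ^ 2 = 0 := by
      have : ∀ t, ‖R t‖ ^ 2 = inner ℝ (g (u t)) (g (R t)) - inner ℝ (F t) (v (R t)) := fun t => by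
        rw [← real_inner_self_eq_norm_sq, hRin]
      simp only [this]
      refine (integral_sub (integrable_inner (g.comp_memLp' (Lp.memLp u)) (g.comp_memLp' hφ))
        (integrable_inner (Lp.memLp F) (v.comp_memLp' hφ))).trans ?_
      exact sub_eq_zero.2 k
    rw [integral_eq_zero_iff_of_nonneg (fun t => sq_nonneg _) (integrable_norm_sq hR)] at e₃
    filter_upwards [e₃] with t ht
    exact norm_eq_zero.1 (pow_eq_zero_iff two_ne_zero |>.1 ht)
  -- the pairs of a stationary function and its source
  let Z : Submodule ℝ (V × Y) :=
    { carrier := {z | ∀ φ, τ φ = 0 → inner ℝ (g z.1) (g φ) = inner ℝ z.2 (v φ)}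
      add_mem' := fun {x y} hx hy φ hφ => by
        simp only [Prod.fst_add, Prod.snd_add, map_add, inner_add_left, hx φ hφ, hy φ hφ]
      zero_mem' := fun φ _ => by simp
      smul_mem' := fun r x hx φ hφ => by
        simp only [Prod.smul_fst, Prod.smul_snd, map_smul, real_inner_smul_left, hx φ hφ] }
  let J : S × Y →L[ℝ] WithLp 2 (S × Y) :=
    ((WithLp.prodContinuousLinearEquiv 2 ℝ S Y).symm : S × Y →L[ℝ] WithLp 2 (S × Y)).comp
      ((C₁ • ContinuousLinearMap.fst ℝ S Y).prod (C₂ • ContinuousLinearMap.snd ℝ S Y))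
  have hJ : ∀ x, ‖J x‖ ^ 2 = C₁ ^ 2 * ‖x.1‖ ^ 2 + C₂ ^ 2 * ‖x.2‖ ^ 2 := fun x => by
    have : ‖J x‖ ^ 2 = ‖C₁ • x.1‖ ^ 2 + ‖C₂ • x.2‖ ^ 2 := WithLp.prod_norm_sq_eq_of_L2 _
    rw [this, norm_smul, norm_smul, mul_pow, mul_pow, Real.norm_eq_abs, Real.norm_eq_abs, sq_abs,
      sq_abs]
  obtain ⟨Λ, hΛ, hΛn⟩ := exists_clm_comp_eq
    ((J.comp (τ.prodMap (ContinuousLinearMap.id ℝ Y))).toLinearMap ∘ₗ Z.subtype)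
    ((v.comp (ContinuousLinearMap.fst ℝ V Y)).toLinearMap ∘ₗ Z.subtype) fun z => by
      refine (sq_le_sq₀ (norm_nonneg _) (norm_nonneg _)).1 ?_
      exact (hreg z.1.1 z.1.2 z.2).trans (hJ (τ z.1.1, z.1.2)).ge
  let L : S × Y →L[ℝ] Y := Λ.comp J
  have hL : ∀ w F, (∀ φ, τ φ = 0 → inner ℝ (g w) (g φ) = inner ℝ F (v φ)) → L (τ w, F) = v w :=
    fun w F h => hΛ ⟨(w, F), h⟩
  have hqF : MemLp (fun t => (q t, F' t)) 2 (timeMeasure T) := by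
    refine (((Lp.memLp q).norm).add ((Lp.memLp F').norm)).of_le
      ((Lp.aestronglyMeasurable q).prodMk (Lp.aestronglyMeasurable F'))
      (Eventually.of_forall fun t => ?_)
    rw [Prod.norm_def, Pi.add_apply, Real.norm_of_nonneg (by positivity)]
    exact max_le_add_of_nonneg (norm_nonneg _) (norm_nonneg _)
  have hd : MemLp (fun t => L (q t, F' t)) 2 (timeMeasure T) := L.comp_memLp' hqF
  refine ⟨hd.toLp _, L (0, c), ?_, ?_⟩
  · filter_upwards [hR0, hq, hF, ae_restrict_mem measurableSet_Ioo] with t h0 h1 h2 ht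
    have hI := Ioo_subset_Icc_self ht
    have hi := hqF.integrable one_le_two
    have e₁ : prim (fun t => (q t, F' t)) t = (prim q t, prim F' t) :=
      Prod.ext (clm_prim (ContinuousLinearMap.fst ℝ S Y) hI hi)
        (clm_prim (ContinuousLinearMap.snd ℝ S Y) hI hi)
    rw [prim_congr hI hd.coeFn_toLp, ← clm_prim L hI hi, e₁, ← map_add, Prod.mk_add_mk, zero_add,
      ← h1, ← h2]
    refine (hL _ _ fun φ hφ => ?_).symm
    have k := hRin t ⟨φ, hφ⟩
    rw [h0, inner_zero_left] at k
    exact sub_eq_zero.1 k.symm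
  · rw [norm_sq_toLp, norm_sq_Lp, norm_sq_Lp, ← integral_const_mul, ← integral_const_mul,
      ← integral_add ((integrable_norm_sq (Lp.memLp q)).const_mul _)
        ((integrable_norm_sq (Lp.memLp F')).const_mul _)]
    refine integral_mono (integrable_norm_sq hd)
      (((integrable_norm_sq (Lp.memLp q)).const_mul _).add
        ((integrable_norm_sq (Lp.memLp F')).const_mul _)) fun t => ?_
    have := hΛn (J (q t, F' t))
    calc ‖L (q t, F' t)‖ ^ 2 ≤ ‖J (q t, F' t)‖ ^ 2 := by gcongr; exact this
      _ = _ := hJ _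

/-- Two solutions of an evolution equation with zero initial values agree. -/
theorem ae_eq_of_evolution [CompleteSpace V] (hT : 0 < T) (a b : V →L[ℝ] StrongDual ℝ V)
    (hasymm : ∀ v w, a v w = a w v) (ha0 : ∀ v, 0 ≤ a v v) (haz : ∀ v, a v v = 0 → v = 0)
    (hb0 : ∀ v, 0 ≤ b v v) (hbz : ∀ v, b v v = 0 → b v = 0) {u u' : ℝ → V}
    {w w' : ℝ → StrongDual ℝ V} (hu : MemLp u 2 (timeMeasure T)) (hu' : MemLp u' 2 (timeMeasure T))
    (hw : MemLp w 2 (timeMeasure T)) (hw' : MemLp w' 2 (timeMeasure T))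
    (hbw : ∀ᵐ t ∂timeMeasure T, b (u t) = prim w t)
    (hbw' : ∀ᵐ t ∂timeMeasure T, b (u' t) = prim w' t)
    (heq : ∀ φ : ℝ → V, MemLp φ 2 (timeMeasure T) →
      (∫ t in Ioo 0 T, w t (φ t)) + ∫ t in Ioo 0 T, a (u t) (φ t)
        = (∫ t in Ioo 0 T, w' t (φ t)) + ∫ t in Ioo 0 T, a (u' t) (φ t)) :
    u =ᵐ[timeMeasure T] u' := by
  have hpair : ∀ {z : ℝ → StrongDual ℝ V} {x : ℝ → V}, MemLp z 2 (timeMeasure T) →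
      MemLp x 2 (timeMeasure T) → Integrable (fun t => z t (x t)) (timeMeasure T) :=
    fun hz hx => memLp_one_iff_integrable.1
      ((ContinuousLinearMap.id ℝ (StrongDual ℝ V)).memLp_of_bilin 1 hz hx)
  have h := ae_eq_zero_of_evolution hT a b hasymm ha0 haz hb0 hbz (hu.sub hu') (hw.sub hw') (by
    filter_upwards [hbw, hbw', ae_restrict_mem measurableSet_Ioo] with t h1 h2 ht
    have hI := Ioo_subset_Icc_self ht
    have i₁ := integrable_Ioo_mono hI.2 (hw.integrable one_le_two)
    have i₂ := integrable_Ioo_mono hI.2 (hw'.integrable one_le_two)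
    rw [Pi.sub_apply, map_sub, h1, h2, prim_eq_setIntegral _ ht.1.le, prim_eq_setIntegral _ ht.1.le,
      prim_eq_setIntegral _ ht.1.le, ← integral_sub i₁ i₂]
    rfl) (fun φ hφ => by
    have had : MemLp (fun t => a (u t)) 2 (timeMeasure T) := a.comp_memLp' hu
    have had' : MemLp (fun t => a (u' t)) 2 (timeMeasure T) := a.comp_memLp' hu'
    have k := heq φ hφ
    simp only [Pi.sub_apply, map_sub, sub_apply]
    rw [integral_sub (hpair hw hφ) (hpair hw' hφ), integral_sub (hpair had hφ) (hpair had' hφ)]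
    linarith)
  filter_upwards [h] with t ht
  exact sub_eq_zero.1 ht

end TwoMasses

/-! ### Weak solutions as operator equations -/

section OperatorForm

variable {V Q Y S : Type*} [NormedAddCommGroup V] [InnerProductSpace ℝ V]
  [NormedAddCommGroup Q] [NormedSpace ℝ Q]
  [NormedAddCommGroup Y] [InnerProductSpace ℝ Y]
  [NormedAddCommGroup S] [InnerProductSpace ℝ S] {T : ℝ}

/-- A family of functionals that is the primitive of another one has that one as distributional
derivative. -/
theorem isTimeDeriv_of_prim {V : Type*} (hT : 0 < T) {y w : ℝ → V → ℝ}
    (hw : ∀ φ, Integrable (fun t => w t φ) (timeMeasure T))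
    (hy : ∀ φ, ∀ᵐ t ∂timeMeasure T, y t φ = prim (fun s => w s φ) t) : IsTimeDeriv T y w := by
  intro φ η hη _ hs
  have k := integral_deriv_smul_prim hT.le (hw φ) hη hs
  simp only [smul_eq_mul] at k
  simp only [mul_comm (w _ φ)]
  rw [← k]
  refine integral_congr_ae ?_
  filter_upwards [hy φ] with t ht
  rw [ht, mul_comm]

/-- A multiple of a curve which vanishes initially, paired with test functions, has the expected
distributional time derivative. -/
theorem isTimeDeriv_innerPull [CompleteSpace Y] (hT : 0 < T) (L : V →L[ℝ] Y)
    {y p : ℝ → Y} (hp : Integrable p (timeMeasure T)) {α a : ℝ}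
    (hy : ∀ᵐ t ∂timeMeasure T, α • y t = a • prim p t) :
    IsTimeDeriv T (fun t φ => α * inner ℝ (y t) (L φ)) (fun t φ => a * inner ℝ (p t) (L φ)) := by
  have hc : ∀ φ, (fun s => a * inner ℝ (p s) (L φ))
      = fun s => (a • ((innerSL ℝ).flip (L φ) : Y →L[ℝ] ℝ)) (p s) := fun φ => rfl
  refine isTimeDeriv_of_prim hT (fun φ => ?_) fun φ => ?_
  · rw [hc]
    exact ContinuousLinearMap.integrable_comp _ hp
  · filter_upwards [hy, ae_restrict_mem measurableSet_Ioo] with t h1 ht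
    rw [hc, ← clm_prim _ (Ioo_subset_Icc_self ht) hp]
    change _ = a * inner ℝ (prim p t) (L φ)
    rw [← real_inner_smul_left, h1, real_inner_smul_left]

/-- Weak time derivatives tested with scalar functions are weak derivatives in the dual space. -/
theorem integral_smul_operator_form (v : V →L[ℝ] Y) (τ : V →L[ℝ] S) (mk : V →L[ℝ] Q)
    {α β : ℝ} (e : ℝ) {u : ℝ → V} (hu : Integrable u (timeMeasure T)) {w₁ : ℝ → StrongDual ℝ V}
    {w₂ : ℝ → StrongDual ℝ Q} (hw₁ : Integrable w₁ (timeMeasure T))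
    (hw₂ : Integrable w₂ (timeMeasure T)) {η : ℝ → ℝ} (hη : ContDiff ℝ ∞ η)
    (k₁ : ∀ φ, ∫ t in Ioo 0 T, α * inner ℝ (v (u t)) (v φ) * deriv η t
      = -∫ t in Ioo 0 T, w₁ t φ * η t)
    (k₂ : ∀ φ, ∫ t in Ioo 0 T, β * inner ℝ (τ (u t)) (τ φ) * deriv η t
      = -∫ t in Ioo 0 T, w₂ t (mk φ) * η t) :
    ∫ t in Ioo 0 T, deriv η t • (α • (innerPull v).comp v + (e * β) • (innerPull τ).comp τ) (u t)
      = -∫ t in Ioo 0 T, η t • (w₁ t + e • (ContinuousLinearMap.compL ℝ V Q ℝ).flip mk (w₂ t)) := by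
  have hd := hη.continuous_deriv (by simp)
  have i₁ : Integrable (fun t => deriv η t •
      (α • (innerPull v).comp v + (e * β) • (innerPull τ).comp τ) (u t)) (timeMeasure T) :=
    integrable_smul_of_continuous (ContinuousLinearMap.integrable_comp _ hu) hd
  have hPw : Integrable (fun t => (ContinuousLinearMap.compL ℝ V Q ℝ).flip mk (w₂ t))
      (timeMeasure T) := ContinuousLinearMap.integrable_comp _ hw₂
  have i₂ : Integrable (fun t => η t • (w₁ t + e • (ContinuousLinearMap.compL ℝ V Q ℝ).flip mk
      (w₂ t))) (timeMeasure T) :=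
    integrable_smul_of_continuous (hw₁.add (hPw.smul e)) hη.continuous
  ext φ
  have iv : Integrable (fun t => deriv η t • inner ℝ (v (u t)) (v φ)) (timeMeasure T) :=
    integrable_smul_of_continuous ((((innerPull v).comp v).flip φ).integrable_comp hu) hd
  have iτ : Integrable (fun t => deriv η t • inner ℝ (τ (u t)) (τ φ)) (timeMeasure T) :=
    integrable_smul_of_continuous ((((innerPull τ).comp τ).flip φ).integrable_comp hu) hd
  have j₁ : Integrable (fun t => η t • w₁ t φ) (timeMeasure T) :=
    integrable_smul_of_continuous ((ContinuousLinearMap.apply ℝ ℝ φ).integrable_comp hw₁)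
      hη.continuous
  have j₂ : Integrable (fun t => η t • w₂ t (mk φ)) (timeMeasure T) :=
    integrable_smul_of_continuous ((ContinuousLinearMap.apply ℝ ℝ (mk φ)).integrable_comp hw₂)
      hη.continuous
  have l : ∫ t in Ioo 0 T, (ContinuousLinearMap.apply ℝ ℝ φ) (deriv η t •
      (α • (innerPull v).comp v + (e * β) • (innerPull τ).comp τ) (u t))
      = (∫ t in Ioo 0 T, α * inner ℝ (v (u t)) (v φ) * deriv η t)
        + e * ∫ t in Ioo 0 T, β * inner ℝ (τ (u t)) (τ φ) * deriv η t := by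
    rw [← integral_const_mul, ← integral_add]
    · refine integral_congr_ae (Eventually.of_forall fun t => ?_)
      change deriv η t * (α * inner ℝ (v (u t)) (v φ) + e * β * inner ℝ (τ (u t)) (τ φ)) = _
      ring
    · refine (iv.const_mul α).congr (Eventually.of_forall fun t => ?_)
      simp only [smul_eq_mul]
      ring
    · refine (iτ.const_mul (e * β)).congr (Eventually.of_forall fun t => ?_)
      simp only [smul_eq_mul]
      ring
  have r : ∫ t in Ioo 0 T, (ContinuousLinearMap.apply ℝ ℝ φ)
      (η t • (w₁ t + e • (ContinuousLinearMap.compL ℝ V Q ℝ).flip mk (w₂ t)))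
      = (∫ t in Ioo 0 T, w₁ t φ * η t) + e * ∫ t in Ioo 0 T, w₂ t (mk φ) * η t := by
    rw [← integral_const_mul, ← integral_add]
    · refine integral_congr_ae (Eventually.of_forall fun t => ?_)
      change η t * (w₁ t φ + e * w₂ t (mk φ)) = _
      ring
    · refine j₁.congr (Eventually.of_forall fun t => ?_)
      simp only [smul_eq_mul]
      ring
    · refine (j₂.const_mul e).congr (Eventually.of_forall fun t => ?_)
      simp only [smul_eq_mul]
      ring
  rw [neg_apply]
  refine ((ContinuousLinearMap.apply ℝ ℝ φ).integral_comp_comm i₁).symm.trans ?_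
  refine Eq.trans ?_ (congrArg Neg.neg ((ContinuousLinearMap.apply ℝ ℝ φ).integral_comp_comm i₂))
  rw [l, k₁, k₂, r]
  ring

theorem memLp_add_smul {A : Type*} [NormedAddCommGroup A] [NormedSpace ℝ A] {f g : ℝ → A}
    (hf : MemLp f 2 (timeMeasure T)) (hg : MemLp g 2 (timeMeasure T)) (e : ℝ) :
    MemLp (fun t => f t + e • g t) 2 (timeMeasure T) := hf.add (hg.const_smul e)

/-- The operator form of the time derivatives in the interior and on the boundary. -/
theorem exists_operator_form [CompleteSpace V] [CompleteSpace Y] [CompleteSpace S] (hT : 0 < T)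
    (v : V →L[ℝ] Y) (τ : V →L[ℝ] S) (mk : V →L[ℝ] Q) {α β : ℝ} (e : ℝ) {u : ℝ → V}
    (hu : MemLp u 2 (timeMeasure T)) (h₁ : HasZeroInitialValue T fun t => α • v (u t))
    (h₂ : HasZeroInitialValue T fun t => β • τ (u t)) {w₁ : ℝ → StrongDual ℝ V}
    {w₂ : ℝ → StrongDual ℝ Q} (hw₁ : MemLp w₁ 2 (timeMeasure T)) (hw₂ : MemLp w₂ 2 (timeMeasure T))
    (hd₁ : IsTimeDeriv T (fun t φ => α * inner ℝ (v (u t)) (v φ)) fun t φ => w₁ t φ)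
    (hd₂ : IsTimeDeriv T (fun t φ => β * inner ℝ (τ (u t)) (τ φ)) fun t φ => w₂ t (mk φ)) :
    ∃ w : ℝ → StrongDual ℝ V, MemLp w 2 (timeMeasure T) ∧
      (∀ᵐ t ∂timeMeasure T,
        (α • (innerPull v).comp v + (e * β) • (innerPull τ).comp τ) (u t) = prim w t) ∧
      ∀ φ : ℝ → V, MemLp φ 2 (timeMeasure T) → ∫ t in Ioo 0 T, w t (φ t)
        = (∫ t in Ioo 0 T, w₁ t (φ t)) + e * ∫ t in Ioo 0 T, w₂ t (mk (φ t)) := by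
  obtain ⟨Y₁, hY₁, hy₁, hz₁⟩ := h₁
  obtain ⟨Y₂, hY₂, hy₂, hz₂⟩ := h₂
  have hPw : MemLp (fun t => (ContinuousLinearMap.compL ℝ V Q ℝ).flip mk (w₂ t)) 2 (timeMeasure T) :=
    ContinuousLinearMap.comp_memLp' _ hw₂
  have hw : MemLp (fun t => w₁ t + e • (ContinuousLinearMap.compL ℝ V Q ℝ).flip mk (w₂ t)) 2
      (timeMeasure T) := memLp_add_smul hw₁ hPw e
  have hpair : ∀ {z : ℝ → StrongDual ℝ V} {x : ℝ → V}, MemLp z 2 (timeMeasure T) →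
      MemLp x 2 (timeMeasure T) → Integrable (fun t => z t (x t)) (timeMeasure T) :=
    fun hz hx => memLp_one_iff_integrable.1
      ((ContinuousLinearMap.id ℝ (StrongDual ℝ V)).memLp_of_bilin 1 hz hx)
  refine ⟨fun t => w₁ t + e • (ContinuousLinearMap.compL ℝ V Q ℝ).flip mk (w₂ t), hw, ?_, fun φ hφ => ?_⟩
  · refine ae_eq_prim_of_zero_initial hT (hw.integrable one_le_two)
      (Y := fun t => innerPull v (Y₁ t) + e • innerPull τ (Y₂ t))
      (((innerPull v).continuous.comp_continuousOn hY₁).add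
        (((innerPull τ).continuous.comp_continuousOn hY₂).const_smul e)) ?_ ?_ ?_
    · filter_upwards [hy₁, hy₂] with t k₁ k₂
      rw [k₁, k₂, map_smul, map_smul, smul_smul]
      rfl
    · simp only [hz₁, hz₂, map_zero, smul_zero, add_zero]
    · intro η hη hc hs
      exact integral_smul_operator_form v τ mk e (hu.integrable one_le_two)
        (hw₁.integrable one_le_two) (hw₂.integrable one_le_two) hη (fun φ => hd₁ φ η hη hc hs)
        fun φ => hd₂ φ η hη hc hs
  · rw [← integral_const_mul]
    exact integral_add (hpair hw₁ hφ) ((hpair hPw hφ).const_mul e)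

end OperatorForm

section TwoMassForms

variable {V X Y S : Type*} [NormedAddCommGroup V] [InnerProductSpace ℝ V]
  [NormedAddCommGroup X] [InnerProductSpace ℝ X]
  [NormedAddCommGroup Y] [InnerProductSpace ℝ Y]
  [NormedAddCommGroup S] [InnerProductSpace ℝ S] {T : ℝ}

/-- The bilinear form `a ⟨P u, P φ⟩ + b ⟨R u, R φ⟩`. -/
def sumForm (P : V →L[ℝ] X) (R : V →L[ℝ] S) (a b : ℝ) : V →L[ℝ] StrongDual ℝ V :=
  a • (innerPull P).comp P + b • (innerPull R).comp R

theorem sumForm_apply (P : V →L[ℝ] X) (R : V →L[ℝ] S) (a b : ℝ) (u φ : V) :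
    sumForm P R a b u φ = a * inner ℝ (P u) (P φ) + b * inner ℝ (R u) (R φ) := rfl

theorem sumForm_self (P : V →L[ℝ] X) (R : V →L[ℝ] S) (a b : ℝ) (u : V) :
    sumForm P R a b u u = a * ‖P u‖ ^ 2 + b * ‖R u‖ ^ 2 := by
  rw [sumForm_apply, real_inner_self_eq_norm_sq, real_inner_self_eq_norm_sq]

theorem sumForm_eq_zero (P : V →L[ℝ] X) (R : V →L[ℝ] S) {a b : ℝ} (ha : 0 ≤ a) (hb : 0 ≤ b)
    {u : V} (hu : sumForm P R a b u u = 0) : sumForm P R a b u = 0 := by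
  rw [sumForm_self] at hu
  have h1 : 0 ≤ a * ‖P u‖ ^ 2 := by positivity
  have h2 : 0 ≤ b * ‖R u‖ ^ 2 := by positivity
  have h3 : a * ‖P u‖ ^ 2 = 0 := by linarith
  have h4 : b * ‖R u‖ ^ 2 = 0 := by linarith
  ext φ
  rw [sumForm_apply]
  have e₁ : a * inner ℝ (P u) (P φ) = 0 := by
    rcases mul_eq_zero.1 h3 with h | h
    · rw [h, zero_mul]
    · rw [norm_eq_zero.1 (pow_eq_zero_iff two_ne_zero |>.1 h), inner_zero_left, mul_zero]
  have e₂ : b * inner ℝ (R u) (R φ) = 0 := by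
    rcases mul_eq_zero.1 h4 with h | h
    · rw [h, zero_mul]
    · rw [norm_eq_zero.1 (pow_eq_zero_iff two_ne_zero |>.1 h), inner_zero_left, mul_zero]
  rw [e₁, e₂, add_zero]
  rfl

theorem integral_sumForm (P : V →L[ℝ] X) (R : V →L[ℝ] S) (a b : ℝ) {u φ : ℝ → V}
    (hu : MemLp u 2 (timeMeasure T)) (hφ : MemLp φ 2 (timeMeasure T)) :
    ∫ t in Ioo 0 T, sumForm P R a b (u t) (φ t)
      = a * (∫ t in Ioo 0 T, inner ℝ (P (u t)) (P (φ t)))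
        + b * ∫ t in Ioo 0 T, inner ℝ (R (u t)) (R (φ t)) := by
  rw [← integral_const_mul, ← integral_const_mul]
  exact integral_add ((integrable_inner (P.comp_memLp' hu) (P.comp_memLp' hφ)).const_mul a)
    ((integrable_inner (R.comp_memLp' hu) (R.comp_memLp' hφ)).const_mul b)

/-- Uniqueness for the equation with the mass `sumForm v τ α m` and the energy
`sumForm g τ 1 s`. -/
theorem ae_eq_of_sumForm [CompleteSpace V] (hT : 0 < T) (v : V →L[ℝ] Y) (g : V →L[ℝ] X)
    (τ : V →L[ℝ] S) {α m s : ℝ} (hα : 0 ≤ α) (hm : 0 ≤ m) (hs : 0 ≤ s)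
    (hinj : ∀ u, ‖g u‖ ^ 2 + s * ‖τ u‖ ^ 2 = 0 → u = 0) {u u' : ℝ → V}
    {w w' : ℝ → StrongDual ℝ V} (hu : MemLp u 2 (timeMeasure T)) (hu' : MemLp u' 2 (timeMeasure T))
    (hw : MemLp w 2 (timeMeasure T)) (hw' : MemLp w' 2 (timeMeasure T))
    (hbw : ∀ᵐ t ∂timeMeasure T, sumForm v τ α m (u t) = prim w t)
    (hbw' : ∀ᵐ t ∂timeMeasure T, sumForm v τ α m (u' t) = prim w' t)
    (heq : ∀ φ : ℝ → V, MemLp φ 2 (timeMeasure T) →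
      (∫ t in Ioo 0 T, w t (φ t)) + (∫ t in Ioo 0 T, inner ℝ (g (u t)) (g (φ t)))
          + s * (∫ t in Ioo 0 T, inner ℝ (τ (u t)) (τ (φ t)))
        = (∫ t in Ioo 0 T, w' t (φ t)) + (∫ t in Ioo 0 T, inner ℝ (g (u' t)) (g (φ t)))
          + s * (∫ t in Ioo 0 T, inner ℝ (τ (u' t)) (τ (φ t)))) :
    u =ᵐ[timeMeasure T] u' := by
  refine ae_eq_of_evolution hT (sumForm g τ 1 s) (sumForm v τ α m) (fun x y => ?_) (fun x => ?_)
    (fun x hx => hinj x ?_) (fun x => ?_) (fun x hx => sumForm_eq_zero v τ hα hm hx) hu hu' hw hw'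
    hbw hbw' fun φ hφ => ?_
  · rw [sumForm_apply, sumForm_apply, real_inner_comm, real_inner_comm (τ x)]
  · rw [sumForm_self]
    positivity
  · rw [sumForm_self, one_mul] at hx
    exact hx
  · rw [sumForm_self]
    positivity
  · rw [integral_sumForm g τ 1 s hu hφ, integral_sumForm g τ 1 s hu' hφ, one_mul, one_mul,
      ← add_assoc, ← add_assoc]
    exact heq φ hφ

/-- Uniqueness for the weak formulation with separate time derivatives in the interior and on
the boundary. -/
theorem ae_eq_of_dual_form {Q : Type*} [NormedAddCommGroup Q] [NormedSpace ℝ Q] [CompleteSpace V]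
    [CompleteSpace Y] [CompleteSpace S]
    (hT : 0 < T) (v : V →L[ℝ] Y) (g : V →L[ℝ] X)
    (τ : V →L[ℝ] S) (mk : V →L[ℝ] Q) {α β e s : ℝ} (hα : 0 ≤ α) (hβ : 0 ≤ β) (he : 0 ≤ e)
    (hs : 0 ≤ s) (hinj : ∀ u, ‖g u‖ ^ 2 + s * ‖τ u‖ ^ 2 = 0 → u = 0) {u u' : ℝ → V}
    (hu : IsL2Bochner T u) (hu' : IsL2Bochner T u')
    (h₁ : HasZeroInitialValue T fun t => α • v (u t))
    (h₁' : HasZeroInitialValue T fun t => α • v (u' t))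
    (h₂ : HasZeroInitialValue T fun t => β • τ (u t))
    (h₂' : HasZeroInitialValue T fun t => β • τ (u' t))
    {w₁ w₁' : ℝ → StrongDual ℝ V} {w₂ w₂' : ℝ → StrongDual ℝ Q}
    (hw₁ : IsL2Bochner T w₁) (hw₁' : IsL2Bochner T w₁')
    (hw₂ : IsL2Bochner T w₂) (hw₂' : IsL2Bochner T w₂')
    (hd₁ : IsTimeDeriv T (fun t φ => α * inner ℝ (v (u t)) (v φ)) fun t φ => w₁ t φ)
    (hd₁' : IsTimeDeriv T (fun t φ => α * inner ℝ (v (u' t)) (v φ)) fun t φ => w₁' t φ)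
    (hd₂ : IsTimeDeriv T (fun t φ => β * inner ℝ (τ (u t)) (τ φ)) fun t φ => w₂ t (mk φ))
    (hd₂' : IsTimeDeriv T (fun t φ => β * inner ℝ (τ (u' t)) (τ φ)) fun t φ => w₂' t (mk φ))
    (heq : ∀ φ : ℝ → V, IsL2Bochner T φ →
      (∫ t in Ioo 0 T, w₁ t (φ t)) + e * (∫ t in Ioo 0 T, w₂ t (mk (φ t)))
          + (∫ t in Ioo 0 T, inner ℝ (g (u t)) (g (φ t)))
          + s * (∫ t in Ioo 0 T, inner ℝ (τ (u t)) (τ (φ t)))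
        = (∫ t in Ioo 0 T, w₁' t (φ t)) + e * (∫ t in Ioo 0 T, w₂' t (mk (φ t)))
          + (∫ t in Ioo 0 T, inner ℝ (g (u' t)) (g (φ t)))
          + s * (∫ t in Ioo 0 T, inner ℝ (τ (u' t)) (τ (φ t)))) :
    u =ᵐ[timeMeasure T] u' := by
  obtain ⟨w, k1, k2, k3⟩ := exists_operator_form hT v τ mk e hu h₁ h₂ hw₁ hw₂ hd₁ hd₂
  obtain ⟨w', k1', k2', k3'⟩ := exists_operator_form hT v τ mk e hu' h₁' h₂' hw₁' hw₂' hd₁' hd₂'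
  exact ae_eq_of_sumForm hT v g τ hα (mul_nonneg he hβ) hs hinj hu hu' k1 k1' k2 k2' fun φ hφ => by
    rw [k3 φ hφ, k3' φ hφ]
    exact heq φ hφ

theorem integral_mul_Lp {X : Type*} [MeasurableSpace X] {μ : Measure X} (f g : Lp ℝ 2 μ) :
    ∫ x, f x * g x ∂μ = inner ℝ f g := by
  rw [L2.inner_def]
  refine integral_congr_ae (Eventually.of_forall fun x => ?_)
  change _ = g x * f x
  exact mul_comm _ _

end TwoMassForms

section SurfaceDual

variable {n : ℕ} {Ω : Set (E n)} {C₀ ε M b : ℝ} {ψ κ : E n → ℝ}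

/-- The trace as a continuous linear map into `H^{1/2}`. -/
def traceHalfL (Ω : Set (E n)) (C₀ ε : ℝ) : Vε Ω C₀ ε →L[ℝ] HHalfS Ω C₀ ε :=
  (traceKer Ω (perforated Ω C₀ ε) (surfaceMeasure Ω C₀ ε)).mkQL

theorem traceHalfL_apply (φ : Vε Ω C₀ ε) : traceHalfL Ω C₀ ε φ = trHalf φ := rfl

/-- The embedding of `H^{1/2}` into `L²` of the surface. -/
def IsBarrier.halfToLp (h : Admissible Ω C₀ ε) (hB : IsBarrier Ω C₀ ε M b ψ κ) :
    HHalfS Ω C₀ ε →L[ℝ] Lp ℝ 2 (surfaceMeasure Ω C₀ ε) :=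
  (traceKer Ω (perforated Ω C₀ ε) (surfaceMeasure Ω C₀ ε)).liftQL (hB.traceL h)
    fun _ hu => (hB.mem_traceKer h).1 hu

theorem IsBarrier.halfToLp_trHalf (h : Admissible Ω C₀ ε) (hB : IsBarrier Ω C₀ ε M b ψ κ)
    (φ : Vε Ω C₀ ε) : hB.halfToLp h (trHalf φ) = hB.traceL h φ := rfl

end SurfaceDual

section TwoMassExistence

variable {V X Y S : Type*} [NormedAddCommGroup V] [InnerProductSpace ℝ V]
  [NormedAddCommGroup X] [InnerProductSpace ℝ X] [NormedAddCommGroup Y] [InnerProductSpace ℝ Y]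
  [NormedAddCommGroup S] [InnerProductSpace ℝ S] {T : ℝ}

theorem curveFunctional_toLp {V Z : Type*} [NormedAddCommGroup V] [InnerProductSpace ℝ V]
    [NormedAddCommGroup Z] [InnerProductSpace ℝ Z] (κ : V →L[ℝ] Z) (H : Lp Z 2 (timeMeasure T))
    {φ : ℝ → V} (hφ : MemLp φ 2 (timeMeasure T)) :
    curveFunctional κ H (hφ.toLp φ) = ∫ t in Ioo 0 T, inner ℝ (H t) (κ (φ t)) := by
  rw [curveFunctional_apply]
  refine integral_congr_ae ?_
  filter_upwards [hφ.coeFn_toLp] with t ht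
  rw [ht]

theorem norm_sq_compLp {V Z : Type*} [NormedAddCommGroup V] [InnerProductSpace ℝ V]
    [NormedAddCommGroup Z] [InnerProductSpace ℝ Z] (L : V →L[ℝ] Z) (u : Lp V 2 (timeMeasure T)) :
    ‖L.compLp u‖ ^ 2 = ∫ t in Ioo 0 T, ‖L (u t)‖ ^ 2 := by
  rw [norm_sq_Lp]
  refine integral_congr_ae ?_
  filter_upwards [L.coeFn_compLp u] with t ht
  rw [ht]

/-- The curve `u` solves `(a² v*v + b² τ*τ) u' + (g*g + s² τ*τ) u = v* F + e τ* G` with zero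
initial values; here `p₁` and `p₂` are the derivatives of `a • v u` and of `b • τ u`. -/
structure SolvesEvolution (v : V →L[ℝ] Y) (g : V →L[ℝ] X) (τ : V →L[ℝ] S)
    (a b s e : ℝ) (F : Lp Y 2 (timeMeasure T)) (G : Lp S 2 (timeMeasure T))
    (u : Lp V 2 (timeMeasure T)) (p₁ : Lp Y 2 (timeMeasure T)) (p₂ : Lp S 2 (timeMeasure T)) :
    Prop where
  eq_prim₁ : ∀ᵐ t ∂timeMeasure T, a • v (u t) = prim p₁ t
  eq_prim₂ : ∀ᵐ t ∂timeMeasure T, b • τ (u t) = prim p₂ t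
  eq : ∀ φ : ℝ → V, MemLp φ 2 (timeMeasure T) →
    a * (∫ t in Ioo 0 T, inner ℝ (p₁ t) (v (φ t)))
      + b * (∫ t in Ioo 0 T, inner ℝ (p₂ t) (τ (φ t)))
      + (∫ t in Ioo 0 T, inner ℝ (g (u t)) (g (φ t)))
      + s ^ 2 * (∫ t in Ioo 0 T, inner ℝ (τ (u t)) (τ (φ t)))
      = (∫ t in Ioo 0 T, inner ℝ (F t) (v (φ t)))
        + e * ∫ t in Ioo 0 T, inner ℝ (G t) (τ (φ t))

/-- Existence of a solution of the evolution equation with source `F` and boundary source `G`,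
with bounds depending only on the size of these and on the Poincaré constant `P`. The constant
`K` is a bound for the functional of the source `F`. -/
theorem exists_two_mass_evolution [CompleteSpace V] [CompleteSpace X] [CompleteSpace Y]
    [CompleteSpace S] (hT : 0 < T) (v : V →L[ℝ] Y) (g : V →L[ℝ] X) (τ : V →L[ℝ] S)
    (a b : ℝ) {s e P K : ℝ} (hs : 0 < s) (he : 0 ≤ e) (hK : 0 ≤ K)
    (hV : ∀ u, ‖u‖ ^ 2 = ‖v u‖ ^ 2 + ‖g u‖ ^ 2)
    (hP : ∀ u, ‖v u‖ ^ 2 ≤ P ^ 2 * (‖g u‖ ^ 2 + s ^ 2 * ‖τ u‖ ^ 2))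
    (F : Lp Y 2 (timeMeasure T))
    (hF : ∀ w : C(ℝ, V), |curveFunctional v F (contToLp V T (mulWeight V T w))|
      ≤ K * weightNorm v g τ a b s T w)
    {G G' : Lp S 2 (timeMeasure T)} {c : S} (hG : ∀ᵐ t ∂timeMeasure T, G t = c + prim G' t)
    {M : ℝ} (hM : K + e * (timeConst T * (‖G‖ + ‖G'‖) * s⁻¹) ≤ M) :
    ∃ (u : Lp V 2 (timeMeasure T)) (p₁ : Lp Y 2 (timeMeasure T)) (p₂ : Lp S 2 (timeMeasure T)),
      SolvesEvolution v g τ a b s e F G u p₁ p₂ ∧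
      ‖g.compLp u‖ ^ 2 ≤ (2 * M) ^ 2 ∧ ‖v.compLp u‖ ^ 2 ≤ P ^ 2 * (2 * M) ^ 2 ∧
      ‖p₁‖ ≤ 2 * M ∧ ‖p₂‖ ≤ 2 * M := by
  have htc := timeConst_pos hT
  have hM0 : 0 ≤ M := le_trans (by positivity) hM
  have hτ : ∀ u, ‖τ u‖ ^ 2 ≤ s⁻¹ ^ 2 * (‖g u‖ ^ 2 + s ^ 2 * ‖τ u‖ ^ 2) := fun u => by
    have : s⁻¹ ^ 2 * (s ^ 2 * ‖τ u‖ ^ 2) = ‖τ u‖ ^ 2 := by field_simp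
    have h2 : 0 ≤ s⁻¹ ^ 2 * ‖g u‖ ^ 2 := by positivity
    linarith
  obtain ⟨u, p₁, p₂, h1, h2, h3, h4, h5, h6⟩ := exists_evolution_pair v g τ a b s
    (c := P ^ 2 + 1) (fun u => by
      have := hP u
      have : 0 ≤ s ^ 2 * ‖τ u‖ ^ 2 := by positivity
      rw [hV]
      linarith) hT (curveFunctional v F + e • curveFunctional τ G) hM0 fun w => by
    change _ ≤ M * weightNorm v g τ a b s T w
    have hN : 0 ≤ weightNorm v g τ a b s T w := Real.sqrt_nonneg _
    have k1 := hF w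
    have k2 := (abs_curveFunctional_weight_le_of_deriv hT τ hG w).trans
      (mul_le_mul_of_nonneg_left (sqrt_prim_le_weightNorm v g τ a b s hT τ
        (inv_nonneg.2 hs.le) hτ w) (by positivity))
    rw [add_apply, smul_apply, smul_eq_mul]
    refine (abs_add_le _ _).trans ?_
    rw [abs_mul, abs_of_nonneg he]
    calc _ ≤ K * weightNorm v g τ a b s T w + e * (timeConst T * (‖G‖ + ‖G'‖)
          * (s⁻¹ * weightNorm v g τ a b s T w)) := by gcongr
      _ = (K + e * (timeConst T * (‖G‖ + ‖G'‖) * s⁻¹)) * weightNorm v g τ a b s T w := by ring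
      _ ≤ _ := by gcongr
  have hu := Lp.memLp u
  have ig := integrable_norm_sq (g.comp_memLp' hu)
  have iv := integrable_norm_sq (v.comp_memLp' hu)
  have iτ := integrable_norm_sq (τ.comp_memLp' hu)
  refine ⟨u, p₁, p₂, ⟨h1, h2, fun φ hφ => ?_⟩, ?_, ?_, h5, h6⟩
  · have k := h3 (hφ.toLp φ)
    rw [add_apply, smul_apply, curveFunctional_toLp, curveFunctional_toLp, smul_eq_mul] at k
    rw [← k, ← integral_const_mul, ← integral_const_mul, ← integral_const_mul, add_assoc]
    congr 1
    · refine (integral_add ((integrable_inner (Lp.memLp p₁) (v.comp_memLp' hφ)).const_mul a)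
        ((integrable_inner (Lp.memLp p₂) (τ.comp_memLp' hφ)).const_mul b)).symm.trans ?_
      refine integral_congr_ae ?_
      filter_upwards [hφ.coeFn_toLp] with t ht
      rw [ht]
      rfl
    · refine (integral_add (integrable_inner (g.comp_memLp' hu) (g.comp_memLp' hφ))
        ((integrable_inner (τ.comp_memLp' hu) (τ.comp_memLp' hφ)).const_mul _)).symm.trans ?_
      refine integral_congr_ae ?_
      filter_upwards [hφ.coeFn_toLp] with t ht
      rw [ht]
      rfl
  · rw [norm_sq_compLp]
    refine le_trans (integral_mono ig (ig.add (iτ.const_mul _)) fun t => ?_) h4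
    exact le_add_of_nonneg_right (by positivity)
  · rw [norm_sq_compLp]
    refine le_trans (integral_mono iv ((ig.add (iτ.const_mul _)).const_mul (P ^ 2))
      fun t => hP _) ?_
    rw [integral_const_mul]
    gcongr
    exact h4

/-- With mass in the interior, a square-integrable source is admissible. -/
theorem abs_curveFunctional_le_weightNorm (hT : 0 < T) (v : V →L[ℝ] Y) (g : V →L[ℝ] X)
    (τ : V →L[ℝ] S) {a : ℝ} (b s : ℝ) (ha : 0 < a) (F : Lp Y 2 (timeMeasure T)) (w : C(ℝ, V)) :
    |curveFunctional v F (contToLp V T (mulWeight V T w))|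
      ≤ (1 + T) * ‖F‖ * a⁻¹ * weightNorm v g τ a b s T w := by
  refine (abs_curveFunctional_weight_le hT v F w).trans ?_
  rw [mul_assoc ((1 + T) * ‖F‖)]
  gcongr
  exact sqrt_integral_le_weightNorm v g τ a b s ha le_rfl w

/-- Without mass in the interior, a source with a square-integrable time derivative is admissible,
because the energy controls `v` by the Poincaré inequality. -/
theorem abs_curveFunctional_le_weightNorm_of_deriv [CompleteSpace V] [CompleteSpace Y]
    (hT : 0 < T) (v : V →L[ℝ] Y) (g : V →L[ℝ] X) (τ : V →L[ℝ] S) (a b s : ℝ) {P : ℝ} (hP0 : 0 ≤ P)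
    (hP : ∀ u, ‖v u‖ ^ 2 ≤ P ^ 2 * (‖g u‖ ^ 2 + s ^ 2 * ‖τ u‖ ^ 2))
    {F F' : Lp Y 2 (timeMeasure T)} {c : Y} (hF : ∀ᵐ t ∂timeMeasure T, F t = c + prim F' t)
    (w : C(ℝ, V)) :
    |curveFunctional v F (contToLp V T (mulWeight V T w))|
      ≤ timeConst T * (‖F‖ + ‖F'‖) * P * weightNorm v g τ a b s T w := by
  have := timeConst_pos hT
  refine (abs_curveFunctional_weight_le_of_deriv hT v hF w).trans ?_
  rw [mul_assoc (timeConst T * (‖F‖ + ‖F'‖))]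
  gcongr
  exact sqrt_prim_le_weightNorm v g τ a b s hT v hP0 hP w

/-- With mass in the interior, the time derivative of `v u` is `a⁻¹ p₁`. -/
theorem SolvesEvolution.exists_deriv_of_pos [CompleteSpace Y]
    {v : V →L[ℝ] Y} {g : V →L[ℝ] X} {τ : V →L[ℝ] S}
    {a b s e : ℝ} {F : Lp Y 2 (timeMeasure T)} {G : Lp S 2 (timeMeasure T)}
    {u : Lp V 2 (timeMeasure T)} {p₁ : Lp Y 2 (timeMeasure T)} {p₂ : Lp S 2 (timeMeasure T)}
    (h : SolvesEvolution v g τ a b s e F G u p₁ p₂) (ha : 0 < a) :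
    ∃ (d : Lp Y 2 (timeMeasure T)) (c : Y), (∀ᵐ t ∂timeMeasure T, v.compLp u t = c + prim d t) ∧
      ‖d‖ ^ 2 ≤ (a⁻¹ * ‖p₁‖) ^ 2 := by
  refine ⟨a⁻¹ • p₁, 0, ?_, ?_⟩
  · filter_upwards [h.eq_prim₁, v.coeFn_compLp u, ae_restrict_mem measurableSet_Ioo] with t h1 h2 ht
    have hI := Ioo_subset_Icc_self ht
    have k := clm_prim (a⁻¹ • ContinuousLinearMap.id ℝ Y) hI ((Lp.memLp p₁).integrable one_le_two)
    rw [prim_congr hI (Lp.coeFn_smul a⁻¹ p₁), zero_add, h2]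
    refine Eq.trans ?_ k
    rw [smul_apply, ContinuousLinearMap.id_apply, ← h1, smul_smul, inv_mul_cancel₀ ha.ne', one_smul]
  · rw [norm_smul, Real.norm_of_nonneg (inv_nonneg.2 ha.le)]

/-- Without mass in the interior, the function at time `t` is determined by its trace and by the
source at time `t`, which gives its time derivative. -/
theorem SolvesEvolution.exists_deriv_of_zero [CompleteSpace V] [CompleteSpace X] [CompleteSpace Y]
    [CompleteSpace S] {v : V →L[ℝ] Y} {g : V →L[ℝ] X} {τ : V →L[ℝ] S}
    {b s e C₁ C₂ : ℝ} {F F' : Lp Y 2 (timeMeasure T)} {G : Lp S 2 (timeMeasure T)}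
    {u : Lp V 2 (timeMeasure T)} {p₁ : Lp Y 2 (timeMeasure T)} {p₂ : Lp S 2 (timeMeasure T)}
    (h : SolvesEvolution v g τ 0 b s e F G u p₁ p₂) (hb : 0 < b)
    (hreg : ∀ w F, (∀ φ, τ φ = 0 → inner ℝ (g w) (g φ) = inner ℝ F (v φ)) →
      ‖v w‖ ^ 2 ≤ C₁ ^ 2 * ‖τ w‖ ^ 2 + C₂ ^ 2 * ‖F‖ ^ 2)
    {c : Y} (hF : ∀ᵐ t ∂timeMeasure T, F t = c + prim F' t) :
    ∃ (d : Lp Y 2 (timeMeasure T)) (c : Y), (∀ᵐ t ∂timeMeasure T, v.compLp u t = c + prim d t) ∧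
      ‖d‖ ^ 2 ≤ C₁ ^ 2 * (b⁻¹ * ‖p₂‖) ^ 2 + C₂ ^ 2 * ‖F'‖ ^ 2 := by
  have hq : ∀ᵐ t ∂timeMeasure T, τ (u t) = prim (b⁻¹ • p₂ : Lp S 2 (timeMeasure T)) t := by
    filter_upwards [h.eq_prim₂, ae_restrict_mem measurableSet_Ioo] with t h1 ht
    have hI := Ioo_subset_Icc_self ht
    have k := clm_prim (b⁻¹ • ContinuousLinearMap.id ℝ S) hI ((Lp.memLp p₂).integrable one_le_two)
    rw [prim_congr hI (Lp.coeFn_smul b⁻¹ p₂)]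
    refine Eq.trans ?_ k
    rw [smul_apply, ContinuousLinearMap.id_apply, ← h1, smul_smul, inv_mul_cancel₀ hb.ne', one_smul]
  obtain ⟨d, c', h1, h2⟩ := exists_time_deriv v g τ hreg hq hF fun φ hφ => by
    have z : ∀ H : ℝ → S, ∫ t in Ioo 0 T, inner ℝ (H t) (τ (φ t)) = 0 := fun H =>
      integral_eq_zero_of_ae (by filter_upwards [hφ] with t ht; rw [ht, inner_zero_right]; rfl)
    have k := h.eq φ (Lp.memLp φ)
    rw [z, z, z] at k
    linarith
  refine ⟨d, c', ?_, ?_⟩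
  · filter_upwards [h1, v.coeFn_compLp u] with t k1 k2
    rw [k2, k1]
  · rwa [norm_smul, Real.norm_of_nonneg (inv_nonneg.2 hb.le)] at h2

theorem integral_inner_curveOf_comp {V X Z : Type*} [NormedAddCommGroup V] [InnerProductSpace ℝ V]
    [MeasurableSpace X] [MeasurableSpace Z] {μ : Measure X} {ν : Measure Z} [SFinite μ] [SFinite ν]
    (L : V →L[ℝ] Lp ℝ 2 μ) {f : X × Z → ℝ} (hf : MemLp f 2 (μ.prod ν)) {φ : Z → V}
    (hφ : MemLp φ 2 ν) :
    ∫ t, inner ℝ (curveOf hf t) (L (φ t)) ∂ν = ∫ t, ∫ x, f (x, t) * L (φ t) x ∂μ ∂ν := by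
  have hL : MemLp (fun t => L (φ t)) 2 ν := L.comp_memLp' hφ
  have k := integral_inner_curveOf hf (hL.toLp _)
  refine Eq.trans (integral_congr_ae ?_) (k.trans (integral_congr_ae ?_))
  · filter_upwards [hL.coeFn_toLp] with t ht
    rw [ht]
  · filter_upwards [hL.coeFn_toLp] with t ht
    rw [ht]
    refine integral_congr_ae (Eventually.of_forall fun x => ?_)
    change L (φ t) x * f (x, t) = _
    exact mul_comm _ _

end TwoMassExistence

section WeakForm

variable {L X Y S Q : Type*} [NormedAddCommGroup L] [InnerProductSpace ℝ L] {H : Submodule ℝ L}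
  {V : Submodule ℝ H} [NormedAddCommGroup X] [InnerProductSpace ℝ X]
  [NormedAddCommGroup Y] [InnerProductSpace ℝ Y] [NormedAddCommGroup S] [InnerProductSpace ℝ S]
  [NormedAddCommGroup Q] [NormedSpace ℝ Q] {T : ℝ}

/-- `ae_eq_of_dual_form` for a subspace of a subspace. The statement is the same, but the vector
space structure of `V`, on which the type of its dual space depends, is that of `H1V`. -/
theorem ae_eq_of_weak_form [CompleteSpace V] [CompleteSpace Y] [CompleteSpace S]
    (hT : 0 < T) (v : V →L[ℝ] Y) (g : V →L[ℝ] X)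
    (τ : V →L[ℝ] S) (mk : V →L[ℝ] Q) {α β e s : ℝ} (hα : 0 ≤ α) (hβ : 0 ≤ β) (he : 0 ≤ e)
    (hs : 0 ≤ s) (hinj : ∀ u, ‖g u‖ ^ 2 + s * ‖τ u‖ ^ 2 = 0 → u = 0) {u u' : ℝ → V}
    (hu : IsL2Bochner T u) (hu' : IsL2Bochner T u')
    (h₁ : HasZeroInitialValue T fun t => α • v (u t))
    (h₁' : HasZeroInitialValue T fun t => α • v (u' t))
    (h₂ : HasZeroInitialValue T fun t => β • τ (u t))
    (h₂' : HasZeroInitialValue T fun t => β • τ (u' t))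
    {w₁ w₁' : ℝ → StrongDual ℝ V} {w₂ w₂' : ℝ → StrongDual ℝ Q}
    (hw₁ : IsL2Bochner T w₁) (hw₁' : IsL2Bochner T w₁')
    (hw₂ : IsL2Bochner T w₂) (hw₂' : IsL2Bochner T w₂')
    (hd₁ : IsTimeDeriv T (fun t φ => α * inner ℝ (v (u t)) (v φ)) fun t φ => w₁ t φ)
    (hd₁' : IsTimeDeriv T (fun t φ => α * inner ℝ (v (u' t)) (v φ)) fun t φ => w₁' t φ)
    (hd₂ : IsTimeDeriv T (fun t φ => β * inner ℝ (τ (u t)) (τ φ)) fun t φ => w₂ t (mk φ))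
    (hd₂' : IsTimeDeriv T (fun t φ => β * inner ℝ (τ (u' t)) (τ φ)) fun t φ => w₂' t (mk φ))
    (heq : ∀ φ : ℝ → V, IsL2Bochner T φ →
      (∫ t in Ioo 0 T, w₁ t (φ t)) + e * (∫ t in Ioo 0 T, w₂ t (mk (φ t)))
          + (∫ t in Ioo 0 T, inner ℝ (g (u t)) (g (φ t)))
          + s * (∫ t in Ioo 0 T, inner ℝ (τ (u t)) (τ (φ t)))
        = (∫ t in Ioo 0 T, w₁' t (φ t)) + e * (∫ t in Ioo 0 T, w₂' t (mk (φ t)))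
          + (∫ t in Ioo 0 T, inner ℝ (g (u' t)) (g (φ t)))
          + s * (∫ t in Ioo 0 T, inner ℝ (τ (u' t)) (τ (φ t)))) :
    u =ᵐ[timeMeasure T] u' := by
  exact ae_eq_of_dual_form (V := V) hT v g τ mk hα hβ he hs hinj hu hu' h₁ h₁' h₂ h₂' hw₁ hw₁'
    hw₂ hw₂' hd₁ hd₁' hd₂ hd₂' heq

theorem hasZeroInitialValue_of_prim {A : Type*} [NormedAddCommGroup A] [NormedSpace ℝ A]
    [CompleteSpace A] (hT : 0 ≤ T) {p y : ℝ → A} (hp : Integrable p (timeMeasure T))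
    {α a c : ℝ} (hc : c * a = α) (hy : ∀ᵐ t ∂timeMeasure T, a • y t = prim p t) :
    HasZeroInitialValue T fun t => α • y t := by
  refine ⟨fun t => c • prim p t, (continuousOn_prim hT hp).const_smul c, ?_, by simp⟩
  filter_upwards [hy] with t ht
  rw [← ht, smul_smul, hc]

/-- A solution of the evolution equation in `W` satisfies the weak formulation in `V`, if `i` and
`j` identify `V` and `W`. The constants `c₁` and `c₂` account for the square roots in `a = √α` and
`b = √(β e)`. -/
theorem SolvesEvolution.exists_weak_form {W : Type*} [NormedAddCommGroup W] [InnerProductSpace ℝ W]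
    [CompleteSpace Y] [CompleteSpace S] (hT : 0 < T)
    {v : W →L[ℝ] Y} {g : W →L[ℝ] X} {τ : W →L[ℝ] S} (i : V →L[ℝ] W) (j : W →L[ℝ] V)
    (hij : ∀ x, i (j x) = x) {v' : V →L[ℝ] Y} {τ' : V →L[ℝ] S} (hv : ∀ x, v' x = v (i x))
    (hτ : ∀ x, τ' x = τ (i x)) (mk : V →L[ℝ] Q) (σ : Q →L[ℝ] S)
    (hσ : ∀ φ, σ (mk φ) = τ' φ) {α β a b e s s' c₁ c₂ : ℝ} (hc₁ : c₁ * a = α) (hc₁' : c₁ = a)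
    (hc₂ : c₂ * b = β) (hc₂' : e * c₂ = b) (hs : s ^ 2 = s')
    {F : Lp Y 2 (timeMeasure T)} {G : Lp S 2 (timeMeasure T)}
    {u : Lp W 2 (timeMeasure T)} {p₁ : Lp Y 2 (timeMeasure T)} {p₂ : Lp S 2 (timeMeasure T)}
    (h : SolvesEvolution v g τ a b s e F G u p₁ p₂) :
    (HasZeroInitialValue T fun t => α • v' (j (u t))) ∧
    (HasZeroInitialValue T fun t => β • τ' (j (u t))) ∧
    ∃ (w₁ : ℝ → StrongDual ℝ V) (w₂ : ℝ → StrongDual ℝ Q), IsL2Bochner T w₁ ∧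
      IsTimeDeriv T (fun t φ => α * inner ℝ (v' (j (u t))) (v' φ)) (fun t φ => w₁ t φ) ∧
      IsL2Bochner T w₂ ∧
      IsTimeDeriv T (fun t φ => β * inner ℝ (τ' (j (u t))) (τ' φ)) (fun t φ => w₂ t (mk φ)) ∧
      ∀ φ : ℝ → V, IsL2Bochner T φ →
        (∫ t in Ioo 0 T, w₁ t (φ t)) + e * (∫ t in Ioo 0 T, w₂ t (mk (φ t)))
          + (∫ t in Ioo 0 T, inner ℝ (g (u t)) (g (i (φ t))))
          + s' * (∫ t in Ioo 0 T, inner ℝ (τ' (j (u t))) (τ' (φ t)))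
        = e * (∫ t in Ioo 0 T, inner ℝ (G t) (τ' (φ t)))
          + ∫ t in Ioo 0 T, inner ℝ (F t) (v' (φ t)) := by
  have hp₁ := (Lp.memLp p₁).integrable one_le_two
  have hp₂ := (Lp.memLp p₂).integrable one_le_two
  have q₁ : ∀ᵐ t ∂timeMeasure T, a • v' (j (u t)) = prim p₁ t := by
    simpa only [hv, hij] using h.eq_prim₁
  have q₂ : ∀ᵐ t ∂timeMeasure T, b • τ' (j (u t)) = prim p₂ t := by
    simpa only [hτ, hij] using h.eq_prim₂
  refine ⟨hasZeroInitialValue_of_prim hT.le hp₁ hc₁ q₁,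
    hasZeroInitialValue_of_prim hT.le hp₂ hc₂ q₂, fun t => (c₁ • innerPull v') (p₁ t),
    fun t => (c₂ • innerPull σ) (p₂ t), (c₁ • innerPull v').comp_memLp' (Lp.memLp p₁), ?_,
    (c₂ • innerPull σ).comp_memLp' (Lp.memLp p₂), ?_, fun φ hφ => ?_⟩
  · exact isTimeDeriv_innerPull (V := V) (α := α) (a := c₁) (y := fun t => v' (j (u t))) hT v' hp₁ (by
      filter_upwards [q₁] with t ht
      rw [← ht, smul_smul, hc₁])
  · have k := isTimeDeriv_innerPull (V := V) (α := β) (a := c₂) (y := fun t => τ' (j (u t))) hT τ'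
      hp₂ (by
        filter_upwards [q₂] with t ht
        rw [← ht, smul_smul, hc₂])
    have e₁ : (fun (t : ℝ) (φ : V) => (c₂ • innerPull σ) (p₂ t) (mk φ))
        = fun t φ => c₂ * inner ℝ (p₂ t) (τ' φ) := by
      funext t φ
      rw [← hσ]
      rfl
    rw [e₁]
    exact k
  · have e₁ : ∫ t in Ioo 0 T, (c₁ • innerPull v') (p₁ t) (φ t)
        = a * ∫ t in Ioo 0 T, inner ℝ (p₁ t) (v' (φ t)) := by
      rw [← integral_const_mul, hc₁']
      rfl
    have e₂ : e * ∫ t in Ioo 0 T, (c₂ • innerPull σ) (p₂ t) (mk (φ t))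
        = b * ∫ t in Ioo 0 T, inner ℝ (p₂ t) (τ' (φ t)) := by
      rw [← hc₂', mul_assoc, ← integral_const_mul c₂]
      congr 1
      refine integral_congr_ae (Eventually.of_forall fun t => ?_)
      simp only
      rw [← hσ]
      rfl
    have k := h.eq (fun t => i (φ t)) (i.comp_memLp' hφ)
    rw [e₁, e₂, ← hs]
    simp only [hv, hτ, hij]
    rw [k, add_comm]

end WeakForm

section EnergySpace

variable {n : ℕ}

/-- A copy of `H1V Ω D` which remembers only that it is a Hilbert space, so that the general
theory applies to it without unfolding a subspace of a subspace of a product. -/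
def EnergySpace (Ω D : Set (E n)) : Type := H1V Ω D

instance (Ω D : Set (E n)) : NormedAddCommGroup (EnergySpace Ω D) :=
  inferInstanceAs (NormedAddCommGroup (H1V Ω D))

instance (Ω D : Set (E n)) : InnerProductSpace ℝ (EnergySpace Ω D) :=
  inferInstanceAs (InnerProductSpace ℝ (H1V Ω D))

instance (Ω D : Set (E n)) : CompleteSpace (EnergySpace Ω D) :=
  inferInstanceAs (CompleteSpace (H1V Ω D))

/-- The identity map from `H1V Ω D`. -/
def toEnergy (Ω D : Set (E n)) : H1V Ω D →L[ℝ] EnergySpace Ω D where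
  toFun u := u
  map_add' _ _ := rfl
  map_smul' _ _ := rfl
  cont := continuous_id

/-- The identity map to `H1V Ω D`. -/
def ofEnergy (Ω D : Set (E n)) : EnergySpace Ω D →L[ℝ] H1V Ω D where
  toFun u := u
  map_add' _ _ := rfl
  map_smul' _ _ := rfl
  cont := continuous_id

/-- The underlying function. -/
def valE (Ω D : Set (E n)) : EnergySpace Ω D →L[ℝ] Lp ℝ 2 (volume.restrict D) :=
  (valL Ω D).comp (ofEnergy Ω D)

/-- The weak gradient. -/
def gradE (Ω D : Set (E n)) : EnergySpace Ω D →L[ℝ] Lp (E n) 2 (volume.restrict D) :=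
  (gradL Ω D).comp (ofEnergy Ω D)

/-- The trace on the surface of the particles. -/
def IsBarrier.traceE {Ω : Set (E n)} {C₀ ε M b : ℝ} {ψ κ : E n → ℝ} (h : Admissible Ω C₀ ε)
    (hB : IsBarrier Ω C₀ ε M b ψ κ) :
    EnergySpace Ω (perforated Ω C₀ ε) →L[ℝ] Lp ℝ 2 (surfaceMeasure Ω C₀ ε) :=
  (hB.traceL h).comp (ofEnergy Ω (perforated Ω C₀ ε))

end EnergySpace

/-! ### Weak solutions in the perforated domain -/

section WeakSolution

variable {n : ℕ} {Ω : Set (E n)} {T C₀ α β lam ε M b : ℝ} {ψ κ : E n → ℝ} {f g : E n × ℝ → ℝ}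

theorem IsBarrier.isVolumeTimeDeriv_iff {u : ℝ → Vε Ω C₀ ε} {w : ℝ → StrongDual ℝ (Vε Ω C₀ ε)} :
    IsVolumeTimeDeriv T α u w ↔ IsTimeDeriv T (fun t φ => α *
      inner ℝ (valL Ω (perforated Ω C₀ ε) (u t)) (valL Ω (perforated Ω C₀ ε) φ))
      fun t φ => w t φ := by
  have : (fun t (φ : Vε Ω C₀ ε) => α * ∫ x in perforated Ω C₀ ε, H1V.val (u t) x * H1V.val φ x)
      = fun t φ => α * inner ℝ (valL Ω (perforated Ω C₀ ε) (u t))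
        (valL Ω (perforated Ω C₀ ε) φ) := by
    funext t φ
    exact congrArg (α * ·) (integral_mul_Lp _ _)
  rw [IsVolumeTimeDeriv, this]

theorem IsBarrier.isSurfaceTimeDeriv_iff (h : Admissible Ω C₀ ε) (hB : IsBarrier Ω C₀ ε M b ψ κ)
    {u : ℝ → Vε Ω C₀ ε} {w : ℝ → StrongDual ℝ (HHalfS Ω C₀ ε)} :
    IsSurfaceTimeDeriv T β u w ↔ IsTimeDeriv T (fun t φ => β *
      inner ℝ (hB.traceL h (u t)) (hB.traceL h φ)) fun t φ => w t (traceHalfL Ω C₀ ε φ) := by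
  have : (fun t (φ : Vε Ω C₀ ε) => β * ∫ x, tr (u t) x * tr φ x ∂surfaceMeasure Ω C₀ ε)
      = fun t φ => β * inner ℝ (hB.traceL h (u t)) (hB.traceL h φ) := by
    funext t φ
    exact congrArg (β * ·) (integral_mul_Lp _ _)
  rw [IsSurfaceTimeDeriv, this]
  rfl

theorem IsBarrier.integral_tr_eq (h : Admissible Ω C₀ ε) (hB : IsBarrier Ω C₀ ε M b ψ κ)
    (u φ : ℝ → Vε Ω C₀ ε) :
    ∫ t in Ioo 0 T, ∫ x, tr (u t) x * tr (φ t) x ∂surfaceMeasure Ω C₀ ε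
      = ∫ t in Ioo 0 T, inner ℝ (hB.traceL h (u t)) (hB.traceL h (φ t)) :=
  integral_congr_ae (Eventually.of_forall fun t => integral_mul_Lp (tr (u t)) (tr (φ t)))

/-- The energy is definite, by the Poincaré inequality. -/
theorem IsBarrier.eq_zero_of_energy (h : Admissible Ω C₀ ε) (hB : IsBarrier Ω C₀ ε M b ψ κ)
    {s : ℝ} (hs : 0 < s) {x : Vε Ω C₀ ε}
    (hx : ‖gradL Ω (perforated Ω C₀ ε) x‖ ^ 2 + s * ‖hB.traceL h x‖ ^ 2 = 0) : x = 0 := by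
  have i1 : 0 ≤ ‖gradL Ω (perforated Ω C₀ ε) x‖ ^ 2 := sq_nonneg _
  have i2 : 0 ≤ s * ‖hB.traceL h x‖ ^ 2 := mul_nonneg hs.le (sq_nonneg _)
  have e1 : ‖H1V.grad x‖ ^ 2 = 0 := by
    have : ‖gradL Ω (perforated Ω C₀ ε) x‖ ^ 2 = 0 := by linarith
    exact this
  have e2 : ‖tr x‖ ^ 2 = 0 := by
    have : s * ‖hB.traceL h x‖ ^ 2 = 0 := by linarith
    exact (mul_eq_zero.1 this).resolve_left hs.ne'
  have k := hB.norm_sq_val_le h x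
  rw [e1, e2, mul_zero, add_zero, mul_zero] at k
  have e3 : ‖x‖ ^ 2 = 0 := by
    rw [norm_sq_H1V, e1, add_zero]
    exact le_antisymm k (sq_nonneg _)
  exact norm_eq_zero.1 (pow_eq_zero_iff two_ne_zero |>.1 e3)

/-- Uniqueness of weak solutions. -/
theorem IsWeakSolution.ae_eq (h : Admissible Ω C₀ ε) (hB : IsBarrier Ω C₀ ε M b ψ κ) (hT : 0 < T)
    (hα : 0 ≤ α) (hβ : 0 ≤ β) (hlam : 0 < lam) {u u' : ℝ → Vε Ω C₀ ε}
    (hu : IsWeakSolution Ω T C₀ α β lam f g ε u) (hu' : IsWeakSolution Ω T C₀ α β lam f g ε u') :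
    u =ᵐ[volume.restrict (Ioo 0 T)] u' := by
  have he : 0 < ε ^ (-gam n) := Real.rpow_pos_of_pos h.pos _
  obtain ⟨hu2, h1, h2, w₁, w₂, hw₁, hd₁, hw₂, hd₂, heq⟩ := hu
  obtain ⟨hu2', h1', h2', w₁', w₂', hw₁', hd₁', hw₂', hd₂', heq'⟩ := hu'
  refine ae_eq_of_weak_form (V := H1V Ω (perforated Ω C₀ ε)) hT (valL Ω (perforated Ω C₀ ε))
    (gradL Ω (perforated Ω C₀ ε)) (hB.traceL h) (traceHalfL Ω C₀ ε) hα hβ he.le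
    (mul_nonneg hlam.le he.le) (fun x hx => hB.eq_zero_of_energy h (mul_pos hlam he) hx)
    hu2 hu2' h1 h1' h2 h2' hw₁ hw₁' hw₂ hw₂'
    (IsBarrier.isVolumeTimeDeriv_iff.1 hd₁) (IsBarrier.isVolumeTimeDeriv_iff.1 hd₁')
    ((hB.isSurfaceTimeDeriv_iff h).1 hd₂) ((hB.isSurfaceTimeDeriv_iff h).1 hd₂')
    fun φ hφ => ?_
  rw [← hB.integral_tr_eq h, ← hB.integral_tr_eq h]
  exact (heq φ hφ).trans (heq' φ hφ).symm

/-- A solution of the abstract evolution equation is a weak solution. -/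
theorem IsBarrier.isWeakSolution (h : Admissible Ω C₀ ε) (hB : IsBarrier Ω C₀ ε M b ψ κ)
    [IsFiniteMeasure (surfaceMeasure Ω C₀ ε)] (hT : 0 < T) (hα : 0 ≤ α) (hβ : 0 ≤ β)
    (hlam : 0 ≤ lam)
    (hf : MemLp f 2 ((volume.restrict (perforated Ω C₀ ε)).prod (timeMeasure T)))
    (hg : MemLp g 2 ((surfaceMeasure Ω C₀ ε).prod (timeMeasure T)))
    {u : Lp (EnergySpace Ω (perforated Ω C₀ ε)) 2 (timeMeasure T)}
    {p₁ : Lp (Lp ℝ 2 (volume.restrict (perforated Ω C₀ ε))) 2 (timeMeasure T)}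
    {p₂ : Lp (Lp ℝ 2 (surfaceMeasure Ω C₀ ε)) 2 (timeMeasure T)}
    (hu : SolvesEvolution (valE Ω (perforated Ω C₀ ε)) (gradE Ω (perforated Ω C₀ ε)) (hB.traceE h)
      √α √(β * ε ^ (-gam n)) √(lam * ε ^ (-gam n)) (ε ^ (-gam n)) (curveOf hf) (curveOf hg)
      u p₁ p₂) :
    IsWeakSolution Ω T C₀ α β lam f g ε fun t => ofEnergy Ω (perforated Ω C₀ ε) (u t) := by
  have he : 0 < ε ^ (-gam n) := Real.rpow_pos_of_pos h.pos _
  have hb : √(β * ε ^ (-gam n)) * √(β * ε ^ (-gam n)) = β * ε ^ (-gam n) :=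
    Real.mul_self_sqrt (mul_nonneg hβ he.le)
  obtain ⟨h1, h2, w₁, w₂, hw₁, hd₁, hw₂, hd₂, heq⟩ := hu.exists_weak_form hT
    (toEnergy Ω (perforated Ω C₀ ε)) (ofEnergy Ω (perforated Ω C₀ ε)) (fun _ => rfl)
    (v' := valL Ω (perforated Ω C₀ ε)) (τ' := hB.traceL h) (fun _ => rfl) (fun _ => rfl)
    (traceHalfL Ω C₀ ε) (hB.halfToLp h) (fun φ => hB.halfToLp_trHalf h φ)
    (Real.mul_self_sqrt hα) rfl (c₂ := √(β * ε ^ (-gam n)) / ε ^ (-gam n))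
    (by rw [div_mul_eq_mul_div, hb, mul_div_cancel_right₀ _ he.ne'])
    (mul_div_cancel₀ _ he.ne') (Real.sq_sqrt (mul_nonneg hlam he.le))
  refine ⟨(ofEnergy Ω (perforated Ω C₀ ε)).comp_memLp' (Lp.memLp u), h1, h2, w₁, w₂, hw₁,
    IsBarrier.isVolumeTimeDeriv_iff.2 hd₁, hw₂, (hB.isSurfaceTimeDeriv_iff h).2 hd₂,
    fun φ hφ => ?_⟩
  have e₁ := integral_inner_curveOf_comp (valL Ω (perforated Ω C₀ ε)) hf hφ
  have e₂ := integral_inner_curveOf_comp (hB.traceL h) hg hφ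
  have k := heq φ hφ
  rw [e₁, e₂, ← hB.integral_tr_eq h] at k
  exact k

end WeakSolution

/-! ### Uniform bounds -/

section UniformBounds

variable {n : ℕ} {Ω D : Set (E n)} {T : ℝ}

theorem integral_norm_sq_jointLp {F : Type*} [NormedAddCommGroup F] [InnerProductSpace ℝ F]
    [CompleteSpace F] (y : Lp (Lp F 2 (volume.restrict D)) 2 (timeMeasure T)) :
    ∫ z in cylinder D T, ‖jointLp F (volume.restrict D) (timeMeasure T) y z‖ ^ 2 = ‖y‖ ^ 2 := by
  rw [restrict_cylinder, ← norm_sq_Lp, LinearIsometry.norm_map]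

theorem memLp_jointLp {F : Type*} [NormedAddCommGroup F] [InnerProductSpace ℝ F]
    [CompleteSpace F] (y : Lp (Lp F 2 (volume.restrict D)) 2 (timeMeasure T)) :
    MemLp (jointLp F (volume.restrict D) (timeMeasure T) y) 2 (volume.restrict (cylinder D T)) := by
  rw [restrict_cylinder]
  exact Lp.memLp _

theorem eventuallyEq_of_eq_Lp {X : Type*} [MeasurableSpace X] {μ : Measure X} {f : X → ℝ}
    {y z : Lp ℝ 2 μ} (h : y = z) (hf : f =ᵐ[μ] y) : f =ᵐ[μ] z := h ▸ hf

theorem norm_sq_energy (u : EnergySpace Ω D) : ‖u‖ ^ 2 = ‖valE Ω D u‖ ^ 2 + ‖gradE Ω D u‖ ^ 2 :=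
  norm_sq_H1V (ofEnergy Ω D u)

theorem represents_jointLp (u : Lp (EnergySpace Ω D) 2 (timeMeasure T)) :
    Represents T (jointLp ℝ (volume.restrict D) (timeMeasure T) ((valE Ω D).compLp u))
      fun t => ofEnergy Ω D (u t) := by
  have key : ∀ᵐ t ∂timeMeasure T, ((valE Ω D).compLp u t : Lp ℝ 2 (volume.restrict D))
      = H1V.val (ofEnergy Ω D (u t)) := (valE Ω D).coeFn_compLp u
  filter_upwards [isJoint_jointLp ((valE Ω D).compLp u), key] with t h1 h2
  exact eventuallyEq_of_eq_Lp h2 h1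

/-- A curve in `H¹(D, ∂Ω)` whose values in `L²(D)` have the time derivative `d` is a
function in `H¹` of the cylinder. -/
theorem exists_h1NormLE (hT : 0 < T) (hD : Bornology.IsBounded D)
    (u : Lp (EnergySpace Ω D) 2 (timeMeasure T))
    {d : Lp (Lp ℝ 2 (volume.restrict D)) 2 (timeMeasure T)} {c : Lp ℝ 2 (volume.restrict D)}
    (hd : ∀ᵐ t ∂timeMeasure T, (valE Ω D).compLp u t = c + prim d t) {K : ℝ} (hK : 0 ≤ K)
    (h : ‖(valE Ω D).compLp u‖ ^ 2 + ‖(gradE Ω D).compLp u‖ ^ 2 + ‖d‖ ^ 2 ≤ K ^ 2) :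
    ∃ U : E n × ℝ → ℝ, Represents T U (fun t => ofEnergy Ω D (u t)) ∧
      H1NormLE (cylinder D T) U K := by
  let u' : Lp (H1V Ω D) 2 (timeMeasure T) := (ofEnergy Ω D).compLp u
  have hv : (valL Ω D).compLp u' = (valE Ω D).compLp u := by
    refine Lp.ext ?_
    filter_upwards [(valL Ω D).coeFn_compLp u', (ofEnergy Ω D).coeFn_compLp u,
      (valE Ω D).coeFn_compLp u] with t h0 h1 h2
    rw [h0, h2, h1]
    rfl
  have hg : (gradL Ω D).compLp u' = (gradE Ω D).compLp u := by
    refine Lp.ext ?_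
    filter_upwards [(gradL Ω D).coeFn_compLp u', (ofEnergy Ω D).coeFn_compLp u,
      (gradE Ω D).coeFn_compLp u] with t h0 h1 h2
    rw [h0, h2, h1]
    rfl
  have hw := hasWeakDeriv_space_jointLp u'
  rw [hv, hg] at hw
  refine ⟨jointLp ℝ (volume.restrict D) (timeMeasure T) ((valE Ω D).compLp u),
    represents_jointLp u, jointLp (E n) (volume.restrict D) (timeMeasure T) ((gradE Ω D).compLp u),
    jointLp ℝ (volume.restrict D) (timeMeasure T) d, memLp_jointLp _, memLp_jointLp _,
    memLp_jointLp _, hw, hasWeakDeriv_time_jointLp hT hD hd, ?_⟩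
  · rw [Real.sqrt_le_left hK]
    have e₁ := integral_norm_sq_jointLp ((valE Ω D).compLp u)
    have e₂ := integral_norm_sq_jointLp ((gradE Ω D).compLp u)
    have e₃ := integral_norm_sq_jointLp d
    simp only [Real.norm_eq_abs, sq_abs] at e₁ e₃
    exact (congrArg₂ (· + ·) (congrArg₂ (· + ·) e₁ e₂) e₃).trans_le h

/-- The norm of a function in `L²` of the cylinder bounds that of its restrictions. -/
theorem IsL2.norm_curveOf_le (hDΩ : D ⊆ Ω) {f : E n × ℝ → ℝ} (hf : IsL2 Ω T f) :
    ‖curveOf (hf.memLp_prod hDΩ)‖ ≤ √(∫ z in cylinder Ω T, ‖f z‖ ^ 2) := by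
  refine Real.le_sqrt_of_sq_le ((DynBC.norm_curveOf_le _).trans ?_)
  rw [← restrict_cylinder]
  exact setIntegral_mono_set (integrable_norm_sq hf) (Eventually.of_forall fun z => sq_nonneg _)
    (LE.le.eventuallyLE (prod_mono_left hDΩ))

/-- A bound, free of `e`, for a boundary source of size `e X` relative to the trace norm with the
factor `√(l e)`. -/
theorem mul_mul_inv_sqrt_le {e l X R : ℝ} (he : 0 < e) (hl : 0 < l)
    (h : e * X ^ 2 ≤ R) : e * (X * (√(l * e))⁻¹) ≤ √(R / l) := by
  refine Real.le_sqrt_of_sq_le ?_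
  rw [mul_pow, mul_pow, inv_pow, Real.sq_sqrt (by positivity), le_div_iff₀ hl]
  refine le_trans (le_of_eq ?_) h
  field_simp

/-- The Poincaré inequality in terms of the energy of the problem: the flux `b` of the barrier is at
most a multiple of `lam ε^{-γ}`. -/
theorem IsBarrier.poincare {C₀ ε M b C lam : ℝ} {ψ κ : E n → ℝ} (h : Admissible Ω C₀ ε)
    (hB : IsBarrier Ω C₀ ε M b ψ κ) (hlam : 0 < lam) (hb : b ≤ C * ε ^ (-gam n))
    (u : Vε Ω C₀ ε) :
    ‖valL Ω (perforated Ω C₀ ε) u‖ ^ 2 ≤ √(Real.exp M * max 1 (C / lam)) ^ 2 *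
      (‖gradL Ω (perforated Ω C₀ ε) u‖ ^ 2
        + √(lam * ε ^ (-gam n)) ^ 2 * ‖hB.traceL h u‖ ^ 2) := by
  have he : 0 < ε ^ (-gam n) := Real.rpow_pos_of_pos h.pos _
  have h1 : (1 : ℝ) ≤ max 1 (C / lam) := le_max_left _ _
  rw [Real.sq_sqrt (by positivity), Real.sq_sqrt (by positivity), mul_assoc]
  refine (hB.norm_sq_val_le h u).trans ?_
  change _ ≤ Real.exp M * (max 1 (C / lam) * (‖H1V.grad u‖ ^ 2 + lam * ε ^ (-gam n) * ‖tr u‖ ^ 2))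
  rw [mul_add (max 1 (C / lam))]
  have k1 : ‖H1V.grad u‖ ^ 2 ≤ max 1 (C / lam) * ‖H1V.grad u‖ ^ 2 :=
    le_mul_of_one_le_left (sq_nonneg _) h1
  have k2 : b ≤ max 1 (C / lam) * (lam * ε ^ (-gam n)) := by
    refine hb.trans ?_
    calc C * ε ^ (-gam n) = C / lam * (lam * ε ^ (-gam n)) := by field_simp
      _ ≤ _ := by
        gcongr
        exact le_max_right _ _
  have k3 : b * ‖tr u‖ ^ 2 ≤ max 1 (C / lam) * (lam * ε ^ (-gam n)) * ‖tr u‖ ^ 2 := by gcongr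
  rw [← mul_assoc (max 1 (C / lam))]
  exact mul_le_mul_of_nonneg_left (add_le_add k1 k3) (Real.exp_pos _).le

/-- `IsBarrier.poincare` on `EnergySpace`. -/
theorem IsBarrier.poincare_energy {C₀ ε M b C lam : ℝ} {ψ κ : E n → ℝ} (h : Admissible Ω C₀ ε)
    (hB : IsBarrier Ω C₀ ε M b ψ κ) (hlam : 0 < lam) (hb : b ≤ C * ε ^ (-gam n))
    (u : EnergySpace Ω (perforated Ω C₀ ε)) :
    ‖valE Ω (perforated Ω C₀ ε) u‖ ^ 2 ≤ √(Real.exp M * max 1 (C / lam)) ^ 2 *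
      (‖gradE Ω (perforated Ω C₀ ε) u‖ ^ 2
        + √(lam * ε ^ (-gam n)) ^ 2 * ‖hB.traceE h u‖ ^ 2) :=
  hB.poincare h hlam hb (ofEnergy Ω (perforated Ω C₀ ε) u)

/-- Existence with bounds in terms of the data, `K` being a bound for the functional of `f`. -/
theorem IsBarrier.exists_solvesEvolution {C₀ ε M b C α β lam R K : ℝ} {ψ κ : E n → ℝ}
    {f g : E n × ℝ → ℝ} (h : Admissible Ω C₀ ε)
    (hB : IsBarrier Ω C₀ ε M b ψ κ) [IsFiniteMeasure (surfaceMeasure Ω C₀ ε)] (hT : 0 < T)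
    (hlam : 0 < lam) (hb : b ≤ C * ε ^ (-gam n)) (hK : 0 ≤ K)
    (hf : MemLp f 2 ((volume.restrict (perforated Ω C₀ ε)).prod (timeMeasure T)))
    (hF : ∀ w : C(ℝ, EnergySpace Ω (perforated Ω C₀ ε)),
      |curveFunctional (valE Ω (perforated Ω C₀ ε)) (curveOf hf) (contToLp _ T (mulWeight _ T w))|
        ≤ K * weightNorm (valE Ω (perforated Ω C₀ ε)) (gradE Ω (perforated Ω C₀ ε)) (hB.traceE h)
          √α √(β * ε ^ (-gam n)) √(lam * ε ^ (-gam n)) T w)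
    (hg : MemLp g 2 ((surfaceMeasure Ω C₀ ε).prod (timeMeasure T)))
    {G' : Lp (Lp ℝ 2 (surfaceMeasure Ω C₀ ε)) 2 (timeMeasure T)}
    {c : Lp ℝ 2 (surfaceMeasure Ω C₀ ε)}
    (hG : ∀ᵐ t ∂timeMeasure T, curveOf hg t = c + prim G' t)
    (hR : ε ^ (-gam n) * ‖curveOf hg‖ ^ 2 ≤ R) (hR' : ε ^ (-gam n) * ‖G'‖ ^ 2 ≤ R) {N P : ℝ}
    (hN : N = 2 * (K + timeConst T * (2 * √(R / lam))))
    (hP : P = √(Real.exp M * max 1 (C / lam))) :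
    ∃ (u : Lp (EnergySpace Ω (perforated Ω C₀ ε)) 2 (timeMeasure T))
      (p₁ : Lp (Lp ℝ 2 (volume.restrict (perforated Ω C₀ ε))) 2 (timeMeasure T))
      (p₂ : Lp (Lp ℝ 2 (surfaceMeasure Ω C₀ ε)) 2 (timeMeasure T)),
      SolvesEvolution (valE Ω (perforated Ω C₀ ε)) (gradE Ω (perforated Ω C₀ ε)) (hB.traceE h)
        √α √(β * ε ^ (-gam n)) √(lam * ε ^ (-gam n)) (ε ^ (-gam n)) (curveOf hf) (curveOf hg)
        u p₁ p₂ ∧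
      ‖(gradE Ω (perforated Ω C₀ ε)).compLp u‖ ^ 2 ≤ N ^ 2 ∧
      ‖(valE Ω (perforated Ω C₀ ε)).compLp u‖ ^ 2 ≤ P ^ 2 * N ^ 2 ∧ ‖p₁‖ ≤ N ∧ ‖p₂‖ ≤ N := by
  have he : 0 < ε ^ (-gam n) := Real.rpow_pos_of_pos h.pos _
  have htc := timeConst_pos hT
  subst hN hP
  refine exists_two_mass_evolution hT (valE Ω (perforated Ω C₀ ε))
    (gradE Ω (perforated Ω C₀ ε)) (hB.traceE h) _ _ (Real.sqrt_pos.2 (mul_pos hlam he)) he.le hK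
    norm_sq_energy (hB.poincare_energy h hlam hb) _ hF hG ?_
  have k1 := mul_mul_inv_sqrt_le he hlam hR
  have k2 := mul_mul_inv_sqrt_le he hlam hR'
  have k3 := mul_le_mul_of_nonneg_left (add_le_add k1 k2) htc.le
  refine add_le_add_right ?_ K
  refine le_trans (le_of_eq ?_) (k3.trans (le_of_eq ?_))
  · ring
  · ring

end UniformBounds

/-! ### Existence and uniqueness with a uniform bound -/

section WellPosedness

variable {n : ℕ} {Ω : Set (E n)} {T C₀ ε M b C α β lam R K N P L : ℝ} {ψ κ : E n → ℝ}
  {f g : E n × ℝ → ℝ}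

/-- `u` is, up to equality almost everywhere, the only weak solution, and its norm in `H¹` of the
space-time domain is at most `K`. -/
def IsUniqueSolutionWithBound (Ω : Set (E n)) (T C₀ α β lam : ℝ) (f g : E n × ℝ → ℝ) (K ε : ℝ)
    (u : ℝ → Vε Ω C₀ ε) : Prop :=
  IsWeakSolution Ω T C₀ α β lam f g ε u ∧
    (∀ v : ℝ → Vε Ω C₀ ε, IsWeakSolution Ω T C₀ α β lam f g ε v →
      v =ᵐ[volume.restrict (Ioo 0 T)] u) ∧
    ∃ U : E n × ℝ → ℝ, Represents T U u ∧ H1NormLE (cylinder (perforated Ω C₀ ε) T) U K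

/-- Well-posedness, given a bound `K` for the functional of `f` and a bound `L` for the square of
the norm of the time derivative. -/
theorem IsBarrier.exists_solution (h : Admissible Ω C₀ ε)
    (hB : IsBarrier Ω C₀ ε M b ψ κ) [IsFiniteMeasure (surfaceMeasure Ω C₀ ε)] (hT : 0 < T)
    (hα : 0 ≤ α) (hβ : 0 ≤ β) (hlam : 0 < lam) (hb : b ≤ C * ε ^ (-gam n)) (hK : 0 ≤ K)
    (hf : MemLp f 2 ((volume.restrict (perforated Ω C₀ ε)).prod (timeMeasure T)))
    (hF : ∀ w : C(ℝ, EnergySpace Ω (perforated Ω C₀ ε)),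
      |curveFunctional (valE Ω (perforated Ω C₀ ε)) (curveOf hf) (contToLp _ T (mulWeight _ T w))|
        ≤ K * weightNorm (valE Ω (perforated Ω C₀ ε)) (gradE Ω (perforated Ω C₀ ε)) (hB.traceE h)
          √α √(β * ε ^ (-gam n)) √(lam * ε ^ (-gam n)) T w)
    (hg : MemLp g 2 ((surfaceMeasure Ω C₀ ε).prod (timeMeasure T)))
    {G' : Lp (Lp ℝ 2 (surfaceMeasure Ω C₀ ε)) 2 (timeMeasure T)}
    {c : Lp ℝ 2 (surfaceMeasure Ω C₀ ε)}
    (hG : ∀ᵐ t ∂timeMeasure T, curveOf hg t = c + prim G' t)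
    (hR : ε ^ (-gam n) * ‖curveOf hg‖ ^ 2 ≤ R) (hR' : ε ^ (-gam n) * ‖G'‖ ^ 2 ≤ R)
    (hN : N = 2 * (K + timeConst T * (2 * √(R / lam))))
    (hP : P = √(Real.exp M * max 1 (C / lam)))
    (hd : ∀ u p₁ p₂, SolvesEvolution (valE Ω (perforated Ω C₀ ε)) (gradE Ω (perforated Ω C₀ ε))
        (hB.traceE h) √α √(β * ε ^ (-gam n)) √(lam * ε ^ (-gam n)) (ε ^ (-gam n)) (curveOf hf)
        (curveOf hg) u p₁ p₂ → ‖p₁‖ ≤ N → ‖p₂‖ ≤ N →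
      ∃ (d : Lp (Lp ℝ 2 (volume.restrict (perforated Ω C₀ ε))) 2 (timeMeasure T))
        (c : Lp ℝ 2 (volume.restrict (perforated Ω C₀ ε))), (∀ᵐ t ∂timeMeasure T,
          (valE Ω (perforated Ω C₀ ε)).compLp u t = c + prim d t) ∧ ‖d‖ ^ 2 ≤ L) :
    ∃ u, IsUniqueSolutionWithBound Ω T C₀ α β lam f g √(P ^ 2 * N ^ 2 + N ^ 2 + L) ε u := by
  obtain ⟨u, p₁, p₂, hu, h1, h2, h3, h4⟩ :=
    hB.exists_solvesEvolution h hT hlam hb hK hf hF hg hG hR hR' hN hP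
  obtain ⟨d, c', hd, hdL⟩ := hd u p₁ p₂ hu h3 h4
  have hw := hB.isWeakSolution h hT hα hβ hlam.le hf hg hu
  have hL : 0 ≤ L := (sq_nonneg _).trans hdL
  refine ⟨_, hw, fun v hv => IsWeakSolution.ae_eq h hB hT hα hβ hlam hv hw,
    exists_h1NormLE hT (h.isBounded.subset perforated_subset) u hd (Real.sqrt_nonneg _) ?_⟩
  rw [Real.sq_sqrt (by positivity)]
  exact add_le_add (add_le_add h2 h1) hdL

/-- Boundary data bounded by the area of `S_ε` are bounded uniformly after scaling with `ε^{-γ}`. -/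
theorem surface_bound (h : Admissible Ω C₀ ε) (hn : 3 ≤ n) {B x : ℝ} (hB : 0 ≤ B)
    (hx : x ≤ B * (surfaceMeasure Ω C₀ ε).real univ) :
    ε ^ (-gam n) * x ≤ B * (volume.real Ω * (n * 2 ^ n * C₀ ^ (n - 1))) := by
  have he : 0 < ε ^ (-gam n) := Real.rpow_pos_of_pos h.pos _
  calc ε ^ (-gam n) * x ≤ ε ^ (-gam n) * (B * (surfaceMeasure Ω C₀ ε).real univ) := by gcongr
    _ = B * (ε ^ (-gam n) * (surfaceMeasure Ω C₀ ε).real univ) := by ring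
    _ ≤ _ := mul_le_mul_of_nonneg_left
      (surfaceMeasure_univ_le hn h.isBounded h.isOpen h.const_pos h.pos h.radius_lt) hB

/-- A bound for `u` on `Ω_ε` in terms of its trace, if `-Δu = F` in the weak sense. -/
theorem IsBarrier.norm_sq_valE_le (h : Admissible Ω C₀ ε) (hB : IsBarrier Ω C₀ ε M b ψ κ)
    (hM : 0 ≤ M) (w : EnergySpace Ω (perforated Ω C₀ ε))
    (F : Lp ℝ 2 (volume.restrict (perforated Ω C₀ ε)))
    (hw : ∀ φ, hB.traceE h φ = 0 → inner ℝ (gradE Ω (perforated Ω C₀ ε) w)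
      (gradE Ω (perforated Ω C₀ ε) φ) = inner ℝ F (valE Ω (perforated Ω C₀ ε) φ)) :
    ‖valE Ω (perforated Ω C₀ ε) w‖ ^ 2
      ≤ √(2 * b) ^ 2 * ‖hB.traceE h w‖ ^ 2 + (2 * M) ^ 2 * ‖F‖ ^ 2 := by
  have hb := hB.flux_pos
  have key := hB.norm_sq_val_le_of_forall_traceKer h hM (ofEnergy Ω (perforated Ω C₀ ε) w) F
    fun φ hφ => hw (toEnergy Ω (perforated Ω C₀ ε) φ) ((hB.mem_traceKer h).1 hφ)
  rw [Real.sq_sqrt (by positivity)]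
  exact key.trans (le_of_eq (by rw [mul_pow]; norm_num1; rfl))

/-- If `α > 0`, the mass in the interior controls both `f` and the time derivative. -/
theorem exists_uniform_solution_of_pos (hn : 3 ≤ n) (hΩo : IsOpen Ω)
    (hΩb : Bornology.IsBounded Ω) (hT : 0 < T) (hC₀ : 0 < C₀) (hα : 0 < α) (hβ : 0 ≤ β)
    (hlam : 0 < lam) (hg : IsC1OnClosure (cylinder Ω T) g) (hf : IsL2 Ω T f) :
    ∃ K : ℝ, ∀ ε : ℝ, 0 < ε → radius n C₀ ε < ε / 4 →
      ∃ u, IsUniqueSolutionWithBound Ω T C₀ α β lam f g K ε u := by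
  obtain ⟨M, C, hM, hC, hbar⟩ := exists_isBarrier hn hΩo hΩb hC₀
  obtain ⟨B, hB0, hcurve⟩ := exists_boundary_curve hT hΩb hg
  set R := B * (volume.real Ω * (n * 2 ^ n * C₀ ^ (n - 1))) with hR
  set K := (1 + T) * √(∫ z in cylinder Ω T, ‖f z‖ ^ 2) * (√α)⁻¹ with hK
  set N := 2 * (K + timeConst T * (2 * √(R / lam))) with hN
  refine ⟨√(√(Real.exp M * max 1 (C / lam)) ^ 2 * N ^ 2 + N ^ 2 + ((√α)⁻¹ * N) ^ 2),
    fun ε hε hr => ?_⟩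
  have h : Admissible Ω C₀ ε := ⟨hΩo, hΩb, hC₀, hε, hr⟩
  have := h.isFiniteMeasure
  obtain ⟨ψ, κ, b, hb, hB⟩ := hbar ε hε hr
  obtain ⟨hgm, H', c, hc, h1, h2⟩ := hcurve (surfaceMeasure Ω C₀ ε) h.ae_mem
  have hα' : 0 < √α := Real.sqrt_pos.2 hα
  have hb' {x : ℝ} := surface_bound h hn hB0 (x := x)
  refine hB.exists_solution h hT hα.le hβ hlam hb (by positivity) (hf.memLp_prod perforated_subset)
    (fun w => ?_) hgm hc (hb' h1) (hb' h2) hN rfl fun u p₁ p₂ hu hp₁ _ => ?_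
  · refine (abs_curveFunctional_le_weightNorm hT (valE Ω (perforated Ω C₀ ε))
      (gradE Ω (perforated Ω C₀ ε)) (hB.traceE h) √(β * ε ^ (-gam n)) √(lam * ε ^ (-gam n)) hα' _ w).trans ?_
    have := hf.norm_curveOf_le (perforated_subset (C₀ := C₀) (ε := ε))
    have hw := weightNorm_nonneg (T := T) (valE Ω (perforated Ω C₀ ε)) (gradE Ω (perforated Ω C₀ ε))
      (hB.traceE h) √α √(β * ε ^ (-gam n)) √(lam * ε ^ (-gam n)) w
    refine mul_le_mul_of_nonneg_right ?_ hw
    rw [hK]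
    gcongr
  · obtain ⟨d, c, hd, hdn⟩ := hu.exists_deriv_of_pos hα'
    refine ⟨d, c, hd, hdn.trans ?_⟩
    gcongr

/-- If `α = 0`, then `-Δu = f` at almost all times, so that the time derivative is controlled by
that of the trace and that of `f`. -/
theorem exists_uniform_solution_of_zero (hn : 3 ≤ n) (hΩo : IsOpen Ω)
    (hΩb : Bornology.IsBounded Ω) (hT : 0 < T) (hC₀ : 0 < C₀) (hβ : 0 < β)
    (hlam : 0 < lam) (hg : IsC1OnClosure (cylinder Ω T) g) (hf : IsH1TimeL2 Ω T f) :
    ∃ K : ℝ, ∀ ε : ℝ, 0 < ε → radius n C₀ ε < ε / 4 →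
      ∃ u, IsUniqueSolutionWithBound Ω T C₀ 0 β lam f g K ε u := by
  obtain ⟨hf, f', hf', hw⟩ := hf
  obtain ⟨M, C, hM, hC, hbar⟩ := exists_isBarrier hn hΩo hΩb hC₀
  obtain ⟨B, hB0, hcurve⟩ := exists_boundary_curve hT hΩb hg
  set R := B * (volume.real Ω * (n * 2 ^ n * C₀ ^ (n - 1))) with hR
  set P := √(Real.exp M * max 1 (C / lam)) with hP
  set A := √(∫ z in cylinder Ω T, ‖f z‖ ^ 2)
  set A' := √(∫ z in cylinder Ω T, ‖f' z‖ ^ 2)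
  set K := timeConst T * (A + A') * P with hK
  set N := 2 * (K + timeConst T * (2 * √(R / lam))) with hN
  have htc := timeConst_pos hT
  refine ⟨√(P ^ 2 * N ^ 2 + N ^ 2 + (2 * C / β * N ^ 2 + (2 * M) ^ 2 * A' ^ 2)),
    fun ε hε hr => ?_⟩
  have h : Admissible Ω C₀ ε := ⟨hΩo, hΩb, hC₀, hε, hr⟩
  have := h.isFiniteMeasure
  have he : 0 < ε ^ (-gam n) := Real.rpow_pos_of_pos h.pos _
  obtain ⟨ψ, κ, b, hb, hB⟩ := hbar ε hε hr
  obtain ⟨hgm, H', c, hc, h1, h2⟩ := hcurve (surfaceMeasure Ω C₀ ε) h.ae_mem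
  obtain ⟨c₁, hc₁⟩ := exists_curveOf_eq_of_hasWeakDeriv hT h.isOpen_perforated
    perforated_subset hf hf' hw
  have hb' {x : ℝ} := surface_bound h hn hB0 (x := x)
  have hA := hf.norm_curveOf_le (perforated_subset (C₀ := C₀) (ε := ε))
  have hA' := hf'.norm_curveOf_le (perforated_subset (C₀ := C₀) (ε := ε))
  refine hB.exists_solution h hT le_rfl hβ.le hlam hb (by positivity)
    (hf.memLp_prod perforated_subset)
    (fun w => ?_) hgm hc (hb' h1) (hb' h2) hN rfl fun u p₁ p₂ hu _ hp₂ => ?_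
  · refine (abs_curveFunctional_le_weightNorm_of_deriv hT (valE Ω (perforated Ω C₀ ε))
      (gradE Ω (perforated Ω C₀ ε)) (hB.traceE h) √0 √(β * ε ^ (-gam n)) _ (Real.sqrt_nonneg _)
      (hB.poincare_energy h hlam hb) hc₁ w).trans ?_
    have hw := weightNorm_nonneg (T := T) (valE Ω (perforated Ω C₀ ε)) (gradE Ω (perforated Ω C₀ ε))
      (hB.traceE h) √0 √(β * ε ^ (-gam n)) √(lam * ε ^ (-gam n)) w
    refine mul_le_mul_of_nonneg_right ?_ hw
    rw [hK, hP]
    gcongr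
  · rw [Real.sqrt_zero] at hu
    have hbe : 0 < β * ε ^ (-gam n) := mul_pos hβ he
    obtain ⟨d, c, hd, hdn⟩ := hu.exists_deriv_of_zero (Real.sqrt_pos.2 hbe)
      (hB.norm_sq_valE_le h hM.le) hc₁
    refine ⟨d, c, hd, hdn.trans (add_le_add ?_ (by gcongr))⟩
    have hb0 := hB.flux_pos
    rw [mul_pow, inv_pow, Real.sq_sqrt (by positivity), Real.sq_sqrt (by positivity), ← mul_assoc]
    refine mul_le_mul ?_ (by gcongr) (sq_nonneg _) (by positivity)
    rw [← div_eq_mul_inv, div_le_div_iff₀ hbe hβ]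
    have := mul_le_mul_of_nonneg_right hb (mul_nonneg zero_le_two hβ.le)
    linarith

end WellPosedness

end DynBC

end

theorem theorem2 (n : ℕ) (hn : 3 ≤ n) (Ω : Set (DynBC.E n)) (hΩo : IsOpen Ω)
    (hΩc : IsConnected Ω) (hΩb : Bornology.IsBounded Ω) (hΩs : DynBC.HasSmoothBoundary Ω)
    (T C₀ α β lam : ℝ) (hT : 0 < T) (hC₀ : 0 < C₀) (hα : 0 ≤ α) (hβ : 0 ≤ β) (hlam : 0 < lam)
    (f g : DynBC.E n × ℝ → ℝ) (hg : DynBC.IsC1OnClosure (DynBC.cylinder Ω T) g)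
    (hf : (0 < α ∧ DynBC.IsL2 Ω T f) ∨ (0 < β ∧ DynBC.IsH1TimeL2 Ω T f)) :
    ∃ K : ℝ, 0 < K ∧ ∀ ε : ℝ, 0 < ε → DynBC.radius n C₀ ε < ε / 4 →
      ∃ u : ℝ → DynBC.Vε Ω C₀ ε,
        DynBC.IsWeakSolution Ω T C₀ α β lam f g ε u ∧
        (∀ v : ℝ → DynBC.Vε Ω C₀ ε, DynBC.IsWeakSolution Ω T C₀ α β lam f g ε v →
          v =ᵐ[volume.restrict (Ioo 0 T)] u) ∧
        ∃ U : DynBC.E n × ℝ → ℝ, DynBC.Represents T U u ∧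
          DynBC.H1NormLE (DynBC.cylinder (DynBC.perforated Ω C₀ ε) T) U K := by
  have key : ∃ K : ℝ, ∀ ε : ℝ, 0 < ε → DynBC.radius n C₀ ε < ε / 4 →
      ∃ u, DynBC.IsUniqueSolutionWithBound Ω T C₀ α β lam f g K ε u := by
    rcases hα.eq_or_lt with rfl | hα'
    · rcases hf with ⟨h, _⟩ | ⟨hβ', hf⟩
      · exact absurd h (lt_irrefl _)
      · exact DynBC.exists_uniform_solution_of_zero hn hΩo hΩb hT hC₀ hβ' hlam hg hf
    · have hf2 : DynBC.IsL2 Ω T f := hf.elim (fun h => h.2) fun h => h.2.1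
      exact DynBC.exists_uniform_solution_of_pos hn hΩo hΩb hT hC₀ hα' hβ hlam hg hf2
  obtain ⟨K, hK⟩ := key
  refine ⟨max K 1, zero_lt_one.trans_le (le_max_right _ _), fun ε hε hr => ?_⟩
  obtain ⟨u, h1, h2, U, hU, G, D, k1, k2, k3, k4, k5, k6⟩ := hK ε hε hr
  exact ⟨u, h1, h2, U, hU, G, D, k1, k2, k3, k4, k5, k6.trans (le_max_left _ _)⟩
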